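/- Let $0<\sigma<2$, and let $6<p<\infty$ if $\sigma\le 1$, $8<p<\infty$ if $1<\sigma<2$; put $p'=p/(p-1)$ and $$\beta_\sigma=\begin{cases}3\left(\tfrac12-\tfrac1p\right),&0<\sigma\le1,\\ \tfrac83\left(\tfrac12-\tfrac1p\right),&1<\sigma<2.\end{cases}$$ Let $s>1+\frac3p$ be real. For functions on $\mathbb R^3$ and $t\ge 0$ set $$\|f\|_{X}=\|f\|_{\dot H^{-\frac{2-\sigma}2}}+\|f\|_{H^{2s}}+(1+t)^{\beta_\sigma}\|f\|_{W^{s,p}},\qquad \|f\|_{Y}=\|f\|_{\dot H^{-\frac{2-\sigma}2}}+\|f\|_{H^{2s}}+\|f\|_{W^{s+6(\frac12-\frac1p),\,p'}},$$ where $W^{a,q}$ for real $a$ and $1<q<\infty$ is the Bessel potential space, $\|\alpha(t)\|_X$ is taken with the weight at time $t$, and the norm of a tuple is the sum of the norms of its components. For every $\varepsilon>0$ there is a constant $C=C(\sigma,p,s,\varepsilon)$ such that the following holds for every $T^*>0$. Let $(n,u)$ be a real-valued solution on $[0,T^*)$, with initial data $(n_0,u_0)$, of $$\partial_t n+\nabla\cdot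 u+\nabla\cdot(nu)=0,\qquad \partial_t u+\nabla n+\nabla\left(\tfrac12 n^2+\tfrac12|u|^2\right)=-\nabla|\nabla|^{-\sigma}n,\qquad \nabla\times u=0,$$ (for $0<t<T^*$, in the sense of tempered distributions in $x$), let $$\alpha=\frac{p(|\nabla|)}{|\nabla|}n+i\,\frac{\nabla}{|\nabla|}\cdot u,\qquad p(r)=(r^2+r^{2-\sigma})^{1/2},$$ and suppose that $\alpha\in C([0,T^*);X)$. If $$\|(n_0,u_0)\|_Y<\varepsilon\qquad\text{and}\qquad \sup_{0<t<T^*}\|n(t)\|_{L^\infty}<\tfrac12,$$ then for all $0\le t<T^*$ $$\|\alpha(t)\|_{H^{2s}}\le C\left(\|\alpha(0)\|_Y+\sup_{0<\tau<T^*}\|\alpha(\tau)\|_X^{3/2}\right).$$ -/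

import Mathlib

open MeasureTheory Set Filter Topology FourierTransform
open scoped ENNReal NNReal SchwartzMap

noncomputable section

namespace EulerRiesz

/-- The space `ℝ³` with its Euclidean norm. -/
abbrev E3 : Type := EuclideanSpace ℝ (Fin 3)

/-- Real-valued square integrable functions on `ℝ³`. -/
abbrev L2R : Type := Lp ℝ 2 (volume : Measure E3)

/-- Complex-valued square integrable functions on `ℝ³`. -/
abbrev L2C : Type := Lp ℂ 2 (volume : Measure E3)

/-- A real-valued function regarded as a complex-valued one. -/
def cplx (f : L2R) : L2C := Complex.ofRealCLM.compLp f

/-- The partial derivative `∂_j φ` of a Schwartz function. -/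
def pderiv (j : Fin 3) (φ : 𝓢(E3, ℝ)) (x : E3) : ℝ :=
  fderiv ℝ φ x (EuclideanSpace.single j 1)

/-- The symbol of `|∇|`. Mathlib's Fourier transform is `∫ e^{-2πi x·ξ} f(x) dx`, so it is
`2π|ξ|`; in the same way the symbol of `∂_j` is `2πi ξ_j`. -/
def freq (ξ : E3) : ℝ := 2 * Real.pi * ‖ξ‖

/-- The dispersion relation `p(r) = (r² + r^{2-σ})^{1/2}`. -/
def dispersion (σ r : ℝ) : ℝ := Real.sqrt (r ^ 2 + r ^ (2 - σ))

/-- The norm `‖f‖_{Ḣ^a} = ‖|∇|^a f‖_{L²}` of an `L²` function. -/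
def hDotNorm (a : ℝ) (f : L2C) : ℝ≥0∞ :=
  (∫⁻ ξ, ENNReal.ofReal (freq ξ ^ (2 * a)) * ‖(𝓕 f : L2C) ξ‖ₑ ^ 2) ^ (1 / 2 : ℝ)

/-- The norm `‖f‖_{H^a} = ‖(1 - Δ)^{a/2} f‖_{L²}` of an `L²` function. -/
def hNorm (a : ℝ) (f : L2C) : ℝ≥0∞ :=
  (∫⁻ ξ, ENNReal.ofReal ((1 + freq ξ ^ 2) ^ a) * ‖(𝓕 f : L2C) ξ‖ₑ ^ 2) ^ (1 / 2 : ℝ)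

/-- The norm of `W^{a,q}` for a real order `a`, as the Bessel potential norm: the `L^q` norm of the
function `g` that represents the Bessel potential of `f` of order `a`, and `∞` if there is no such
`g` in `L^q`. The Bessel potential of Mathlib has the symbol `(1 + |ξ|²)^{a/2}`, which for
`1 < q < ∞` changes the norm only up to equivalence. -/
def wNorm (a : ℝ) (q : ℝ≥0∞) (f : L2C) : ℝ≥0∞ :=
  ⨅ (g : E3 → ℂ) (_ : MemLp g q volume)
    (_ : ∀ φ : 𝓢(E3, ℂ),
      TemperedDistribution.besselPotential E3 ℂ a (Lp.toTemperedDistribution f) φ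
        = ∫ x, φ x * g x),
    eLpNorm g q volume

/-- The decay exponent `β_σ`. -/
def beta (σ p : ℝ) : ℝ :=
  if σ ≤ 1 then 3 * (1 / 2 - 1 / p) else 8 / 3 * (1 / 2 - 1 / p)

/-- The admissible exponents `p`. -/
def AdmissibleExponent (σ p : ℝ) : Prop :=
  (σ ≤ 1 → 6 < p) ∧ (1 < σ → 8 < p)

/-- The norm of `X` at time `t`:
`‖f‖_{Ḣ^{-(2-σ)/2} ∩ H^{2s}} + (1+t)^{β_σ} ‖f‖_{W^{s,p}}`. -/
def xNorm (σ p s t : ℝ) (f : L2C) : ℝ≥0∞ :=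
  hDotNorm (-((2 - σ) / 2)) f + hNorm (2 * s) f
    + ENNReal.ofReal ((1 + t) ^ beta σ p) * wNorm s (ENNReal.ofReal p) f

/-- The norm of `Y`:
`‖f‖_{Ḣ^{-(2-σ)/2} ∩ H^{2s}} + ‖f‖_{W^{s+6(1/2-1/p),p'}}` with `p' = p/(p-1)`. -/
def yNorm (σ p s : ℝ) (f : L2C) : ℝ≥0∞ :=
  hDotNorm (-((2 - σ) / 2)) f + hNorm (2 * s) f
    + wNorm (s + 6 * (1 / 2 - 1 / p)) (ENNReal.ofReal (p / (p - 1))) f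

/-- The norm of a pair `(n, u)` in `Y`. -/
def yNormPair (σ p s : ℝ) (n : L2R) (u : Fin 3 → L2R) : ℝ≥0∞ :=
  yNorm σ p s (cplx n) + ∑ j, yNorm σ p s (cplx (u j))

/-- `F` is the `j`-th component of `∇ |∇|^{-σ} n`. -/
def IsRieszGradient (σ : ℝ) (j : Fin 3) (n F : L2R) : Prop :=
  ∀ᵐ ξ : E3, (𝓕 (cplx F) : L2C) ξ =
    (2 * Real.pi * ξ j : ℝ) * Complex.I * (freq ξ ^ (-σ) : ℝ) * (𝓕 (cplx n) : L2C) ξ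

/-- `∇ × u = 0` in the sense of distributions. -/
def Irrotational (u : Fin 3 → L2R) : Prop :=
  ∀ (φ : 𝓢(E3, ℝ)) (j k : Fin 3), ∫ x, u j x * pderiv k φ x = ∫ x, u k x * pderiv j φ x

/-- `(n, u)` is an irrotational solution on the time interval `[0, T)` of
`∂_t n + ∇·u + ∇·(n u) = 0`, `∂_t u + ∇n + ∇(n²/2 + |u|²/2) = -∇|∇|^{-σ} n`,
where the equations hold for all `0 < t < T` in the sense of tempered distributions on `ℝ³`. -/
structure IsSolution (σ T : ℝ) (n : ℝ → L2R) (u : ℝ → Fin 3 → L2R) : Prop where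
  irrotational : ∀ t ∈ Ico 0 T, Irrotational (u t)
  mass : ∀ t ∈ Ioo 0 T, ∀ φ : 𝓢(E3, ℝ),
    HasDerivAt (fun τ => ∫ x, n τ x * φ x)
      (∑ j, ∫ x, (u t j x + n t x * u t j x) * pderiv j φ x) t
  momentum : ∀ t ∈ Ioo 0 T, ∀ j : Fin 3, ∃ F : L2R, IsRieszGradient σ j (n t) F ∧
    ∀ φ : 𝓢(E3, ℝ),
      HasDerivAt (fun τ => ∫ x, u τ j x * φ x)
        ((∫ x, (n t x + (n t x) ^ 2 / 2 + (∑ k, (u t k x) ^ 2) / 2) * pderiv j φ x)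
          - ∫ x, F x * φ x) t

/-- `α = (p(|∇|)/|∇|) n + i (∇/|∇|)·u`, where `∂_j/|∇|` has the symbol `i ξ_j/|ξ|`. -/
def IsAlpha (σ : ℝ) (n : L2R) (u : Fin 3 → L2R) (α : L2C) : Prop :=
  ∀ᵐ ξ : E3, (𝓕 α : L2C) ξ =
    (dispersion σ (freq ξ) / freq ξ : ℝ) * (𝓕 (cplx n) : L2C) ξ
      + Complex.I * ∑ j, Complex.I * (ξ j / ‖ξ‖ : ℝ) * (𝓕 (cplx (u j)) : L2C) ξ

/-- `α ∈ C([0, T); X)`. -/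
def ContinuousInX (σ p s T : ℝ) (α : ℝ → L2C) : Prop :=
  ∀ t ∈ Ico 0 T, xNorm σ p s t (α t) < ∞ ∧
    Tendsto (fun τ => xNorm σ p s t (α τ - α t)) (𝓝[Ico 0 T] t) (𝓝 0)

end EulerRiesz

end

noncomputable section
namespace EulerRiesz

section Translation
variable {F : Type*} [NormedAddCommGroup F] [NormedSpace ℝ F]

/-- Translation `f ↦ f(· + h)` on `L²`. -/
def tr (h : E3) : Lp F 2 (volume : Measure E3) →ₗᵢ[ℝ] Lp F 2 (volume : Measure E3) :=
  Lp.compMeasurePreservingₗᵢ ℝ (· + h) (measurePreserving_add_right volume h)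

lemma coe_tr (h : E3) (f : Lp F 2 (volume : Measure E3)) : tr h f =ᵐ[volume] fun x => f (x + h) :=
  Lp.coeFn_compMeasurePreserving f (measurePreserving_add_right volume h)

lemma ae_add_right {p : E3 → Prop} (hp : ∀ᵐ x, p x) (h : E3) : ∀ᵐ x, p (x + h) :=
  (measurePreserving_add_right volume h).quasiMeasurePreserving.ae hp

lemma tr_tr (h k : E3) (f : Lp F 2 (volume : Measure E3)) : tr h (tr k f) = tr (h + k) f := by
  refine Lp.ext ?_
  filter_upwards [coe_tr h (tr k f), coe_tr (h + k) f, ae_add_right (coe_tr k f) h] with x h1 h2 h3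
  rw [h1, h2, h3, add_assoc]

lemma tr_comm (h k : E3) (f : Lp F 2 (volume : Measure E3)) : tr h (tr k f) = tr k (tr h f) := by
  rw [tr_tr, tr_tr, add_comm]

@[simp] lemma tr_zero (f : Lp F 2 (volume : Measure E3)) : tr 0 f = f := by
  refine Lp.ext ?_
  filter_upwards [coe_tr 0 f] with x h1
  rw [h1, add_zero]

lemma continuous_tr (f : Lp F 2 (volume : Measure E3)) : Continuous fun h => tr h f := by
  have : Continuous fun h : E3 => (⟨fun x => x + h, by fun_prop⟩ : C(E3, E3)) :=
    ContinuousMap.continuous_of_continuous_uncurry _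
      (by simpa [Function.uncurry_def] using (by fun_prop : Continuous fun z : E3 × E3 => z.2 + z.1))
  exact Continuous.compMeasurePreservingLp continuous_const this
    (fun h => measurePreserving_add_right volume h) (by norm_num)

end Translation

/-- `cplx` as a continuous linear map. -/
def cplxL : L2R →L[ℝ] L2C := Complex.ofRealCLM.compLpL 2 volume

lemma coe_cplx (f : L2R) : cplx f =ᵐ[volume] fun x => (f x : ℂ) :=
  Complex.ofRealCLM.coeFn_compLp f

lemma cplx_add (f g : L2R) : cplx (f + g) = cplx f + cplx g := cplxL.map_add f g
lemma cplx_sub (f g : L2R) : cplx (f - g) = cplx f - cplx g := cplxL.map_sub f g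
lemma cplx_smul (c : ℝ) (f : L2R) : cplx (c • f) = c • cplx f := cplxL.map_smul c f

lemma cplx_tr (h : E3) (f : L2R) : cplx (tr h f) = tr (F := ℂ) h (cplx f) := by
  refine Lp.ext ?_
  filter_upwards [coe_tr h (cplx f), ae_add_right (coe_cplx f) h, coe_cplx (tr h f), coe_tr h f]
    with x h1 h2 h3 h4
  rw [h3, h4, h1, h2]

/-- The real part of an `L²` function. -/
def reL : L2C →L[ℝ] L2R := Complex.reCLM.compLpL 2 volume

lemma coe_reL (f : L2C) : reL f =ᵐ[volume] fun x => (f x).re :=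
  Complex.reCLM.coeFn_compLp f

lemma integral_fourier_mul (f : L2C) (φ : 𝓢(E3, ℂ)) :
    ∫ x, (𝓕 f : L2C) x * φ x = ∫ x, f x * (𝓕 φ) x := by
  have h := Lp.fourier_toTemperedDistribution_eq f
  have h2 := DFunLike.congr_fun h φ
  rw [TemperedDistribution.fourier_apply, Lp.toTemperedDistribution_apply,
    Lp.toTemperedDistribution_apply] at h2
  simp only [smul_eq_mul] at h2
  simp_rw [mul_comm _ (φ _), ← h2, mul_comm]

lemma integral_mul_fourierInv (f : L2C) (φ : 𝓢(E3, ℂ)) :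
    ∫ x, (𝓕 f : L2C) x * (𝓕⁻ φ) x = ∫ x, f x * φ x := by
  rw [integral_fourier_mul, FourierTransform.fourier_fourierInv_eq]

lemma lintegral_fourier (f : L2C) : ∫⁻ ξ, ‖(𝓕 f : L2C) ξ‖ₑ ^ 2 = ∫⁻ x, ‖f x‖ₑ ^ 2 := by
  have h : eLpNorm (𝓕 f : L2C) 2 volume = eLpNorm f 2 volume := by
    have := Lp.norm_fourier_eq f
    rw [Lp.norm_def, Lp.norm_def, ENNReal.toReal_eq_toReal_iff' (Lp.eLpNorm_ne_top _)
      (Lp.eLpNorm_ne_top _)] at this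
    exact this
  have key : ∀ g : E3 → ℂ, eLpNorm g 2 volume ^ (2:ℝ) = ∫⁻ x, ‖g x‖ₑ ^ 2 := by
    intro g
    have := eLpNorm_nnreal_pow_eq_lintegral (μ := (volume : Measure E3)) (f := g) (p := 2) (by norm_num)
    simpa using this
  rw [← key, ← key, h]

lemma lintegral_cplx (f : L2R) : ∫⁻ x, ‖cplx f x‖ₑ ^ 2 = ∫⁻ x, ‖f x‖ₑ ^ 2 := by
  refine lintegral_congr_ae ?_
  filter_upwards [coe_cplx f] with x hx
  rw [hx, ← enorm_norm, Complex.norm_real, enorm_norm]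

lemma lintegral_fourier_cplx (f : L2R) :
    ∫⁻ ξ, ‖(𝓕 (cplx f) : L2C) ξ‖ₑ ^ 2 = ∫⁻ x, ‖f x‖ₑ ^ 2 := by
  rw [lintegral_fourier, lintegral_cplx]

lemma fourier_injective {f g : L2C} (h : (𝓕 f : L2C) =ᵐ[volume] (𝓕 g : L2C)) : f = g := by
  have := Lp.ext h
  have h2 := congrArg (fun z : L2C => (𝓕⁻ z : L2C)) this
  simpa using h2

lemma cplx_injective : Function.Injective cplx := by
  intro f g h
  refine Lp.ext ?_
  filter_upwards [coe_cplx f, coe_cplx g] with x h1 h2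
  rw [h] at h1
  exact_mod_cast h1.symm.trans h2

/-- Two `L²` functions with the same integrals against Schwartz functions agree. -/
lemma L2C_ext_schwartz {f g : L2C} (h : ∀ φ : 𝓢(E3, ℂ), ∫ x, f x * φ x = ∫ x, g x * φ x) :
    f = g := by
  have hk := Lp.ker_toTemperedDistributionCLM_eq_bot (F := ℂ) (μ := (volume : Measure E3)) (p := 2)
  have : Function.Injective (Lp.toTemperedDistributionCLM ℂ (volume : Measure E3) 2) :=
    LinearMap.ker_eq_bot.1 hk
  apply this
  ext φ
  rw [Lp.toTemperedDistributionCLM_apply, Lp.toTemperedDistributionCLM_apply,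
    Lp.toTemperedDistribution_apply, Lp.toTemperedDistribution_apply]
  simp only [smul_eq_mul]
  simp_rw [mul_comm (φ _)]
  exact h φ

/-- The symbol of translation by `h`. -/
def trSymb (h ξ : E3) : ℂ := Complex.exp ((2 * Real.pi * inner ℝ h ξ : ℝ) * Complex.I)

lemma norm_trSymb (h ξ : E3) : ‖trSymb h ξ‖ = 1 := Complex.norm_exp_ofReal_mul_I _

lemma continuous_trSymb (h : E3) : Continuous (trSymb h) := by
  unfold trSymb; fun_prop

lemma continuous_trSymb_uncurry : Continuous fun z : E3 × E3 => trSymb z.1 z.2 := by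
  unfold trSymb; fun_prop

lemma memLp_bdd_mul {μ : E3 → ℂ} {c : ℝ} (hμ : AEStronglyMeasurable μ volume)
    (hc : ∀ ξ, ‖μ ξ‖ ≤ c) (f : L2C) : MemLp (fun ξ => μ ξ * f ξ) 2 volume :=
  (Lp.memLp f).of_le_mul (c := c) (hμ.mul (Lp.aestronglyMeasurable f))
    (.of_forall fun ξ => by
      rw [norm_mul]; exact mul_le_mul_of_nonneg_right (hc ξ) (norm_nonneg _))

lemma fourier_tr (h : E3) (f : L2C) :
    (𝓕 (tr h f) : L2C) =ᵐ[volume] fun ξ => trSymb h ξ * (𝓕 f : L2C) ξ := by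
  have hm := memLp_bdd_mul (continuous_trSymb h).aestronglyMeasurable
    (fun ξ => (norm_trSymb h ξ).le) (𝓕 f : L2C)
  have : (𝓕 (tr h f) : L2C) = hm.toLp := by
    apply L2C_ext_schwartz
    intro φ
    rw [integral_fourier_mul]
    let ψ : 𝓢(E3, ℂ) := 𝓕⁻ (SchwartzMap.compSubConstCLM ℂ h (𝓕 φ))
    have hψ : ∀ x, ψ x = trSymb h x * φ x := fun x => by
      have h1 : φ x = (𝓕⁻ (𝓕 φ)) x := by rw [FourierTransform.fourierInv_fourier_eq]
      rw [h1]
      change (𝓕⁻ (SchwartzMap.compSubConstCLM ℂ h (𝓕 φ))) x = _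
      rw [SchwartzMap.fourierInv_coe, SchwartzMap.fourierInv_coe, Real.fourierInv_eq',
        Real.fourierInv_eq', ← integral_add_right_eq_self _ h, ← integral_const_mul]
      congr 1
      ext v
      rw [SchwartzMap.compSubConstCLM_apply, add_sub_cancel_right, smul_eq_mul, smul_eq_mul,
        ← mul_assoc, trSymb, ← Complex.exp_add]
      congr 2
      rw [inner_add_left]
      push_cast; ring
    have e1 : ∫ x, (hm.toLp : L2C) x * φ x = ∫ x, (𝓕 f : L2C) x * ψ x := by
      refine integral_congr_ae ?_
      filter_upwards [hm.coeFn_toLp] with x hx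
      rw [hx, hψ]; ring
    rw [e1, integral_fourier_mul]
    have e2 : ∀ x, (𝓕 ψ) (x + h) = (𝓕 φ) x := by
      intro x
      change (𝓕 (𝓕⁻ (SchwartzMap.compSubConstCLM ℂ h (𝓕 φ)))) (x + h) = _
      rw [FourierTransform.fourier_fourierInv_eq, SchwartzMap.compSubConstCLM_apply,
        add_sub_cancel_right]
    calc ∫ x, (tr h f : E3 → ℂ) x * (𝓕 φ) x = ∫ x, f (x + h) * (𝓕 ψ) (x + h) := by
          refine integral_congr_ae ?_
          filter_upwards [coe_tr h f] with x hx
          rw [hx, e2]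
      _ = _ := integral_add_right_eq_self (fun x => f x * (𝓕 ψ) x) h
  rw [this]
  exact hm.coeFn_toLp

/-- Complex conjugation reflects the Fourier transform. -/
lemma fourier_star (f : L2C) :
    ∀ᵐ ξ, (𝓕 (star f) : L2C) (-ξ) = (starRingEnd ℂ) ((𝓕 f : L2C) ξ) := by
  set g : L2C := 𝓕 f
  set g' : L2C := 𝓕 (star f)
  have hmp : MeasurePreserving (fun x : E3 => -x) volume volume := Measure.measurePreserving_neg volume
  let A : L2C := Lp.compMeasurePreserving _ hmp g'
  have hA : A =ᵐ[volume] fun x => g' (-x) := Lp.coeFn_compMeasurePreserving g' hmp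
  have : A = star g := by
    apply L2C_ext_schwartz
    intro φ
    let φc : 𝓢(E3, ℂ) := SchwartzMap.postcompCLM (𝕜 := ℝ) (Complex.conjCLE : ℂ →L[ℝ] ℂ) φ
    have hφc : ∀ x, φc x = (starRingEnd ℂ) (φ x) := fun x => rfl
    let φn : 𝓢(E3, ℂ) := SchwartzMap.compCLMOfContinuousLinearEquiv ℂ
      (ContinuousLinearEquiv.neg ℝ : E3 ≃L[ℝ] E3) φ
    have hφn : ∀ x, φn x = φ (-x) := fun x => rfl
    have e1 : ∫ x, A x * φ x = ∫ x, g' x * φn x := by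
      rw [← integral_neg_eq_self]
      refine integral_congr_ae ?_
      have := hmp.quasiMeasurePreserving.ae hA
      filter_upwards [this] with x hx
      rw [hx, neg_neg, hφn]
    have e2 : ∫ x, (star g : L2C) x * φ x = (starRingEnd ℂ) (∫ x, g x * φc x) := by
      rw [← integral_conj]
      refine integral_congr_ae ?_
      filter_upwards [Lp.coeFn_star g] with x hx
      rw [hx, hφc]; simp
    rw [e1, e2, integral_fourier_mul, integral_fourier_mul, ← integral_conj]
    refine integral_congr_ae ?_
    filter_upwards [Lp.coeFn_star f] with x hx
    rw [hx, map_mul, Pi.star_apply, Complex.star_def]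
    congr 1
    rw [SchwartzMap.fourier_coe, SchwartzMap.fourier_coe, Real.fourier_eq', Real.fourier_eq',
      ← integral_conj, ← integral_neg_eq_self]
    congr 1
    ext v
    rw [smul_eq_mul, smul_eq_mul, hφn, hφc, map_mul, ← Complex.exp_conj]
    have : (starRingEnd ℂ) 2 = 2 := Complex.conj_ofReal 2
    simp [this]
  filter_upwards [hA, Lp.coeFn_star g] with x h1 h2
  rw [← h1, this, h2]; rfl

lemma star_cplx (f : L2R) : star (cplx f) = cplx f := by
  refine Lp.ext ?_
  filter_upwards [Lp.coeFn_star (cplx f), coe_cplx f] with x h1 h2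
  rw [h1, Pi.star_apply, h2]; simp

lemma fourier_cplx_neg (f : L2R) :
    ∀ᵐ ξ, (𝓕 (cplx f) : L2C) (-ξ) = (starRingEnd ℂ) ((𝓕 (cplx f) : L2C) ξ) := by
  simpa [star_cplx] using fourier_star (cplx f)

lemma ae_neg {p : E3 → Prop} (hp : ∀ᵐ x, p x) : ∀ᵐ x, p (-x) :=
  (Measure.measurePreserving_neg (volume : Measure E3)).quasiMeasurePreserving.ae hp

lemma cplx_reL_of_star {z : L2C} (h : star z = z) : cplx (reL z) = z := by
  refine Lp.ext ?_
  filter_upwards [coe_cplx (reL z), coe_reL z, Lp.coeFn_star z] with x h1 h2 h3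
  rw [h, Pi.star_apply, Complex.star_def] at h3
  rw [h1, h2]
  exact Complex.conj_eq_iff_re.1 h3.symm

/-- An `L²` function with Hermitian Fourier transform is real. -/
lemma exists_cplx_of_hermitian {z : L2C}
    (h : ∀ᵐ ξ, (𝓕 z : L2C) (-ξ) = (starRingEnd ℂ) ((𝓕 z : L2C) ξ)) : ∃ g : L2R, cplx g = z := by
  refine ⟨reL z, cplx_reL_of_star (fourier_injective ?_)⟩
  filter_upwards [ae_neg (fourier_star z), ae_neg h] with ξ h1 h2
  rw [neg_neg] at h1 h2
  rw [h1, h2]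

/-- A Hermitian symbol maps real functions to real functions. -/
lemma exists_real_multiplier (μ : E3 → ℂ) (f : L2R)
    (hμ : ∀ ξ, μ (-ξ) = (starRingEnd ℂ) (μ ξ))
    (hm : MemLp (fun ξ => μ ξ * (𝓕 (cplx f) : L2C) ξ) 2 volume) :
    ∃ g : L2R, (𝓕 (cplx g) : L2C) =ᵐ[volume] fun ξ => μ ξ * (𝓕 (cplx f) : L2C) ξ := by
  have hz : (𝓕 (𝓕⁻ hm.toLp : L2C) : L2C) = hm.toLp := FourierTransform.fourier_fourierInv_eq _
  obtain ⟨g, hg⟩ := exists_cplx_of_hermitian (z := (𝓕⁻ hm.toLp : L2C)) (by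
    rw [hz]
    filter_upwards [hm.coeFn_toLp, ae_neg hm.coeFn_toLp, fourier_cplx_neg f] with ξ h1 h2 h3
    rw [h1, h2, h3, hμ, map_mul])
  exact ⟨g, by rw [hg, hz]; exact hm.coeFn_toLp⟩

end EulerRiesz

noncomputable section
namespace EulerRiesz

open scoped Convolution

lemma eLpNorm_two_sq {X F : Type*} [MeasurableSpace X] {ν : Measure X} [NormedAddCommGroup F]
    (g : X → F) : eLpNorm g 2 ν ^ 2 = ∫⁻ x, ‖g x‖ₑ ^ 2 ∂ν := by
  have := eLpNorm_nnreal_pow_eq_lintegral (μ := ν) (f := g) (p := 2) (by norm_num)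
  simp only [NNReal.coe_ofNat, ENNReal.rpow_ofNat, ENNReal.coe_ofNat] at this
  exact this

lemma lintegral_enorm_sq {F : Type*} [NormedAddCommGroup F] (f : Lp F 2 (volume : Measure E3)) :
    ∫⁻ x, ‖f x‖ₑ ^ 2 = ENNReal.ofReal (‖f‖ ^ 2) := by
  rw [← eLpNorm_two_sq, Lp.norm_def, ENNReal.ofReal_pow ENNReal.toReal_nonneg,
    ENNReal.ofReal_toReal (Lp.eLpNorm_ne_top _)]

lemma tendsto_Lp_iff_lintegral {F ι : Type*} [NormedAddCommGroup F] {l : Filter ι}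
    {f : ι → Lp F 2 (volume : Measure E3)} {g : Lp F 2 (volume : Measure E3)} :
    Tendsto f l (𝓝 g) ↔ Tendsto (fun i => ∫⁻ x, ‖f i x - g x‖ₑ ^ 2) l (𝓝 0) := by
  have e : ∀ i, ∫⁻ x, ‖f i x - g x‖ₑ ^ 2 = ENNReal.ofReal (‖f i - g‖ ^ 2) := by
    intro i
    rw [← lintegral_enorm_sq]
    refine lintegral_congr_ae ?_
    filter_upwards [Lp.coeFn_sub (f i) g] with x hx
    rw [hx, Pi.sub_apply]
  simp_rw [e]
  rw [tendsto_iff_norm_sub_tendsto_zero]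
  constructor
  · intro h
    have := ENNReal.tendsto_ofReal (h.pow 2)
    simpa using this
  · intro h
    have h1 := (ENNReal.tendsto_toReal ENNReal.zero_ne_top).comp h
    have h2 : Tendsto (fun i => ‖f i - g‖ ^ 2) l (𝓝 0) := by
      refine h1.congr fun i => ?_
      simp
    have h3 := h2.sqrt
    simpa [Real.sqrt_sq] using h3

/-- Essential bounds pass to `L²` limits. -/
lemma eLpNorm_le_of_tendsto_L2 {F ι : Type*} [NormedAddCommGroup F] {l : Filter ι} [l.NeBot]
    [l.IsCountablyGenerated]
    {f : ι → Lp F 2 (volume : Measure E3)} {g : Lp F 2 (volume : Measure E3)}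
    (h : Tendsto f l (𝓝 g)) {q C : ℝ≥0∞} (hC : ∀ᶠ i in l, eLpNorm (f i) q volume ≤ C) :
    eLpNorm g q volume ≤ C :=
  eLpNorm_le_of_tendstoInMeasure hC (tendstoInMeasure_of_tendsto_Lp h)
    (fun i => Lp.aestronglyMeasurable (f i))

lemma eLpNorm_top_le_iff {F : Type*} [NormedAddCommGroup F] {f : E3 → F} {c : ℝ} (hc : 0 ≤ c) :
    eLpNorm f ∞ volume ≤ ENNReal.ofReal c ↔ ∀ᵐ x, ‖f x‖ ≤ c := by
  rw [eLpNorm_exponent_top]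
  constructor
  · intro h
    filter_upwards [enorm_ae_le_eLpNormEssSup f volume] with x hx
    have := hx.trans h
    rwa [← ofReal_norm, ENNReal.ofReal_le_ofReal_iff hc] at this
  · intro h
    refine essSup_le_of_ae_le _ ?_
    filter_upwards [h] with x hx
    rw [← ofReal_norm]
    exact ENNReal.ofReal_le_ofReal hx

lemma ae_le_of_tendsto_L2 {F ι : Type*} [NormedAddCommGroup F] {l : Filter ι} [l.NeBot]
    [l.IsCountablyGenerated]
    {f : ι → Lp F 2 (volume : Measure E3)} {g : Lp F 2 (volume : Measure E3)}
    (h : Tendsto f l (𝓝 g)) {c : ℝ} (hc0 : 0 ≤ c) (hc : ∀ᶠ i in l, ∀ᵐ x, ‖f i x‖ ≤ c) :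
    ∀ᵐ x, ‖g x‖ ≤ c :=
  (eLpNorm_top_le_iff hc0).1 (eLpNorm_le_of_tendsto_L2 h
    (hc.mono fun _ hi => (eLpNorm_top_le_iff hc0).2 hi))

/-- An `L²` function that is bounded as a functional on `L¹` is essentially bounded. -/
lemma ae_norm_le_of_schwartz {f : L2C} {c : ℝ}
    (h : ∀ φ : 𝓢(E3, ℂ), ‖∫ x, f x * φ x‖ ≤ c * ∫ x, ‖φ x‖) : ∀ᵐ x, ‖f x‖ ≤ c := by
  let φ : ℕ → ContDiffBump (0 : E3) := fun i =>
    ⟨1 / ((i : ℝ) + 1), 2 / ((i : ℝ) + 1), by positivity, by gcongr; norm_num⟩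
  have hlim : Tendsto (fun i => (φ i).rOut) atTop (𝓝 0) := by
    have := (tendsto_one_div_add_atTop_nhds_zero_nat (𝕜 := ℝ)).const_mul 2
    simp only [mul_zero] at this
    refine this.congr fun i => ?_
    change _ = 2 / ((i : ℝ) + 1)
    ring
  have hloc : LocallyIntegrable f volume := (Lp.memLp f).locallyIntegrable (by norm_num)
  have key := ContDiffBump.ae_convolution_tendsto_right_of_locallyIntegrable (K := 2) (φ := φ)
    hlim (.of_forall fun i => by
      change 2 / ((i : ℝ) + 1) ≤ 2 * (1 / ((i : ℝ) + 1))
      rw [mul_one_div]) hloc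
  filter_upwards [key] with x hx
  refine le_of_tendsto hx.norm (.of_forall fun i => ?_)
  have hcs : HasCompactSupport fun y : E3 => (((φ i).normed volume (x - y) : ℝ) : ℂ) := by
    have h1 : HasCompactSupport ((φ i).normed (volume : Measure E3)) := (φ i).hasCompactSupport_normed
    have h2 := h1.comp_homeomorph (Homeomorph.subLeft x)
    exact h2.comp_left (g := fun r : ℝ => (r : ℂ)) (by simp)
  let ψ : 𝓢(E3, ℂ) := hcs.toSchwartzMap (by
    have h1 : ContDiff ℝ ((⊤ : ℕ∞) : WithTop ℕ∞) ((φ i).normed (volume : Measure E3)) :=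
      (φ i).contDiff_normed
    exact Complex.ofRealCLM.contDiff.comp (h1.comp (contDiff_const.sub contDiff_id)))
  have hψ : ∀ y, ψ y = (((φ i).normed volume (x - y) : ℝ) : ℂ) := fun y => rfl
  have e1 : ((φ i).normed volume ⋆[ContinuousLinearMap.lsmul ℝ ℝ, volume] (f : E3 → ℂ)) x
      = ∫ y, f y * ψ y := by
    rw [convolution_eq_swap]
    refine integral_congr_ae (.of_forall fun y => ?_)
    simp only [ContinuousLinearMap.lsmul_apply, hψ, Complex.real_smul]
    ring
  have e2 : ∫ y, ‖ψ y‖ = 1 := by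
    simp_rw [hψ, Complex.norm_real, Real.norm_of_nonneg ((φ i).nonneg_normed _)]
    rw [integral_sub_left_eq_self (fun y => (φ i).normed volume y) volume x]
    exact (φ i).integral_normed
  rw [e1]
  simpa [e2] using h ψ

/-- An integrable Fourier transform bounds the function. -/
lemma ae_norm_le_lintegral_fourier {f : L2C} (h : ∫⁻ ξ, ‖(𝓕 f : L2C) ξ‖ₑ ≠ ∞) :
    ∀ᵐ x, ‖f x‖ ≤ (∫⁻ ξ, ‖(𝓕 f : L2C) ξ‖ₑ).toReal := by
  have hint : Integrable (𝓕 f : L2C) volume :=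
    ⟨Lp.aestronglyMeasurable _, by rwa [hasFiniteIntegral_iff_enorm, lt_top_iff_ne_top]⟩
  rw [← integral_norm_eq_lintegral_enorm hint.1]
  refine ae_norm_le_of_schwartz fun φ => ?_
  rw [← integral_mul_fourierInv]
  calc ‖∫ x, (𝓕 f : L2C) x * (𝓕⁻ φ) x‖ ≤ ∫ x, ‖(𝓕 f : L2C) x‖ * ∫ x, ‖φ x‖ := by
        refine norm_integral_le_of_norm_le (hint.norm.mul_const _) (.of_forall fun x => ?_)
        rw [norm_mul]
        gcongr
        rw [SchwartzMap.fourierInv_coe, Real.fourierInv_eq']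
        refine (norm_integral_le_integral_norm _).trans (le_of_eq ?_)
        congr 1
        ext v
        rw [norm_smul]
        have := Complex.norm_exp_ofReal_mul_I (2 * Real.pi * inner ℝ v x)
        push_cast at this ⊢
        rw [this, one_mul]
    _ = _ := integral_mul_const _ _

lemma finrank_E3 : (Module.finrank ℝ E3 : ℝ) = 3 := by simp

lemma measurable_freq : Measurable freq := by unfold freq; fun_prop
lemma freq_nonneg (ξ : E3) : 0 ≤ freq ξ := by unfold freq; positivity
lemma freq_neg (ξ : E3) : freq (-ξ) = freq ξ := by simp [freq]
lemma freq_pos {ξ : E3} (h : ξ ≠ 0) : 0 < freq ξ := by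
  unfold freq; have := norm_pos_iff.2 h; positivity

lemma ae_ne_zero : ∀ᵐ ξ : E3, ξ ≠ 0 := by
  simp [ae_iff]

/-- The weight `(1+freq²)^{-a}` is integrable for `a > 3/2`. -/
lemma lintegral_japanese {a : ℝ} (ha : 3 / 2 < a) :
    ∫⁻ ξ : E3, ENNReal.ofReal ((1 + freq ξ ^ 2) ^ (-a)) < ∞ := by
  have h := integrable_rpow_neg_one_add_norm_sq (E := E3) (μ := volume) (r := 2 * a)
    (by rw [finrank_E3]; linarith)
  refine lt_of_le_of_lt (lintegral_mono fun ξ => ENNReal.ofReal_le_ofReal ?_) h.lintegral_lt_top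
  rw [show -(2 * a) / 2 = -a by ring, Real.rpow_neg (by positivity), Real.rpow_neg (by positivity)]
  gcongr
  unfold freq
  have : (1 : ℝ) ≤ 2 * Real.pi := by linarith [Real.pi_gt_three]
  nlinarith [norm_nonneg ξ, mul_le_mul this this (by norm_num) (by positivity), sq_nonneg ‖ξ‖]

/-- Cauchy–Schwarz on the Fourier side: `H^a` controls the `L¹` norm of the transform. -/
lemma lintegral_fourier_le_hNorm {a : ℝ} (f : L2C) :
    ∫⁻ ξ, ‖(𝓕 f : L2C) ξ‖ₑ ≤
      (∫⁻ ξ : E3, ENNReal.ofReal ((1 + freq ξ ^ 2) ^ (-a))) ^ (1 / 2 : ℝ) * hNorm a f := by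
  have hpos : ∀ ξ, 0 < 1 + freq ξ ^ 2 := fun ξ => by positivity
  have hm : ∀ b : ℝ, Measurable fun ξ => ENNReal.ofReal ((1 + freq ξ ^ 2) ^ b) := fun b =>
    ((measurable_const.add (measurable_freq.pow_const 2)).pow_const b).ennreal_ofReal
  have := ENNReal.lintegral_mul_le_Lp_mul_Lq (volume : Measure E3) (p := 2) (q := 2)
    ⟨by norm_num, by norm_num, by norm_num⟩
    (f := fun ξ => ENNReal.ofReal ((1 + freq ξ ^ 2) ^ (-a / 2)))
    (g := fun ξ => ENNReal.ofReal ((1 + freq ξ ^ 2) ^ (a / 2)) * ‖(𝓕 f : L2C) ξ‖ₑ)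
    (hm _).aemeasurable ((hm _).aemeasurable.mul (Lp.aestronglyMeasurable _).enorm)
  refine le_trans (le_of_eq ?_) (this.trans (le_of_eq ?_))
  · refine lintegral_congr fun ξ => ?_
    rw [Pi.mul_apply, ← mul_assoc, ← ENNReal.ofReal_mul (by positivity), ← Real.rpow_add (hpos ξ)]
    rw [show -a / 2 + a / 2 = 0 by ring, Real.rpow_zero, ENNReal.ofReal_one, one_mul]
  · have e : ∀ b : ℝ, ∀ ξ, ENNReal.ofReal ((1 + freq ξ ^ 2) ^ (b / 2)) ^ (2 : ℝ)
        = ENNReal.ofReal ((1 + freq ξ ^ 2) ^ b) := fun b ξ => by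
      rw [ENNReal.ofReal_rpow_of_nonneg (by positivity) (by norm_num), ← Real.rpow_mul (hpos ξ).le]
      congr 2; ring
    unfold hNorm
    congr 2
    · exact lintegral_congr fun ξ => e _ ξ
    · refine lintegral_congr fun ξ => ?_
      rw [ENNReal.mul_rpow_of_nonneg _ _ (by norm_num : (0:ℝ) ≤ 2), e, ENNReal.rpow_ofNat]

end EulerRiesz

noncomputable section
namespace EulerRiesz

/-- The symbol of the derivative in direction `v`. -/
def dsymb (v ξ : E3) : ℂ := (2 * Real.pi * inner ℝ v ξ : ℝ) * Complex.I

lemma measurable_dsymb (v : E3) : Measurable (dsymb v) := by unfold dsymb; fun_prop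
lemma measurable_trSymb (v : E3) : Measurable (trSymb v) := (continuous_trSymb v).measurable

lemma dsymb_neg (v ξ : E3) : dsymb v (-ξ) = (starRingEnd ℂ) (dsymb v ξ) := by
  simp [dsymb, Complex.conj_ofNat]

lemma dsymb_add (v w ξ : E3) : dsymb (v + w) ξ = dsymb v ξ + dsymb w ξ := by
  simp only [dsymb, inner_add_left]; push_cast; ring

lemma dsymb_smul (c : ℝ) (v ξ : E3) : dsymb (c • v) ξ = c * dsymb v ξ := by
  simp only [dsymb, real_inner_smul_left]; push_cast; ring

lemma norm_dsymb_le (v ξ : E3) : ‖dsymb v ξ‖ ≤ ‖v‖ * freq ξ := by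
  rw [dsymb, norm_mul, Complex.norm_I, mul_one, Complex.norm_real, Real.norm_eq_abs, abs_mul,
    abs_of_pos (by positivity : 0 < 2 * Real.pi), freq]
  nlinarith [abs_real_inner_le_norm v ξ, Real.pi_pos]

lemma trSymb_zero (ξ : E3) : trSymb 0 ξ = 1 := by simp [trSymb]

lemma trSymb_neg (h ξ : E3) : trSymb h (-ξ) = (starRingEnd ℂ) (trSymb h ξ) := by
  rw [trSymb, trSymb, ← Complex.exp_conj]
  simp [Complex.conj_ofNat]

lemma norm_trSymb_sub_one_le (h ξ : E3) : ‖trSymb h ξ - 1‖ ≤ ‖dsymb h ξ‖ := by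
  rw [trSymb, mul_comm, dsymb]
  refine (Real.norm_exp_I_mul_ofReal_sub_one_le).trans (le_of_eq ?_)
  rw [norm_mul _ Complex.I, Complex.norm_I, mul_one, Complex.norm_real]

lemma norm_trSymb_sub_one_le_two (h ξ : E3) : ‖trSymb h ξ - 1‖ ≤ 2 := by
  refine (norm_sub_le _ _).trans ?_
  rw [norm_trSymb, norm_one]; norm_num

/-- `g` is the derivative of `f` in direction `v`, on the Fourier side. -/
def FD (v : E3) (f g : L2R) : Prop :=
  (𝓕 (cplx g) : L2C) =ᵐ[volume] fun ξ => dsymb v ξ * (𝓕 (cplx f) : L2C) ξ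

lemma fourier_cplx_tr (h : E3) (f : L2R) :
    (𝓕 (cplx (tr h f)) : L2C) =ᵐ[volume] fun ξ => trSymb h ξ * (𝓕 (cplx f) : L2C) ξ := by
  rw [cplx_tr]; exact fourier_tr h _

lemma fourier_cplx_add (f g : L2R) : (𝓕 (cplx (f + g)) : L2C) =ᵐ[volume]
    fun ξ => (𝓕 (cplx f) : L2C) ξ + (𝓕 (cplx g) : L2C) ξ := by
  rw [cplx_add, FourierTransform.fourier_add]; exact Lp.coeFn_add _ _

lemma fourier_sub' (f g : L2C) : (𝓕 (f - g) : L2C) = 𝓕 f - 𝓕 g :=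
  (Lp.fourierTransformₗᵢ E3 ℂ).map_sub f g

lemma fourier_cplx_sub (f g : L2R) : (𝓕 (cplx (f - g)) : L2C) =ᵐ[volume]
    fun ξ => (𝓕 (cplx f) : L2C) ξ - (𝓕 (cplx g) : L2C) ξ := by
  rw [cplx_sub, fourier_sub']; exact Lp.coeFn_sub _ _

lemma fourier_cplx_smul (c : ℝ) (f : L2R) : (𝓕 (cplx (c • f)) : L2C) =ᵐ[volume]
    fun ξ => (c : ℂ) * (𝓕 (cplx f) : L2C) ξ := by
  have : cplx (c • f) = (c : ℂ) • cplx f := by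
    rw [cplx_smul]
    refine Lp.ext ?_
    filter_upwards [Lp.coeFn_smul c (cplx f), Lp.coeFn_smul (c : ℂ) (cplx f)] with x h1 h2
    rw [h1, h2]; simp
  rw [this, FourierTransform.fourier_smul]
  filter_upwards [Lp.coeFn_smul (c : ℂ) (𝓕 (cplx f) : L2C)] with x hx
  rw [hx]; rfl

lemma FD.add {v f g f' g'} (hf : FD v f f') (hg : FD v g g') : FD v (f + g) (f' + g') := by
  unfold FD at *
  filter_upwards [hf, hg, fourier_cplx_add f g, fourier_cplx_add f' g'] with ξ h1 h2 h3 h4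
  rw [h4, h1, h2, h3]; ring

lemma FD.sub {v f g f' g'} (hf : FD v f f') (hg : FD v g g') : FD v (f - g) (f' - g') := by
  unfold FD at *
  filter_upwards [hf, hg, fourier_cplx_sub f g, fourier_cplx_sub f' g'] with ξ h1 h2 h3 h4
  rw [h4, h1, h2, h3]; ring

lemma FD.smul {v f f'} (c : ℝ) (hf : FD v f f') : FD v (c • f) (c • f') := by
  unfold FD at *
  filter_upwards [hf, fourier_cplx_smul c f, fourier_cplx_smul c f'] with ξ h1 h2 h3
  rw [h3, h1, h2]; ring

lemma FD.tr {v f f'} (h : E3) (hf : FD v f f') : FD v (tr h f) (tr h f') := by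
  unfold FD at *
  filter_upwards [hf, fourier_cplx_tr h f, fourier_cplx_tr h f'] with ξ h1 h2 h3
  rw [h3, h1, h2]; ring

lemma FD.dir_add {v w f f' f''} (hf : FD v f f') (hg : FD w f f'') : FD (v + w) f (f' + f'') := by
  unfold FD at *
  filter_upwards [hf, hg, fourier_cplx_add f' f''] with ξ h1 h2 h3
  rw [h3, h1, h2, dsymb_add]; ring

lemma FD.dir_smul {v f f'} (c : ℝ) (hf : FD v f f') : FD (c • v) f (c • f') := by
  unfold FD at *
  filter_upwards [hf, fourier_cplx_smul c f'] with ξ h1 h3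
  rw [h3, h1, dsymb_smul]; ring

lemma fourier_slope (v : E3) (f : L2R) (r : ℝ) :
    (𝓕 (cplx (r⁻¹ • (tr (r • v) f - f))) : L2C) =ᵐ[volume]
      fun ξ => (r : ℂ)⁻¹ * (trSymb (r • v) ξ - 1) * (𝓕 (cplx f) : L2C) ξ := by
  filter_upwards [fourier_cplx_smul r⁻¹ (tr (r • v) f - f), fourier_cplx_sub (tr (r • v) f) f,
    fourier_cplx_tr (r • v) f] with ξ h1 h2 h3
  rw [h1, h2, h3]; push_cast; ring

lemma tendsto_slope_symb (v ξ : E3) :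
    Tendsto (fun r : ℝ => (r : ℂ)⁻¹ * (trSymb (r • v) ξ - 1)) (𝓝[≠] 0) (𝓝 (dsymb v ξ)) := by
  have h : HasDerivAt (fun r : ℝ => trSymb (r • v) ξ) (dsymb v ξ) 0 := by
    have h1 : HasDerivAt (fun r : ℝ => (r : ℂ) * dsymb v ξ) (1 * dsymb v ξ) 0 :=
      (HasDerivAt.ofReal_comp (hasDerivAt_id (0 : ℝ))).mul_const _
    have h2 := h1.cexp
    simp only [Complex.ofReal_zero, zero_mul, Complex.exp_zero, one_mul] at h2
    refine h2.congr_of_eventuallyEq (.of_forall fun r => ?_)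
    simp only [trSymb, dsymb, real_inner_smul_left]
    congr 1; push_cast; ring
  have := hasDerivAt_iff_tendsto_slope_zero.1 h
  simpa [trSymb_zero] using this

lemma lintegral_sub_eq_fourier (f g : L2R) : ∫⁻ x, ‖f x - g x‖ₑ ^ 2
    = ∫⁻ ξ, ‖(𝓕 (cplx f) : L2C) ξ - (𝓕 (cplx g) : L2C) ξ‖ₑ ^ 2 := by
  have h1 : ∫⁻ x, ‖f x - g x‖ₑ ^ 2 = ∫⁻ x, ‖(f - g : L2R) x‖ₑ ^ 2 := by
    refine lintegral_congr_ae ?_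
    filter_upwards [Lp.coeFn_sub f g] with x hx
    rw [hx, Pi.sub_apply]
  rw [h1, ← lintegral_fourier_cplx]
  refine lintegral_congr_ae ?_
  filter_upwards [fourier_cplx_sub f g] with x hx
  rw [hx]

lemma FD.hasDerivAt {v f g} (h : FD v f g) : HasDerivAt (fun r : ℝ => EulerRiesz.tr (r • v) f) g 0 := by
  rw [hasDerivAt_iff_tendsto_slope_zero]
  simp only [zero_add, zero_smul, tr_zero]
  rw [tendsto_Lp_iff_lintegral]
  have e : ∀ r : ℝ, ∫⁻ x, ‖(r⁻¹ • (EulerRiesz.tr (r • v) f - f)) x - g x‖ₑ ^ 2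
      = ∫⁻ ξ, ‖((r : ℂ)⁻¹ * (trSymb (r • v) ξ - 1) - dsymb v ξ) * (𝓕 (cplx f) : L2C) ξ‖ₑ ^ 2 := by
    intro r
    rw [lintegral_sub_eq_fourier]
    refine lintegral_congr_ae ?_
    filter_upwards [fourier_slope v f r, h] with ξ h1 h2
    rw [h1, h2, sub_mul]
  simp_rw [e]
  have hz : (0 : ℝ≥0∞) = ∫⁻ ξ : E3, 0 := by simp
  rw [hz]
  refine tendsto_lintegral_filter_of_dominated_convergence
    (fun ξ => (2 * ‖(𝓕 (cplx g) : L2C) ξ‖ₑ) ^ 2) ?_ ?_ ?_ ?_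
  · exact .of_forall fun r => ((((measurable_const.mul ((measurable_trSymb _).sub_const 1)).sub
      (measurable_dsymb v)).mul (Lp.stronglyMeasurable _).measurable).enorm.pow_const 2)
  · filter_upwards [self_mem_nhdsWithin] with r hr
    filter_upwards [h] with ξ h2
    refine pow_le_pow_left₀ (by simp) ?_ 2
    rw [h2, enorm_mul, enorm_mul, ← mul_assoc]
    refine mul_le_mul_left ?_ _
    refine (enorm_sub_le).trans ?_
    rw [two_mul]
    refine add_le_add_left ?_ _
    rw [enorm_le_iff_norm_le, norm_mul]
    have := norm_trSymb_sub_one_le (r • v) ξ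
    rw [dsymb_smul, norm_mul] at this
    rw [norm_inv]
    have hr' : 0 < ‖(r : ℂ)‖ := norm_pos_iff.2 (by exact_mod_cast hr)
    rwa [inv_mul_le_iff₀ hr']
  · simp_rw [mul_pow]
    rw [lintegral_const_mul' _ _ (by norm_num), lintegral_enorm_sq]
    exact (ENNReal.mul_lt_top (by norm_num) ENNReal.ofReal_lt_top).ne
  · refine .of_forall fun ξ => ?_
    have h1 := (((tendsto_slope_symb v ξ).sub_const (dsymb v ξ)).mul_const
      ((𝓕 (cplx f) : L2C) ξ)).enorm
    have h2 := ENNReal.Tendsto.pow (n := 2) h1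
    simpa using h2

lemma FD.of_hasDerivAt {v : E3} {f g : L2R}
    (h : HasDerivAt (fun r : ℝ => EulerRiesz.tr (r • v) f) g 0) : FD v f g := by
  rw [hasDerivAt_iff_tendsto_slope_zero] at h
  simp only [zero_add, zero_smul, tr_zero] at h
  have h1 : Tendsto (fun r : ℝ => (𝓕 (cplx (r⁻¹ • (EulerRiesz.tr (r • v) f - f))) : L2C)) (𝓝[≠] 0)
      (𝓝 (𝓕 (cplx g))) :=
    ((Lp.fourierTransformₗᵢ E3 ℂ).continuous.comp cplxL.continuous).continuousAt.tendsto.comp h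
  obtain ⟨l, hl, hl2⟩ := (tendstoInMeasure_of_tendsto_Lp h1).exists_seq_tendsto_ae'
  have h3 : ∀ᵐ ξ, ∀ i, (𝓕 (cplx ((l i)⁻¹ • (EulerRiesz.tr (l i • v) f - f))) : L2C) ξ
      = ((l i : ℝ) : ℂ)⁻¹ * (trSymb (l i • v) ξ - 1) * (𝓕 (cplx f) : L2C) ξ :=
    ae_all_iff.2 fun i => fourier_slope v f (l i)
  filter_upwards [hl2, h3] with ξ h4 h5
  refine tendsto_nhds_unique h4 ?_
  simp_rw [h5]
  exact ((tendsto_slope_symb v ξ).comp hl).mul_const _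

lemma inner_L2R (f g : L2R) : inner ℝ f g = ∫ x, f x * g x := by
  rw [L2.inner_def]
  refine integral_congr_ae (.of_forall fun x => ?_)
  simp [mul_comm]

lemma inner_tr_left (h : E3) (f g : L2R) : inner ℝ (tr h f) g = inner ℝ f (tr (-h) g) := by
  have := (tr (F := ℝ) h).inner_map_map f (EulerRiesz.tr (-h) g)
  rw [tr_tr] at this
  simpa using this

lemma FD.inner_ibp {v f f' g g'} (hf : FD v f f') (hg : FD v g g') :
    inner ℝ f' g = - inner ℝ f g' := by
  have h1 : HasDerivAt (fun r : ℝ => inner ℝ (EulerRiesz.tr (r • v) f) g) (inner ℝ f' g) 0 := by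
    simpa using hf.hasDerivAt.inner ℝ (hasDerivAt_const (0 : ℝ) g)
  have h2 : HasDerivAt (fun r : ℝ => inner ℝ f (EulerRiesz.tr ((-r) • v) g)) (-inner ℝ f g') 0 := by
    have h3 : HasDerivAt (fun r : ℝ => EulerRiesz.tr ((-r) • v) g) (-g') 0 := by
      have := HasDerivAt.scomp (0 : ℝ) (h := fun r : ℝ => -r) (h' := -1) (g₁ := fun r : ℝ => EulerRiesz.tr (r • v) g)
        (g₁' := g') (by simpa using hg.hasDerivAt) (hasDerivAt_neg 0)
      simpa [Function.comp_def] using this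
    simpa using (hasDerivAt_const (0 : ℝ) f).inner ℝ h3
  refine h1.unique (h2.congr_of_eventuallyEq (.of_forall fun r => ?_))
  simp only [inner_tr_left, neg_smul]

/-- Essentially bounded. -/
def Bdd (f : L2R) : Prop := ∃ c : ℝ, ∀ᵐ x, ‖f x‖ ≤ c

/-- Essentially bounded and uniformly continuous up to null sets. -/
def Nice (f : L2R) : Prop :=
  Bdd f ∧ ∀ ε > 0, ∀ᶠ h in 𝓝 (0 : E3), ∀ᵐ x, ‖tr h f x - f x‖ ≤ ε

/-- The product of two `L²` functions, when it is in `L²`. -/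
def mulL (f g : L2R) : L2R := by
  classical exact if h : MemLp (fun x => f x * g x) 2 volume then h.toLp else 0

lemma coe_mulL_of_memLp {f g : L2R} (h : MemLp (fun x => f x * g x) 2 volume) :
    mulL f g =ᵐ[volume] fun x => f x * g x := by
  rw [mulL, dif_pos h]; exact h.coeFn_toLp

lemma memLp_mul_of_bdd {f : E3 → ℝ} {c : ℝ} (hfm : AEStronglyMeasurable f volume)
    (hf : ∀ᵐ x, ‖f x‖ ≤ c) (g : L2R) : MemLp (fun x => f x * g x) 2 volume :=
  (Lp.memLp g).of_le_mul (c := c) (hfm.mul (Lp.aestronglyMeasurable g)) (by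
    filter_upwards [hf] with x hx
    rw [norm_mul]; exact mul_le_mul_of_nonneg_right hx (norm_nonneg _))

lemma Bdd.coe_mulL {f : L2R} (hf : Bdd f) (g : L2R) : mulL f g =ᵐ[volume] fun x => f x * g x := by
  obtain ⟨c, hc⟩ := hf
  exact coe_mulL_of_memLp (memLp_mul_of_bdd (Lp.aestronglyMeasurable f) hc g)

lemma mulL_comm (f g : L2R) : mulL f g = mulL g f := by
  have : (fun x => f x * g x) = fun x => g x * f x := funext fun x => mul_comm _ _
  by_cases h : MemLp (fun x => f x * g x) 2 volume
  · refine Lp.ext ((coe_mulL_of_memLp h).trans ?_)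
    rw [this]
    exact (coe_mulL_of_memLp (this ▸ h)).symm
  · rw [mulL, mulL, dif_neg h, dif_neg (this ▸ h)]

lemma norm_le_of_ae_le {f g : L2R} {c : ℝ} (h : ∀ᵐ x, ‖f x‖ ≤ c * ‖g x‖) : ‖f‖ ≤ c * ‖g‖ :=
  Lp.norm_le_mul_norm_of_ae_le_mul h

lemma Bdd.nonneg_bound {f : L2R} (hf : Bdd f) : ∃ c : ℝ, 0 ≤ c ∧ ∀ᵐ x, ‖f x‖ ≤ c := by
  obtain ⟨c, hc⟩ := hf
  exact ⟨max c 0, le_max_right _ _, hc.mono fun x hx => hx.trans (le_max_left _ _)⟩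

lemma Bdd.tr {f : L2R} (hf : Bdd f) (h : E3) : Bdd (tr h f) := by
  obtain ⟨c, hc⟩ := hf
  refine ⟨c, ?_⟩
  filter_upwards [coe_tr h f, ae_add_right hc h] with x h1 h2
  rwa [h1]

lemma Bdd.sub {f g : L2R} (hf : Bdd f) (hg : Bdd g) : Bdd (f - g) := by
  obtain ⟨c, hc⟩ := hf
  obtain ⟨d, hd⟩ := hg
  refine ⟨c + d, ?_⟩
  filter_upwards [hc, hd, Lp.coeFn_sub f g] with x h1 h2 h3
  rw [h3]
  exact (norm_sub_le _ _).trans (add_le_add h1 h2)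

lemma Bdd.mulL {f g : L2R} (hf : Bdd f) (hg : Bdd g) : Bdd (mulL f g) := by
  obtain ⟨c, hc0, hc⟩ := hf.nonneg_bound
  obtain ⟨d, hd⟩ := hg
  refine ⟨c * d, ?_⟩
  filter_upwards [hc, hd, hf.coe_mulL g] with x h1 h2 h3
  rw [h3, norm_mul]
  exact mul_le_mul h1 h2 (norm_nonneg _) hc0

lemma Nice.tr {f : L2R} (hf : Nice f) (h : E3) : Nice (tr h f) := by
  refine ⟨hf.1.tr h, fun ε hε => (hf.2 ε hε).mono fun k hk => ?_⟩
  rw [tr_comm]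
  filter_upwards [coe_tr h (EulerRiesz.tr k f), coe_tr h f, ae_add_right hk h] with x h1 h2 h3
  rwa [h1, h2]

lemma Nice.sub {f g : L2R} (hf : Nice f) (hg : Nice g) : Nice (f - g) := by
  refine ⟨hf.1.sub hg.1, fun ε hε => ?_⟩
  filter_upwards [hf.2 (ε / 2) (by positivity), hg.2 (ε / 2) (by positivity)] with h h1 h2
  rw [map_sub]
  filter_upwards [h1, h2, Lp.coeFn_sub f g, Lp.coeFn_sub (EulerRiesz.tr h f) (EulerRiesz.tr h g)]
    with x h3 h4 h5 h6
  rw [h5, h6, Pi.sub_apply, Pi.sub_apply, sub_sub_sub_comm]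
  exact (norm_sub_le _ _).trans (by linarith)

lemma Nice.mulL {f g : L2R} (hf : Nice f) (hg : Nice g) : Nice (mulL f g) := by
  refine ⟨hf.1.mulL hg.1, fun ε hε => ?_⟩
  obtain ⟨c, hc0, hc⟩ := hf.1.nonneg_bound
  obtain ⟨d, hd0, hd⟩ := hg.1.nonneg_bound
  filter_upwards [hf.2 (ε / (2 * (d + 1))) (by positivity),
    hg.2 (ε / (2 * (c + 1))) (by positivity)] with h h1 h2
  filter_upwards [h1, h2, hf.1.coe_mulL g, ae_add_right (hf.1.coe_mulL g) h,
    coe_tr h (EulerRiesz.mulL f g), coe_tr h f, coe_tr h g, hc, ae_add_right hd h]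
    with x h3 h4 h5 h6 h7 h8 h9 h10 h11
  rw [h7, h6, h5]
  rw [h8] at h3
  rw [h9] at h4
  have : f (x + h) * g (x + h) - f x * g x = (f (x + h) - f x) * g (x + h) + f x * (g (x + h) - g x) := by
    ring
  rw [this]
  refine (norm_add_le _ _).trans ?_
  rw [norm_mul, norm_mul]
  have e1 : ‖f (x + h) - f x‖ * ‖g (x + h)‖ ≤ ε / (2 * (d + 1)) * d :=
    mul_le_mul h3 h11 (norm_nonneg _) (by positivity)
  have e2 : ‖f x‖ * ‖g (x + h) - g x‖ ≤ c * (ε / (2 * (c + 1))) :=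
    mul_le_mul h10 h4 (norm_nonneg _) hc0
  have e3 : ε / (2 * (d + 1)) * d ≤ ε / 2 := by
    rw [div_mul_eq_mul_div, div_le_div_iff₀ (by positivity) (by positivity)]; nlinarith
  have e4 : c * (ε / (2 * (c + 1))) ≤ ε / 2 := by
    rw [mul_div_assoc', div_le_div_iff₀ (by positivity) (by positivity)]; nlinarith
  linarith

/-- Functions with integrable Fourier transform are bounded and uniformly continuous. -/
lemma nice_of_fourier {f : L2R} (hf : ∫⁻ ξ, ‖(𝓕 (cplx f) : L2C) ξ‖ₑ ≠ ∞) : Nice f := by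
  have tobd : ∀ g : L2R, ∀ c : ℝ≥0∞, c ≠ ∞ → ∫⁻ ξ, ‖(𝓕 (cplx g) : L2C) ξ‖ₑ = c →
      ∀ᵐ x, ‖g x‖ ≤ c.toReal := by
    intro g c hc hg
    have := ae_norm_le_lintegral_fourier (f := cplx g) (by rwa [hg])
    rw [hg] at this
    filter_upwards [this, coe_cplx g] with x h1 h2
    rwa [h2, Complex.norm_real] at h1
  refine ⟨⟨_, tobd f _ hf rfl⟩, fun ε hε => ?_⟩
  have e : ∀ h, ∫⁻ ξ, ‖(𝓕 (cplx (EulerRiesz.tr h f - f)) : L2C) ξ‖ₑ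
      = ∫⁻ ξ, ‖(trSymb h ξ - 1) * (𝓕 (cplx f) : L2C) ξ‖ₑ := by
    intro h
    refine lintegral_congr_ae ?_
    filter_upwards [fourier_cplx_sub (EulerRiesz.tr h f) f, fourier_cplx_tr h f] with ξ h1 h2
    rw [h1, h2, sub_mul, one_mul]
  have hlim : Tendsto (fun h => ∫⁻ ξ, ‖(trSymb h ξ - 1) * (𝓕 (cplx f) : L2C) ξ‖ₑ) (𝓝 (0 : E3))
      (𝓝 0) := by
    have hz : (0 : ℝ≥0∞) = ∫⁻ ξ : E3, 0 := by simp
    rw [hz]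
    refine tendsto_lintegral_filter_of_dominated_convergence
      (fun ξ => 2 * ‖(𝓕 (cplx f) : L2C) ξ‖ₑ) (.of_forall fun h => ?_) (.of_forall fun h => ?_) ?_ ?_
    · exact (((measurable_trSymb h).sub_const 1).mul (Lp.stronglyMeasurable _).measurable).enorm
    · refine .of_forall fun ξ => ?_
      rw [enorm_mul]
      refine mul_le_mul' ?_ le_rfl
      rw [← ofReal_norm]
      exact (ENNReal.ofReal_le_ofReal (norm_trSymb_sub_one_le_two h ξ)).trans (by simp)
    · rw [lintegral_const_mul' _ _ (by norm_num)]
      exact ENNReal.mul_ne_top (by norm_num) hf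
    · refine .of_forall fun ξ => ?_
      have h1 : Tendsto (fun h : E3 => trSymb h ξ) (𝓝 0) (𝓝 (trSymb 0 ξ)) :=
        (continuous_trSymb_uncurry.comp (Continuous.prodMk_left ξ)).tendsto 0
      have := ((h1.sub_const 1).mul_const ((𝓕 (cplx f) : L2C) ξ)).enorm
      simpa [trSymb_zero] using this
  have hev : ∀ᶠ h in 𝓝 (0 : E3), ∫⁻ ξ, ‖(trSymb h ξ - 1) * (𝓕 (cplx f) : L2C) ξ‖ₑ ≤
      ENNReal.ofReal ε := hlim.eventually (Iic_mem_nhds (by simpa using hε))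
  filter_upwards [hev] with h hh
  have hne : ∫⁻ ξ, ‖(trSymb h ξ - 1) * (𝓕 (cplx f) : L2C) ξ‖ₑ ≠ ∞ :=
    (hh.trans_lt ENNReal.ofReal_lt_top).ne
  filter_upwards [tobd _ _ hne (e h), Lp.coeFn_sub (EulerRiesz.tr h f) f] with x h1 h2
  rw [h2] at h1
  exact h1.trans (ENNReal.toReal_le_of_le_ofReal hε.le hh)

/-- Product rule for `L²`-differentiable curves, one of which is continuous in sup norm. -/
lemma hasDerivAt_mul_curve {F G P : ℝ → L2R} {f' g' p' : L2R} {r₀ : ℝ}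
    (hP : ∀ᶠ r in 𝓝 r₀, P r =ᵐ[volume] fun x => F r x * G r x)
    (hF : HasDerivAt F f' r₀) (hG : HasDerivAt G g' r₀) (bF : Bdd (F r₀)) (bG : Bdd (G r₀))
    (cF : ∀ ε > 0, ∀ᶠ r in 𝓝 r₀, ∀ᵐ x, ‖F r x - F r₀ x‖ ≤ ε)
    (hp : p' =ᵐ[volume] fun x => F r₀ x * g' x + f' x * G r₀ x) : HasDerivAt P p' r₀ := by
  have hP0 := hP.self_of_nhds
  rw [hasDerivAt_iff_isLittleO] at hF hG ⊢
  obtain ⟨c, hc0, hc⟩ := bF.nonneg_bound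
  obtain ⟨d, hd0, hd⟩ := bG.nonneg_bound
  rw [Asymptotics.isLittleO_iff] at hF hG ⊢
  intro η hη
  set D := c + d + ‖g'‖ + 2
  have hD : 0 < D := by positivity
  have hη' : 0 < min (η / D) 1 := by positivity
  filter_upwards [hP, hF hη', hG hη', cF _ hη'] with r h1 h2 h3 h4
  have key : P r - P r₀ - (r - r₀) • p' =
      (P r - P r₀ - (r - r₀) • p') := rfl
  set A := F r - F r₀ - (r - r₀) • f'
  set B := G r - G r₀ - (r - r₀) • g'
  set δ := min (η / D) 1
  have hBG : ‖G r - G r₀‖ ≤ δ * ‖r - r₀‖ + ‖r - r₀‖ * ‖g'‖ := by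
    have : G r - G r₀ = B + (r - r₀) • g' := by simp [B]
    rw [this]
    refine (norm_add_le _ _).trans ?_
    rw [norm_smul]
    exact add_le_add h3 le_rfl
  obtain ⟨m1, e1⟩ : ∃ m : L2R, m =ᵐ[volume] fun x => F r₀ x * B x :=
    ⟨EulerRiesz.mulL (F r₀) B, bF.coe_mulL B⟩
  obtain ⟨m2, e2⟩ : ∃ m : L2R, m =ᵐ[volume] fun x => G r₀ x * A x :=
    ⟨EulerRiesz.mulL (G r₀) A, bG.coe_mulL A⟩
  have hm3 : MemLp (fun x => (F r x - F r₀ x) * (G r - G r₀ : L2R) x) 2 volume :=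
    memLp_mul_of_bdd ((Lp.aestronglyMeasurable _).sub (Lp.aestronglyMeasurable _)) h4 _
  have e3 := hm3.coeFn_toLp
  set m3 : L2R := hm3.toLp
  have hsum : P r - P r₀ - (r - r₀) • p' = m1 + m2 + m3 := by
    refine Lp.ext ?_
    filter_upwards [h1, hP0, hp, e1, e2, e3, Lp.coeFn_sub (P r - P r₀) ((r - r₀) • p'),
      Lp.coeFn_sub (P r) (P r₀), Lp.coeFn_smul (r - r₀) p', Lp.coeFn_add (m1 + m2) m3,
      Lp.coeFn_add m1 m2, Lp.coeFn_sub (F r - F r₀) ((r - r₀) • f'), Lp.coeFn_sub (F r) (F r₀),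
      Lp.coeFn_smul (r - r₀) f', Lp.coeFn_sub (G r - G r₀) ((r - r₀) • g'),
      Lp.coeFn_sub (G r) (G r₀), Lp.coeFn_smul (r - r₀) g']
      with x a1 a2 a3 a4 a5 a6 a7 a8 a9 a10 a11 a12 a13 a14 a15 a16 a17
    simp only [a7, a8, a9, a10, a11, Pi.sub_apply, Pi.add_apply, Pi.smul_apply, smul_eq_mul, a1, a2,
      a3, a4, a5, a6, A, B, a12, a13, a14, a15, a16, a17]
    ring
  have n1 : ‖m1‖ ≤ c * ‖B‖ := norm_le_of_ae_le (by
    filter_upwards [e1, hc] with x h5 h6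
    rw [h5, norm_mul]; gcongr)
  have n2 : ‖m2‖ ≤ d * ‖A‖ := norm_le_of_ae_le (by
    filter_upwards [e2, hd] with x h5 h6
    rw [h5, norm_mul]; gcongr)
  have n3 : ‖m3‖ ≤ δ * ‖G r - G r₀‖ := norm_le_of_ae_le (by
    filter_upwards [e3, h4] with x h5 h6
    rw [h5, norm_mul]; gcongr)
  have hδ1 : δ ≤ 1 := min_le_right _ _
  have hδ2 : δ * D ≤ η := by
    have : δ ≤ η / D := min_le_left _ _
    rwa [le_div_iff₀ hD] at this
  rw [hsum]
  have hr := norm_nonneg (r - r₀)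
  have hg := norm_nonneg g'
  calc ‖m1 + m2 + m3‖ ≤ ‖m1‖ + ‖m2‖ + ‖m3‖ := norm_add₃_le
    _ ≤ c * (δ * ‖r - r₀‖) + d * (δ * ‖r - r₀‖) + δ * (1 * ‖r - r₀‖ + ‖r - r₀‖ * ‖g'‖) := by
        refine add_le_add (add_le_add (n1.trans ?_) (n2.trans ?_)) (n3.trans ?_)
        · gcongr
        · gcongr
        · refine mul_le_mul_of_nonneg_left (hBG.trans ?_) hη'.le
          gcongr
    _ = δ * (c + d + ‖g'‖ + 1) * ‖r - r₀‖ := by ring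
    _ ≤ δ * D * ‖r - r₀‖ := by gcongr; simp only [D]; linarith
    _ ≤ η * ‖r - r₀‖ := by gcongr

/-- The Leibniz rule. -/
lemma FD.mulL {v f f' g g'} (hf : FD v f f') (hg : FD v g g') (nf : Nice f) (ng : Nice g) :
    FD v (mulL f g) (EulerRiesz.mulL f g' + EulerRiesz.mulL g f') := by
  apply FD.of_hasDerivAt
  refine hasDerivAt_mul_curve (F := fun r : ℝ => EulerRiesz.tr (r • v) f)
    (G := fun r : ℝ => EulerRiesz.tr (r • v) g) (.of_forall fun r => ?_) hf.hasDerivAt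
    hg.hasDerivAt (by simpa using nf.1) (by simpa using ng.1) (fun ε hε => ?_) ?_
  · filter_upwards [coe_tr (r • v) (EulerRiesz.mulL f g), coe_tr (r • v) f, coe_tr (r • v) g,
      ae_add_right (nf.1.coe_mulL g) (r • v)] with x h1 h2 h3 h4
    rw [h1, h2, h3, h4]
  · have : Tendsto (fun r : ℝ => r • v) (𝓝 0) (𝓝 0) := by
      have : Continuous fun r : ℝ => r • v := by fun_prop
      simpa using this.tendsto 0
    simpa using this.eventually (nf.2 ε hε)
  · simp only [zero_smul, tr_zero]
    filter_upwards [Lp.coeFn_add (EulerRiesz.mulL f g') (EulerRiesz.mulL g f'), nf.1.coe_mulL g',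
      ng.1.coe_mulL f'] with x h1 h2 h3
    rw [h1, Pi.add_apply, h2, h3]; ring

end EulerRiesz

noncomputable section
namespace EulerRiesz

/-- The homogeneous weight `|h|^{-3-a}`. -/
def kw (a : ℝ) (h : E3) : ℝ≥0∞ := ENNReal.ofReal (‖h‖ ^ (-3 - a))

lemma measurable_kw (a : ℝ) : Measurable (kw a) := by unfold kw; fun_prop

lemma kw_ne_top (a : ℝ) (h : E3) : kw a h ≠ ∞ := ENNReal.ofReal_ne_top

lemma kw_mul_rpow {a b : ℝ} {h : E3} (hh : h ≠ 0) :
    ENNReal.ofReal (‖h‖ ^ b) * kw a h = kw (a - b) h := by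
  rw [kw, kw, ← ENNReal.ofReal_mul (by positivity), ← Real.rpow_add (norm_pos_iff.2 hh)]
  congr 2; ring

lemma kw_smul {a r : ℝ} (hr : 0 < r) (h : E3) :
    kw a (r • h) = ENNReal.ofReal (r ^ (-3 - a)) * kw a h := by
  rw [kw, kw, ← ENNReal.ofReal_mul (by positivity), norm_smul, Real.norm_of_nonneg hr.le,
    Real.mul_rpow hr.le (norm_nonneg _)]

lemma lintegral_comp_smul_E3 {r : ℝ} (hr : 0 < r) {f : E3 → ℝ≥0∞} (hf : Measurable f) :
    ∫⁻ x, f (r • x) = ENNReal.ofReal (r ^ (-3 : ℝ)) * ∫⁻ x, f x := by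
  have h1 := Measure.map_addHaar_smul (volume : Measure E3) hr.ne'
  have h2 : ∫⁻ x, f x ∂(Measure.map (r • ·) (volume : Measure E3)) = ∫⁻ x, f (r • x) :=
    lintegral_map hf (measurable_const_smul r)
  rw [← h2, h1, lintegral_smul_measure, smul_eq_mul]
  congr 2
  have : Module.finrank ℝ E3 = 3 := by simp
  rw [this, abs_of_pos (by positivity), Real.rpow_neg hr.le]
  norm_cast

lemma lintegral_min_kw_lt_top {a b : ℝ} (ha : 0 < a) (hab : a < b) :
    ∫⁻ h, ENNReal.ofReal (min 1 (‖h‖ ^ b)) * kw a h < ∞ := by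
  have hint : Integrable (fun h : E3 => (fun y : ℝ => min 1 (y ^ b) * y ^ (-3 - a)) ‖h‖) volume := by
    refine (integrable_fun_norm_addHaar (volume : Measure E3) (f := fun y : ℝ => min 1 (y ^ b) * y ^ (-3 - a))).2 ?_
    have : Module.finrank ℝ E3 - 1 = 2 := by simp
    rw [this, ← Ioc_union_Ioi_eq_Ioi (zero_le_one' ℝ)]
    refine IntegrableOn.union ?_ ?_
    · have h1 : IntegrableOn (fun y : ℝ => y ^ (b - a - 1)) (Ioc 0 1) := by
        rw [← intervalIntegrable_iff_integrableOn_Ioc_of_le zero_le_one]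
        exact intervalIntegral.intervalIntegrable_rpow' (by linarith)
      refine h1.congr_fun (fun y hy => ?_) measurableSet_Ioc
      have hy0 := hy.1
      simp only [smul_eq_mul]
      rw [min_eq_right (Real.rpow_le_one hy.1.le hy.2 (by linarith)), ← Real.rpow_natCast,
        ← Real.rpow_add hy0, ← Real.rpow_add hy0]
      congr 1; push_cast; ring
    · have h1 : IntegrableOn (fun y : ℝ => y ^ (-1 - a)) (Ioi 1) :=
        integrableOn_Ioi_rpow_of_lt (by linarith) one_pos
      refine h1.congr_fun (fun y hy => ?_) measurableSet_Ioi
      have hy1 : (1 : ℝ) < y := hy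
      have hy0 : 0 < y := by linarith
      simp only [smul_eq_mul]
      rw [min_eq_left (Real.one_le_rpow hy1.le (by linarith)), one_mul, ← Real.rpow_natCast,
        ← Real.rpow_add hy0]
      congr 1; push_cast; ring
  refine lt_of_le_of_lt (le_of_eq (lintegral_congr fun h => ?_)) hint.lintegral_lt_top
  rw [kw, ENNReal.ofReal_mul (by positivity)]

lemma exists_isometry_to (ξ : E3) (e : E3) (he : ‖e‖ = 1) :
    ∃ L : E3 ≃ₗᵢ[ℝ] E3, L ξ = ‖ξ‖ • e :=
  ⟨_, Submodule.reflection_sub (v := ξ) (w := ‖ξ‖ • e) (by rw [norm_smul, he]; simp)⟩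

/-- Homogeneous integrals of functions of `⟪h, ξ⟫` are powers of `|ξ|`. -/
lemma lintegral_kw_inner {φ : ℝ → ℝ≥0∞} (hφ : Measurable φ) (a : ℝ) {e : E3} (he : ‖e‖ = 1)
    {ξ : E3} (hξ : ξ ≠ 0) :
    ∫⁻ h, φ (inner ℝ h ξ) * kw a h
      = ENNReal.ofReal (‖ξ‖ ^ a) * ∫⁻ h, φ (inner ℝ h e) * kw a h := by
  obtain ⟨L, hL⟩ := exists_isometry_to ξ e he
  have hpos := norm_pos_iff.2 hξ
  have hmeas : ∀ v : E3, Measurable fun h => φ (inner ℝ h v) * kw a h := fun v =>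
    (hφ.comp (by fun_prop)).mul (measurable_kw a)
  calc ∫⁻ h, φ (inner ℝ h ξ) * kw a h = ∫⁻ h, φ (inner ℝ (L h) (‖ξ‖ • e)) * kw a (L h) := by
        refine lintegral_congr fun h => ?_
        rw [← hL, L.inner_map_map, kw, kw, L.norm_map]
    _ = ∫⁻ h, φ (inner ℝ h (‖ξ‖ • e)) * kw a h :=
        L.measurePreserving.lintegral_comp (hmeas _)
    _ = ENNReal.ofReal (‖ξ‖ ^ (3 + a)) *
          ∫⁻ h, φ (inner ℝ (‖ξ‖ • h) e) * kw a (‖ξ‖ • h) := by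
        rw [← lintegral_const_mul' _ _ ENNReal.ofReal_ne_top]
        refine lintegral_congr fun h => ?_
        rw [kw_smul hpos, real_inner_smul_left, real_inner_smul_right]
        rw [mul_left_comm, ← mul_assoc (ENNReal.ofReal _) (ENNReal.ofReal _) (kw a h),
          ← ENNReal.ofReal_mul (by positivity), ← Real.rpow_add hpos]
        simp
    _ = _ := by
        rw [lintegral_comp_smul_E3 hpos (hmeas e), ← mul_assoc, ← ENNReal.ofReal_mul (by positivity),
          ← Real.rpow_add hpos]
        congr 3; ring

lemma lintegral_kw_inner_pos {φ : ℝ → ℝ≥0∞} (hφ : Continuous φ) (a : ℝ) {e : E3} (he : ‖e‖ = 1)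
    (hne : φ (1 / 2) ≠ 0) : ∫⁻ h, φ (inner ℝ h e) * kw a h ≠ 0 := by
  intro h0
  have hm : Measurable fun h => φ (inner ℝ h e) * kw a h :=
    (hφ.measurable.comp (by fun_prop)).mul (measurable_kw a)
  rw [lintegral_eq_zero_iff hm] at h0
  have ho : IsOpen {h : E3 | φ (inner ℝ h e) ≠ 0 ∧ h ≠ 0} := by
    refine IsOpen.inter ?_ isOpen_ne
    exact isOpen_ne.preimage (hφ.comp (by fun_prop : Continuous fun h : E3 => inner ℝ h e))
  have hn : {h : E3 | φ (inner ℝ h e) ≠ 0 ∧ h ≠ 0}.Nonempty := by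
    refine ⟨(1 / 2 : ℝ) • e, ?_, ?_⟩
    · rw [real_inner_smul_left, real_inner_self_eq_norm_sq, he]; simpa using hne
    · simp [← norm_ne_zero_iff, he]
  have := ho.measure_pos volume hn
  refine this.ne' (measure_mono_null ?_ h0)
  rintro h ⟨h1, h2⟩
  simp only [mem_compl_iff, mem_ofPred_eq, Pi.zero_apply, mul_eq_zero, not_or]
  refine ⟨h1, ?_⟩
  rw [kw, ENNReal.ofReal_eq_zero, not_le]
  have := norm_pos_iff.2 h2
  positivity

/-- The first basis vector. -/
abbrev e₀ : E3 := EuclideanSpace.single 0 1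

lemma norm_e₀ : ‖e₀‖ = 1 := by simp [e₀]

/-- The constant in the difference characterization of `Ḣ^a`. -/
def diffConst (k : ℕ) (a : ℝ) : ℝ≥0∞ := ∫⁻ h, ‖trSymb h e₀ - 1‖ₑ ^ (2 * k) * kw (2 * a) h

lemma lintegral_trSymb (k : ℕ) (a : ℝ) {ξ : E3} (hξ : ξ ≠ 0) :
    ∫⁻ h, ‖trSymb h ξ - 1‖ₑ ^ (2 * k) * kw (2 * a) h
      = ENNReal.ofReal (‖ξ‖ ^ (2 * a)) * diffConst k a := by
  have := lintegral_kw_inner (φ := fun t =>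
    ‖Complex.exp ((2 * Real.pi * t : ℝ) * Complex.I) - 1‖ₑ ^ (2 * k)) (by fun_prop) (2 * a) norm_e₀ hξ
  exact this

lemma diffConst_ne_zero (k : ℕ) (a : ℝ) : diffConst k a ≠ 0 := by
  have := lintegral_kw_inner_pos (φ := fun t =>
    ‖Complex.exp ((2 * Real.pi * t : ℝ) * Complex.I) - 1‖ₑ ^ (2 * k))
    ((ENNReal.continuous_pow _).comp (by fun_prop : Continuous fun t : ℝ =>
      Complex.exp ((2 * Real.pi * t : ℝ) * Complex.I) - 1).enorm) (2 * a) norm_e₀ (by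
      have : Complex.exp ((2 * Real.pi * (1 / 2) : ℝ) * Complex.I) = -1 := by
        rw [show 2 * Real.pi * (1 / 2) = Real.pi by ring, Complex.exp_pi_mul_I]
      rw [this]
      refine pow_ne_zero _ ?_
      rw [enorm_ne_zero]; norm_num)
  exact this

lemma norm_trSymb_e₀_le (h : E3) : ‖trSymb h e₀ - 1‖ ≤ 2 * Real.pi * min 1 ‖h‖ := by
  rw [mul_min_of_nonneg _ _ (by positivity), le_min_iff]
  constructor
  · exact (norm_trSymb_sub_one_le_two h e₀).trans (by linarith [Real.pi_gt_three])
  · refine (norm_trSymb_sub_one_le h e₀).trans ((norm_dsymb_le h e₀).trans (le_of_eq ?_))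
    rw [freq, norm_e₀]; ring

lemma diffConst_lt_top {k : ℕ} {a : ℝ} (ha : 0 < a) (hk : a < k) : diffConst k a < ∞ := by
  have hb := lintegral_min_kw_lt_top (a := 2 * a) (b := 2 * k) (by positivity) (by linarith)
  refine lt_of_le_of_lt (b := ∫⁻ h, ENNReal.ofReal ((2 * Real.pi) ^ (2 * k)) *
    (ENNReal.ofReal (min 1 (‖h‖ ^ (2 * k : ℝ))) * kw (2 * a) h)) ?_ ?_
  · refine lintegral_mono fun h => ?_
    dsimp only
    rw [← mul_assoc, ← ENNReal.ofReal_mul (by positivity)]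
    refine mul_le_mul' ?_ le_rfl
    rw [← ofReal_norm, ← ENNReal.ofReal_pow (norm_nonneg _)]
    refine ENNReal.ofReal_le_ofReal ?_
    refine (pow_le_pow_left₀ (norm_nonneg _) (norm_trSymb_e₀_le h) _).trans ?_
    rw [mul_pow]
    gcongr
    rw [le_min_iff]
    have h0 : (0 : ℝ) ≤ min 1 ‖h‖ := le_min zero_le_one (norm_nonneg _)
    constructor
    · exact pow_le_one₀ h0 (min_le_left _ _)
    · have : ‖h‖ ^ (2 * k : ℝ) = ‖h‖ ^ (2 * k) := by
        rw [← Real.rpow_natCast]; push_cast; rfl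
      rw [this]
      exact pow_le_pow_left₀ h0 (min_le_right _ _) _
  · rw [lintegral_const_mul' _ _ ENNReal.ofReal_ne_top]
    exact ENNReal.mul_lt_top ENNReal.ofReal_lt_top hb

/-- The difference operator `f ↦ f(· + h) - f`. -/
def dl {F : Type*} [NormedAddCommGroup F] [NormedSpace ℝ F] (h : E3) :
    Lp F 2 (volume : Measure E3) →L[ℝ] Lp F 2 (volume : Measure E3) :=
  (tr h).toContinuousLinearMap - ContinuousLinearMap.id ℝ _

lemma dl_apply {F : Type*} [NormedAddCommGroup F] [NormedSpace ℝ F] (h : E3)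
    (f : Lp F 2 (volume : Measure E3)) : dl h f = tr h f - f := rfl

lemma dl_pow_succ {F : Type*} [NormedAddCommGroup F] [NormedSpace ℝ F] (h : E3) (k : ℕ)
    (f : Lp F 2 (volume : Measure E3)) :
    (dl h ^ (k + 1)) f = tr h ((dl h ^ k) f) - (dl h ^ k) f := by
  rw [pow_succ']; rfl

lemma norm_dl_pow_le {F : Type*} [NormedAddCommGroup F] [NormedSpace ℝ F] (h : E3) (k : ℕ)
    (f : Lp F 2 (volume : Measure E3)) : ‖(dl h ^ k) f‖ ≤ 2 ^ k * ‖f‖ := by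
  induction k with
  | zero => simp
  | succ k ih =>
    rw [dl_pow_succ]
    refine (norm_sub_le _ _).trans ?_
    rw [LinearIsometry.norm_map, pow_succ]; linarith

lemma FD.dl_pow {v f f'} (hf : FD v f f') (h : E3) (k : ℕ) : FD v ((dl h ^ k) f) ((dl h ^ k) f') := by
  induction k with
  | zero => simpa using hf
  | succ k ih => rw [dl_pow_succ, dl_pow_succ]; exact (ih.tr h).sub ih

lemma Nice.dl_pow {f : L2R} (hf : Nice f) (h : E3) (k : ℕ) : Nice ((dl h ^ k) f) := by
  induction k with
  | zero => simpa using hf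
  | succ k ih => rw [dl_pow_succ]; exact (ih.tr h).sub ih

lemma fourier_dl_pow (h : E3) (k : ℕ) (f : L2R) : (𝓕 (cplx ((dl h ^ k) f)) : L2C) =ᵐ[volume]
    fun ξ => (trSymb h ξ - 1) ^ k * (𝓕 (cplx f) : L2C) ξ := by
  induction k with
  | zero => simp
  | succ k ih =>
    rw [dl_pow_succ]
    filter_upwards [ih, fourier_cplx_sub (tr h ((dl h ^ k) f)) ((dl h ^ k) f),
      fourier_cplx_tr h ((dl h ^ k) f)] with ξ h1 h2 h3
    rw [h2, h3, h1, pow_succ]; ring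

/-- Differences characterize the homogeneous Sobolev norm. -/
lemma lintegral_dl_pow_kw (k : ℕ) (a : ℝ) (g : E3 → ℝ≥0∞) (hg : Measurable g) :
    ∫⁻ h, (∫⁻ ξ, ‖trSymb h ξ - 1‖ₑ ^ (2 * k) * g ξ) * kw (2 * a) h
      = diffConst k a * ∫⁻ ξ, ENNReal.ofReal (‖ξ‖ ^ (2 * a)) * g ξ := by
  have hm : Measurable fun z : E3 × E3 => ‖trSymb z.1 z.2 - 1‖ₑ ^ (2 * k) * g z.2 * kw (2 * a) z.1 :=
    (((continuous_trSymb_uncurry.sub continuous_const).measurable.enorm.pow_const _).mul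
      (hg.comp measurable_snd)).mul ((measurable_kw _).comp measurable_fst)
  calc ∫⁻ h, (∫⁻ ξ, ‖trSymb h ξ - 1‖ₑ ^ (2 * k) * g ξ) * kw (2 * a) h
      = ∫⁻ h, ∫⁻ ξ, ‖trSymb h ξ - 1‖ₑ ^ (2 * k) * g ξ * kw (2 * a) h := by
        refine lintegral_congr fun h => ?_
        rw [lintegral_mul_const' _ _ (kw_ne_top _ _)]
    _ = ∫⁻ ξ, ∫⁻ h, ‖trSymb h ξ - 1‖ₑ ^ (2 * k) * g ξ * kw (2 * a) h :=
        lintegral_lintegral_swap hm.aemeasurable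
    _ = ∫⁻ ξ, diffConst k a * (ENNReal.ofReal (‖ξ‖ ^ (2 * a)) * g ξ) := by
        refine lintegral_congr_ae ?_
        filter_upwards [ae_ne_zero] with ξ hξ
        have hm2 : Measurable fun h => ‖trSymb h ξ - 1‖ₑ ^ (2 * k) * kw (2 * a) h :=
          (((continuous_trSymb_uncurry.comp (Continuous.prodMk_left ξ)).sub
            continuous_const).measurable.enorm.pow_const _).mul (measurable_kw _)
        simp_rw [mul_right_comm _ (g ξ)]
        rw [lintegral_mul_const _ hm2, lintegral_trSymb k a hξ]
        ring
    _ = _ := by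
        rw [lintegral_const_mul _ (by fun_prop)]

end EulerRiesz

noncomputable section
namespace EulerRiesz

/-- The weight `|h|^{-3-a}` restricted to `|h| > ε`. -/
def nu (a ε : ℝ) : Measure E3 := (volume.withDensity (kw a)).restrict {h | ε < ‖h‖}

lemma measurableSet_gt (ε : ℝ) : MeasurableSet {h : E3 | ε < ‖h‖} :=
  measurableSet_lt measurable_const measurable_norm

lemma lintegral_nu (a ε : ℝ) {g : E3 → ℝ≥0∞} (hg : Measurable g) :
    ∫⁻ h, g h ∂(nu a ε) = ∫⁻ h, {h : E3 | ε < ‖h‖}.indicator 1 h * (g h * kw a h) := by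
  rw [nu, restrict_withDensity (measurableSet_gt ε),
    lintegral_withDensity_eq_lintegral_mul _ (measurable_kw a) hg,
    ← lintegral_indicator (measurableSet_gt ε)]
  refine lintegral_congr fun h => ?_
  by_cases hh : h ∈ {h : E3 | ε < ‖h‖}
  · rw [indicator_of_mem hh, indicator_of_mem hh]; simp [mul_comm]
  · simp only [indicator_of_notMem hh, zero_mul]

lemma lintegral_nu_le (a ε : ℝ) {g : E3 → ℝ≥0∞} (hg : Measurable g) :
    ∫⁻ h, g h ∂(nu a ε) ≤ ∫⁻ h, g h * kw a h := by
  rw [lintegral_nu a ε hg]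
  refine lintegral_mono fun h => ?_
  by_cases hh : h ∈ {h : E3 | ε < ‖h‖}
  · simp [indicator_of_mem hh]
  · simp [indicator_of_notMem hh]

instance sfinite_nu (a ε : ℝ) : SFinite (nu a ε) := by unfold nu; infer_instance

lemma nu_finite {a ε : ℝ} (ha : 0 < a) (hε : 0 < ε) : IsFiniteMeasure (nu a ε) := by
  constructor
  have h1 : nu a ε univ = ∫⁻ h, (1 : E3 → ℝ≥0∞) h ∂(nu a ε) := by simp
  rw [h1, lintegral_nu a ε measurable_one]
  have hfin := lintegral_min_kw_lt_top ha (show a < a + 1 by linarith)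
  have hc : 0 < min 1 (ε ^ (a + 1)) := by positivity
  refine lt_of_le_of_lt (b := ∫⁻ h, ENNReal.ofReal (min 1 (ε ^ (a + 1)))⁻¹ *
    (ENNReal.ofReal (min 1 (‖h‖ ^ (a + 1))) * kw a h)) ?_ ?_
  · refine lintegral_mono fun h => ?_
    by_cases hh : h ∈ {h : E3 | ε < ‖h‖}
    · simp only [indicator_of_mem hh, Pi.one_apply, one_mul]
      rw [← mul_assoc, ← ENNReal.ofReal_mul (by positivity)]
      refine le_mul_of_one_le_left' ?_
      rw [ENNReal.one_le_ofReal, ← div_eq_inv_mul, one_le_div hc]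
      have hh' : ε < ‖h‖ := hh
      gcongr
    · simp [indicator_of_notMem hh]
  · rw [lintegral_const_mul' _ _ ENNReal.ofReal_ne_top]
    exact ENNReal.mul_lt_top ENNReal.ofReal_lt_top hfin

/-- Scaling of the truncated weight. -/
lemma lintegral_nu_double (a ε : ℝ) (hε : 0 < ε) {g : E3 → ℝ≥0∞} (hg : Measurable g) :
    ∫⁻ h, g ((2 : ℝ) • h) ∂(nu a ε) ≤ ENNReal.ofReal (2 ^ a) * ∫⁻ h, g h ∂(nu a ε) := by
  have hind : Measurable fun h : E3 => {h : E3 | ε < ‖h‖}.indicator (1 : E3 → ℝ≥0∞) h :=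
    measurable_one.indicator (measurableSet_gt ε)
  rw [lintegral_nu a ε (g := fun h => g ((2 : ℝ) • h)) (hg.comp (measurable_const_smul _)),
    lintegral_nu a ε hg]
  calc ∫⁻ h, {h : E3 | ε < ‖h‖}.indicator 1 h * (g ((2 : ℝ) • h) * kw a h)
      ≤ ∫⁻ h, ENNReal.ofReal (2 ^ (3 + a)) * ({h : E3 | ε < ‖h‖}.indicator 1 ((2 : ℝ) • h) *
          (g ((2 : ℝ) • h) * kw a ((2 : ℝ) • h))) := by
        refine lintegral_mono fun h => ?_
        by_cases hh : h ∈ {h : E3 | ε < ‖h‖}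
        · have hh2 : (2 : ℝ) • h ∈ {h : E3 | ε < ‖h‖} := by
            have : ε < ‖h‖ := hh
            simp only [mem_ofPred_eq, norm_smul]
            norm_num; linarith
          simp only [indicator_of_mem hh, indicator_of_mem hh2, Pi.one_apply, one_mul]
          rw [kw_smul two_pos, mul_left_comm, ← mul_assoc (ENNReal.ofReal _) (ENNReal.ofReal _),
            ← ENNReal.ofReal_mul (by positivity), ← Real.rpow_add two_pos]
          simp
        · simp [indicator_of_notMem hh]
    _ = _ := by
        rw [lintegral_const_mul' _ _ ENNReal.ofReal_ne_top,
          lintegral_comp_smul_E3 two_pos (f := fun h => {h : E3 | ε < ‖h‖}.indicator 1 h *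
            (g h * kw a h)) (hind.mul (hg.mul (measurable_kw a))), ← mul_assoc,
          ← ENNReal.ofReal_mul (by positivity), ← Real.rpow_add two_pos]
        congr 3; ring

/-- The measure on pairs `(h, x)`. -/
abbrev nuX (a ε : ℝ) : Measure (E3 × E3) := (nu a ε).prod volume

/-- Shift of the second variable by the first. -/
def sh (G : E3 × E3 → ℝ) : E3 × E3 → ℝ := fun z => G (z.1, z.2 + z.1)

/-- Iterated differences as functions of increment and position. -/
def Df (k : ℕ) (F : E3 → ℝ) : E3 × E3 → ℝ := (fun G => sh G - G)^[k] (fun z => F z.2)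

lemma Df_zero (F : E3 → ℝ) : Df 0 F = fun z => F z.2 := rfl

lemma Df_succ (k : ℕ) (F : E3 → ℝ) : Df (k + 1) F = sh (Df k F) - Df k F := by
  unfold Df; rw [Function.iterate_succ_apply']

lemma measurable_sh {G : E3 × E3 → ℝ} (hG : Measurable G) : Measurable (sh G) := by
  unfold sh; exact hG.comp (by fun_prop)

lemma measurable_Df (k : ℕ) {F : E3 → ℝ} (hF : Measurable F) : Measurable (Df k F) := by
  induction k with
  | zero => exact hF.comp measurable_snd
  | succ k ih => rw [Df_succ]; exact (measurable_sh ih).sub ih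

lemma coe_dl_pow (h : E3) (k : ℕ) (f : L2R) {F : E3 → ℝ} (hF : f =ᵐ[volume] F) :
    (dl h ^ k) f =ᵐ[volume] fun x => Df k F (h, x) := by
  induction k with
  | zero => simpa [Df_zero] using hF
  | succ k ih =>
    rw [dl_pow_succ]
    filter_upwards [ih, ae_add_right ih h, Lp.coeFn_sub (tr h ((dl h ^ k) f)) ((dl h ^ k) f),
      coe_tr h ((dl h ^ k) f)] with x h1 h2 h3 h4
    rw [h3, Pi.sub_apply, h4, h1, h2, Df_succ]; rfl

lemma measurePreserving_shear (a ε : ℝ) :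
    MeasurePreserving (fun z : E3 × E3 => (z.1, z.2 + z.1)) (nuX a ε) (nuX a ε) :=
  (MeasurePreserving.id (nu a ε)).skew_product (g := fun h x => x + h) (by fun_prop)
    (.of_forall fun h => (measurePreserving_add_right volume h).map_eq)

lemma eLpNorm_sh (a ε : ℝ) {G : E3 × E3 → ℝ} (hG : Measurable G) (q : ℝ≥0∞) :
    eLpNorm (sh G) q (nuX a ε) = eLpNorm G q (nuX a ε) :=
  eLpNorm_comp_measurePreserving hG.aestronglyMeasurable (measurePreserving_shear a ε)

lemma eLpNorm_Df_succ_le (a ε : ℝ) {F : E3 → ℝ} (hF : Measurable F) {q : ℝ≥0∞} (hq : 1 ≤ q) (k : ℕ) :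
    eLpNorm (Df (k + 1) F) q (nuX a ε) ≤ 2 * eLpNorm (Df k F) q (nuX a ε) := by
  have hm := measurable_Df k hF
  rw [Df_succ, two_mul]
  refine (eLpNorm_sub_le (measurable_sh hm).aestronglyMeasurable hm.aestronglyMeasurable hq).trans ?_
  rw [eLpNorm_sh a ε hm]

/-- Doubling the increment: `δ_{2h}^k = (δ_h + 2)^k δ_h^k`. -/
lemma Df_double (k : ℕ) (F : E3 → ℝ) (z : E3 × E3) :
    Df k F ((2 : ℝ) • z.1, z.2) = ((fun G => sh G + G)^[k] (Df k F)) z := by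
  have comm : ∀ G : E3 × E3 → ℝ, (fun G => sh G - G) ((fun G => sh G + G) G)
      = (fun G => sh G + G) ((fun G => sh G - G) G) := by
    intro G
    ext z
    simp only [sh, Pi.add_apply, Pi.sub_apply]; ring
  have hcomm : Function.Commute (fun G : E3 × E3 → ℝ => sh G - G) (fun G => sh G + G) := comm
  have key : ∀ k, (fun z : E3 × E3 => Df k F ((2 : ℝ) • z.1, z.2))
      = (fun G => sh G + G)^[k] (Df k F) := by
    intro k
    induction k with
    | zero => rfl
    | succ k ih =>
      have e1 : (fun z : E3 × E3 => Df (k + 1) F ((2 : ℝ) • z.1, z.2))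
          = (fun G => sh G - G) ((fun G => sh G + G) (fun z => Df k F ((2 : ℝ) • z.1, z.2))) := by
        ext z
        have e2 : z.2 + (2 : ℝ) • z.1 = z.2 + z.1 + z.1 := by rw [two_smul]; abel
        rw [Df_succ]
        simp only [sh, Pi.add_apply, Pi.sub_apply, e2]; ring
      have e3 := (hcomm.iterate_right (k + 1)) (Df k F)
      rw [Function.iterate_succ_apply'] at e3
      rw [e1, ih, Df_succ]
      exact e3
  exact congrFun (key k) z

lemma eLpNorm_iterate_sub_le (a ε : ℝ) {q : ℝ≥0∞} (hq : 1 ≤ q) (k : ℕ) {G : E3 × E3 → ℝ}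
    (hG : Measurable G) : Measurable ((fun G => sh G + G)^[k] G) ∧
    eLpNorm ((fun G => sh G + G)^[k] G - (2 : ℝ) ^ k • G) q (nuX a ε)
      ≤ (k * 2 ^ k : ℕ) * eLpNorm (sh G - G) q (nuX a ε) := by
  induction k with
  | zero => simpa using hG
  | succ k ih =>
    obtain ⟨hm, ih⟩ := ih
    rw [Function.iterate_succ_apply']
    set A := (fun G => sh G + G)^[k] G
    refine ⟨(measurable_sh hm).add hm, ?_⟩
    have hD : Measurable (A - (2 : ℝ) ^ k • G) := hm.sub (hG.const_smul _)
    have e : (sh A + A) - (2 : ℝ) ^ (k + 1) • G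
        = sh (A - (2 : ℝ) ^ k • G) + (A - (2 : ℝ) ^ k • G) + (2 : ℝ) ^ k • (sh G - G) := by
      ext z
      simp only [sh, Pi.add_apply, Pi.sub_apply, Pi.smul_apply, smul_eq_mul]; ring
    change eLpNorm ((sh A + A) - (2 : ℝ) ^ (k + 1) • G) q (nuX a ε) ≤ _
    rw [e]
    have hS : Measurable (sh G - G) := (measurable_sh hG).sub hG
    refine (eLpNorm_add_le ((measurable_sh hD).add hD).aestronglyMeasurable
      (hS.const_smul _).aestronglyMeasurable hq).trans ?_
    refine (add_le_add_left (eLpNorm_add_le (measurable_sh hD).aestronglyMeasurable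
      hD.aestronglyMeasurable hq) _).trans ?_
    rw [eLpNorm_sh a ε hD, eLpNorm_const_smul]
    have e2 : ‖(2 : ℝ) ^ k‖ₑ = 2 ^ k := by
      rw [enorm_pow]; congr 1
      rw [← ofReal_norm]; norm_num
    rw [e2]
    calc _ ≤ (k * 2 ^ k : ℕ) * eLpNorm (sh G - G) q (nuX a ε)
            + (k * 2 ^ k : ℕ) * eLpNorm (sh G - G) q (nuX a ε)
            + 2 ^ k * eLpNorm (sh G - G) q (nuX a ε) := by gcongr
      _ = (2 * (k * 2 ^ k) + 2 ^ k : ℕ) * eLpNorm (sh G - G) q (nuX a ε) := by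
          push_cast; ring
      _ ≤ _ := by
          gcongr
          rw [pow_succ]; nlinarith [Nat.one_le_two_pow (n := k)]

lemma eLpNorm_Df_double (a ε : ℝ) (hε : 0 < ε) {F : E3 → ℝ} (hF : Measurable F) {q : ℝ} (hq : 1 ≤ q)
    (k : ℕ) :
    eLpNorm ((fun G => sh G + G)^[k] (Df k F)) (ENNReal.ofReal q) (nuX a ε)
      ≤ ENNReal.ofReal (2 ^ (a / q)) * eLpNorm (Df k F) (ENNReal.ofReal q) (nuX a ε) := by
  have hq0 : 0 < q := by linarith
  have e1 : ((fun G => sh G + G)^[k] (Df k F)) = fun z => Df k F ((2 : ℝ) • z.1, z.2) := by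
    ext z; rw [Df_double]
  have hm := measurable_Df k hF
  have hm1 : Measurable fun z : E3 × E3 => ‖Df k F z‖ₑ ^ q := by fun_prop
  have hm2 : Measurable fun z : E3 × E3 => ‖Df k F ((2 : ℝ) • z.1, z.2)‖ₑ ^ q :=
    hm1.comp (g := fun z : E3 × E3 => ‖Df k F z‖ₑ ^ q) (f := fun z : E3 × E3 => ((2 : ℝ) • z.1, z.2))
      (by fun_prop)
  rw [e1, eLpNorm_eq_lintegral_rpow_enorm_toReal (by simpa using hq0) (by simp),
    eLpNorm_eq_lintegral_rpow_enorm_toReal (by simpa using hq0) (by simp),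
    ENNReal.toReal_ofReal hq0.le]
  have e2 : ENNReal.ofReal (2 ^ (a / q)) = ENNReal.ofReal (2 ^ a) ^ (1 / q) := by
    rw [ENNReal.ofReal_rpow_of_nonneg (by positivity) (by positivity), ← Real.rpow_mul (by norm_num)]
    congr 2; ring
  rw [e2, ← ENNReal.mul_rpow_of_nonneg _ _ (by positivity)]
  refine ENNReal.rpow_le_rpow ?_ (by positivity)
  rw [lintegral_prod _ hm2.aemeasurable, lintegral_prod _ hm1.aemeasurable]
  exact lintegral_nu_double a ε hε (g := fun h => ∫⁻ x, ‖Df k F (h, x)‖ₑ ^ q)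
    hm1.lintegral_prod_right'

lemma eLpNorm_Df_lt_top {a ε : ℝ} (ha : 0 < a) (hε : 0 < ε) {F : E3 → ℝ} (hF : Measurable F)
    {q : ℝ≥0∞} (hq : 1 ≤ q) (hFq : MemLp F q volume) (k : ℕ) :
    eLpNorm (Df k F) q (nuX a ε) < ∞ := by
  induction k with
  | zero =>
    have := nu_finite ha hε
    exact (hFq.comp_snd (nu a ε)).eLpNorm_lt_top
  | succ k ih =>
    exact (eLpNorm_Df_succ_le a ε hF hq k).trans_lt (ENNReal.mul_lt_top (by simp) ih)

lemma eLpNorm_Df_le_succ {a ε : ℝ} (ha : 0 < a) (hε : 0 < ε) {q : ℝ} (hq : 1 ≤ q) {k : ℕ}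
    (hk : a / q < k) {F : E3 → ℝ} (hF : Measurable F) (hFq : MemLp F (ENNReal.ofReal q) volume) :
    eLpNorm (Df k F) (ENNReal.ofReal q) (nuX a ε)
      ≤ ENNReal.ofReal ((k * 2 ^ k) / (2 ^ k - 2 ^ (a / q))) *
        eLpNorm (Df (k + 1) F) (ENNReal.ofReal q) (nuX a ε) := by
  have hq1 : 1 ≤ ENNReal.ofReal q := by simpa using hq
  have hm := measurable_Df k hF
  obtain ⟨hmi, hit⟩ := eLpNorm_iterate_sub_le a ε hq1 k hm
  rw [← Df_succ] at hit
  have hdb := eLpNorm_Df_double a ε hε hF hq k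
  have hfin := (eLpNorm_Df_lt_top ha hε hF hq1 hFq k).ne
  have hfin' := (eLpNorm_Df_lt_top ha hε hF hq1 hFq (k + 1)).ne
  set N := eLpNorm (Df k F) (ENNReal.ofReal q) (nuX a ε)
  set N' := eLpNorm (Df (k + 1) F) (ENNReal.ofReal q) (nuX a ε)
  have h1 : (2 : ℝ≥0∞) ^ k * N ≤ (k * 2 ^ k : ℕ) * N' + ENNReal.ofReal (2 ^ (a / q)) * N := by
    have e2 : ‖(2 : ℝ) ^ k‖ₑ = 2 ^ k := by
      rw [enorm_pow]; congr 1
      rw [← ofReal_norm]; norm_num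
    calc (2 : ℝ≥0∞) ^ k * N = eLpNorm ((2 : ℝ) ^ k • Df k F) (ENNReal.ofReal q) (nuX a ε) := by
          rw [eLpNorm_const_smul, e2]
      _ = eLpNorm ((fun G => sh G + G)^[k] (Df k F)
            - ((fun G => sh G + G)^[k] (Df k F) - (2 : ℝ) ^ k • Df k F))
            (ENNReal.ofReal q) (nuX a ε) := by rw [sub_sub_cancel]
      _ ≤ _ := by
          refine (eLpNorm_sub_le hmi.aestronglyMeasurable
            (hmi.sub (hm.const_smul _)).aestronglyMeasurable hq1).trans ?_
          rw [add_comm]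
          exact add_le_add hit hdb
  have hpos : (0 : ℝ) < 2 ^ k - 2 ^ (a / q) := by
    rw [sub_pos, ← Real.rpow_natCast]
    exact Real.rpow_lt_rpow_of_exponent_lt (by norm_num) hk
  have h2 := (ENNReal.toReal_le_toReal (by finiteness) (by finiteness)).2 h1
  rw [ENNReal.toReal_add (by finiteness) (by finiteness)] at h2
  simp only [ENNReal.toReal_mul, ENNReal.toReal_pow, ENNReal.toReal_ofNat, ENNReal.toReal_natCast] at h2
  rw [ENNReal.toReal_ofReal (by positivity)] at h2
  rw [← ENNReal.ofReal_toReal hfin, ← ENNReal.ofReal_toReal hfin', ← ENNReal.ofReal_mul (by positivity)]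
  refine ENNReal.ofReal_le_ofReal ?_
  rw [div_mul_eq_mul_div, le_div_iff₀ hpos]
  push_cast at h2
  linarith

/-- Gagliardo–Nirenberg inequality in terms of differences of bounded functions. -/
lemma exists_lintegral_Df_le {K i : ℕ} {R : ℝ} (hR : 0 < R) (hRK : R < K) (hi : 1 ≤ i) (hiK : i ≤ K) :
    ∃ C : ℝ≥0, ∀ ε : ℝ, 0 < ε → ∀ F : E3 → ℝ, Measurable F → (∀ x, |F x| ≤ 1) →
      MemLp F 2 volume →
      ∫⁻ z, ‖Df i F z‖ₑ ^ (2 * K / i : ℝ) ∂(nuX (2 * R) ε)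
        ≤ C * ∫⁻ z, ‖Df K F z‖ₑ ^ 2 ∂(nuX (2 * R) ε) := by
  have hK0 : (0 : ℝ) < K := by linarith
  have hi0 : (0 : ℝ) < i := by exact_mod_cast hi
  set q : ℝ := 2 * K / i with hq
  have hiK' : (i : ℝ) ≤ K := by exact_mod_cast hiK
  have hq2 : 2 ≤ q := by rw [hq, le_div_iff₀ hi0]; linarith
  have haq : 2 * R / q < i := by
    rw [hq, div_lt_iff₀ (by positivity), mul_div_cancel₀ _ hi0.ne']; linarith
  have hbd : ∀ (F : E3 → ℝ), (∀ x, |F x| ≤ 1) → ∀ (k : ℕ) z, |Df k F z| ≤ 2 ^ k := by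
    intro F hF k
    induction k with
    | zero => intro z; simpa [Df_zero] using hF z.2
    | succ k ih =>
      intro z
      rw [Df_succ, pow_succ]
      have e : sh (Df k F) z = Df k F (z.1, z.2 + z.1) := rfl
      have i1 := ih z
      have i2 := ih (z.1, z.2 + z.1)
      rw [← e] at i2
      calc |sh (Df k F) z - Df k F z| ≤ |sh (Df k F) z| + |Df k F z| := abs_sub _ _
        _ ≤ _ := by linarith
  have hstep : ∀ d : ℕ, ∃ C : ℝ≥0, ∀ ε : ℝ, 0 < ε → ∀ F : E3 → ℝ, Measurable F →
      MemLp F (ENNReal.ofReal q) volume →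
      eLpNorm (Df i F) (ENNReal.ofReal q) (nuX (2 * R) ε) ≤
        C * eLpNorm (Df (i + d) F) (ENNReal.ofReal q) (nuX (2 * R) ε) := by
    intro d
    induction d with
    | zero => exact ⟨1, fun ε hε F hF hFq => by simp⟩
    | succ d ih =>
      obtain ⟨C, hC⟩ := ih
      refine ⟨C * Real.toNNReal (((i + d : ℕ) * 2 ^ (i + d)) / (2 ^ (i + d) - 2 ^ (2 * R / q))),
        fun ε hε F hF hFq => (hC ε hε F hF hFq).trans ?_⟩
      rw [ENNReal.coe_mul, mul_assoc]
      gcongr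
      exact eLpNorm_Df_le_succ (by linarith) hε (by linarith)
        (haq.trans_le (by push_cast; linarith [(Nat.cast_nonneg d : (0 : ℝ) ≤ d)])) hF hFq
  obtain ⟨C, hC⟩ := hstep (K - i)
  rw [show i + (K - i) = K by omega] at hC
  refine ⟨C ^ q * Real.toNNReal ((2 ^ K) ^ (q - 2)), fun ε hε F hF hF1 hF2 => ?_⟩
  have hFq : MemLp F (ENNReal.ofReal q) volume := by
    refine ⟨hF2.1, ?_⟩
    have h2 := hF2.2
    rw [eLpNorm_lt_top_iff_lintegral_rpow_enorm_lt_top (by simp; linarith) (by simp),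
      ENNReal.toReal_ofReal (by linarith)]
    rw [eLpNorm_lt_top_iff_lintegral_rpow_enorm_lt_top (by simp) (by simp)] at h2
    refine lt_of_le_of_lt (lintegral_mono fun x => ?_) h2
    have : ‖F x‖ₑ ≤ 1 := by
      rw [← ofReal_norm]; simpa using hF1 x
    exact ENNReal.rpow_le_rpow_of_exponent_ge this (by simpa using hq2)
  have h1 := hC ε hε F hF hFq
  have hq0 : 0 < q := by linarith
  rw [eLpNorm_eq_lintegral_rpow_enorm_toReal (by simpa using hq0) (by simp),
    eLpNorm_eq_lintegral_rpow_enorm_toReal (by simpa using hq0) (by simp),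
    ENNReal.toReal_ofReal hq0.le] at h1
  have h2 := ENNReal.rpow_le_rpow h1 hq0.le
  rw [ENNReal.mul_rpow_of_nonneg _ _ hq0.le, ← ENNReal.rpow_mul, ← ENNReal.rpow_mul,
    one_div_mul_cancel hq0.ne', ENNReal.rpow_one, ENNReal.rpow_one] at h2
  refine h2.trans ?_
  rw [ENNReal.coe_mul, mul_assoc, ENNReal.coe_rpow_of_nonneg _ hq0.le,
    ← lintegral_const_mul' _ _ ENNReal.coe_ne_top]
  gcongr with z
  have hb := hbd F hF1 K z
  calc ‖Df K F z‖ₑ ^ q = ‖Df K F z‖ₑ ^ (q - 2) * ‖Df K F z‖ₑ ^ 2 := by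
        rw [← ENNReal.rpow_ofNat, ← ENNReal.rpow_add_of_nonneg _ _ (by linarith) (by norm_num)]
        congr 1; norm_num
    _ ≤ _ := by
        gcongr
        rw [← ofReal_norm, ENNReal.ofReal_rpow_of_nonneg (norm_nonneg _) (by linarith)]
        exact ENNReal.ofReal_le_ofReal (Real.rpow_le_rpow (norm_nonneg _) hb (by linarith))

end EulerRiesz

noncomputable section
namespace EulerRiesz

/-- The coordinate vectors. -/
abbrev ev (k : Fin 3) : E3 := EuclideanSpace.single k 1

/-- The difference operator on functions. -/
def dfun (h : E3) : Module.End ℝ (E3 → ℝ) := LinearMap.funLeft ℝ ℝ (fun x => x + h) - 1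

lemma dfun_pow_succ (h : E3) (k : ℕ) (F : E3 → ℝ) (x : E3) :
    (dfun h ^ (k + 1)) F x = (dfun h ^ k) F (x + h) - (dfun h ^ k) F x := by
  rw [pow_succ']; rfl

lemma coe_dl_pow_dfun (h : E3) (k : ℕ) (f : L2R) {F : E3 → ℝ} (hF : f =ᵐ[volume] F) :
    (dl h ^ k) f =ᵐ[volume] (dfun h ^ k) F := by
  induction k with
  | zero => simpa using hF
  | succ k ih =>
    rw [dl_pow_succ]
    filter_upwards [ih, ae_add_right ih h, Lp.coeFn_sub (tr h ((dl h ^ k) f)) ((dl h ^ k) f),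
      coe_tr h ((dl h ^ k) f)] with x h1 h2 h3 h4
    rw [h3, Pi.sub_apply, h4, h1, h2, dfun_pow_succ]

/-- Leibniz rule for iterated differences. -/
lemma dfun_pow_mul (h : E3) (m : ℕ) (F G : E3 → ℝ) (x : E3) :
    (dfun h ^ m) (fun y => F y * G y) x = ∑ j ∈ Finset.range (m + 1),
      (m.choose j : ℝ) * ((dfun h ^ j) F x * (dfun h ^ (m - j)) G (x + (j : ℝ) • h)) := by
  let Sx : Module.End ℝ (E3 × E3 → ℝ) := LinearMap.funLeft ℝ ℝ fun z => (z.1 + h, z.2)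
  let Sy : Module.End ℝ (E3 × E3 → ℝ) := LinearMap.funLeft ℝ ℝ fun z => (z.1, z.2 + h)
  have hc : Commute Sx Sy := rfl
  have hdiag : ∀ (m : ℕ) (P : E3 × E3 → ℝ), (dfun h ^ m) (fun y => P (y, y)) = fun y =>
      ((Sx * Sy - 1) ^ m) P (y, y) := by
    intro m
    induction m with
    | zero => intro P; rfl
    | succ m ih =>
      intro P
      ext y
      rw [dfun_pow_succ, ih, pow_succ']
      rfl
  have hten : ∀ (j k : ℕ) (A B : E3 → ℝ), ((Sx - 1) ^ j * (Sy ^ j * (Sy - 1) ^ k)) (fun z => A z.1 * B z.2)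
      = fun z => (dfun h ^ j) A z.1 * (dfun h ^ k) B (z.2 + (j : ℝ) • h) := by
    intro j k A B
    have h1 : ∀ (k : ℕ) (B : E3 → ℝ), ((Sy - 1) ^ k) (fun z => A z.1 * B z.2)
        = fun z => A z.1 * (dfun h ^ k) B z.2 := by
      intro k B
      induction k with
      | zero => rfl
      | succ k ih =>
        rw [pow_succ', Module.End.mul_apply, ih]
        ext z
        rw [dfun_pow_succ]
        change A z.1 * (dfun h ^ k) B (z.2 + h) - A z.1 * (dfun h ^ k) B z.2 = _
        ring
    have h2 : ∀ (j : ℕ) (B : E3 → ℝ), (Sy ^ j) (fun z => A z.1 * B z.2)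
        = fun z => A z.1 * B (z.2 + (j : ℝ) • h) := by
      intro j B
      induction j with
      | zero => ext z; simp
      | succ j ih =>
        rw [pow_succ', Module.End.mul_apply, ih]
        ext z
        change A z.1 * B (z.2 + h + (j : ℝ) • h) = _
        congr 2
        push_cast
        rw [add_smul, one_smul]; abel
    have h3 : ∀ (j : ℕ) (B : E3 → ℝ), ((Sx - 1) ^ j) (fun z => A z.1 * B z.2)
        = fun z => (dfun h ^ j) A z.1 * B z.2 := by
      intro j B
      induction j with
      | zero => rfl
      | succ j ih =>
        rw [pow_succ', Module.End.mul_apply, ih]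
        ext z
        rw [dfun_pow_succ]
        change (dfun h ^ j) A (z.1 + h) * B z.2 - (dfun h ^ j) A z.1 * B z.2 = _
        ring
    rw [Module.End.mul_apply, Module.End.mul_apply, h1, h2]
    exact h3 j fun y => (dfun h ^ k) B (y + (j : ℝ) • h)
  have hsum : Sx * Sy - 1 = (Sx - 1) * Sy + (Sy - 1) := by rw [sub_mul, one_mul]; abel
  have c1 : Commute (Sx - 1) Sy := hc.sub_left (Commute.one_left _)
  have c2 : Commute ((Sx - 1) * Sy) (Sy - 1) :=
    (c1.sub_right (Commute.one_right _)).mul_left ((Commute.refl Sy).sub_right (Commute.one_right _))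
  rw [hdiag m (fun z => F z.1 * G z.2), hsum, c2.add_pow]
  simp only [LinearMap.sum_apply, Finset.sum_apply]
  refine Finset.sum_congr rfl fun j _ => ?_
  rw [c1.mul_pow, mul_assoc ((Sx - 1) ^ j), ← (Nat.cast_commute _ _).eq, Module.End.mul_apply, hten]
  rw [Module.End.natCast_apply, Pi.smul_apply, nsmul_eq_mul]

lemma coe_tr_dl_pow_dfun (h k : E3) (i : ℕ) (f : L2R) {F : E3 → ℝ} (hF : f =ᵐ[volume] F) :
    tr k ((dl h ^ i) f) =ᵐ[volume] fun x => (dfun h ^ i) F (x + k) := by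
  filter_upwards [coe_tr k ((dl h ^ i) f), ae_add_right (coe_dl_pow_dfun h i f hF) k] with x h1 h2
  rw [h1, h2]

lemma dl_pow_mulL {f g : L2R} (hf : Bdd f) (h : E3) (m : ℕ) :
    ∀ᵐ x, (dl h ^ m) (mulL f g) x = ∑ j ∈ Finset.range (m + 1),
      (m.choose j : ℝ) * ((dl h ^ j) f x * tr ((j : ℝ) • h) ((dl h ^ (m - j)) g) x) := by
  have h1 := coe_dl_pow_dfun h m (mulL f g) (hf.coe_mulL g)
  have h2 : ∀ᵐ x, ∀ j : ℕ, (dl h ^ j) f x = (dfun h ^ j) f x :=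
    ae_all_iff.2 fun j => coe_dl_pow_dfun h j f (ae_eq_refl _)
  have h3 : ∀ᵐ x, ∀ j : ℕ, tr ((j : ℝ) • h) ((dl h ^ (m - j)) g) x
      = (dfun h ^ (m - j)) g (x + (j : ℝ) • h) :=
    ae_all_iff.2 fun j => coe_tr_dl_pow_dfun h _ _ g (ae_eq_refl _)
  filter_upwards [h1, h2, h3] with x h1 h2 h3
  rw [h1, dfun_pow_mul]
  refine Finset.sum_congr rfl fun j _ => ?_
  rw [h2, h3]

lemma measurable_lintegral_dl (i : ℕ) (q : ℝ) (f : L2R) :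
    Measurable fun h : E3 => ∫⁻ x, ‖(dl h ^ i) f x‖ₑ ^ q := by
  obtain ⟨F, hF, hfF⟩ := (Lp.aestronglyMeasurable f)
  have e : (fun h : E3 => ∫⁻ x, ‖(dl h ^ i) f x‖ₑ ^ q) = fun h => ∫⁻ x, ‖Df i F (h, x)‖ₑ ^ q := by
    ext h
    refine lintegral_congr_ae ?_
    filter_upwards [coe_dl_pow h i f hfF] with x hx
    rw [hx]
  rw [e]
  have := measurable_Df i hF.measurable
  exact Measurable.lintegral_prod_right' (f := fun z => ‖Df i F z‖ₑ ^ q) (by fun_prop)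

lemma measurable_lintegral_dl_sq (i : ℕ) (f : L2R) :
    Measurable fun h : E3 => ∫⁻ x, ‖(dl h ^ i) f x‖ₑ ^ 2 := by
  simpa using measurable_lintegral_dl i 2 f

lemma lintegral_nuX_Df (a ε : ℝ) {f : L2R} {F : E3 → ℝ} (hF : Measurable F) (hfF : f =ᵐ[volume] F)
    (i : ℕ) (q : ℝ) : ∫⁻ z, ‖Df i F z‖ₑ ^ q ∂(nuX a ε)
      = ∫⁻ h, (∫⁻ x, ‖(dl h ^ i) f x‖ₑ ^ q) ∂(nu a ε) := by
  have hm : Measurable fun z => ‖Df i F z‖ₑ ^ q := (measurable_Df i hF).enorm.pow_const q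
  rw [lintegral_prod _ hm.aemeasurable]
  refine lintegral_congr fun h => lintegral_congr_ae ?_
  filter_upwards [coe_dl_pow h i f hfF] with x hx
  rw [hx]

lemma exists_truncated_rep {f : L2R} (hf : ∀ᵐ x, ‖f x‖ ≤ 1) :
    ∃ F : E3 → ℝ, Measurable F ∧ (∀ x, |F x| ≤ 1) ∧ f =ᵐ[volume] F := by
  obtain ⟨F₀, hF₀, hfF₀⟩ := (Lp.aestronglyMeasurable f)
  have hm := hF₀.measurable
  refine ⟨fun x => max (-1) (min 1 (F₀ x)), by fun_prop, fun x => ?_, ?_⟩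
  · rw [abs_le]
    exact ⟨le_max_left _ _, max_le (by norm_num) (min_le_left _ _)⟩
  · filter_upwards [hf, hfF₀] with x h1 h2
    rw [Real.norm_eq_abs, abs_le, h2] at h1
    rw [h2, min_eq_right h1.2, max_eq_right h1.1]

lemma exists_lintegral_dl_le {K i : ℕ} {R : ℝ} (hR : 0 < R) (hRK : R < K) (hi : 1 ≤ i) (hiK : i ≤ K) :
    ∃ C : ℝ≥0, ∀ ε : ℝ, 0 < ε → ∀ f : L2R, (∀ᵐ x, ‖f x‖ ≤ 1) →
      ∫⁻ h, (∫⁻ x, ‖(dl h ^ i) f x‖ₑ ^ (2 * K / i : ℝ)) ∂(nu (2 * R) ε)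
        ≤ C * ∫⁻ h, (∫⁻ x, ‖(dl h ^ K) f x‖ₑ ^ 2) ∂(nu (2 * R) ε) := by
  obtain ⟨C, hC⟩ := exists_lintegral_Df_le hR hRK hi hiK
  refine ⟨C, fun ε hε f hf => ?_⟩
  obtain ⟨F, hF, hF1, hfF⟩ := exists_truncated_rep hf
  have key := hC ε hε F hF hF1 ((memLp_congr_ae hfF).1 (Lp.memLp f))
  have e2 := lintegral_nuX_Df (2 * R) ε hF hfF K 2
  simp only [ENNReal.rpow_ofNat] at e2
  rwa [lintegral_nuX_Df (2 * R) ε hF hfF, e2] at key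

/-- The increment of a function is bounded in `L^q` by its directional derivative. -/
lemma FD.eLpNorm_sub_le {h : E3} {f g : L2R} (hfg : FD h f g) {q : ℝ≥0∞} (hq : 1 ≤ q) :
    eLpNorm (dl h f) q volume ≤ eLpNorm g q volume := by
  have hder := hfg.hasDerivAt
  let A : ℕ → L2R := fun N => ((N : ℝ) + 1)⁻¹ •
    ∑ i ∈ Finset.range (N + 1), EulerRiesz.tr (((i : ℝ) / (N + 1)) • h) g
  have hA : ∀ N, eLpNorm (A N) q volume ≤ eLpNorm g q volume := by
    intro N
    have hs : ∀ n, eLpNorm (∑ i ∈ Finset.range n, EulerRiesz.tr (((i : ℝ) / (N + 1)) • h) g : L2R) q volume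
        ≤ n * eLpNorm g q volume := by
      intro n
      induction n with
      | zero =>
        rw [Finset.sum_range_zero, eLpNorm_congr_ae (Lp.coeFn_zero ℝ 2 volume)]; simp
      | succ n ih =>
        rw [Finset.sum_range_succ, eLpNorm_congr_ae (Lp.coeFn_add _ _)]
        refine (eLpNorm_add_le (Lp.aestronglyMeasurable _) (Lp.aestronglyMeasurable _) hq).trans ?_
        have e := eLpNorm_comp_measurePreserving (p := q) (Lp.aestronglyMeasurable g)
          (measurePreserving_add_right volume (((n : ℝ) / (N + 1)) • h))
        rw [eLpNorm_congr_ae (coe_tr _ g)]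
        change _ + eLpNorm (g ∘ fun x => x + ((n : ℝ) / (N + 1)) • h) q volume ≤ _
        rw [e]
        rw [Nat.cast_add, Nat.cast_one, add_mul, one_mul]
        exact add_le_add_left ih _
    rw [eLpNorm_congr_ae (Lp.coeFn_smul _ _), eLpNorm_const_smul]
    refine (mul_le_mul_right (hs (N + 1)) _).trans ?_
    rw [← mul_assoc]
    have : ‖((N : ℝ) + 1)⁻¹‖ₑ * ((N + 1 : ℕ) : ℝ≥0∞) = 1 := by
      rw [← ofReal_norm, Real.norm_of_nonneg (by positivity),
        ← ENNReal.ofReal_natCast, ← ENNReal.ofReal_mul (by positivity)]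
      push_cast
      rw [inv_mul_cancel₀ (by positivity), ENNReal.ofReal_one]
    rw [this, one_mul]
  have htel : ∀ N : ℕ, dl h f - A N = ((N : ℝ) + 1)⁻¹ • ∑ i ∈ Finset.range (N + 1),
      EulerRiesz.tr (((i : ℝ) / (N + 1)) • h)
        (((N : ℝ) + 1) • (EulerRiesz.tr ((1 / ((N : ℝ) + 1)) • h) f - f) - g) := by
    intro N
    have hN : ((N : ℝ) + 1) ≠ 0 := by positivity
    simp only [map_sub, map_smul, Finset.sum_sub_distrib, smul_sub, ← Finset.smul_sum]
    simp only [smul_smul, inv_mul_cancel₀ hN, one_smul]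
    congr 1
    rw [← Finset.sum_sub_distrib]
    have := Finset.sum_range_sub (fun i : ℕ => EulerRiesz.tr (((i : ℝ) / (N + 1)) • h) f) (N + 1)
    rw [dl_apply]
    have e0 : EulerRiesz.tr ((((N + 1 : ℕ) : ℝ) / (N + 1)) • h) f = EulerRiesz.tr h f := by
      push_cast; rw [div_self hN, one_smul]
    rw [e0] at this
    simp only [Nat.cast_zero, zero_div, zero_smul, tr_zero] at this
    rw [← this]
    refine Finset.sum_congr rfl fun i _ => ?_
    rw [tr_tr, ← add_smul]
    congr 4
    push_cast; ring
  have hlim : Tendsto A atTop (𝓝 (dl h f)) := by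
    rw [tendsto_iff_norm_sub_tendsto_zero]
    have h1 : Tendsto (fun N : ℕ => ((N : ℝ) + 1) • (EulerRiesz.tr ((1 / ((N : ℝ) + 1)) • h) f - f))
        atTop (𝓝 g) := by
      have := (hasDerivAt_iff_tendsto_slope_zero.1 hder).comp
        (tendsto_nhdsWithin_iff.2 ⟨tendsto_one_div_add_atTop_nhds_zero_nat (𝕜 := ℝ),
          Eventually.of_forall fun N => ne_of_gt (by positivity)⟩)
      refine this.congr fun N => ?_
      simp
    have h2 := tendsto_iff_norm_sub_tendsto_zero.1 h1
    refine squeeze_zero (fun _ => norm_nonneg _) (fun N => ?_) h2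
    rw [norm_sub_rev, htel, norm_smul, norm_inv, Real.norm_of_nonneg (by positivity)]
    rw [inv_mul_le_iff₀ (by positivity)]
    refine (norm_sum_le _ _).trans ?_
    simp only [LinearIsometry.norm_map]
    rw [Finset.sum_const, Finset.card_range, nsmul_eq_mul]
    push_cast; rfl
  exact eLpNorm_le_of_tendsto_L2 hlim (.of_forall hA)

end EulerRiesz

noncomputable section
namespace EulerRiesz

lemma FD.sum_dir {f : L2R} {d : Fin 3 → L2R} (hd : ∀ k, FD (ev k) f (d k)) (h : E3) :
    FD h f (∑ k, h k • d k) := by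
  have e : h = h 0 • ev 0 + h 1 • ev 1 + h 2 • ev 2 := by
    ext i; fin_cases i <;> simp [ev]
  have := (((hd 0).dir_smul (h 0)).dir_add ((hd 1).dir_smul (h 1))).dir_add ((hd 2).dir_smul (h 2))
  rw [← e] at this
  rwa [Fin.sum_univ_three]

lemma eLpNorm_dl_succ_le {f : L2R} {d : Fin 3 → L2R} (hd : ∀ k, FD (ev k) f (d k)) (h : E3) (i : ℕ)
    {q : ℝ≥0∞} (hq : 1 ≤ q) :
    eLpNorm ((dl h ^ (i + 1)) f) q volume ≤
      ENNReal.ofReal ‖h‖ * ∑ k, eLpNorm ((dl h ^ i) (d k)) q volume := by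
  have h1 := (FD.sum_dir (fun k => (hd k).dl_pow h i) h).eLpNorm_sub_le hq
  have e : (dl h ^ (i + 1)) f = dl h ((dl h ^ i) f) := by rw [pow_succ']; rfl
  rw [e]
  refine h1.trans ?_
  have h2 : ∀ k, eLpNorm (h k • (dl h ^ i) (d k) : L2R) q volume
      ≤ ENNReal.ofReal ‖h‖ * eLpNorm ((dl h ^ i) (d k)) q volume := by
    intro k
    rw [eLpNorm_congr_ae (Lp.coeFn_smul _ _), eLpNorm_const_smul]
    gcongr
    rw [← ofReal_norm]
    exact ENNReal.ofReal_le_ofReal (PiLp.norm_apply_le h k)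
  have h3 : ∀ a b : L2R, eLpNorm (a + b : L2R) q volume ≤ eLpNorm a q volume + eLpNorm b q volume := by
    intro a b
    rw [eLpNorm_congr_ae (Lp.coeFn_add _ _)]
    exact eLpNorm_add_le (Lp.aestronglyMeasurable _) (Lp.aestronglyMeasurable _) hq
  rw [Fin.sum_univ_three, Fin.sum_univ_three, mul_add, mul_add]
  exact (h3 _ _).trans (add_le_add ((h3 _ _).trans (add_le_add (h2 0) (h2 1))) (h2 2))

lemma eLpNorm_rpow_eq {q : ℝ} (hq : 0 < q) (f : E3 → ℝ) :
    eLpNorm f (ENNReal.ofReal q) volume ^ q = ∫⁻ x, ‖f x‖ₑ ^ q := by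
  rw [eLpNorm_eq_lintegral_rpow_enorm_toReal (by simpa using hq) (by simp), ENNReal.toReal_ofReal hq.le,
    ← ENNReal.rpow_mul, one_div_mul_cancel hq.ne', ENNReal.rpow_one]

lemma lintegral_dl_succ_le {f : L2R} {d : Fin 3 → L2R} (hd : ∀ k, FD (ev k) f (d k)) (h : E3) (i : ℕ)
    {q : ℝ} (hq : 1 ≤ q) :
    ∫⁻ x, (ENNReal.ofReal ‖h‖⁻¹ * ‖(dl h ^ (i + 1)) f x‖ₑ) ^ q ≤
      ENNReal.ofReal (3 ^ (q - 1)) * ∑ k, ∫⁻ x, ‖(dl h ^ i) (d k) x‖ₑ ^ q := by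
  have hq0 : 0 < q := by linarith
  have h1 := eLpNorm_dl_succ_le hd h i (q := ENNReal.ofReal q) (by simpa using hq)
  have h2 : ENNReal.ofReal ‖h‖⁻¹ * eLpNorm ((dl h ^ (i + 1)) f) (ENNReal.ofReal q) volume ≤
      ∑ k, eLpNorm ((dl h ^ i) (d k)) (ENNReal.ofReal q) volume := by
    refine (mul_le_mul_right h1 _).trans ?_
    rw [← mul_assoc, ← ENNReal.ofReal_mul (by positivity)]
    refine mul_le_of_le_one_left' ?_
    rw [← ENNReal.ofReal_one]
    refine ENNReal.ofReal_le_ofReal ?_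
    rcases eq_or_ne h 0 with rfl | hh
    · simp
    · rw [inv_mul_cancel₀ (norm_ne_zero_iff.2 hh)]
  have h3 := ENNReal.rpow_le_rpow h2 hq0.le
  rw [ENNReal.mul_rpow_of_nonneg _ _ hq0.le, eLpNorm_rpow_eq hq0] at h3
  simp_rw [ENNReal.mul_rpow_of_nonneg _ _ hq0.le]
  rw [lintegral_const_mul' _ _ (by finiteness)]
  refine h3.trans ((ENNReal.rpow_sum_le_const_mul_sum_rpow Finset.univ _ hq).trans_eq ?_)
  simp only [eLpNorm_rpow_eq hq0, Finset.card_univ, Fintype.card_fin]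
  congr 1
  rw [← ENNReal.ofReal_rpow_of_pos (by norm_num)]
  norm_num

lemma lintegral_tr (k : E3) (f : L2R) (q : ℝ) : ∫⁻ x, ‖tr k f x‖ₑ ^ q = ∫⁻ x, ‖f x‖ₑ ^ q := by
  rw [← lintegral_add_right_eq_self (fun x => ‖f x‖ₑ ^ q) k]
  refine lintegral_congr_ae ?_
  filter_upwards [coe_tr k f] with x hx
  rw [hx]

/-- The terms of the Leibniz formula for a commutator. -/
def leibTerm (K i : ℕ) (h : E3) (f g : L2R) : ℝ≥0∞ :=
  ∫⁻ x, (ENNReal.ofReal ‖h‖⁻¹ * ‖(dl h ^ (i + 1)) f x‖ₑ * ‖tr (((i + 1 : ℕ) : ℝ) • h) ((dl h ^ (K - i)) g) x‖ₑ) ^ 2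

/-- The square function of differences of order `K`. -/
def sqDiff (K : ℕ) (R ε : ℝ) (f : L2R) : ℝ≥0∞ :=
  ∫⁻ h, (∫⁻ x, ‖(dl h ^ K) f x‖ₑ ^ 2) ∂(nu (2 * R) ε)

lemma leibTerm_first {K : ℕ} {f g : L2R} {d : Fin 3 → L2R} (hd : ∀ k, FD (ev k) f (d k))
    (hd1 : ∀ k, ∀ᵐ x, ‖d k x‖ ≤ 1) (h : E3) :
    leibTerm K 0 h f g ≤ 9 * ∫⁻ x, ‖(dl h ^ K) g x‖ₑ ^ 2 := by
  have h1 := eLpNorm_dl_succ_le hd h 0 (q := ∞) le_top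
  have h2 : eLpNorm ((dl h ^ (0 + 1)) f) ∞ volume ≤ ENNReal.ofReal (‖h‖ * 3) := by
    refine h1.trans ?_
    rw [ENNReal.ofReal_mul (norm_nonneg h)]
    gcongr
    calc ∑ k, eLpNorm ((dl h ^ 0) (d k)) ∞ volume ≤ ∑ k : Fin 3, 1 := by
          refine Finset.sum_le_sum fun k _ => ?_
          have := (eLpNorm_top_le_iff (f := d k) zero_le_one).2 (hd1 k)
          simpa using this
      _ = ENNReal.ofReal 3 := by simp
  have h3 := (eLpNorm_top_le_iff (by positivity)).1 h2
  rw [leibTerm]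
  have h4 := lintegral_tr (((0 + 1 : ℕ) : ℝ) • h) ((dl h ^ (K - 0)) g) 2
  simp only [ENNReal.rpow_ofNat, Nat.sub_zero] at h4
  rw [Nat.sub_zero, ← h4, ← lintegral_const_mul' _ _ (by simp)]
  refine lintegral_mono_ae ?_
  filter_upwards [h3] with x hx
  rw [mul_pow]
  gcongr
  have : ENNReal.ofReal ‖h‖⁻¹ * ‖(dl h ^ (0 + 1)) f x‖ₑ ≤ 3 := by
    rw [← ofReal_norm, ← ENNReal.ofReal_mul (by positivity)]
    refine (ENNReal.ofReal_le_ofReal (q := 3) ?_).trans_eq (by simp)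
    rcases eq_or_ne h 0 with rfl | hh
    · simp
    · rw [inv_mul_le_iff₀ (norm_pos_iff.2 hh)]; exact hx
  calc _ ≤ (3 : ℝ≥0∞) ^ 2 := by gcongr
    _ = 9 := by norm_num

lemma leibTerm_last {K : ℕ} {f g : L2R} {d : Fin 3 → L2R} (hd : ∀ k, FD (ev k) f (d k))
    (hg1 : ∀ᵐ x, ‖g x‖ ≤ 1) (h : E3) :
    leibTerm K K h f g ≤ 3 * ∑ k, ∫⁻ x, ‖(dl h ^ K) (d k) x‖ₑ ^ 2 := by
  have h1 := lintegral_dl_succ_le hd h K (q := 2) (by norm_num)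
  simp only [ENNReal.rpow_ofNat] at h1
  have e3 : ENNReal.ofReal (3 ^ ((2 : ℝ) - 1)) = 3 := by norm_num
  rw [e3] at h1
  refine le_trans (lintegral_mono_ae ?_) h1
  rw [Nat.sub_self, pow_zero, one_apply_eq_self]
  filter_upwards [coe_tr (((K + 1 : ℕ) : ℝ) • h) g, ae_add_right hg1 (((K + 1 : ℕ) : ℝ) • h)] with x h2 h3
  rw [h2]
  refine pow_le_pow_left₀ zero_le (mul_le_of_le_one_right' ?_) 2
  rw [← ofReal_norm]
  exact (ENNReal.ofReal_le_ofReal h3).trans_eq ENNReal.ofReal_one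

lemma leibTerm_mid {K i : ℕ} (hi : 1 ≤ i) (hiK : i < K) {f g : L2R} {d : Fin 3 → L2R}
    (hd : ∀ k, FD (ev k) f (d k)) (h : E3) :
    leibTerm K i h f g ≤ ENNReal.ofReal (3 ^ ((2 * K / i : ℝ) - 1)) *
        (∑ k, ∫⁻ x, ‖(dl h ^ i) (d k) x‖ₑ ^ (2 * K / i : ℝ))
      + ∫⁻ x, ‖(dl h ^ (K - i)) g x‖ₑ ^ (2 * K / (K - i : ℕ) : ℝ) := by
  have hi0 : (0 : ℝ) < i := by exact_mod_cast hi
  have hK : (i : ℝ) < K := by exact_mod_cast hiK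
  have hKi : ((K - i : ℕ) : ℝ) = K - i := by push_cast [hiK.le]; ring
  have hq1 : 1 ≤ (2 * K / i : ℝ) := by rw [le_div_iff₀ hi0]; linarith
  rw [← lintegral_tr (((i + 1 : ℕ) : ℝ) • h) ((dl h ^ (K - i)) g)]
  refine le_trans ?_ (add_le_add_left (lintegral_dl_succ_le hd h i hq1) _)
  rw [← lintegral_add_right' _ (by
    have := Lp.aestronglyMeasurable (tr (((i + 1 : ℕ) : ℝ) • h) ((dl h ^ (K - i)) g))
    exact this.enorm.pow_const _)]
  refine lintegral_mono fun x => ?_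
  dsimp only
  set a := ENNReal.ofReal ‖h‖⁻¹ * ‖(dl h ^ (i + 1)) f x‖ₑ
  set b := ‖tr (((i + 1 : ℕ) : ℝ) • h) ((dl h ^ (K - i)) g) x‖ₑ
  have hconj : Real.HolderConjugate (K / i : ℝ) (K / (K - i) : ℝ) := by
    rw [Real.holderConjugate_iff]
    refine ⟨by rw [lt_div_iff₀ hi0]; linarith, ?_⟩
    have hK0 : (K : ℝ) ≠ 0 := by linarith
    have : (K : ℝ) - i ≠ 0 := by linarith
    field_simp; simp
  have hy := ENNReal.young_inequality (a ^ 2) (b ^ 2) hconj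
  rw [mul_pow]
  refine hy.trans ?_
  have e1 : ∀ (c : ℝ≥0∞) (r : ℝ), (c ^ 2) ^ r = c ^ (2 * r) := by
    intro c r; rw [← ENNReal.rpow_ofNat, ← ENNReal.rpow_mul]
  rw [e1, e1, hKi, ← mul_div_assoc, ← mul_div_assoc]
  refine add_le_add (ENNReal.div_le_of_le_mul ?_) (ENNReal.div_le_of_le_mul ?_)
  · refine le_mul_of_one_le_right' ?_
    rw [ENNReal.one_le_ofReal]; exact hconj.lt.le
  · refine le_mul_of_one_le_right' ?_
    rw [ENNReal.one_le_ofReal]; exact hconj.symm.lt.le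

lemma exists_leibTerm_bound {K i : ℕ} {R : ℝ} (hR : 0 < R) (hRK : R < K) (hiK : i ≤ K) :
    ∃ C : ℝ≥0, ∀ ε : ℝ, 0 < ε → ∀ (f g : L2R) (d : Fin 3 → L2R), (∀ k, FD (ev k) f (d k)) →
      (∀ k, ∀ᵐ x, ‖d k x‖ ≤ 1) → (∀ᵐ x, ‖g x‖ ≤ 1) →
      ∫⁻ h, leibTerm K i h f g ∂(nu (2 * R) ε) ≤ C * (∑ k, sqDiff K R ε (d k) + sqDiff K R ε g) := by
  rcases Nat.eq_zero_or_pos i with rfl | hi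
  · refine ⟨9, fun ε hε f g d hd hd1 hg1 => ?_⟩
    calc _ ≤ ∫⁻ h, 9 * (∫⁻ x, ‖(dl h ^ K) g x‖ₑ ^ 2) ∂(nu (2 * R) ε) :=
          lintegral_mono fun h => leibTerm_first hd hd1 h
      _ = 9 * sqDiff K R ε g := lintegral_const_mul' _ _ (by simp)
      _ ≤ _ := by rw [mul_add]; exact le_add_self
  rcases hiK.eq_or_lt with rfl | hiK'
  · refine ⟨3, fun ε hε f g d hd hd1 hg1 => ?_⟩
    calc _ ≤ ∫⁻ h, 3 * (∑ k, ∫⁻ x, ‖(dl h ^ i) (d k) x‖ₑ ^ 2) ∂(nu (2 * R) ε) :=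
          lintegral_mono fun h => leibTerm_last hd hg1 h
      _ = 3 * ∑ k, sqDiff i R ε (d k) := by
          rw [lintegral_const_mul' _ _ (by simp),
            lintegral_finsetSum _ fun k _ => measurable_lintegral_dl_sq i (d k)]
          rfl
      _ ≤ _ := by rw [mul_add]; exact le_self_add
  obtain ⟨C₁, hC₁⟩ := exists_lintegral_dl_le hR hRK hi hiK
  obtain ⟨C₂, hC₂⟩ := exists_lintegral_dl_le hR hRK (i := K - i) (by omega) (by omega)
  refine ⟨Real.toNNReal (3 ^ ((2 * K / i : ℝ) - 1)) * C₁ + C₂, fun ε hε f g d hd hd1 hg1 => ?_⟩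
  calc _ ≤ ∫⁻ h, (ENNReal.ofReal (3 ^ ((2 * K / i : ℝ) - 1)) *
        (∑ k, ∫⁻ x, ‖(dl h ^ i) (d k) x‖ₑ ^ (2 * K / i : ℝ))
      + ∫⁻ x, ‖(dl h ^ (K - i)) g x‖ₑ ^ (2 * K / (K - i : ℕ) : ℝ)) ∂(nu (2 * R) ε) :=
        lintegral_mono fun h => leibTerm_mid hi hiK' hd h
    _ ≤ ENNReal.ofReal (3 ^ ((2 * K / i : ℝ) - 1)) * (∑ k, C₁ * sqDiff K R ε (d k))
        + C₂ * sqDiff K R ε g := by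
        rw [lintegral_add_right _ (measurable_lintegral_dl _ _ _),
          lintegral_const_mul' _ _ (by simp),
          lintegral_finsetSum _ fun k _ => measurable_lintegral_dl _ _ _]
        gcongr with k
        · exact hC₁ ε hε (d k) (hd1 k)
        · exact hC₂ ε hε g hg1
    _ ≤ _ := by
        rw [← Finset.mul_sum, ENNReal.coe_add, ENNReal.coe_mul, add_mul, mul_assoc]
        refine add_le_add ?_ ?_
        · exact mul_le_mul_right (mul_le_mul_right le_self_add _) _
        · exact mul_le_mul_right le_add_self _

lemma nu_add_two (a ε : ℝ) (hε : 0 < ε) :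
    nu (a + 2) ε = (nu a ε).withDensity fun h => ENNReal.ofReal ‖h‖⁻¹ ^ 2 := by
  have hm : Measurable fun h : E3 => ENNReal.ofReal ‖h‖⁻¹ ^ 2 := by fun_prop
  rw [nu, nu, restrict_withDensity (measurableSet_gt ε), restrict_withDensity (measurableSet_gt ε),
    ← withDensity_mul _ (measurable_kw a) hm]
  refine withDensity_congr_ae ?_
  filter_upwards [ae_restrict_mem (measurableSet_gt ε)] with h hh
  have hh0 : h ≠ 0 := norm_pos_iff.1 (hε.trans hh)
  rw [Pi.mul_apply, ← ENNReal.ofReal_pow (by positivity), mul_comm,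
    show ‖h‖⁻¹ ^ 2 = ‖h‖ ^ (-2 : ℝ) by
      rw [Real.rpow_neg (norm_nonneg _), inv_pow]; norm_cast, kw_mul_rpow hh0]
  congr 1; ring

lemma commutator_eq_sum {f g : L2R} (hf : Bdd f) (K : ℕ) (h : E3) :
    ∀ᵐ x, ((dl h ^ (K + 1)) (mulL f g) - mulL f ((dl h ^ (K + 1)) g) : L2R) x
      = ∑ i ∈ Finset.range (K + 1), ((K + 1).choose (i + 1) : ℝ) *
        ((dl h ^ (i + 1)) f x * tr (((i + 1 : ℕ) : ℝ) • h) ((dl h ^ (K - i)) g) x) := by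
  have ht : tr (((0 : ℕ) : ℝ) • h) ((dl h ^ (K + 1)) g) = (dl h ^ (K + 1)) g := by
    have hz : ((0 : ℕ) : ℝ) • h = 0 := by rw [Nat.cast_zero]; exact zero_smul ℝ h
    rw [hz]; exact tr_zero _
  have h0 : (dl h ^ 0) f = f := by rw [pow_zero]; rfl
  filter_upwards [dl_pow_mulL (g := g) hf h (K + 1), hf.coe_mulL ((dl h ^ (K + 1)) g),
    Lp.coeFn_sub ((dl h ^ (K + 1)) (mulL f g)) (mulL f ((dl h ^ (K + 1)) g))] with x h1 h2 h3
  have hsum := h1.trans (Finset.sum_range_succ' _ (K + 1))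
  have e1 : (dl h ^ 0) f x * tr (((0 : ℕ) : ℝ) • h) ((dl h ^ (K + 1)) g) x
      = f x * (dl h ^ (K + 1)) g x := congrArg₂ (fun v w : L2R => v x * w x) h0 ht
  have e2 : ((K + 1).choose 0 : ℝ) = 1 := by simp
  have e3 : ∀ i, K + 1 - (i + 1) = K - i := fun i => Nat.add_sub_add_right K 1 i
  simp only [e3, e2, Nat.sub_zero, one_mul] at hsum
  rw [e1] at hsum
  refine h3.trans ?_
  rw [Pi.sub_apply, h2, hsum]
  exact add_sub_cancel_right _ _

lemma enorm_sum_sq_le (n : ℕ) (a : ℕ → ℝ) : ‖∑ i ∈ Finset.range n, a i‖ₑ ^ 2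
      ≤ ∑ i ∈ Finset.range n, (n : ℝ≥0∞) * ‖a i‖ₑ ^ 2 := by
  have e1 := ENNReal.rpow_sum_le_const_mul_sum_rpow (Finset.range n) (fun i => ‖a i‖ₑ)
    (p := 2) (by norm_num)
  have e2 : ((2 : ℝ) - 1) = 1 := by norm_num
  rw [e2, ENNReal.rpow_one, Finset.card_range] at e1
  simp only [ENNReal.rpow_ofNat] at e1
  rw [← Finset.mul_sum]
  exact le_trans (pow_le_pow_left₀ zero_le (enorm_sum_le _ _) 2) e1

set_option maxHeartbeats 1000000 in
lemma lintegral_commutator_le {f g : L2R} (hf : Bdd f) (K : ℕ) (h : E3) :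
    (∫⁻ x, ‖((dl h ^ (K + 1)) (mulL f g) - mulL f ((dl h ^ (K + 1)) g) : L2R) x‖ₑ ^ 2)
        * ENNReal.ofReal ‖h‖⁻¹ ^ 2
      ≤ ∑ i ∈ Finset.range (K + 1), ((K + 1 : ℕ) * ((K + 1).choose (i + 1)) ^ 2 : ℝ≥0∞)
          * leibTerm K i h f g := by
  have hfin : ∀ i : ℕ, ((K + 1 : ℕ) * ((K + 1).choose (i + 1)) ^ 2 : ℝ≥0∞) ≠ ∞ := fun i => by
    finiteness
  have e0 : ∀ i, ((K + 1 : ℕ) * ((K + 1).choose (i + 1)) ^ 2 : ℝ≥0∞) * leibTerm K i h f g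
      = ∫⁻ x, ((K + 1 : ℕ) * ((K + 1).choose (i + 1)) ^ 2 : ℝ≥0∞) *
        (ENNReal.ofReal ‖h‖⁻¹ * ‖(dl h ^ (i + 1)) f x‖ₑ *
          ‖tr (((i + 1 : ℕ) : ℝ) • h) ((dl h ^ (K - i)) g) x‖ₑ) ^ 2 := by
    intro i; rw [leibTerm, lintegral_const_mul' _ _ (hfin i)]
  have hm : ∀ i, AEMeasurable (fun x => ((K + 1 : ℕ) * ((K + 1).choose (i + 1)) ^ 2 : ℝ≥0∞) *
        (ENNReal.ofReal ‖h‖⁻¹ * ‖(dl h ^ (i + 1)) f x‖ₑ *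
          ‖tr (((i + 1 : ℕ) : ℝ) • h) ((dl h ^ (K - i)) g) x‖ₑ) ^ 2) volume := by
    intro i
    have h1 := Lp.aestronglyMeasurable ((dl h ^ (i + 1)) f)
    have h2 := Lp.aestronglyMeasurable (tr (((i + 1 : ℕ) : ℝ) • h) ((dl h ^ (K - i)) g))
    exact (((h1.enorm.const_mul _).mul h2.enorm).pow_const _).const_mul _
  rw [← lintegral_mul_const' _ _ (by finiteness), Finset.sum_congr rfl fun i _ => e0 i,
    ← lintegral_finsetSum' _ fun i _ => hm i]
  refine lintegral_mono_ae ?_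
  filter_upwards [commutator_eq_sum (g := g) hf K h] with x hx
  rw [hx]
  refine (mul_le_mul_left (enorm_sum_sq_le (K + 1) _) _).trans_eq ?_
  rw [Finset.sum_mul]
  refine Finset.sum_congr rfl fun i _ => ?_
  rw [enorm_mul, enorm_mul]
  have : ‖((K + 1).choose (i + 1) : ℝ)‖ₑ = (((K + 1).choose (i + 1) : ℕ) : ℝ≥0∞) := by
    rw [← ofReal_norm, Real.norm_natCast, ENNReal.ofReal_natCast]
  rw [this]
  ring

lemma leibTerm_smul (K i : ℕ) (h : E3) (f g : L2R) {A : ℝ} (hA : 0 < A) :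
    leibTerm K i h (A • f) (A • g) = ENNReal.ofReal (A ^ 4) * leibTerm K i h f g := by
  rw [leibTerm, leibTerm, ← lintegral_const_mul' _ _ (by simp)]
  simp only [map_smul]
  refine lintegral_congr_ae ?_
  filter_upwards [Lp.coeFn_smul A ((dl h ^ (i + 1)) f),
    Lp.coeFn_smul A (tr (((i + 1 : ℕ) : ℝ) • h) ((dl h ^ (K - i)) g))] with x h1 h2
  rw [h1, h2, Pi.smul_apply, Pi.smul_apply, enorm_smul, enorm_smul,
    ENNReal.ofReal_pow hA.le, Real.enorm_of_nonneg hA.le]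
  ring

lemma sqDiff_smul (K : ℕ) (R ε : ℝ) (f : L2R) {A : ℝ} (hA : 0 < A) :
    sqDiff K R ε (A • f) = ENNReal.ofReal (A ^ 2) * sqDiff K R ε f := by
  rw [sqDiff, sqDiff, ← lintegral_const_mul' _ _ (by simp)]
  refine lintegral_congr fun h => ?_
  rw [← lintegral_const_mul' _ _ (by simp)]
  simp only [map_smul]
  refine lintegral_congr_ae ?_
  filter_upwards [Lp.coeFn_smul A ((dl h ^ K) f)] with x h1
  rw [h1, Pi.smul_apply, enorm_smul, ENNReal.ofReal_pow hA.le, Real.enorm_of_nonneg hA.le]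
  ring

lemma measurable_leibTerm (K i : ℕ) (f g : L2R) : Measurable fun h => leibTerm K i h f g := by
  obtain ⟨F, hF, hfF⟩ := Lp.aestronglyMeasurable f
  obtain ⟨G, hG, hgG⟩ := Lp.aestronglyMeasurable g
  have e : (fun h => leibTerm K i h f g) = fun h => ∫⁻ x, (ENNReal.ofReal ‖h‖⁻¹ *
      ‖Df (i + 1) F (h, x)‖ₑ * ‖Df (K - i) G (h, x + ((i + 1 : ℕ) : ℝ) • h)‖ₑ) ^ 2 := by
    ext h
    refine lintegral_congr_ae ?_
    filter_upwards [coe_dl_pow h (i + 1) f hfF, ae_add_right (coe_dl_pow h (K - i) g hgG)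
      (((i + 1 : ℕ) : ℝ) • h), coe_tr (((i + 1 : ℕ) : ℝ) • h) ((dl h ^ (K - i)) g)] with x h1 h2 h3
    rw [h3, h1, h2]
  rw [e]
  have m1 := measurable_Df (i + 1) hF.measurable
  have m2 : Measurable fun z : E3 × E3 => Df (K - i) G (z.1, z.2 + ((i + 1 : ℕ) : ℝ) • z.1) :=
    (measurable_Df (K - i) hG.measurable).comp (by fun_prop)
  exact Measurable.lintegral_prod_right' (f := fun z : E3 × E3 => (ENNReal.ofReal ‖z.1‖⁻¹ *
      ‖Df (i + 1) F z‖ₑ * ‖Df (K - i) G (z.1, z.2 + ((i + 1 : ℕ) : ℝ) • z.1)‖ₑ) ^ 2)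
      ((((by fun_prop : Measurable fun z : E3 × E3 => ENNReal.ofReal ‖z.1‖⁻¹).mul m1.enorm).mul
        m2.enorm).pow_const _)

/-- Commutator estimate for iterated differences in a weighted square function. -/
theorem exists_commutator_bound {K : ℕ} {R : ℝ} (hR : 0 < R) (hRK : R < K) :
    ∃ C : ℝ≥0, ∀ ε A : ℝ, 0 < ε → 0 < A → ∀ (f g : L2R) (d : Fin 3 → L2R), Bdd f →
      (∀ k, FD (ev k) f (d k)) → (∀ k, ∀ᵐ x, ‖d k x‖ ≤ A) → (∀ᵐ x, ‖g x‖ ≤ A) →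
      ∫⁻ h, (∫⁻ x, ‖((dl h ^ (K + 1)) (mulL f g) - mulL f ((dl h ^ (K + 1)) g) : L2R) x‖ₑ ^ 2)
          ∂(nu (2 * R + 2) ε)
        ≤ C * ENNReal.ofReal (A ^ 2) * (∑ k, sqDiff K R ε (d k) + sqDiff K R ε g) := by
  have hex : ∀ i : ℕ, ∃ C : ℝ≥0, i ≤ K → ∀ ε : ℝ, 0 < ε → ∀ (f g : L2R) (d : Fin 3 → L2R),
      (∀ k, FD (ev k) f (d k)) → (∀ k, ∀ᵐ x, ‖d k x‖ ≤ 1) → (∀ᵐ x, ‖g x‖ ≤ 1) →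
      ∫⁻ h, leibTerm K i h f g ∂(nu (2 * R) ε)
        ≤ C * (∑ k, sqDiff K R ε (d k) + sqDiff K R ε g) := by
    intro i
    by_cases hi : i ≤ K
    · obtain ⟨C, hC⟩ := exists_leibTerm_bound hR hRK hi
      exact ⟨C, fun _ => hC⟩
    · exact ⟨0, fun h => absurd h hi⟩
  choose C hC using hex
  refine ⟨∑ i ∈ Finset.range (K + 1), ((K + 1 : ℕ) * ((K + 1).choose (i + 1)) ^ 2 : ℝ≥0) * C i,
    fun ε A hε hA f g d hf hd hd1 hg1 => ?_⟩
  have hsc : ∀ {φ : L2R}, (∀ᵐ x, ‖φ x‖ ≤ A) → ∀ᵐ x, ‖(A⁻¹ • φ : L2R) x‖ ≤ 1 := by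
    intro φ hφ
    filter_upwards [hφ, Lp.coeFn_smul A⁻¹ φ] with x h1 h2
    rw [h2, Pi.smul_apply, norm_smul, norm_inv, Real.norm_of_nonneg hA.le, inv_mul_le_iff₀ hA, mul_one]
    exact h1
  have hterm : ∀ i ∈ Finset.range (K + 1), ∫⁻ h, leibTerm K i h f g ∂(nu (2 * R) ε)
      ≤ C i * ENNReal.ofReal (A ^ 2) * (∑ k, sqDiff K R ε (d k) + sqDiff K R ε g) := by
    intro i hi
    have h1 := hC i (Nat.lt_succ_iff.1 (Finset.mem_range.1 hi)) ε hε (A⁻¹ • f) (A⁻¹ • g)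
      (fun k => A⁻¹ • d k) (fun k => (hd k).smul _) (fun k => hsc (hd1 k)) (hsc hg1)
    have hA' : 0 < A⁻¹ := inv_pos.2 hA
    simp only [leibTerm_smul K i _ f g hA', sqDiff_smul K R ε _ hA'] at h1
    rw [lintegral_const_mul' _ _ (by simp), ← Finset.mul_sum, ← mul_add] at h1
    have h2 := mul_le_mul_right h1 (ENNReal.ofReal (A ^ 4))
    rw [← mul_assoc, ← ENNReal.ofReal_mul (by positivity),
      show A ^ 4 * A⁻¹ ^ 4 = 1 by field_simp, ENNReal.ofReal_one, one_mul] at h2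
    refine h2.trans_eq ?_
    rw [mul_left_comm, ← mul_assoc (ENNReal.ofReal _) (ENNReal.ofReal _), ← ENNReal.ofReal_mul (by positivity),
      show A ^ 4 * A⁻¹ ^ 2 = A ^ 2 by field_simp, mul_assoc]
  rw [nu_add_two _ _ hε]
  refine (lintegral_withDensity_le_lintegral_mul _ (by fun_prop) _).trans ?_
  calc _ ≤ ∫⁻ h, ∑ i ∈ Finset.range (K + 1), ((K + 1 : ℕ) * ((K + 1).choose (i + 1)) ^ 2 : ℝ≥0∞)
          * leibTerm K i h f g ∂(nu (2 * R) ε) := by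
        refine lintegral_mono fun h => ?_
        rw [Pi.mul_apply, mul_comm]
        exact lintegral_commutator_le hf K h
    _ = ∑ i ∈ Finset.range (K + 1), ((K + 1 : ℕ) * ((K + 1).choose (i + 1)) ^ 2 : ℝ≥0∞)
          * ∫⁻ h, leibTerm K i h f g ∂(nu (2 * R) ε) := by
        rw [lintegral_finsetSum']
        · refine Finset.sum_congr rfl fun i _ => ?_
          rw [lintegral_const_mul' _ _ (by finiteness)]
        · intro i _
          exact ((measurable_leibTerm K i f g).const_mul _).aemeasurable
    _ ≤ ∑ i ∈ Finset.range (K + 1), ((K + 1 : ℕ) * ((K + 1).choose (i + 1)) ^ 2 : ℝ≥0∞) *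
          (C i * ENNReal.ofReal (A ^ 2) * (∑ k, sqDiff K R ε (d k) + sqDiff K R ε g)) :=
        Finset.sum_le_sum fun i hi => mul_le_mul_right (hterm i hi) _
    _ = _ := by
        push_cast
        simp only [Finset.sum_mul]
        refine Finset.sum_congr rfl fun i _ => ?_
        ring

end EulerRiesz

noncomputable section
namespace EulerRiesz

lemma sqDiff_le (K : ℕ) (R ε : ℝ) (f : L2R) :
    sqDiff K R ε f ≤ diffConst K R * ∫⁻ ξ, ENNReal.ofReal (‖ξ‖ ^ (2 * R)) * ‖(𝓕 (cplx f) : L2C) ξ‖ₑ ^ 2 := by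
  obtain ⟨G, hG, hfG⟩ := Lp.aestronglyMeasurable (𝓕 (cplx f) : L2C)
  have hm : Measurable fun ξ => ‖G ξ‖ₑ ^ 2 := hG.measurable.enorm.pow_const _
  have e1 : ∫⁻ ξ, ENNReal.ofReal (‖ξ‖ ^ (2 * R)) * ‖(𝓕 (cplx f) : L2C) ξ‖ₑ ^ 2
      = ∫⁻ ξ, ENNReal.ofReal (‖ξ‖ ^ (2 * R)) * ‖G ξ‖ₑ ^ 2 :=
    lintegral_congr_ae (by filter_upwards [hfG] with ξ h; rw [h])
  rw [e1, ← lintegral_dl_pow_kw K R _ hm]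
  refine (lintegral_nu_le _ _ (measurable_lintegral_dl_sq K f)).trans_eq ?_
  refine lintegral_congr fun h => ?_
  congr 1
  rw [← lintegral_cplx, ← lintegral_fourier]
  refine lintegral_congr_ae ?_
  filter_upwards [fourier_dl_pow h K f, hfG] with ξ h1 h2
  rw [h1, h2, enorm_mul, enorm_pow, mul_pow, ← pow_mul, mul_comm K 2]

lemma one_add_pow_mul_exp_le {r y : ℝ} (hr : 0 < r) (hy : 0 ≤ y) (M : ℕ) :
    (1 + y) ^ M * Real.exp (-(r * y ^ 2)) ≤ Real.exp (3 * r) * (M.factorial / (2 * r) ^ M) := by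
  have h1 := Real.pow_div_factorial_le_exp (x := 2 * r * (1 + y)) (by positivity) M
  have h2 : (1 + y) ^ M ≤ M.factorial / (2 * r) ^ M * Real.exp (2 * r * (1 + y)) := by
    rw [div_mul_eq_mul_div, le_div_iff₀ (by positivity), ← mul_pow, mul_comm (1 + y)]
    rwa [div_le_iff₀ (by positivity), mul_comm (Real.exp _)] at h1
  calc (1 + y) ^ M * Real.exp (-(r * y ^ 2))
      ≤ M.factorial / (2 * r) ^ M * Real.exp (2 * r * (1 + y)) * Real.exp (-(r * y ^ 2)) := by gcongr
    _ = M.factorial / (2 * r) ^ M * Real.exp (2 * r * (1 + y) - r * y ^ 2) := by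
        rw [mul_assoc, ← Real.exp_add]; ring_nf
    _ ≤ M.factorial / (2 * r) ^ M * Real.exp (3 * r) := by
        gcongr
        nlinarith [sq_nonneg (y - 1), mul_nonneg hr.le (sq_nonneg (y - 1))]
    _ = _ := mul_comm _ _

/-- The Gaussian `e^{-r|x|²}` as a Schwartz function. -/
def gauss (r : ℝ) (hr : 0 < r) : 𝓢(E3, ℂ) where
  toFun x := (Real.exp (-(r * ‖x‖ ^ 2)) : ℂ)
  smooth' := Complex.ofRealCLM.contDiff.comp
    (Real.contDiff_exp.comp ((contDiff_const.mul (contDiff_norm_sq ℝ)).neg))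
  decay' := by
    intro k n
    have hf : (fun x : E3 => -(r * ‖x‖ ^ 2)).HasTemperateGrowth :=
      ((Function.HasTemperateGrowth.const r).mul (Function.hasTemperateGrowth_norm_sq E3)).neg
    obtain ⟨l, C, hC, hb⟩ := hf.norm_iteratedFDeriv_le_uniform n
    have hg : ContDiff ℝ n fun t : ℝ => (Real.exp t : ℂ) :=
      Complex.ofRealCLM.contDiff.comp Real.contDiff_exp
    have hgi : ∀ (i : ℕ) (t : ℝ), ‖iteratedFDeriv ℝ i (fun t : ℝ => (Real.exp t : ℂ)) t‖ = Real.exp t := by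
      intro i t
      rw [norm_iteratedFDeriv_eq_norm_iteratedDeriv]
      have : iteratedDeriv i (fun t : ℝ => (Real.exp t : ℂ)) = fun t : ℝ => (Real.exp t : ℂ) := by
        induction i with
        | zero => simp
        | succ i ih =>
          rw [iteratedDeriv_succ, ih]
          ext t
          exact ((Real.hasDerivAt_exp t).ofReal_comp).deriv
      rw [this, Complex.norm_real, Real.norm_of_nonneg (Real.exp_pos t).le]
    refine ⟨n.factorial * (1 + C) ^ n * (Real.exp (3 * r) *
      ((k + l * n).factorial / (2 * r) ^ (k + l * n))), fun x => ?_⟩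
    have hcomp := norm_iteratedFDeriv_comp_le hg (hf.1.of_le (by exact_mod_cast le_top)) le_rfl x
      (C := Real.exp (-(r * ‖x‖ ^ 2))) (D := (1 + C) * (1 + ‖x‖) ^ l)
      (fun i _ => (hgi i _).le) (fun i hi hin => by
        refine (hb i hin x).trans ?_
        have h1 : 1 ≤ (1 + C) * (1 + ‖x‖) ^ l :=
          one_le_mul_of_one_le_of_one_le (by linarith) (one_le_pow₀ (by linarith [norm_nonneg x]))
        refine le_trans ?_ (le_self_pow₀ h1 (by omega))
        gcongr; linarith)
    have hx : ‖x‖ ^ k ≤ (1 + ‖x‖) ^ k := by gcongr; linarith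
    calc _ ≤ (1 + ‖x‖) ^ k * (n.factorial * Real.exp (-(r * ‖x‖ ^ 2)) * ((1 + C) * (1 + ‖x‖) ^ l) ^ n) :=
          mul_le_mul hx hcomp (norm_nonneg _) (by positivity)
      _ = n.factorial * (1 + C) ^ n * ((1 + ‖x‖) ^ (k + l * n) * Real.exp (-(r * ‖x‖ ^ 2))) := by
          rw [mul_pow, ← pow_mul, pow_add]; ring
      _ ≤ _ := by
          exact mul_le_mul_of_nonneg_left (one_add_pow_mul_exp_le hr (norm_nonneg x) _) (by positivity)

lemma gauss_apply {r : ℝ} (hr : 0 < r) (x : E3) : gauss r hr x = (Real.exp (-(r * ‖x‖ ^ 2)) : ℂ) := rfl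

/-- The product of a temperate function and a Gaussian. -/
def pg (P : E3 → ℂ) (r : ℝ) (hr : 0 < r) : 𝓢(E3, ℂ) := SchwartzMap.smulLeftCLM ℂ P (gauss r hr)

lemma pg_apply {P : E3 → ℂ} (hP : P.HasTemperateGrowth) {r : ℝ} (hr : 0 < r) (x : E3) :
    pg P r hr x = P x * (Real.exp (-(r * ‖x‖ ^ 2)) : ℂ) := by
  rw [pg, SchwartzMap.smulLeftCLM_apply_apply hP, gauss_apply, smul_eq_mul]

/-- The kernels of the operators with symbols `P e^{-r|ξ|²}` scale. -/
lemma fourier_pg {P : E3 → ℂ} (hP : P.HasTemperateGrowth) {l : ℕ}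
    (hl : ∀ (c : ℝ) ξ, P (c • ξ) = (c : ℂ) ^ l * P ξ) {r : ℝ} (hr : 0 < r) (x : E3) :
    𝓕 (pg P r hr) x = ((r ^ (-((3 + l) / 2 : ℝ)) : ℝ) : ℂ) * 𝓕 (pg P 1 one_pos) ((r ^ (-(1 / 2) : ℝ)) • x) := by
  set c := r ^ (-(1 / 2) : ℝ) with hc
  have hcpos : 0 < c := by positivity
  have hc2 : r * c ^ 2 = 1 := by
    rw [hc, ← Real.rpow_natCast, ← Real.rpow_mul hr.le]
    norm_num
    rw [Real.rpow_neg_one, mul_inv_cancel₀ hr.ne']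
  rw [SchwartzMap.fourier_coe, SchwartzMap.fourier_coe, Real.fourier_eq, Real.fourier_eq]
  have h1 := Measure.integral_comp_smul (volume : Measure E3)
    (fun v => Real.fourierChar (-inner ℝ v x) • pg P r hr v) c
  rw [(finrank_euclideanSpace_fin : Module.finrank ℝ E3 = 3), abs_of_pos (by positivity)] at h1
  have h2 : ∀ v, Real.fourierChar (-inner ℝ (c • v) x) • pg P r hr (c • v)
      = (c : ℂ) ^ l * (Real.fourierChar (-inner ℝ v (c • x)) • pg P 1 one_pos v) := by
    intro v
    rw [real_inner_smul_left, real_inner_smul_right, pg_apply hP, pg_apply hP, hl, norm_smul,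
      Real.norm_of_nonneg hcpos.le, mul_pow, ← mul_assoc r, hc2]
    simp only [Circle.smul_def, smul_eq_mul]
    ring
  simp only [h2] at h1
  rw [integral_const_mul] at h1
  have h3 : r ^ (-((3 + l) / 2 : ℝ)) = c ^ 3 * c ^ l := by
    rw [hc, ← Real.rpow_natCast, ← Real.rpow_natCast, ← Real.rpow_mul hr.le, ← Real.rpow_mul hr.le,
      ← Real.rpow_add hr]
    congr 1; push_cast; ring
  rw [h3, Complex.ofReal_mul, mul_assoc, Complex.ofReal_pow, Complex.ofReal_pow, h1]
  rw [Complex.real_smul, ← mul_assoc, Complex.ofReal_inv, Complex.ofReal_pow,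
    mul_inv_cancel₀ (by exact_mod_cast (pow_pos hcpos 3).ne'), one_mul]

/-- A regularized multiplier applied to a Schwartz function. -/
lemma fourier_mul_fourierInv_apply (A φ : 𝓢(E3, ℂ)) (x : E3) :
    𝓕 (SchwartzMap.pairing (ContinuousLinearMap.mul ℂ ℂ) A (𝓕⁻ φ)) x = ∫ y, 𝓕 A y * φ (x - y) := by
  have h : 𝓕⁻ (SchwartzMap.convolution (ContinuousLinearMap.mul ℂ ℂ) (𝓕 A) φ)
      = SchwartzMap.pairing (ContinuousLinearMap.mul ℂ ℂ) A (𝓕⁻ φ) := by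
    ext ξ
    have h1 : ∀ ψ : 𝓢(E3, ℂ), 𝓕⁻ ψ ξ = 𝓕 ψ (-ξ) := fun ψ => rfl
    rw [h1, SchwartzMap.fourier_convolution, SchwartzMap.pairing_apply_apply,
      SchwartzMap.pairing_apply_apply, ← h1, ← h1, FourierTransform.fourierInv_fourier_eq]
  rw [← h, FourierTransform.fourier_fourierInv_eq, SchwartzMap.convolution_apply]
  rfl

end EulerRiesz

noncomputable section
namespace EulerRiesz

/-- Absolute value of the scaled kernel. -/
def kerAbs (P : E3 → ℂ) (l : ℕ) (r : ℝ) (x : E3) : ℝ≥0∞ :=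
  ENNReal.ofReal (r ^ (-((3 + l) / 2 : ℝ))) * ‖𝓕 (pg P 1 one_pos) ((r ^ (-(1 / 2) : ℝ)) • x)‖ₑ

lemma measurable_kerAbs (P : E3 → ℂ) (l : ℕ) : Measurable fun z : ℝ × E3 => kerAbs P l z.1 z.2 := by
  have h1 : Measurable (𝓕 (pg P 1 one_pos) : 𝓢(E3, ℂ)) := (SchwartzMap.continuous _).measurable
  have h2 : Measurable fun z : ℝ × E3 => (z.1 ^ (-(1 / 2) : ℝ)) • z.2 := by fun_prop
  have h3 : Measurable fun z : ℝ × E3 => ENNReal.ofReal (z.1 ^ (-((3 + l) / 2 : ℝ))) := by fun_prop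
  exact h3.mul (h1.comp h2).enorm

lemma enorm_fourier_pg {P : E3 → ℂ} (hP : P.HasTemperateGrowth) {l : ℕ}
    (hl : ∀ (c : ℝ) ξ, P (c • ξ) = (c : ℂ) ^ l * P ξ) {r : ℝ} (hr : 0 < r) (x : E3) :
    ‖𝓕 (pg P r hr) x‖ₑ = kerAbs P l r x := by
  rw [fourier_pg hP hl hr, enorm_mul, kerAbs]
  congr 1
  rw [← ofReal_norm, Complex.norm_real, Real.norm_of_nonneg (by positivity)]

lemma lintegral_kerAbs_rpow (P : E3 → ℂ) (l : ℕ) {r p q : ℝ} (hr : 0 < r) (hpq : p.HolderConjugate q) :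
    (∫⁻ x, kerAbs P l r x ^ q) ^ (1 / q) = ENNReal.ofReal (r ^ (-(l / 2 + 3 / (2 * p)))) *
      (∫⁻ x, ‖𝓕 (pg P 1 one_pos) x‖ₑ ^ q) ^ (1 / q) := by
  have hq := hpq.symm.pos
  have hp := hpq.pos
  have h1 : Measurable (𝓕 (pg P 1 one_pos) : 𝓢(E3, ℂ)) := (SchwartzMap.continuous _).measurable
  have hc : 0 < r ^ (-(1 / 2) : ℝ) := by positivity
  have e1 : ∫⁻ x, kerAbs P l r x ^ q = ENNReal.ofReal (r ^ (-((3 + l) / 2 : ℝ))) ^ q *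
      (ENNReal.ofReal ((r ^ (-(1 / 2) : ℝ)) ^ (-3 : ℝ)) * ∫⁻ x, ‖𝓕 (pg P 1 one_pos) x‖ₑ ^ q) := by
    rw [← lintegral_comp_smul_E3 hc (f := fun x => ‖𝓕 (pg P 1 one_pos) x‖ₑ ^ q) (by fun_prop),
      ← lintegral_const_mul' _ _ (by finiteness)]
    refine lintegral_congr fun x => ?_
    rw [kerAbs, ENNReal.mul_rpow_of_nonneg _ _ hq.le]
  rw [e1, ← mul_assoc, ENNReal.mul_rpow_of_nonneg _ _ (by positivity)]
  congr 1
  rw [ENNReal.ofReal_rpow_of_nonneg (by positivity) hq.le, ← ENNReal.ofReal_mul (by positivity),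
    ENNReal.ofReal_rpow_of_nonneg (by positivity) (by positivity), ← Real.rpow_mul hr.le,
    ← Real.rpow_mul hr.le, ← Real.rpow_add hr, ← Real.rpow_mul hr.le]
  congr 2
  have := hpq.inv_add_inv_eq_one
  have e2 : p⁻¹ = 1 - q⁻¹ := by linarith
  rw [show 3 / (2 * p) = 3 / 2 * p⁻¹ by field_simp, e2]
  field_simp
  ring

/-- Pointwise majorant for the regularized multiplier. -/
def majo (P : E3 → ℂ) (l : ℕ) (φ : 𝓢(E3, ℂ)) (r : ℝ) (x : E3) : ℝ≥0∞ :=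
  ∫⁻ y, kerAbs P l r y * ‖φ (x - y)‖ₑ

lemma measurable_majo (P : E3 → ℂ) (l : ℕ) (φ : 𝓢(E3, ℂ)) :
    Measurable fun z : ℝ × E3 => majo P l φ z.1 z.2 := by
  have h1 : Measurable fun w : (ℝ × E3) × E3 => kerAbs P l w.1.1 w.2 :=
    (measurable_kerAbs P l).comp (by fun_prop : Measurable fun w : (ℝ × E3) × E3 => (w.1.1, w.2))
  have h2 : Measurable fun w : (ℝ × E3) × E3 => ‖φ (w.1.2 - w.2)‖ₑ :=
    ((SchwartzMap.continuous φ).measurable.comp (by fun_prop)).enorm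
  exact (h1.mul h2).lintegral_prod_right'

lemma measurable_majo_add (P : E3 → ℂ) (l : ℕ) (φ : 𝓢(E3, ℂ)) (r : ℝ) :
    Measurable fun z : E3 × ℝ => majo P l φ (r + z.2) z.1 := by
  have hc : Continuous fun z : E3 × ℝ => (r + z.2, z.1) := by fun_prop
  have h2 := (measurable_majo P l φ).comp hc.measurable
  exact h2

lemma enorm_multiplier_le {P : E3 → ℂ} (hP : P.HasTemperateGrowth) {l : ℕ}
    (hl : ∀ (c : ℝ) ξ, P (c • ξ) = (c : ℂ) ^ l * P ξ) {r : ℝ} (hr : 0 < r) (φ : 𝓢(E3, ℂ)) (x : E3) :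
    ‖𝓕 (SchwartzMap.pairing (ContinuousLinearMap.mul ℂ ℂ) (pg P r hr) (𝓕⁻ φ)) x‖ₑ ≤ majo P l φ r x := by
  rw [fourier_mul_fourierInv_apply]
  refine (enorm_integral_le_lintegral_enorm _).trans_eq ?_
  refine lintegral_congr fun y => ?_
  rw [enorm_mul, enorm_fourier_pg hP hl]

lemma lintegral_mul_majo_le (P : E3 → ℂ) (l : ℕ) (φ : 𝓢(E3, ℂ)) {r p q : ℝ} (hr : 0 < r)
    (hpq : p.HolderConjugate q) {g : E3 → ℂ} (hg : Measurable g) :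
    ∫⁻ x, ‖g x‖ₑ * majo P l φ r x ≤ ENNReal.ofReal (r ^ (-(l / 2 + 3 / (2 * p)))) *
      (∫⁻ x, ‖𝓕 (pg P 1 one_pos) x‖ₑ ^ q) ^ (1 / q) * (∫⁻ x, ‖g x‖ₑ ^ p) ^ (1 / p) * ∫⁻ x, ‖φ x‖ₑ := by
  have hk : Measurable fun x => kerAbs P l r x :=
    (measurable_kerAbs P l).comp (measurable_const.prodMk measurable_id)
  have hφ : Measurable φ := (SchwartzMap.continuous φ).measurable
  calc ∫⁻ x, ‖g x‖ₑ * majo P l φ r x = ∫⁻ x, ∫⁻ y, ‖g x‖ₑ * (kerAbs P l r (x - y) * ‖φ y‖ₑ) := by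
        refine lintegral_congr fun x => ?_
        rw [majo, ← lintegral_sub_left_eq_self _ x, lintegral_const_mul' _ _ enorm_ne_top]
        simp only [sub_sub_cancel]
    _ = ∫⁻ y, ∫⁻ x, ‖g x‖ₑ * (kerAbs P l r (x - y) * ‖φ y‖ₑ) := by
        refine lintegral_lintegral_swap (Measurable.aemeasurable ?_)
        have h1 : Measurable fun z : E3 × E3 => kerAbs P l r (z.1 - z.2) := hk.comp (by fun_prop)
        exact (hg.comp measurable_fst).enorm.mul (h1.mul (hφ.comp measurable_snd).enorm)
    _ ≤ ∫⁻ y, ((∫⁻ x, ‖g x‖ₑ ^ p) ^ (1 / p) * (∫⁻ x, kerAbs P l r x ^ q) ^ (1 / q)) * ‖φ y‖ₑ := by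
        refine lintegral_mono fun y => ?_
        have h1 : Measurable fun x => kerAbs P l r (x - y) := hk.comp (by fun_prop)
        simp_rw [← mul_assoc]
        rw [lintegral_mul_const' _ _ enorm_ne_top]
        gcongr
        refine (ENNReal.lintegral_mul_le_Lp_mul_Lq volume hpq hg.enorm.aemeasurable h1.aemeasurable).trans_eq ?_
        rw [lintegral_sub_right_eq_self (fun x => kerAbs P l r x ^ q) y]
    _ = _ := by
        rw [lintegral_const_mul _ hφ.enorm, lintegral_kerAbs_rpow P l hr hpq]
        ring

/-- The inverse symbol of the Bessel potential. -/
def besselInv (s : ℝ) (ξ : E3) : ℂ := (((1 + ‖ξ‖ ^ 2) ^ (-s / 2) : ℝ) : ℂ)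

lemma besselInv_temperate (s : ℝ) : (besselInv s).HasTemperateGrowth := by
  unfold besselInv; fun_prop

/-- The test function that turns a regularized multiplier into the Bessel representation. -/
def besselTest (s : ℝ) (P : E3 → ℂ) (r : ℝ) (hr : 0 < r) (φ : 𝓢(E3, ℂ)) : 𝓢(E3, ℂ) :=
  𝓕 (SchwartzMap.smulLeftCLM ℂ (besselInv s)
    (SchwartzMap.pairing (ContinuousLinearMap.mul ℂ ℂ) (pg P r hr) (𝓕⁻ φ)))

lemma integral_pair_eq {s : ℝ} {f : L2C} {g : E3 → ℂ}
    (hg : ∀ φ : 𝓢(E3, ℂ), TemperedDistribution.besselPotential E3 ℂ s (Lp.toTemperedDistribution f) φ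
        = ∫ x, φ x * g x) {P : E3 → ℂ} (hP : P.HasTemperateGrowth) {r : ℝ} (hr : 0 < r) (φ : 𝓢(E3, ℂ)) :
    ∫ ξ, (𝓕 f : L2C) ξ * (P ξ * (Real.exp (-(r * ‖ξ‖ ^ 2)) : ℂ) * (𝓕⁻ φ) ξ)
      = ∫ x, besselTest s P r hr φ x * g x := by
  rw [← hg, TemperedDistribution.besselPotential, TemperedDistribution.fourierMultiplierCLM_apply_apply,
    besselTest, FourierTransform.fourierInv_fourier_eq,
    SchwartzMap.smulLeftCLM_smulLeftCLM_apply (by fun_prop) (besselInv_temperate s)]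
  have e : ((fun x : E3 => (((1 + ‖x‖ ^ 2) ^ (s / 2) : ℝ) : ℂ)) * besselInv s) = fun _ => 1 := by
    ext x
    rw [Pi.mul_apply, besselInv, ← Complex.ofReal_mul, ← Real.rpow_add (by positivity)]
    rw [show s / 2 + -s / 2 = 0 by ring]
    simp
  rw [e, Lp.toTemperedDistribution_apply]
  simp only [smul_eq_mul]
  rw [show (SchwartzMap.smulLeftCLM ℂ fun _ : E3 => (1 : ℂ)) = ContinuousLinearMap.id ℂ _ by simp]
  simp_rw [mul_comm _ (f _)]
  rw [ContinuousLinearMap.id_apply, ← integral_fourier_mul]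
  simp [pg_apply hP, SchwartzMap.pairing_apply_apply]

lemma besselInv_eq_integral {s : ℝ} (hs : 0 < s) (ξ : E3) :
    besselInv s ξ = ((Real.Gamma (s / 2))⁻¹ : ℝ) * ∫ ρ in Ioi (0 : ℝ),
      ((ρ ^ (s / 2 - 1) * Real.exp (-ρ) : ℝ) : ℂ) * (Real.exp (-(ρ * ‖ξ‖ ^ 2)) : ℂ) := by
  have h := Real.integral_rpow_mul_exp_neg_mul_Ioi (a := s / 2) (r := 1 + ‖ξ‖ ^ 2) (by positivity)
    (by positivity)
  have e : ∀ ρ : ℝ, ((ρ ^ (s / 2 - 1) * Real.exp (-ρ) : ℝ) : ℂ) * (Real.exp (-(ρ * ‖ξ‖ ^ 2)) : ℂ)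
      = ((ρ ^ (s / 2 - 1) * Real.exp (-((1 + ‖ξ‖ ^ 2) * ρ)) : ℝ) : ℂ) := by
    intro ρ
    rw [← Complex.ofReal_mul, mul_assoc, ← Real.exp_add]
    congr 3; ring
  simp_rw [e]
  rw [integral_complex_ofReal, h, besselInv, ← Complex.ofReal_mul]
  congr 1
  have : Real.Gamma (s / 2) ≠ 0 := (Real.Gamma_pos_of_pos (by positivity)).ne'
  rw [one_div, Real.inv_rpow (by positivity), ← Real.rpow_neg (by positivity)]
  field_simp

lemma enorm_besselTest_le {s : ℝ} (hs : 0 < s) {P : E3 → ℂ} (hP : P.HasTemperateGrowth) {l : ℕ}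
    (hl : ∀ (c : ℝ) ξ, P (c • ξ) = (c : ℂ) ^ l * P ξ) {r : ℝ} (hr : 0 < r) (φ : 𝓢(E3, ℂ)) (x : E3) :
    ‖besselTest s P r hr φ x‖ₑ ≤ ENNReal.ofReal (Real.Gamma (s / 2))⁻¹ *
      ∫⁻ ρ in Ioi (0 : ℝ), ENNReal.ofReal (ρ ^ (s / 2 - 1) * Real.exp (-ρ)) * majo P l φ (r + ρ) x := by
  set ψ := SchwartzMap.pairing (ContinuousLinearMap.mul ℂ ℂ) (pg P r hr) (𝓕⁻ φ) with hψ
  have hψa : ∀ ξ, ψ ξ = P ξ * (Real.exp (-(r * ‖ξ‖ ^ 2)) : ℂ) * (𝓕⁻ φ) ξ := by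
    intro ξ; simp [hψ, pg_apply hP, SchwartzMap.pairing_apply_apply]
  have hΓ := Real.Gamma_pos_of_pos (show 0 < s / 2 by positivity)
  have h1 : besselTest s P r hr φ x = ∫ ξ, Real.fourierChar (-inner ℝ ξ x) •
      (besselInv s ξ * ψ ξ) := by
    rw [besselTest, SchwartzMap.fourier_coe, Real.fourier_eq]
    refine integral_congr_ae (.of_forall fun ξ => ?_)
    dsimp only
    rw [SchwartzMap.smulLeftCLM_apply_apply (besselInv_temperate s), smul_eq_mul]
  let w : ℝ → ℂ := fun ρ => ((ρ ^ (s / 2 - 1) * Real.exp (-ρ) : ℝ) : ℂ)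
  have hw : Integrable w (volume.restrict (Ioi 0)) := by
    have := Real.GammaIntegral_convergent (show 0 < s / 2 by positivity)
    exact Integrable.ofReal (this.congr (.of_forall fun ρ => mul_comm _ _))
  have hint : Integrable (fun z : E3 × ℝ => (Real.exp (-(z.2 * ‖z.1‖ ^ 2)) : ℂ) *
      (Real.fourierChar (-inner ℝ z.1 x) : ℂ) * (ψ z.1 * w z.2))
      (volume.prod (volume.restrict (Ioi 0))) := by
    refine Integrable.bdd_mul (c := 1) (ψ.integrable.mul_prod hw) ?_ ?_
    · refine Measurable.aestronglyMeasurable (Measurable.mul (by fun_prop) ?_)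
      have : Continuous fun z : E3 × ℝ => (Real.fourierChar (-inner ℝ z.1 x) : ℂ) :=
        continuous_subtype_val.comp (Real.continuous_fourierChar.comp (by fun_prop))
      exact this.measurable
    · have hae : ∀ᵐ z : E3 × ℝ ∂(volume.prod (volume.restrict (Ioi 0))), z.2 ∈ Ioi (0 : ℝ) :=
        Measure.quasiMeasurePreserving_snd.ae (ae_restrict_mem measurableSet_Ioi)
      filter_upwards [hae] with z hz
      rw [norm_mul, Circle.norm_coe, mul_one, Complex.norm_real, Real.norm_of_nonneg (Real.exp_pos _).le,
        Real.exp_le_one_iff]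
      have : (0 : ℝ) < z.2 := hz
      nlinarith [sq_nonneg ‖z.1‖, mul_nonneg this.le (sq_nonneg ‖z.1‖)]
  have h2 : besselTest s P r hr φ x = ((Real.Gamma (s / 2))⁻¹ : ℝ) * ∫ ρ in Ioi (0 : ℝ), ∫ ξ,
      (Real.exp (-(ρ * ‖ξ‖ ^ 2)) : ℂ) * (Real.fourierChar (-inner ℝ ξ x) : ℂ) * (ψ ξ * w ρ) := by
    rw [h1, ← integral_integral_swap hint, ← integral_const_mul]
    refine integral_congr_ae (.of_forall fun ξ => ?_)
    dsimp only
    rw [besselInv_eq_integral hs, Circle.smul_def, smul_eq_mul, mul_assoc, mul_left_comm, ← integral_mul_const,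
      ← integral_const_mul]
    congr 1
    refine integral_congr_ae (.of_forall fun ρ => ?_)
    simp only [w]
    ring
  rw [h2, enorm_mul]
  have e3 : ‖(((Real.Gamma (s / 2))⁻¹ : ℝ) : ℂ)‖ₑ = ENNReal.ofReal (Real.Gamma (s / 2))⁻¹ := by
    rw [← ofReal_norm, Complex.norm_real, Real.norm_of_nonneg (by positivity)]
  rw [e3]
  gcongr
  refine (enorm_integral_le_lintegral_enorm _).trans ?_
  refine lintegral_mono_ae ?_
  filter_upwards [ae_restrict_mem measurableSet_Ioi] with ρ hρ
  have hρ' : (0 : ℝ) < ρ := hρ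
  have e4 : ∫ ξ, (Real.exp (-(ρ * ‖ξ‖ ^ 2)) : ℂ) * (Real.fourierChar (-inner ℝ ξ x) : ℂ) * (ψ ξ * w ρ)
      = w ρ * 𝓕 (SchwartzMap.pairing (ContinuousLinearMap.mul ℂ ℂ) (pg P (r + ρ) (by positivity)) (𝓕⁻ φ)) x := by
    rw [SchwartzMap.fourier_coe, Real.fourier_eq, ← integral_const_mul]
    refine integral_congr_ae (.of_forall fun ξ => ?_)
    dsimp only
    rw [hψa, Circle.smul_def, smul_eq_mul, SchwartzMap.pairing_apply_apply, pg_apply hP,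
      ContinuousLinearMap.mul_apply', add_mul, neg_add, Real.exp_add, Complex.ofReal_mul]
    ring
  rw [e4, enorm_mul]
  have e5 : ‖w ρ‖ₑ = ENNReal.ofReal (ρ ^ (s / 2 - 1) * Real.exp (-ρ)) := by
    rw [← ofReal_norm, Complex.norm_real, Real.norm_of_nonneg (by positivity)]
  rw [e5]
  gcongr
  exact enorm_multiplier_le hP hl _ φ x

/-- The Bessel representation with density `g`. -/
def IsBesselRep (s : ℝ) (f : L2C) (g : E3 → ℂ) : Prop :=
  ∀ φ : 𝓢(E3, ℂ), TemperedDistribution.besselPotential E3 ℂ s (Lp.toTemperedDistribution f) φ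
    = ∫ x, φ x * g x

/-- Kernel bounds for regularized multipliers on Bessel potentials of `L^p` functions. -/
lemma exists_pair_bound {s p a : ℝ} (hs : 0 < s) (hp : 1 < p) {P : E3 → ℂ} (hP : P.HasTemperateGrowth)
    {l : ℕ} (hl : ∀ (c : ℝ) ξ, P (c • ξ) = (c : ℂ) ^ l * P ξ) (ha : 0 ≤ a)
    (haL : a ≤ l / 2 + 3 / (2 * p)) (has : l / 2 + 3 / (2 * p) - a < s / 2) :
    ∃ C : ℝ≥0, ∀ (f : L2C) (g : E3 → ℂ), IsBesselRep s f g →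
      AEStronglyMeasurable g volume → ∀ (r : ℝ), 0 < r → ∀ φ : 𝓢(E3, ℂ),
      ‖∫ ξ, (𝓕 f : L2C) ξ * (P ξ * (Real.exp (-(r * ‖ξ‖ ^ 2)) : ℂ) * (𝓕⁻ φ) ξ)‖ₑ
        ≤ C * ENNReal.ofReal (r ^ (-a)) * eLpNorm g (ENNReal.ofReal p) volume * ∫⁻ x, ‖φ x‖ₑ := by
  have hp0 : 0 < p := by linarith
  have hpq := Real.HolderConjugate.conjExponent hp
  set q := p.conjExponent
  set L : ℝ := l / 2 + 3 / (2 * p) with hL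
  obtain ⟨κ, hκ⟩ : ∃ κ, κ = (∫⁻ x, ‖𝓕 (pg P 1 one_pos) x‖ₑ ^ q) ^ (1 / q) := ⟨_, rfl⟩
  have hκfin : κ ≠ ∞ := by
    rw [hκ]
    have h1 := (SchwartzMap.memLp (𝓕 (pg P 1 one_pos)) (ENNReal.ofReal q) volume).2
    rw [eLpNorm_eq_lintegral_rpow_enorm_toReal (by simpa using hpq.symm.pos) (by simp),
      ENNReal.toReal_ofReal hpq.symm.pos.le] at h1
    exact h1.ne
  obtain ⟨I, hI⟩ : ∃ I, I = ∫⁻ ρ in Ioi (0 : ℝ), ENNReal.ofReal (Real.exp (-ρ) * ρ ^ ((s / 2 - (L - a)) - 1)) := ⟨_, rfl⟩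
  have hIfin : I ≠ ∞ := by
    rw [hI]
    have h1 := (Real.GammaIntegral_convergent (show 0 < s / 2 - (L - a) by linarith))
    exact ((hasFiniteIntegral_iff_ofReal (by
      filter_upwards [ae_restrict_mem measurableSet_Ioi] with ρ hρ
      have : (0 : ℝ) < ρ := hρ
      positivity)).1 h1.2).ne
  refine ⟨(ENNReal.ofReal (Real.Gamma (s / 2))⁻¹ * κ * I).toNNReal, fun f g₀ hg₀ hgm r hr φ => ?_⟩
  have hCfin : ENNReal.ofReal (Real.Gamma (s / 2))⁻¹ * κ * I ≠ ∞ :=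
    ENNReal.mul_ne_top (ENNReal.mul_ne_top ENNReal.ofReal_ne_top hκfin) hIfin
  rw [ENNReal.coe_toNNReal hCfin]
  obtain ⟨g, hgs, hgg⟩ := hgm
  have hg : Measurable g := hgs.measurable
  rw [integral_pair_eq hg₀ hP hr]
  have e0 : ∫ x, besselTest s P r hr φ x * g₀ x = ∫ x, besselTest s P r hr φ x * g x :=
    integral_congr_ae (by filter_upwards [hgg] with x hx; rw [hx])
  have hnorm : (∫⁻ x, ‖g x‖ₑ ^ p) ^ (1 / p) = eLpNorm g₀ (ENNReal.ofReal p) volume := by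
    rw [eLpNorm_congr_ae hgg, eLpNorm_eq_lintegral_rpow_enorm_toReal (by simpa using hp0) (by simp),
      ENNReal.toReal_ofReal hp0.le]
  have hmaj : Measurable fun z : E3 × ℝ => majo P l φ (r + z.2) z.1 :=
    measurable_majo_add P l φ r
  have hwm : Measurable fun ρ : ℝ => ENNReal.ofReal (ρ ^ (s / 2 - 1) * Real.exp (-ρ)) := by fun_prop
  rw [e0]
  calc _ ≤ ∫⁻ x, ‖g x‖ₑ * (ENNReal.ofReal (Real.Gamma (s / 2))⁻¹ *
      ∫⁻ ρ in Ioi (0 : ℝ), ENNReal.ofReal (ρ ^ (s / 2 - 1) * Real.exp (-ρ)) * majo P l φ (r + ρ) x) := by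
        refine (enorm_integral_le_lintegral_enorm _).trans (lintegral_mono fun x => ?_)
        rw [enorm_mul, mul_comm]
        gcongr
        exact enorm_besselTest_le hs hP hl hr φ x
    _ = ENNReal.ofReal (Real.Gamma (s / 2))⁻¹ * ∫⁻ x, ∫⁻ ρ in Ioi (0 : ℝ),
        ENNReal.ofReal (ρ ^ (s / 2 - 1) * Real.exp (-ρ)) * (‖g x‖ₑ * majo P l φ (r + ρ) x) := by
        rw [← lintegral_const_mul' _ _ (by finiteness)]
        refine lintegral_congr fun x => ?_
        rw [mul_left_comm, ← lintegral_const_mul' _ _ enorm_ne_top]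
        congr 1
        refine lintegral_congr fun ρ => ?_
        ring
    _ = ENNReal.ofReal (Real.Gamma (s / 2))⁻¹ * ∫⁻ ρ in Ioi (0 : ℝ),
        ENNReal.ofReal (ρ ^ (s / 2 - 1) * Real.exp (-ρ)) * ∫⁻ x, (‖g x‖ₑ * majo P l φ (r + ρ) x) := by
        rw [lintegral_lintegral_swap]
        · congr 1
          refine lintegral_congr fun ρ => ?_
          rw [lintegral_const_mul' _ _ (by finiteness)]
        · exact ((hwm.comp measurable_snd).mul ((hg.comp measurable_fst).enorm.mul hmaj)).aemeasurable
    _ ≤ ENNReal.ofReal (Real.Gamma (s / 2))⁻¹ * ∫⁻ ρ in Ioi (0 : ℝ),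
        (ENNReal.ofReal (r ^ (-a)) * κ * eLpNorm g₀ (ENNReal.ofReal p) volume * ∫⁻ x, ‖φ x‖ₑ) *
          ENNReal.ofReal (Real.exp (-ρ) * ρ ^ ((s / 2 - (L - a)) - 1)) := by
        refine mul_le_mul_right (lintegral_mono_ae ?_) _
        filter_upwards [ae_restrict_mem measurableSet_Ioi] with ρ hρ
        have hρ' : (0 : ℝ) < ρ := hρ
        refine (mul_le_mul_right (lintegral_mul_majo_le P l φ (show 0 < r + ρ by positivity) hpq hg) _).trans ?_
        rw [← hκ, hnorm, ← hL]
        have key : ENNReal.ofReal (ρ ^ (s / 2 - 1) * Real.exp (-ρ)) * ENNReal.ofReal ((r + ρ) ^ (-L))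
            ≤ ENNReal.ofReal (r ^ (-a)) * ENNReal.ofReal (Real.exp (-ρ) * ρ ^ ((s / 2 - (L - a)) - 1)) := by
          rw [← ENNReal.ofReal_mul (by positivity), ← ENNReal.ofReal_mul (by positivity)]
          refine ENNReal.ofReal_le_ofReal ?_
          have h1 : (r + ρ) ^ (-L) ≤ r ^ (-a) * ρ ^ (-(L - a)) := by
            have i1 : (r + ρ) ^ (-a) ≤ r ^ (-a) :=
              Real.rpow_le_rpow_of_nonpos hr (by linarith) (by linarith)
            have i2 : (r + ρ) ^ (-(L - a)) ≤ ρ ^ (-(L - a)) :=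
              Real.rpow_le_rpow_of_nonpos hρ' (by linarith) (by linarith)
            rw [show -L = -a + -(L - a) by ring, Real.rpow_add (by positivity)]
            exact mul_le_mul i1 i2 (by positivity) (by positivity)
          calc _ ≤ ρ ^ (s / 2 - 1) * Real.exp (-ρ) * (r ^ (-a) * ρ ^ (-(L - a))) := by gcongr
            _ = r ^ (-a) * (Real.exp (-ρ) * (ρ ^ (s / 2 - 1) * ρ ^ (-(L - a)))) := by ring
            _ = _ := by rw [← Real.rpow_add hρ']; ring_nf
        calc _ = (ENNReal.ofReal (ρ ^ (s / 2 - 1) * Real.exp (-ρ)) * ENNReal.ofReal ((r + ρ) ^ (-L))) *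
            (κ * eLpNorm g₀ (ENNReal.ofReal p) volume * ∫⁻ x, ‖φ x‖ₑ) := by ring
          _ ≤ _ := mul_le_mul_left key _
          _ = _ := by ring
    _ = _ := by
        rw [lintegral_const_mul _ (by fun_prop), ← hI]
        ring

end EulerRiesz

noncomputable section
namespace EulerRiesz

lemma ae_norm_le_wNorm {s p : ℝ} {f h : L2C} {C : ℝ≥0} (hfin : wNorm s (ENNReal.ofReal p) f ≠ ∞)
    (hC : ∀ g : E3 → ℂ, AEStronglyMeasurable g volume → IsBesselRep s f g → ∀ φ : 𝓢(E3, ℂ),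
      ‖∫ x, h x * φ x‖ₑ ≤ C * eLpNorm g (ENNReal.ofReal p) volume * ∫⁻ x, ‖φ x‖ₑ) :
    ∀ᵐ x, ‖h x‖ ≤ C * (wNorm s (ENNReal.ofReal p) f).toReal := by
  refine ae_norm_le_of_schwartz fun φ => ?_
  obtain ⟨W, hW⟩ : ∃ W, W = wNorm s (ENNReal.ofReal p) f := ⟨_, rfl⟩
  rw [← hW] at hfin ⊢
  have key : ∀ δ : ℝ≥0, 0 < δ → ‖∫ x, h x * φ x‖ ≤ C * (W.toReal + δ) * ∫ x, ‖φ x‖ := by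
    intro δ hδ
    have hlt : W < W + δ := ENNReal.lt_add_right hfin (by simpa using hδ.ne')
    obtain ⟨g, hg⟩ := iInf_lt_iff.1 (show (⨅ (g : E3 → ℂ) (_ : MemLp g (ENNReal.ofReal p) volume)
      (_ : ∀ φ : 𝓢(E3, ℂ), TemperedDistribution.besselPotential E3 ℂ s (Lp.toTemperedDistribution f) φ
        = ∫ x, φ x * g x), eLpNorm g (ENNReal.ofReal p) volume) < W + δ by
          rw [hW] at hlt ⊢; exact hlt)
    obtain ⟨hgL, hg⟩ := iInf_lt_iff.1 hg
    obtain ⟨hrep, hg⟩ := iInf_lt_iff.1 hg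
    have h1 := (hC g hgL.1 hrep φ).trans (mul_le_mul_left (mul_le_mul_right hg.le _) _)
    have hφ := (φ.integrable (μ := volume)).2
    rw [hasFiniteIntegral_iff_enorm] at hφ
    have h2 := ENNReal.toReal_mono (ENNReal.mul_ne_top (ENNReal.mul_ne_top ENNReal.coe_ne_top
      (ENNReal.add_ne_top.2 ⟨hfin, ENNReal.coe_ne_top⟩)) hφ.ne) h1
    rw [ENNReal.toReal_mul, ENNReal.toReal_mul, ENNReal.toReal_add hfin ENNReal.coe_ne_top,
      toReal_enorm, ← integral_norm_eq_lintegral_enorm (φ.integrable (μ := volume)).1] at h2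
    exact h2
  refine ge_of_tendsto (x := 𝓝[>] (0 : ℝ≥0)) (f := fun δ : ℝ≥0 => C * (W.toReal + δ) * ∫ x, ‖φ x‖) ?_ ?_
  · have hc : Continuous fun δ : ℝ≥0 => (C : ℝ) * (W.toReal + δ) * ∫ x, ‖φ x‖ := by fun_prop
    have := (hc.tendsto 0).mono_left (nhdsWithin_le_nhds (s := Ioi 0))
    simpa using this
  · filter_upwards [self_mem_nhdsWithin] with δ hδ
    exact key δ hδ

lemma integrable_mul_schwartz (h : L2C) (φ : 𝓢(E3, ℂ)) : Integrable (fun x => h x * φ x) volume :=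
  (Lp.memLp h).integrable_mul (φ.memLp 2 volume)

lemma tendsto_integral_gauss_mul {F : E3 → ℂ} (hF : Integrable F volume) :
    Tendsto (fun r : ℝ => ∫ ξ, (Real.exp (-(r * ‖ξ‖ ^ 2)) : ℂ) * F ξ) (𝓝[>] 0) (𝓝 (∫ ξ, F ξ)) := by
  refine tendsto_integral_filter_of_dominated_convergence (fun ξ => ‖F ξ‖) ?_ ?_ hF.norm ?_
  · exact .of_forall fun r => (by fun_prop : Continuous fun ξ : E3 =>
      (Real.exp (-(r * ‖ξ‖ ^ 2)) : ℂ)).aestronglyMeasurable.mul hF.1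
  · filter_upwards [self_mem_nhdsWithin] with r hr
    refine .of_forall fun ξ => ?_
    rw [norm_mul]
    refine mul_le_of_le_one_left (norm_nonneg _) ?_
    have : (0 : ℝ) < r := hr
    rw [Complex.norm_real, Real.norm_of_nonneg (Real.exp_pos _).le, Real.exp_le_one_iff]
    nlinarith [mul_nonneg this.le (sq_nonneg ‖ξ‖)]
  · refine .of_forall fun ξ => ?_
    have hc : Continuous fun r : ℝ => (Real.exp (-(r * ‖ξ‖ ^ 2)) : ℂ) * F ξ := by fun_prop
    have := (hc.tendsto 0).mono_left (nhdsWithin_le_nhds (s := Ioi 0))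
    simpa using this

/-- `L^∞` bound for polynomial multipliers of low order. -/
lemma exists_sup_bound {s p : ℝ} (hs : 0 < s) (hp : 1 < p) {P : E3 → ℂ} (hP : P.HasTemperateGrowth)
    {l : ℕ} (hl : ∀ (c : ℝ) ξ, P (c • ξ) = (c : ℂ) ^ l * P ξ) (has : l / 2 + 3 / (2 * p) < s / 2) :
    ∃ C : ℝ≥0, ∀ f h : L2C, wNorm s (ENNReal.ofReal p) f ≠ ∞ →
      (∀ᵐ ξ, (𝓕 h : L2C) ξ = P ξ * (𝓕 f : L2C) ξ) →
      ∀ᵐ x, ‖h x‖ ≤ C * (wNorm s (ENNReal.ofReal p) f).toReal := by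
  obtain ⟨C, hC⟩ := exists_pair_bound hs hp hP hl (a := 0) le_rfl (by positivity) (by linarith)
  refine ⟨C, fun f h hfin hfh => ae_norm_le_wNorm hfin fun g hg hrep φ => ?_⟩
  have hb := fun r hr => hC f g hrep hg r hr φ
  simp only [neg_zero, Real.rpow_zero, ENNReal.ofReal_one, mul_one] at hb
  rw [← integral_mul_fourierInv]
  have hint := integrable_mul_schwartz (𝓕 h) (𝓕⁻ φ)
  have hlim := tendsto_integral_gauss_mul hint
  refine le_of_tendsto hlim.enorm ?_
  filter_upwards [self_mem_nhdsWithin] with r hr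
  refine le_trans (le_of_eq ?_) (hb r hr)
  congr 1
  refine integral_congr_ae ?_
  filter_upwards [hfh] with ξ hξ
  rw [hξ]; ring

lemma inv_norm_eq_integral {ξ : E3} (hξ : ξ ≠ 0) : ((‖ξ‖⁻¹ : ℝ) : ℂ) = ((Real.Gamma (1 / 2))⁻¹ : ℝ) *
    ∫ r in Ioi (0 : ℝ), ((r ^ (-(1 / 2) : ℝ) : ℝ) : ℂ) * (Real.exp (-(r * ‖ξ‖ ^ 2)) : ℂ) := by
  have hn := norm_pos_iff.2 hξ
  have h := Real.integral_rpow_mul_exp_neg_mul_Ioi (a := 1 / 2) (r := ‖ξ‖ ^ 2) (by positivity)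
    (by positivity)
  simp_rw [← Complex.ofReal_mul]
  rw [integral_complex_ofReal, ← Complex.ofReal_mul]
  congr 1
  have e : ∫ r in Ioi (0 : ℝ), r ^ (-(1 / 2) : ℝ) * Real.exp (-(r * ‖ξ‖ ^ 2)) = ‖ξ‖⁻¹ * Real.Gamma (1 / 2) := by
    rw [← show (1 / ‖ξ‖ ^ 2) ^ (1 / 2 : ℝ) = ‖ξ‖⁻¹ by
      rw [one_div, ← inv_pow, ← Real.sqrt_eq_rpow, Real.sqrt_sq (by positivity)], ← h]
    refine integral_congr_ae (.of_forall fun r => ?_)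
    dsimp only
    norm_num
    left; ring_nf
  have : Real.Gamma (1 / 2) ≠ 0 := (Real.Gamma_pos_of_pos (by positivity)).ne'
  rw [e]
  field_simp

lemma lintegral_rpow_split_lt_top {a b : ℝ} (ha : a < 1) (hb : 1 < b) :
    (∫⁻ r in Ioc (0 : ℝ) 1, ENNReal.ofReal (r ^ (-a))) + ∫⁻ r in Ioi (1 : ℝ), ENNReal.ofReal (r ^ (-b)) ≠ ∞ := by
  have h1 : IntegrableOn (fun r : ℝ => r ^ (-a)) (Ioc 0 1) :=
    (intervalIntegrable_iff_integrableOn_Ioc_of_le zero_le_one).1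
      (intervalIntegral.intervalIntegrable_rpow' (by linarith))
  have h2 : IntegrableOn (fun r : ℝ => r ^ (-b)) (Ioi 1) := integrableOn_Ioi_rpow_of_lt (by linarith) one_pos
  refine ENNReal.add_ne_top.2 ⟨?_, ?_⟩
  · exact ((hasFiniteIntegral_iff_ofReal (by
      filter_upwards [ae_restrict_mem measurableSet_Ioc] with r hr
      exact Real.rpow_nonneg hr.1.le _)).1 h1.2).ne
  · exact ((hasFiniteIntegral_iff_ofReal (by
      filter_upwards [ae_restrict_mem measurableSet_Ioi] with r hr
      exact Real.rpow_nonneg (zero_le_one.trans (le_of_lt hr)) _)).1 h2.2).ne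

/-- The integrand of the subordination formula for `|ξ|⁻¹`. -/
def subW (r : ℝ) (ξ : E3) : ℂ := ((r ^ (-(1 / 2) : ℝ) : ℝ) : ℂ) * (Real.exp (-(r * ‖ξ‖ ^ 2)) : ℂ)

lemma measurable_subW : Measurable fun z : E3 × ℝ => subW z.2 z.1 := by
  have h1 : Measurable fun z : E3 × ℝ => z.2 ^ (-(1 / 2) : ℝ) := measurable_snd.pow_const _
  have h2 : Continuous fun z : E3 × ℝ => (Real.exp (-(z.2 * ‖z.1‖ ^ 2)) : ℂ) := by fun_prop
  exact (Complex.measurable_ofReal.comp h1).mul h2.measurable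

lemma integral_subW {ξ : E3} (hξ : ξ ≠ 0) : IntegrableOn (fun r => subW r ξ) (Ioi 0) ∧
      ∫ r in Ioi (0 : ℝ), ‖subW r ξ‖ = Real.Gamma (1 / 2) * ‖ξ‖⁻¹ := by
  have hΓ := Real.Gamma_pos_of_pos (show (0 : ℝ) < 1 / 2 by positivity)
  have e : ((‖ξ‖⁻¹ : ℝ) : ℂ) = ((Real.Gamma (1 / 2))⁻¹ : ℝ) * ∫ r in Ioi (0 : ℝ), subW r ξ :=
    inv_norm_eq_integral hξ
  have hne : ∫ r in Ioi (0 : ℝ), subW r ξ ≠ 0 := by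
    intro h0
    rw [h0, mul_zero] at e
    exact (inv_ne_zero (norm_ne_zero_iff.2 hξ)) (by exact_mod_cast e)
  refine ⟨by_contra fun hni => hne (integral_undef hni), ?_⟩
  have e2 : ∫ r in Ioi (0 : ℝ), subW r ξ = ((∫ r in Ioi (0 : ℝ), ‖subW r ξ‖ : ℝ) : ℂ) := by
    rw [← integral_complex_ofReal]
    refine setIntegral_congr_fun measurableSet_Ioi fun r hr => ?_
    have hr' : (0 : ℝ) < r := hr
    simp only [subW]
    rw [← Complex.ofReal_mul, Complex.norm_real, Real.norm_of_nonneg (by positivity)]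
  rw [e2] at e
  have e4 : ‖ξ‖⁻¹ = (Real.Gamma (1 / 2))⁻¹ * ∫ r in Ioi (0 : ℝ), ‖subW r ξ‖ := by exact_mod_cast e
  rw [e4, mul_inv_cancel_left₀ hΓ.ne']

/-- Subordination for `L²` functions whose Fourier transforms differ by the factor `|ξ|⁻¹`. -/
lemma integral_div_norm_eq {h : L2C} {F : E3 → ℂ} (hF : AEStronglyMeasurable F volume) (φ : 𝓢(E3, ℂ))
    (hFh : ∀ᵐ ξ, (𝓕 h : L2C) ξ * (𝓕⁻ φ) ξ = ((‖ξ‖⁻¹ : ℝ) : ℂ) * F ξ) :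
    ∫ x, h x * φ x = ((Real.Gamma (1 / 2))⁻¹ : ℝ) * ∫ r in Ioi (0 : ℝ), ∫ ξ, subW r ξ * F ξ := by
  have hint := integrable_mul_schwartz (𝓕 h) (𝓕⁻ φ)
  have hm : AEStronglyMeasurable (fun z : E3 × ℝ => subW z.2 z.1 * F z.1)
        (volume.prod (volume.restrict (Ioi 0))) :=
    measurable_subW.aestronglyMeasurable.mul hF.comp_fst
  have hprod : Integrable (fun z : E3 × ℝ => subW z.2 z.1 * F z.1)
      (volume.prod (volume.restrict (Ioi 0))) := by
    refine (integrable_prod_iff hm).2 ⟨?_, ?_⟩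
    · filter_upwards [ae_ne_zero] with ξ hξ
      exact (integral_subW hξ).1.mul_const _
    · refine (hint.norm.const_mul (Real.Gamma (1 / 2))).congr ?_
      filter_upwards [hFh, ae_ne_zero] with ξ h1 hξ
      simp_rw [norm_mul]
      rw [integral_mul_const, (integral_subW hξ).2, ← norm_mul, h1, norm_mul, Complex.norm_real,
        Real.norm_of_nonneg (by positivity)]
      ring
  rw [← integral_mul_fourierInv, ← integral_integral_swap hprod, ← integral_const_mul]
  refine integral_congr_ae ?_
  filter_upwards [hFh, ae_ne_zero] with ξ h1 hξ
  rw [h1, integral_mul_const, ← mul_assoc]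
  congr 1
  exact inv_norm_eq_integral hξ

/-- `L^∞` bound for multipliers `P(ξ)/|ξ|`. -/
lemma exists_sup_bound_div {s p a : ℝ} (hs : 0 < s) (hp : 1 < p) {P : E3 → ℂ} (hP : P.HasTemperateGrowth)
    {l : ℕ} (hl : ∀ (c : ℝ) ξ, P (c • ξ) = (c : ℂ) ^ l * P ξ) (hl1 : 1 ≤ l) (ha : 0 ≤ a) (ha1 : a < 1 / 2)
    (has : l / 2 + 3 / (2 * p) - a < s / 2) :
    ∃ C : ℝ≥0, ∀ f h : L2C, wNorm s (ENNReal.ofReal p) f ≠ ∞ →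
      (∀ᵐ ξ, (𝓕 h : L2C) ξ = P ξ * ((‖ξ‖⁻¹ : ℝ) : ℂ) * (𝓕 f : L2C) ξ) →
      ∀ᵐ x, ‖h x‖ ≤ C * (wNorm s (ENNReal.ofReal p) f).toReal := by
  have hl1' : (1 : ℝ) ≤ l := by exact_mod_cast hl1
  have h3p : 0 < 3 / (2 * p) := by positivity
  obtain ⟨C₁, hC₁⟩ := exists_pair_bound hs hp hP hl ha (by linarith) has
  obtain ⟨C₂, hC₂⟩ := exists_pair_bound hs hp hP hl (a := l / 2 + 3 / (2 * p)) (by positivity) le_rfl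
    (by linarith)
  obtain ⟨L, hL⟩ : ∃ L : ℝ, L = l / 2 + 3 / (2 * p) := ⟨_, rfl⟩
  rw [← hL] at hC₂ has
  have hI := lintegral_rpow_split_lt_top (a := 1 / 2 + a) (b := 1 / 2 + L) (by linarith) (by linarith)
  obtain ⟨I₁, hI₁⟩ : ∃ I, I = ∫⁻ r in Ioc (0 : ℝ) 1, ENNReal.ofReal (r ^ (-(1 / 2 + a))) := ⟨_, rfl⟩
  obtain ⟨I₂, hI₂⟩ : ∃ I, I = ∫⁻ r in Ioi (1 : ℝ), ENNReal.ofReal (r ^ (-(1 / 2 + L))) := ⟨_, rfl⟩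
  rw [← hI₁, ← hI₂] at hI
  have hΓ := Real.Gamma_pos_of_pos (show (0 : ℝ) < 1 / 2 by positivity)
  refine ⟨(ENNReal.ofReal (Real.Gamma (1 / 2))⁻¹ * (C₁ + C₂) * (I₁ + I₂)).toNNReal,
    fun f h hfin hfh => ae_norm_le_wNorm hfin fun g hg hrep φ => ?_⟩
  rw [ENNReal.coe_toNNReal (ENNReal.mul_ne_top (by finiteness) hI)]
  obtain ⟨F, hF⟩ : ∃ F : E3 → ℂ, F = fun ξ => (𝓕 f : L2C) ξ * P ξ * (𝓕⁻ φ) ξ := ⟨_, rfl⟩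
  have hFm : AEStronglyMeasurable F volume := by
    rw [hF]
    exact ((Lp.aestronglyMeasurable _).mul hP.1.continuous.aestronglyMeasurable).mul
      (SchwartzMap.continuous _).aestronglyMeasurable
  have hFh : ∀ᵐ ξ, (𝓕 h : L2C) ξ * (𝓕⁻ φ) ξ = ((‖ξ‖⁻¹ : ℝ) : ℂ) * F ξ := by
    filter_upwards [hfh] with ξ hξ
    rw [hξ, hF]; ring
  have hpt : ∀ r : ℝ, 0 < r → ‖∫ ξ, subW r ξ * F ξ‖ₑ = ENNReal.ofReal (r ^ (-(1 / 2) : ℝ)) *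
      ‖∫ ξ, (𝓕 f : L2C) ξ * (P ξ * (Real.exp (-(r * ‖ξ‖ ^ 2)) : ℂ) * (𝓕⁻ φ) ξ)‖ₑ := by
    intro r hr
    have e1 : ENNReal.ofReal (r ^ (-(1 / 2) : ℝ)) = ‖((r ^ (-(1 / 2) : ℝ) : ℝ) : ℂ)‖ₑ := by
      rw [← ofReal_norm, Complex.norm_real, Real.norm_of_nonneg (by positivity)]
    rw [e1, ← enorm_mul, ← integral_const_mul]
    congr 2
    ext ξ
    simp only [subW, hF]; ring
  have e1 : ‖(((Real.Gamma (1 / 2))⁻¹ : ℝ) : ℂ)‖ₑ = ENNReal.ofReal (Real.Gamma (1 / 2))⁻¹ := by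
    rw [← ofReal_norm, Complex.norm_real, Real.norm_of_nonneg (by positivity)]
  rw [integral_div_norm_eq hFm φ hFh, enorm_mul, e1]
  obtain ⟨N, hN⟩ : ∃ N, N = eLpNorm g (ENNReal.ofReal p) volume := ⟨_, rfl⟩
  obtain ⟨Φ, hΦ⟩ : ∃ Φ, Φ = ∫⁻ x, ‖φ x‖ₑ := ⟨_, rfl⟩
  have hb1 : ∫⁻ r in Ioc (0 : ℝ) 1, ‖∫ ξ, subW r ξ * F ξ‖ₑ ≤ C₁ * N * Φ * I₁ := by
    have hm : Measurable fun r : ℝ => ENNReal.ofReal (r ^ (-(1 / 2 + a))) :=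
      (measurable_id.pow_const _).ennreal_ofReal
    rw [hI₁, ← lintegral_const_mul _ hm]
    refine lintegral_mono_ae ?_
    filter_upwards [ae_restrict_mem measurableSet_Ioc] with r hr
    rw [hpt r hr.1]
    refine (mul_le_mul_right (hC₁ f g hrep hg r hr.1 φ) _).trans_eq ?_
    rw [← hN, ← hΦ, show -(1 / 2 + a) = -(1 / 2) + -a by ring, Real.rpow_add hr.1,
      ENNReal.ofReal_mul (Real.rpow_nonneg hr.1.le _)]
    ring
  have hb2 : ∫⁻ r in Ioi (1 : ℝ), ‖∫ ξ, subW r ξ * F ξ‖ₑ ≤ C₂ * N * Φ * I₂ := by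
    have hm : Measurable fun r : ℝ => ENNReal.ofReal (r ^ (-(1 / 2 + L))) :=
      (measurable_id.pow_const _).ennreal_ofReal
    rw [hI₂, ← lintegral_const_mul _ hm]
    refine lintegral_mono_ae ?_
    filter_upwards [ae_restrict_mem measurableSet_Ioi] with r hr
    have hr0 : (0 : ℝ) < r := one_pos.trans hr
    rw [hpt r hr0]
    refine (mul_le_mul_right (hC₂ f g hrep hg r hr0 φ) _).trans_eq ?_
    rw [← hN, ← hΦ, show -(1 / 2 + L) = -(1 / 2) + -L by ring, Real.rpow_add hr0,
      ENNReal.ofReal_mul (Real.rpow_nonneg hr0.le _)]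
    ring
  rw [← hN, ← hΦ]
  calc _ ≤ ENNReal.ofReal (Real.Gamma (1 / 2))⁻¹ * ∫⁻ r in Ioi (0 : ℝ), ‖∫ ξ, subW r ξ * F ξ‖ₑ :=
        mul_le_mul_right (enorm_integral_le_lintegral_enorm _) _
    _ ≤ ENNReal.ofReal (Real.Gamma (1 / 2))⁻¹ * ((C₁ + C₂) * N * Φ * (I₁ + I₂)) := by
        refine mul_le_mul_right ?_ _
        rw [← Ioc_union_Ioi_eq_Ioi zero_le_one]
        refine (lintegral_union_le _ _ _).trans ((add_le_add hb1 hb2).trans ?_)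
        rw [mul_add]
        gcongr
        · exact le_self_add
        · exact le_add_self
    _ = _ := by ring

end EulerRiesz

noncomputable section

namespace EulerRiesz

lemma exists_fourier_eq {μ : E3 → ℂ} {f : L2C}
    (hm : MemLp (fun ξ => μ ξ * (𝓕 f : L2C) ξ) 2 volume) :
    ∃ g : L2C, (𝓕 g : L2C) =ᵐ[volume] fun ξ => μ ξ * (𝓕 f : L2C) ξ := by
  refine ⟨𝓕⁻ hm.toLp, ?_⟩
  rw [fourier_fourierInv_eq]
  exact hm.coeFn_toLp

/-- Fourier multipliers that do not increase sup norms. -/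
structure Contr (z : E3 → ℝ) : Prop where
  meas : Measurable z
  le_one : ∀ ξ, |z ξ| ≤ 1
  bound : ∀ (f g : L2C) (c : ℝ), 0 ≤ c → (∀ᵐ ξ, (𝓕 g : L2C) ξ = z ξ * (𝓕 f : L2C) ξ) →
    (∀ᵐ x, ‖f x‖ ≤ c) → ∀ᵐ x, ‖g x‖ ≤ c

lemma Contr.exists_apply {z : E3 → ℝ} (hz : Contr z) (f : L2C) :
    ∃ g : L2C, ∀ᵐ ξ, (𝓕 g : L2C) ξ = z ξ * (𝓕 f : L2C) ξ :=
  exists_fourier_eq (memLp_bdd_mul (c := 1) (Complex.measurable_ofReal.comp hz.meas).aestronglyMeasurable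
    (fun ξ => by simpa using hz.le_one ξ) _)

lemma contr_zero : Contr 0 where
  meas := measurable_const
  le_one _ := by simp
  bound f g c hc h _ := by
    have hg : g = 0 := by
      refine fourier_injective ?_
      have : (𝓕 (0 : L2C) : L2C) = 0 := (Lp.fourierTransformₗᵢ E3 ℂ).map_zero
      rw [this]
      filter_upwards [h, Lp.coeFn_zero ℂ 2 (volume : Measure E3)] with ξ h1 h2
      rw [h1, h2]; simp
    filter_upwards [Lp.coeFn_zero ℂ 2 (volume : Measure E3)] with x hx
    rw [hg, hx]; simpa using hc

lemma contr_one : Contr 1 where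
  meas := measurable_const
  le_one _ := by simp
  bound f g c hc h hf := by
    have hg : g = f := fourier_injective (by filter_upwards [h] with ξ h1; rw [h1]; simp)
    rw [hg]; exact hf

lemma Contr.mul {y z : E3 → ℝ} (hy : Contr y) (hz : Contr z) : Contr (fun ξ => y ξ * z ξ) where
  meas := hy.meas.mul hz.meas
  le_one ξ := by rw [abs_mul]; exact mul_le_one₀ (hy.le_one ξ) (abs_nonneg _) (hz.le_one ξ)
  bound f g c hc h hf := by
    obtain ⟨k, hk⟩ := hz.exists_apply f
    refine hy.bound k g c hc ?_ (hz.bound f k c hc hk hf)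
    filter_upwards [h, hk] with ξ h1 h2
    rw [h1, h2]; push_cast; ring

lemma Contr.comb {y z : E3 → ℝ} (hy : Contr y) (hz : Contr z) {a b : ℝ} (ha : 0 ≤ a) (hb : 0 ≤ b)
    (hab : a + b ≤ 1) : Contr (fun ξ => a * y ξ + b * z ξ) where
  meas := (hy.meas.const_mul a).add (hz.meas.const_mul b)
  le_one ξ := by
    calc |a * y ξ + b * z ξ| ≤ |a * y ξ| + |b * z ξ| := abs_add_le _ _
      _ ≤ a * 1 + b * 1 := by
        rw [abs_mul, abs_mul, abs_of_nonneg ha, abs_of_nonneg hb]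
        gcongr
        exacts [hy.le_one ξ, hz.le_one ξ]
      _ ≤ 1 := by linarith
  bound f g c hc h hf := by
    obtain ⟨k, hk⟩ := hy.exists_apply f
    obtain ⟨l, hl⟩ := hz.exists_apply f
    have hg : g = (a : ℂ) • k + (b : ℂ) • l := by
      refine fourier_injective ?_
      have e : (𝓕 ((a : ℂ) • k + (b : ℂ) • l) : L2C) = (a : ℂ) • 𝓕 k + (b : ℂ) • 𝓕 l := by
        change Lp.fourierTransformₗᵢ E3 ℂ _ = _
        rw [map_add, map_smul, map_smul]; rfl
      rw [e]
      filter_upwards [h, hk, hl, Lp.coeFn_add ((a : ℂ) • 𝓕 k : L2C) ((b : ℂ) • 𝓕 l),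
        Lp.coeFn_smul (a : ℂ) (𝓕 k : L2C), Lp.coeFn_smul (b : ℂ) (𝓕 l : L2C)] with ξ h1 h2 h3 h4 h5 h6
      rw [h4, Pi.add_apply, h5, h6, Pi.smul_apply, Pi.smul_apply, h1, h2, h3]
      simp only [smul_eq_mul]; push_cast; ring
    filter_upwards [hy.bound f k c hc hk hf, hz.bound f l c hc hl hf,
      Lp.coeFn_add ((a : ℂ) • k : L2C) ((b : ℂ) • l), Lp.coeFn_smul (a : ℂ) (k : L2C),
      Lp.coeFn_smul (b : ℂ) (l : L2C)] with x h1 h2 h3 h4 h5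
    rw [hg, h3, Pi.add_apply, h4, h5, Pi.smul_apply, Pi.smul_apply]
    calc _ ≤ ‖(a : ℂ) • k x‖ + ‖(b : ℂ) • l x‖ := norm_add_le _ _
      _ ≤ a * c + b * c := by
        rw [norm_smul, norm_smul, Complex.norm_real, Complex.norm_real, Real.norm_of_nonneg ha,
          Real.norm_of_nonneg hb]
        gcongr
      _ ≤ c := by nlinarith

lemma Contr.lim {z : ℕ → E3 → ℝ} {y : E3 → ℝ} (hz : ∀ j, Contr (z j))
    (h : ∀ ξ, Tendsto (fun j => z j ξ) atTop (𝓝 (y ξ))) : Contr y where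
  meas := measurable_of_tendsto_metrizable (fun j => (hz j).meas) (tendsto_pi_nhds.2 h)
  le_one ξ := le_of_tendsto (h ξ).abs (.of_forall fun j => (hz j).le_one ξ)
  bound f g c hc hg hf := by
    choose k hk using fun j => (hz j).exists_apply f
    refine ae_le_of_tendsto_L2 (f := k) (l := atTop) ?_ hc
      (.of_forall fun j => (hz j).bound f (k j) c hc (hk j) hf)
    have key : Tendsto (fun j => (𝓕 (k j) : L2C)) atTop (𝓝 (𝓕 g)) := by
      rw [tendsto_Lp_iff_lintegral]
      have h0 : ∫⁻ _ξ : E3, (0 : ℝ≥0∞) = 0 := by simp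
      rw [← h0]
      have hy1 : ∀ ξ, |y ξ| ≤ 1 := fun ξ => le_of_tendsto (h ξ).abs (.of_forall fun j => (hz j).le_one ξ)
      refine tendsto_lintegral_of_dominated_convergence' (fun ξ => 4 * ‖(𝓕 f : L2C) ξ‖ₑ ^ 2)
        (fun j => by
          have := ((Lp.aestronglyMeasurable (𝓕 (k j) : L2C)).sub (Lp.aestronglyMeasurable (𝓕 g : L2C))).enorm
          exact this.pow_const 2) (fun j => ?_) ?_ ?_
      · filter_upwards [hk j, hg] with ξ h1 h2
        rw [h1, h2, ← sub_mul, enorm_mul, mul_pow]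
        gcongr
        have : ‖(z j ξ : ℂ) - y ξ‖ₑ ≤ 2 := by
          rw [← Complex.ofReal_sub, ← ofReal_norm, Complex.norm_real]
          have : ‖z j ξ - y ξ‖ ≤ 2 := by
            rw [Real.norm_eq_abs]
            calc _ ≤ |z j ξ| + |y ξ| := abs_sub _ _
              _ ≤ 2 := by linarith [(hz j).le_one ξ, hy1 ξ]
          calc _ ≤ ENNReal.ofReal 2 := ENNReal.ofReal_le_ofReal this
            _ = 2 := by simp
        calc _ ≤ (2 : ℝ≥0∞) ^ 2 := by gcongr
          _ = 4 := by norm_num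
      · rw [lintegral_const_mul' _ _ (by simp), lintegral_enorm_sq]
        exact ENNReal.mul_ne_top (by simp) ENNReal.ofReal_ne_top
      · filter_upwards [ae_all_iff.2 hk, hg] with ξ h1 h2
        have : Tendsto (fun j => ‖((z j ξ : ℂ) - y ξ) * (𝓕 f : L2C) ξ‖ₑ ^ 2) atTop
            (𝓝 (‖((y ξ : ℂ) - y ξ) * (𝓕 f : L2C) ξ‖ₑ ^ 2)) := by
          refine ((ENNReal.continuous_pow 2).comp continuous_enorm).tendsto _ |>.comp ?_
          exact (((Complex.continuous_ofReal.tendsto _).comp (h ξ)).sub_const _).mul_const _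
        simpa [h1, h2, ← sub_mul] using this
    exact (Lp.fourierTransformₗᵢ E3 ℂ).isometry.isUniformInducing.isInducing.tendsto_nhds_iff.2 key

lemma cos_eq_trSymb (h ξ : E3) : ((Real.cos (2 * Real.pi * inner ℝ h ξ) : ℝ) : ℂ)
    = (1 / 2 : ℂ) * (trSymb h ξ + trSymb (-h) ξ) := by
  rw [Complex.ofReal_cos, Complex.cos, trSymb, trSymb, inner_neg_left]
  push_cast
  ring_nf

lemma continuous_cos_inner :
    Continuous fun z : E3 × E3 => Real.cos (2 * Real.pi * inner ℝ z.1 z.2) := by fun_prop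

lemma measurable_integral_cos (ν : Measure E3) [SFinite ν] :
    Measurable fun ξ : E3 => ∫ h, Real.cos (2 * Real.pi * inner ℝ h ξ) ∂ν := by
  have : StronglyMeasurable fun z : E3 × E3 => Real.cos (2 * Real.pi * inner ℝ z.2 z.1) :=
    (continuous_cos_inner.comp continuous_swap).stronglyMeasurable
  exact this.integral_prod_right.measurable

lemma abs_integral_cos_le (ν : Measure E3) [IsFiniteMeasure ν] (ξ : E3) :
    |∫ h, Real.cos (2 * Real.pi * inner ℝ h ξ) ∂ν| ≤ ν.real univ := by
  have := norm_integral_le_of_norm_le_const (μ := ν) (f := fun h : E3 => Real.cos (2 * Real.pi * inner ℝ h ξ))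
    (C := 1) (.of_forall fun h => by simpa using Real.abs_cos_le_one _)
  simpa using this

lemma contr_average (ν : Measure E3) [IsFiniteMeasure ν] :
    Contr (fun ξ => (ν.real univ)⁻¹ * ∫ h, Real.cos (2 * Real.pi * inner ℝ h ξ) ∂ν) where
  meas := (measurable_integral_cos ν).const_mul _
  le_one ξ := by
    rw [abs_mul, abs_inv, abs_of_nonneg measureReal_nonneg]
    exact (mul_le_mul_of_nonneg_left (abs_integral_cos_le ν ξ) (by positivity)).trans
      (inv_mul_le_one)
  bound f g c hc hg hf := by
    refine ae_norm_le_of_schwartz fun φ => ?_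
    have hcos : ∀ h : E3, ‖∫ ξ, (Real.cos (2 * Real.pi * inner ℝ h ξ) : ℂ) * ((𝓕 f : L2C) ξ * (𝓕⁻ φ) ξ)‖
        ≤ c * ∫ x, ‖φ x‖ := by
      intro h
      have e : ∫ ξ, (Real.cos (2 * Real.pi * inner ℝ h ξ) : ℂ) * ((𝓕 f : L2C) ξ * (𝓕⁻ φ) ξ)
          = (1 / 2 : ℂ) * (∫ x, tr h f x * φ x) + (1 / 2 : ℂ) * (∫ x, tr (-h) f x * φ x) := by
        rw [← integral_mul_fourierInv (tr h f), ← integral_mul_fourierInv (tr (-h) f), ← integral_const_mul, ← integral_const_mul,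
          ← integral_add ((integrable_mul_schwartz _ _).const_mul _) ((integrable_mul_schwartz _ _).const_mul _)]
        refine integral_congr_ae ?_
        filter_upwards [fourier_tr h f, fourier_tr (-h) f] with ξ h1 h2
        rw [cos_eq_trSymb, h1, h2]; ring
      have b : ∀ k : E3, ‖∫ x, tr k f x * φ x‖ ≤ c * ∫ x, ‖φ x‖ := by
        intro k
        rw [← integral_const_mul]
        refine norm_integral_le_of_norm_le (φ.integrable.norm.const_mul c) ?_
        filter_upwards [coe_tr k f, ae_add_right hf k] with x h1 h2
        rw [norm_mul, h1]; gcongr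
      rw [e]
      refine (norm_add_le _ _).trans ?_
      rw [norm_mul, norm_mul]
      have := b h
      have := b (-h)
      norm_num
      linarith
    have hint : Integrable (fun ξ => (𝓕 f : L2C) ξ * (𝓕⁻ φ) ξ) volume := integrable_mul_schwartz _ _
    have swap : ∫ ξ, (∫ h, (Real.cos (2 * Real.pi * inner ℝ h ξ) : ℂ) * ((𝓕 f : L2C) ξ * (𝓕⁻ φ) ξ) ∂ν)
        = ∫ h, (∫ ξ, (Real.cos (2 * Real.pi * inner ℝ h ξ) : ℂ) * ((𝓕 f : L2C) ξ * (𝓕⁻ φ) ξ)) ∂ν := by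
      refine integral_integral_swap ?_
      have hF : Integrable (fun z : E3 × E3 => (𝓕 f : L2C) z.1 * (𝓕⁻ φ) z.1) (volume.prod ν) :=
        hint.comp_fst ν
      refine hF.bdd_mul (c := 1) ?_ (.of_forall fun z => ?_)
      · exact (Complex.continuous_ofReal.comp (continuous_cos_inner.comp continuous_swap)).aestronglyMeasurable
      · rw [Complex.norm_real]; exact Real.abs_cos_le_one _
    have e : ∫ x, g x * φ x = ((ν.real univ)⁻¹ : ℂ) *
        ∫ h, (∫ ξ, (Real.cos (2 * Real.pi * inner ℝ h ξ) : ℂ) * ((𝓕 f : L2C) ξ * (𝓕⁻ φ) ξ)) ∂ν := by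
      rw [← swap, ← integral_mul_fourierInv, ← integral_const_mul]
      refine integral_congr_ae ?_
      filter_upwards [hg] with ξ h1
      rw [h1, integral_mul_const, integral_complex_ofReal]
      push_cast; ring
    rw [e, norm_mul]
    have h1 := norm_integral_le_of_norm_le_const (μ := ν) (.of_forall hcos)
    have h2 : ‖((ν.real univ)⁻¹ : ℂ)‖ = (ν.real univ)⁻¹ := by
      rw [norm_inv, Complex.norm_real, Real.norm_of_nonneg measureReal_nonneg]
    rw [h2]
    have h3 : 0 ≤ c * ∫ x, ‖φ x‖ := mul_nonneg hc (integral_nonneg fun _ => norm_nonneg _)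
    calc _ ≤ (ν.real univ)⁻¹ * ((c * ∫ x, ‖φ x‖) * ν.real univ) := by gcongr
      _ = (c * ∫ x, ‖φ x‖) * ((ν.real univ)⁻¹ * ν.real univ) := by ring
      _ ≤ (c * ∫ x, ‖φ x‖) * 1 := by gcongr; exact inv_mul_le_one
      _ = _ := mul_one _

/-- Resolvents of the truncated fractional Laplacian. -/
lemma contr_resolvent (ν : Measure E3) [IsFiniteMeasure ν] {c : ℝ} (hc : 0 ≤ c) :
    Contr (fun ξ => (1 + c * ∫ h, (1 - Real.cos (2 * Real.pi * inner ℝ h ξ)) ∂ν)⁻¹) := by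
  obtain ⟨Λ, hΛ⟩ : ∃ Λ, Λ = ν.real univ := ⟨_, rfl⟩
  have hΛ0 : 0 ≤ Λ := hΛ ▸ measureReal_nonneg
  let κ : E3 → ℝ := fun ξ => Λ⁻¹ * ∫ h, Real.cos (2 * Real.pi * inner ℝ h ξ) ∂ν
  have hκ : Contr κ := by simpa only [κ, hΛ] using contr_average ν
  have hb : 0 < 1 + c * Λ := by positivity
  let y : ℕ → E3 → ℝ := fun j => Nat.rec 0 (fun _ y ξ =>
    (1 + c * Λ)⁻¹ * (1 : E3 → ℝ) ξ + (c * Λ / (1 + c * Λ)) * (κ ξ * y ξ)) j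
  have hy : ∀ j, Contr (y j) := by
    intro j
    induction j with
    | zero => exact contr_zero
    | succ j ih =>
      refine contr_one.comb (hκ.mul ih) (by positivity) (by positivity) ?_
      rw [div_eq_mul_inv, ← one_add_mul, mul_inv_cancel₀ hb.ne']
  refine Contr.lim hy fun ξ => ?_
  have hI : ∫ h, (1 - Real.cos (2 * Real.pi * inner ℝ h ξ)) ∂ν = Λ - Λ * κ ξ := by
    rw [integral_sub (integrable_const _)]
    · by_cases h0 : Λ = 0
      · have : ν = 0 := by
          rw [← Measure.measure_univ_eq_zero]
          exact (measureReal_eq_zero_iff).1 (hΛ ▸ h0)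
        simp [this, h0]
      · simp only [κ, integral_const, smul_eq_mul, mul_one, ← hΛ]
        field_simp
    · refine (integrable_const (1 : ℝ)).mono' ?_ (.of_forall fun h => by simpa using Real.abs_cos_le_one _)
      exact (by fun_prop : Continuous fun h : E3 => Real.cos (2 * Real.pi * inner ℝ h ξ)).aestronglyMeasurable
  rw [hI]
  have hκ1 := abs_le.1 (hκ.le_one ξ)
  have hpos : 0 < 1 + c * (Λ - Λ * κ ξ) := by
    have : 0 ≤ c * (Λ * (1 - κ ξ)) := mul_nonneg hc (mul_nonneg hΛ0 (by linarith))
    nlinarith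
  obtain ⟨y0, hy0⟩ : ∃ y0, y0 = (1 + c * (Λ - Λ * κ ξ))⁻¹ := ⟨_, rfl⟩
  rw [← hy0]
  have hfix : y0 * (1 + c * Λ) = 1 + c * Λ * κ ξ * y0 := by
    have := inv_mul_cancel₀ hpos.ne'
    rw [← hy0] at this; linarith
  let q : ℝ := c * Λ / (1 + c * Λ)
  have hq0 : 0 ≤ q := by positivity
  have hq1 : q < 1 := by rw [div_lt_one hb]; linarith
  have hstep : ∀ j, |y j ξ - y0| ≤ q ^ j * |y0| := by
    intro j
    induction j with
    | zero => simp [y]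
    | succ j ih =>
      have : y (j + 1) ξ - y0 = q * κ ξ * (y j ξ - y0) := by
        change (1 + c * Λ)⁻¹ * (1 : ℝ) + q * (κ ξ * y j ξ) - y0 = _
        have : (1 + c * Λ)⁻¹ = y0 - q * κ ξ * y0 := by
          simp only [q]; field_simp; linarith
        rw [this]; ring
      rw [this, abs_mul, abs_mul, abs_of_nonneg hq0, pow_succ]
      calc _ ≤ q * 1 * (q ^ j * |y0|) := by gcongr; exact hκ.le_one ξ
        _ = _ := by ring
  rw [tendsto_iff_norm_sub_tendsto_zero]
  refine squeeze_zero (fun _ => norm_nonneg _) hstep ?_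
  simpa using (tendsto_pow_atTop_nhds_zero_of_lt_one hq0 hq1).mul_const |y0|

lemma enorm_trSymb_sub_one_sq (h ξ : E3) : ‖trSymb h ξ - 1‖ₑ ^ 2
    = ENNReal.ofReal (2 * (1 - Real.cos (2 * Real.pi * inner ℝ h ξ))) := by
  rw [← ofReal_norm, ← ENNReal.ofReal_pow (norm_nonneg _)]
  congr 1
  rw [← Complex.normSq_eq_norm_sq, trSymb, Complex.exp_mul_I, ← Complex.ofReal_cos, ← Complex.ofReal_sin]
  simp only [Complex.normSq_apply, Complex.sub_re, Complex.add_re, Complex.ofReal_re, Complex.mul_re,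
    Complex.I_re, Complex.ofReal_im, Complex.I_im, Complex.one_re, Complex.sub_im, Complex.add_im,
    Complex.mul_im, Complex.one_im]
  nlinarith [Real.sin_sq_add_cos_sq (2 * Real.pi * inner ℝ h ξ)]

lemma tendsto_lintegral_nu {a : ℝ} {g : E3 → ℝ≥0∞} (hg : Measurable g)
    (hfin : ∫⁻ h, g h * kw a h ≠ ∞) :
    Tendsto (fun j : ℕ => ∫⁻ h, g h ∂(nu a (1 / ((j : ℝ) + 1)))) atTop (𝓝 (∫⁻ h, g h * kw a h)) := by
  simp_rw [lintegral_nu _ _ hg]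
  refine tendsto_lintegral_of_dominated_convergence (fun h => g h * kw a h) (fun j => ?_) (fun j => ?_)
    hfin ?_
  · exact ((measurable_one.indicator (measurableSet_gt _)).mul (hg.mul (measurable_kw a)))
  · refine .of_forall fun h => ?_
    by_cases hh : h ∈ {h : E3 | 1 / ((j : ℝ) + 1) < ‖h‖}
    · dsimp only; rw [indicator_of_mem hh, Pi.one_apply, one_mul]
    · dsimp only; rw [indicator_of_notMem hh, zero_mul]; exact zero_le
  · filter_upwards [ae_ne_zero] with h hh
    refine tendsto_const_nhds.congr' ?_
    have := (tendsto_one_div_add_atTop_nhds_zero_nat (𝕜 := ℝ)).eventually_lt_const (norm_pos_iff.2 hh)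
    filter_upwards [this] with j hj
    rw [indicator_of_mem (show h ∈ {h : E3 | 1 / ((j : ℝ) + 1) < ‖h‖} from hj), Pi.one_apply, one_mul]

lemma contr_inv_one_add_freq {σ : ℝ} (h0 : 0 < σ) (h2 : σ < 2) :
    Contr (fun ξ => (1 + freq ξ ^ σ)⁻¹) := by
  have hd0 := diffConst_ne_zero 1 (σ / 2)
  have hd1 := (diffConst_lt_top (k := 1) (a := σ / 2) (by linarith) (by norm_num; linarith)).ne
  obtain ⟨d, hd⟩ : ∃ d, d = (diffConst 1 (σ / 2)).toReal := ⟨_, rfl⟩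
  have hdpos : 0 < d := hd ▸ ENNReal.toReal_pos hd0 hd1
  let ν : ℕ → Measure E3 := fun j => nu σ (1 / ((j : ℝ) + 1))
  have hν : ∀ j, IsFiniteMeasure (ν j) := fun j => nu_finite h0 (by positivity)
  let c : ℝ := (2 * Real.pi) ^ σ * 2 / d
  have hc : 0 ≤ c := by positivity
  refine Contr.lim (fun j => contr_resolvent (ν j) hc) fun ξ => ?_
  have hI : ∀ j, ∫ h, (1 - Real.cos (2 * Real.pi * inner ℝ h ξ)) ∂(ν j)
      = (1 / 2) * (∫⁻ h, ‖trSymb h ξ - 1‖ₑ ^ 2 ∂(ν j)).toReal := by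
    intro j
    rw [integral_eq_lintegral_of_nonneg_ae (.of_forall fun h => by
      simpa using Real.cos_le_one _) (by fun_prop : Continuous fun h : E3 =>
        1 - Real.cos (2 * Real.pi * inner ℝ h ξ)).aestronglyMeasurable]
    simp_rw [enorm_trSymb_sub_one_sq, ENNReal.ofReal_mul zero_le_two]
    rw [lintegral_const_mul' _ _ (by simp), ENNReal.toReal_mul]
    norm_num
    ring
  have hm : Measurable fun h : E3 => ‖trSymb h ξ - 1‖ₑ ^ 2 :=
    ((continuous_trSymb_uncurry.comp (by fun_prop : Continuous fun h : E3 => (h, ξ))).sub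
      continuous_const).measurable.enorm.pow_const 2
  have hlim : Tendsto (fun j => (∫⁻ h, ‖trSymb h ξ - 1‖ₑ ^ 2 ∂(ν j)).toReal) atTop
      (𝓝 (‖ξ‖ ^ σ * d)) := by
    have e : ∫⁻ h, ‖trSymb h ξ - 1‖ₑ ^ 2 * kw σ h = ENNReal.ofReal (‖ξ‖ ^ σ) * diffConst 1 (σ / 2) := by
      rcases eq_or_ne ξ 0 with rfl | hξ
      · simp [trSymb, Real.zero_rpow h0.ne']
      · have := lintegral_trSymb 1 (σ / 2) hξ
        rwa [show 2 * (σ / 2) = σ by ring, mul_one] at this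
    have hfin : ENNReal.ofReal (‖ξ‖ ^ σ) * diffConst 1 (σ / 2) ≠ ∞ :=
      ENNReal.mul_ne_top ENNReal.ofReal_ne_top hd1
    have := (ENNReal.tendsto_toReal (e ▸ hfin)).comp (tendsto_lintegral_nu (a := σ) hm (e ▸ hfin))
    rw [e, ENNReal.toReal_mul, ENNReal.toReal_ofReal (by positivity), ← hd] at this
    exact this
  simp_rw [hI]
  have e : (1 + freq ξ ^ σ)⁻¹ = (1 + c * (1 / 2 * (‖ξ‖ ^ σ * d)))⁻¹ := by
    congr 2
    rw [freq, Real.mul_rpow (by positivity) (norm_nonneg _)]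
    simp only [c]; field_simp
  rw [e]
  refine Tendsto.inv₀ ?_ (by positivity)
  exact ((hlim.const_mul _).const_mul _).const_add _

lemma Contr.one_sub_sqrt {y : E3 → ℝ} (hy : Contr y) (h0 : ∀ ξ, 0 ≤ y ξ) :
    Contr (fun ξ => 1 - √(1 - y ξ)) := by
  let z : ℕ → E3 → ℝ := fun j => Nat.rec 0 (fun _ z ξ => (1 / 2) * y ξ + (1 / 2) * (z ξ * z ξ)) j
  have hz : ∀ j, Contr (z j) := by
    intro j
    induction j with
    | zero => exact contr_zero
    | succ j ih => exact hy.comb (ih.mul ih) (by norm_num) (by norm_num) (by norm_num)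
  have hs : ∀ j ξ, z (j + 1) ξ = (1 / 2) * y ξ + (1 / 2) * (z j ξ * z j ξ) := fun _ _ => rfl
  refine Contr.lim hz fun ξ => ?_
  have hnn : ∀ j, 0 ≤ z j ξ ∧ z j ξ ≤ z (j + 1) ξ := by
    intro j
    induction j with
    | zero => rw [hs]; simpa [z] using h0 ξ
    | succ j ih =>
      refine ⟨ih.1.trans ih.2, ?_⟩
      have := mul_le_mul ih.2 ih.2 ih.1 (ih.1.trans ih.2)
      rw [hs (j + 1)]
      linarith [hs j ξ]
  have hmono : Monotone fun j => z j ξ := monotone_nat_of_le_succ fun j => (hnn j).2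
  have hle : ∀ j, z j ξ ≤ 1 := fun j => (abs_le.1 ((hz j).le_one ξ)).2
  obtain ⟨L, hL⟩ : ∃ L, Tendsto (fun j => z j ξ) atTop (𝓝 L) :=
    ⟨_, tendsto_atTop_ciSup hmono ⟨1, by rintro _ ⟨j, rfl⟩; exact hle j⟩⟩
  have hL1 : L ≤ 1 := le_of_tendsto' hL hle
  have heq : L = (1 / 2) * y ξ + (1 / 2) * (L * L) :=
    tendsto_nhds_unique ((tendsto_add_atTop_iff_nat 1).2 hL) (((hL.mul hL).const_mul _).const_add _)
  have : √(1 - y ξ) = 1 - L := by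
    rw [show 1 - y ξ = (1 - L) ^ 2 by linarith, Real.sqrt_sq (by linarith)]
  rw [this, sub_sub_cancel]
  exact hL

/-- The symbol `|∇|/p(|∇|)`. -/
def msymb (σ : ℝ) (ξ : E3) : ℝ := √(1 - (1 + freq ξ ^ σ)⁻¹)

lemma ae_norm_le_of_msymb {σ : ℝ} (h0 : 0 < σ) (h2 : σ < 2) {f g : L2C} {c : ℝ} (hc : 0 ≤ c)
    (hg : ∀ᵐ ξ, (𝓕 g : L2C) ξ = msymb σ ξ * (𝓕 f : L2C) ξ) (hf : ∀ᵐ x, ‖f x‖ ≤ c) :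
    ∀ᵐ x, ‖g x‖ ≤ 2 * c := by
  have hz := (contr_inv_one_add_freq h0 h2).one_sub_sqrt
    fun ξ => inv_nonneg.2 (add_nonneg zero_le_one (Real.rpow_nonneg (freq_nonneg ξ) σ))
  have hk : ∀ᵐ x, ‖(f - g : L2C) x‖ ≤ c := by
    refine hz.bound f (f - g) c hc ?_ hf
    rw [fourier_sub']
    filter_upwards [hg, Lp.coeFn_sub (𝓕 f : L2C) (𝓕 g)] with ξ h1 h2
    rw [h2, Pi.sub_apply, h1, msymb]; push_cast; ring
  filter_upwards [hf, hk, Lp.coeFn_sub f g] with x h1 h2 h3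
  rw [h3, Pi.sub_apply] at h2
  calc ‖g x‖ = ‖f x - (f x - g x)‖ := by rw [sub_sub_cancel]
    _ ≤ ‖f x‖ + ‖f x - g x‖ := norm_sub_le _ _
    _ ≤ 2 * c := by linarith

end EulerRiesz
end

noncomputable section

namespace EulerRiesz

open LineDeriv

lemma temperate_inner (v : E3) : (fun ξ : E3 => inner ℝ ξ v).HasTemperateGrowth := by fun_prop

lemma inner_ev (ξ : E3) (k : Fin 3) : inner ℝ ξ (ev k) = ξ k := by
  simp [ev, EuclideanSpace.inner_single_right]

lemma fourier_lineDeriv_apply (φ : 𝓢(E3, ℂ)) (v ξ : E3) :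
    𝓕 (∂_{v} φ) ξ = dsymb v ξ * 𝓕 φ ξ := by
  rw [SchwartzMap.fourier_lineDerivOp_eq, smul_apply,
    SchwartzMap.smulLeftCLM_apply_apply (temperate_inner v), dsymb, real_inner_comm]
  simp only [Complex.real_smul, smul_eq_mul]
  push_cast; ring

/-- A real Schwartz function regarded as a complex one. -/
def schC (φ : 𝓢(E3, ℝ)) : 𝓢(E3, ℂ) := φ.postcompCLM (𝕜 := ℝ) Complex.ofRealCLM

lemma cplx_toLp (φ : 𝓢(E3, ℝ)) : cplx (φ.toLp 2) = (schC φ).toLp 2 := by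
  refine Lp.ext ?_
  filter_upwards [coe_cplx (φ.toLp 2), φ.coeFn_toLp 2 volume, (schC φ).coeFn_toLp 2 volume] with x h1 h2 h3
  rw [h1, h2, h3]; rfl

lemma coe_schwartz_deriv (φ : 𝓢(E3, ℝ)) (j : Fin 3) :
    (∂_{ev j} φ).toLp 2 volume =ᵐ[volume] pderiv j φ := (∂_{ev j} φ).coeFn_toLp 2 volume

lemma schC_lineDeriv (φ : 𝓢(E3, ℝ)) (v : E3) : schC (∂_{v} φ) = ∂_{v} (schC φ) := by
  ext x
  rw [SchwartzMap.lineDerivOp_apply_eq_fderiv]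
  change Complex.ofRealCLM (fderiv ℝ φ x v) = fderiv ℝ (Complex.ofRealCLM ∘ φ) x v
  rw [(Complex.ofRealCLM.hasFDerivAt.comp x (φ.hasFDerivAt x)).fderiv]
  rfl

lemma FD_schwartz (φ : 𝓢(E3, ℝ)) (v : E3) : FD v (φ.toLp 2) ((∂_{v} φ).toLp 2) := by
  unfold FD
  rw [cplx_toLp, cplx_toLp, schC_lineDeriv, SchwartzMap.toLp_fourier_eq, SchwartzMap.toLp_fourier_eq]
  filter_upwards [(𝓕 (∂_{v} (schC φ))).coeFn_toLp 2 volume, (𝓕 (schC φ)).coeFn_toLp 2 volume] with ξ h1 h2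
  rw [h1, h2, fourier_lineDeriv_apply]

lemma ae_eq_of_integral_schwartz {F : E3 → ℂ} (hF : LocallyIntegrable F volume)
    (h : ∀ φ : 𝓢(E3, ℂ), ∫ ξ, F ξ * φ ξ = 0) : ∀ᵐ ξ, F ξ = 0 := by
  refine ae_eq_zero_of_integral_contDiff_smul_eq_zero hF fun g hg hs => ?_
  have := h (schC (hs.toSchwartzMap hg))
  rw [← this]
  refine integral_congr_ae (.of_forall fun ξ => ?_)
  simp only [Complex.real_smul, mul_comm]; rfl

lemma curl_schwartz {u : Fin 3 → L2R} (hu : Irrotational u) (j k : Fin 3) (φ : 𝓢(E3, ℂ)) :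
    ∫ x, cplx (u j) x * (∂_{ev k} φ) x = ∫ x, cplx (u k) x * (∂_{ev j} φ) x := by
  have hre : ∀ (L : ℂ →L[ℝ] ℝ) (j k : Fin 3), L (∫ x, cplx (u j) x * (∂_{ev k} φ) x)
      = ∫ x, u j x * pderiv k (φ.postcompCLM (𝕜 := ℝ) L) x := by
    intro L j k
    rw [← L.integral_comp_comm (integrable_mul_schwartz _ _)]
    refine integral_congr_ae ?_
    filter_upwards [coe_cplx (u j)] with x hx
    rw [hx, ← Complex.real_smul, map_smul, smul_eq_mul]
    congr 1
    change L (fderiv ℝ φ x (ev k)) = fderiv ℝ (L ∘ φ) x (ev k)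
    rw [(L.hasFDerivAt.comp x (φ.hasFDerivAt x)).fderiv]; rfl
  refine Complex.ext ?_ ?_
  · have := hre Complex.reCLM j k
    rw [hu, ← hre] at this; exact this
  · have := hre Complex.imCLM j k
    rw [hu, ← hre] at this; exact this

lemma locallyIntegrable_coord (f : L2C) (j : Fin 3) :
    LocallyIntegrable (fun ξ : E3 => (ξ j : ℂ) * f ξ) volume := by
  have hf : LocallyIntegrable f volume := (Lp.memLp f).locallyIntegrable one_le_two
  rw [locallyIntegrable_iff] at hf ⊢
  intro K hK
  exact (hf K hK).continuousOn_mul (by fun_prop : Continuous fun ξ : E3 => (ξ j : ℂ)).continuousOn hK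

lemma Irrotational.fourier {u : Fin 3 → L2R} (hu : Irrotational u) (j k : Fin 3) :
    ∀ᵐ ξ : E3, (ξ k : ℂ) * (𝓕 (cplx (u j)) : L2C) ξ = (ξ j : ℂ) * (𝓕 (cplx (u k)) : L2C) ξ := by
  have key : ∀ᵐ ξ : E3, (ξ k : ℂ) * (𝓕 (cplx (u j)) : L2C) ξ - (ξ j : ℂ) * (𝓕 (cplx (u k)) : L2C) ξ = 0 := by
    refine ae_eq_of_integral_schwartz ((locallyIntegrable_coord _ k).sub (locallyIntegrable_coord _ j))
      fun ψ => ?_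
    have e : ∀ j k : Fin 3, ∫ x, cplx (u j) x * (∂_{ev k} (𝓕 ψ)) x = -(2 * Real.pi * Complex.I) *
        ∫ ξ, (𝓕 (cplx (u j)) : L2C) ξ * SchwartzMap.smulLeftCLM ℂ (fun ξ : E3 => inner ℝ ξ (ev k)) ψ ξ := by
      intro j k
      rw [SchwartzMap.lineDerivOp_fourier_eq, ← integral_fourier_mul, ← integral_const_mul]
      refine integral_congr_ae (.of_forall fun ξ => ?_)
      simp only [smul_apply, smul_eq_mul]; ring
    have h := curl_schwartz hu j k (𝓕 ψ)
    rw [e, e] at h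
    have h2 := mul_left_cancel₀ (by simp [Real.pi_ne_zero]) h
    have h3 : ∀ j k : Fin 3, ∫ ξ : E3, (ξ k : ℂ) * (𝓕 (cplx (u j)) : L2C) ξ * ψ ξ
        = ∫ ξ, (𝓕 (cplx (u j)) : L2C) ξ * SchwartzMap.smulLeftCLM ℂ (fun ξ : E3 => inner ℝ ξ (ev k)) ψ ξ := by
      intro j k
      refine integral_congr_ae (.of_forall fun ξ => ?_)
      dsimp only
      rw [SchwartzMap.smulLeftCLM_apply_apply (temperate_inner _), inner_ev, Complex.real_smul]
      ring
    have hi : ∀ j k : Fin 3, Integrable (fun ξ : E3 => (ξ k : ℂ) * (𝓕 (cplx (u j)) : L2C) ξ * ψ ξ) volume := by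
      intro j k
      refine (integrable_mul_schwartz (𝓕 (cplx (u j)))
        (SchwartzMap.smulLeftCLM ℂ (fun ξ : E3 => inner ℝ ξ (ev k)) ψ)).congr (.of_forall fun ξ => ?_)
      dsimp only
      rw [SchwartzMap.smulLeftCLM_apply_apply (temperate_inner _), inner_ev, Complex.real_smul]
      ring
    simp_rw [sub_mul]
    rw [integral_sub (hi j k) (hi k j), h3, h3, h2, sub_self]
  filter_upwards [key] with ξ h
  exact sub_eq_zero.1 h

/-- The image of `f` under the multiplier `μ`, when it is a real `L²` function. -/
def mult (μ : E3 → ℂ) (f : L2R) : L2R := by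
  classical exact if h : ∃ g : L2R, (𝓕 (cplx g) : L2C) =ᵐ[volume] fun ξ => μ ξ * (𝓕 (cplx f) : L2C) ξ
    then h.choose else 0

lemma mult_spec_of_exists {μ : E3 → ℂ} {f : L2R}
    (h : ∃ g : L2R, (𝓕 (cplx g) : L2C) =ᵐ[volume] fun ξ => μ ξ * (𝓕 (cplx f) : L2C) ξ) :
    (𝓕 (cplx (mult μ f)) : L2C) =ᵐ[volume] fun ξ => μ ξ * (𝓕 (cplx f) : L2C) ξ := by
  rw [mult, dif_pos h]; exact h.choose_spec

lemma mult_spec {μ : E3 → ℂ} {f : L2R} (hm : Measurable μ) (hμ : ∀ ξ, μ (-ξ) = (starRingEnd ℂ) (μ ξ))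
    (hf : ∫⁻ ξ, ‖μ ξ‖ₑ ^ 2 * ‖(𝓕 (cplx f) : L2C) ξ‖ₑ ^ 2 ≠ ∞) :
    (𝓕 (cplx (mult μ f)) : L2C) =ᵐ[volume] fun ξ => μ ξ * (𝓕 (cplx f) : L2C) ξ := by
  refine mult_spec_of_exists (exists_real_multiplier μ f hμ ⟨hm.aestronglyMeasurable.mul
    (Lp.aestronglyMeasurable _), ?_⟩)
  have := eLpNorm_two_sq (ν := volume) fun ξ => μ ξ * (𝓕 (cplx f) : L2C) ξ
  simp_rw [enorm_mul, mul_pow] at this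
  rw [← this] at hf
  exact lt_top_iff_ne_top.2 fun h => hf (by rw [h]; rfl)

lemma lintegral_sq_of_fourier {μ : E3 → ℂ} {f g : L2R}
    (h : (𝓕 (cplx g) : L2C) =ᵐ[volume] fun ξ => μ ξ * (𝓕 (cplx f) : L2C) ξ) :
    ENNReal.ofReal (‖g‖ ^ 2) = ∫⁻ ξ, ‖μ ξ‖ₑ ^ 2 * ‖(𝓕 (cplx f) : L2C) ξ‖ₑ ^ 2 := by
  rw [← lintegral_enorm_sq, ← lintegral_fourier_cplx]
  refine lintegral_congr_ae ?_
  filter_upwards [h] with ξ h1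
  rw [h1, enorm_mul, mul_pow]

end EulerRiesz
end

noncomputable section

namespace EulerRiesz

/-- `α` is built from `n` and a curl-free `u`; the curl condition is on the Fourier side. -/
structure Comp (σ : ℝ) (n : L2R) (u : Fin 3 → L2R) (α : L2C) : Prop where
  alpha : IsAlpha σ n u α
  curl : ∀ j k : Fin 3, ∀ᵐ ξ : E3,
    (ξ k : ℂ) * (𝓕 (cplx (u j)) : L2C) ξ = (ξ j : ℂ) * (𝓕 (cplx (u k)) : L2C) ξ

/-- The symbol `p(|∇|)/|∇|`. -/
def psymb (σ : ℝ) (ξ : E3) : ℝ := dispersion σ (freq ξ) / freq ξ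

lemma psymb_neg (σ : ℝ) (ξ : E3) : psymb σ (-ξ) = psymb σ ξ := by rw [psymb, freq_neg, psymb]

lemma psymb_nonneg (σ : ℝ) (ξ : E3) : 0 ≤ psymb σ ξ :=
  div_nonneg (Real.sqrt_nonneg _) (freq_nonneg ξ)

lemma psymb_sq (σ : ℝ) {ξ : E3} (h : ξ ≠ 0) : psymb σ ξ ^ 2 = 1 + freq ξ ^ (-σ) := by
  have hf := freq_pos h
  rw [psymb, dispersion, div_pow, Real.sq_sqrt (by positivity), sub_eq_add_neg, Real.rpow_add hf,
    Real.rpow_two]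
  field_simp

lemma msymb_nonneg (σ : ℝ) (ξ : E3) : 0 ≤ msymb σ ξ := Real.sqrt_nonneg _

lemma msymb_neg (σ : ℝ) (ξ : E3) : msymb σ (-ξ) = msymb σ ξ := by rw [msymb, freq_neg, msymb]

lemma msymb_le_one (σ : ℝ) (ξ : E3) : msymb σ ξ ≤ 1 :=
  Real.sqrt_le_one.2 (by simpa using Real.rpow_nonneg (freq_nonneg ξ) σ |>.trans (by linarith))

lemma measurable_msymb (σ : ℝ) : Measurable (msymb σ) :=
  Measurable.sqrt ((measurable_const.sub ((measurable_const.add (measurable_freq.pow_const σ)).inv)))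

lemma msymb_mul_psymb (σ : ℝ) {ξ : E3} (h : ξ ≠ 0) : msymb σ ξ * psymb σ ξ = 1 := by
  have hf := freq_pos h
  have h1 : (msymb σ ξ * psymb σ ξ) ^ 2 = 1 := by
    have : (0 : ℝ) < freq ξ ^ σ := by positivity
    rw [mul_pow, psymb_sq σ h, msymb, Real.sq_sqrt, Real.rpow_neg hf.le]
    · field_simp
      ring
    · rw [sub_nonneg]; exact inv_le_one_of_one_le₀ (by linarith)
  exact (pow_eq_one_iff_of_nonneg (mul_nonneg (msymb_nonneg _ _) (psymb_nonneg _ _)) two_ne_zero).1 h1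

/-- The symbol of `∑ (∂_j/|∇|) u_j`, without the factor `i`. -/
def bsum (u : Fin 3 → L2R) (ξ : E3) : ℂ := ∑ j, ((ξ j / ‖ξ‖ : ℝ) : ℂ) * (𝓕 (cplx (u j)) : L2C) ξ

lemma IsAlpha.eq {σ : ℝ} {n : L2R} {u : Fin 3 → L2R} {α : L2C} (h : IsAlpha σ n u α) :
    ∀ᵐ ξ, (𝓕 α : L2C) ξ = psymb σ ξ * (𝓕 (cplx n) : L2C) ξ - bsum u ξ := by
  filter_upwards [h] with ξ h1
  rw [h1, psymb, bsum]
  simp_rw [mul_assoc Complex.I, ← Finset.mul_sum, ← mul_assoc, Complex.I_mul_I]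
  ring

lemma bsum_neg (u : Fin 3 → L2R) : ∀ᵐ ξ, bsum u (-ξ) = -(starRingEnd ℂ) (bsum u ξ) := by
  filter_upwards [ae_all_iff.2 fun j => fourier_cplx_neg (u j)] with ξ h
  rw [bsum, bsum, map_sum, ← Finset.sum_neg_distrib]
  refine Finset.sum_congr rfl fun j _ => ?_
  rw [h, norm_neg, map_mul, Complex.conj_ofReal, PiLp.neg_apply]
  push_cast; ring

lemma Comp.u_hat {σ : ℝ} {n : L2R} {u : Fin 3 → L2R} {α : L2C} (h : Comp σ n u α) :
    ∀ᵐ ξ : E3, ∀ j, (𝓕 (cplx (u j)) : L2C) ξ = ((ξ j / ‖ξ‖ : ℝ) : ℂ) * bsum u ξ := by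
  filter_upwards [ae_all_iff.2 fun j => ae_all_iff.2 fun k => h.curl j k, ae_ne_zero] with ξ hc h0 j
  have hn : (‖ξ‖ : ℂ) ≠ 0 := by simpa using h0
  have e : ∑ k : Fin 3, (ξ k : ℂ) ^ 2 = (‖ξ‖ : ℂ) ^ 2 := by
    rw [← Complex.ofReal_pow, EuclideanSpace.real_norm_sq_eq]; push_cast; rfl
  have : ((ξ j / ‖ξ‖ : ℝ) : ℂ) * bsum u ξ
      = (∑ k : Fin 3, (ξ k : ℂ) ^ 2) / (‖ξ‖ : ℂ) ^ 2 * (𝓕 (cplx (u j)) : L2C) ξ := by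
    rw [bsum, Finset.mul_sum, Finset.sum_div, Finset.sum_mul]
    refine Finset.sum_congr rfl fun k _ => ?_
    have := hc j k
    push_cast
    field_simp
    linear_combination -(ξ k : ℂ) * this
  rw [this, e, div_self (pow_ne_zero 2 hn), one_mul]

lemma enorm_sq_eq {F : Type*} [NormedAddCommGroup F] (z : F) : ‖z‖ₑ ^ 2 = ENNReal.ofReal (‖z‖ ^ 2) := by
  rw [← ofReal_norm, ENNReal.ofReal_pow (norm_nonneg _)]

lemma Comp.sum_u_sq {σ : ℝ} {n : L2R} {u : Fin 3 → L2R} {α : L2C} (h : Comp σ n u α) :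
    ∀ᵐ ξ : E3, ∑ j, ‖(𝓕 (cplx (u j)) : L2C) ξ‖ ^ 2 = ‖bsum u ξ‖ ^ 2 := by
  filter_upwards [h.u_hat, ae_ne_zero] with ξ h1 h0
  have hn : ‖ξ‖ ≠ 0 := by simpa using h0
  simp_rw [h1, norm_mul, mul_pow, ← Finset.sum_mul, Complex.norm_real, Real.norm_eq_abs, sq_abs, div_pow,
    ← Finset.sum_div, ← EuclideanSpace.real_norm_sq_eq]
  rw [div_self (pow_ne_zero 2 hn), one_mul]

lemma two_mul_ofReal (x : ℝ) : 2 * ENNReal.ofReal x = ENNReal.ofReal (2 * x) := by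
  rw [ENNReal.ofReal_mul zero_le_two]; simp

lemma Comp.norm_alpha_sq {σ : ℝ} {n : L2R} {u : Fin 3 → L2R} {α : L2C} (h : Comp σ n u α) :
    ∀ᵐ ξ : E3, ‖(𝓕 α : L2C) ξ‖ₑ ^ 2 + ‖(𝓕 α : L2C) (-ξ)‖ₑ ^ 2
      = 2 * (ENNReal.ofReal (1 + freq ξ ^ (-σ)) * ‖(𝓕 (cplx n) : L2C) ξ‖ₑ ^ 2
        + ∑ j, ‖(𝓕 (cplx (u j)) : L2C) ξ‖ₑ ^ 2) := by
  filter_upwards [h.alpha.eq, ae_neg h.alpha.eq, h.sum_u_sq, bsum_neg u, fourier_cplx_neg n, ae_ne_zero]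
    with ξ h1 h2 h3 h4 h5 h0
  have hf : 0 ≤ freq ξ ^ (-σ) := Real.rpow_nonneg (freq_nonneg ξ) _
  have e : ∑ j, ‖(𝓕 (cplx (u j)) : L2C) ξ‖ₑ ^ 2 = ENNReal.ofReal (‖bsum u ξ‖ ^ 2) := by
    rw [← h3, ENNReal.ofReal_sum_of_nonneg fun _ _ => by positivity]
    simp_rw [enorm_sq_eq]
  rw [e, enorm_sq_eq, enorm_sq_eq, enorm_sq_eq, ← ENNReal.ofReal_mul (by positivity),
    ← ENNReal.ofReal_add (by positivity) (by positivity), ← ENNReal.ofReal_add (by positivity) (by positivity),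
    two_mul_ofReal]
  congr 1
  rw [h2, h4, h5, psymb_neg, h1, ← psymb_sq σ h0]
  have e2 : (psymb σ ξ : ℂ) * (starRingEnd ℂ) ((𝓕 (cplx n) : L2C) ξ) - -(starRingEnd ℂ) (bsum u ξ)
      = (starRingEnd ℂ) ((psymb σ ξ : ℂ) * (𝓕 (cplx n) : L2C) ξ + bsum u ξ) := by
    rw [map_add, map_mul, Complex.conj_ofReal]; ring
  rw [e2, RCLike.norm_conj]
  have := parallelogram_law_with_norm ℝ ((psymb σ ξ : ℂ) * (𝓕 (cplx n) : L2C) ξ) (bsum u ξ)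
  have hp : ‖(psymb σ ξ : ℂ) * (𝓕 (cplx n) : L2C) ξ‖ ^ 2 = psymb σ ξ ^ 2 * ‖(𝓕 (cplx n) : L2C) ξ‖ ^ 2 := by
    rw [norm_mul, mul_pow, Complex.norm_real, Real.norm_of_nonneg (psymb_nonneg _ _)]
  rw [← hp]
  linarith

lemma Comp.lintegral_eq {σ : ℝ} {n : L2R} {u : Fin 3 → L2R} {α : L2C} (h : Comp σ n u α)
    {W : E3 → ℝ≥0∞} (hW : Measurable W) (hWn : ∀ ξ, W (-ξ) = W ξ) :
    ∫⁻ ξ, W ξ * ‖(𝓕 α : L2C) ξ‖ₑ ^ 2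
      = ∫⁻ ξ, W ξ * (ENNReal.ofReal (1 + freq ξ ^ (-σ)) * ‖(𝓕 (cplx n) : L2C) ξ‖ₑ ^ 2
        + ∑ j, ‖(𝓕 (cplx (u j)) : L2C) ξ‖ₑ ^ 2) := by
  have hm : AEMeasurable (fun ξ => W ξ * ‖(𝓕 α : L2C) ξ‖ₑ ^ 2) volume :=
    hW.aemeasurable.mul ((Lp.aestronglyMeasurable (𝓕 α : L2C)).enorm.pow_const 2)
  have e : ∫⁻ ξ, W (-ξ) * ‖(𝓕 α : L2C) (-ξ)‖ₑ ^ 2 = ∫⁻ ξ, W ξ * ‖(𝓕 α : L2C) ξ‖ₑ ^ 2 :=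
    (Measure.measurePreserving_neg (volume : Measure E3)).lintegral_comp_emb
      (MeasurableEquiv.neg E3).measurableEmbedding (fun ξ => W ξ * ‖(𝓕 α : L2C) ξ‖ₑ ^ 2)
  have h2 : 2 * ∫⁻ ξ, W ξ * ‖(𝓕 α : L2C) ξ‖ₑ ^ 2
      = 2 * ∫⁻ ξ, W ξ * (ENNReal.ofReal (1 + freq ξ ^ (-σ)) * ‖(𝓕 (cplx n) : L2C) ξ‖ₑ ^ 2
        + ∑ j, ‖(𝓕 (cplx (u j)) : L2C) ξ‖ₑ ^ 2) := by
    rw [two_mul]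
    nth_rewrite 2 [← e]
    rw [← lintegral_add_left' hm, ← lintegral_const_mul' _ _ (by simp)]
    refine lintegral_congr_ae ?_
    filter_upwards [h.norm_alpha_sq] with ξ h1
    rw [hWn, ← mul_add, h1]; ring
  exact (ENNReal.mul_right_inj (by simp) (by simp)).1 h2

lemma hNorm_sq (a : ℝ) (f : L2C) :
    hNorm a f ^ 2 = ∫⁻ ξ, ENNReal.ofReal ((1 + freq ξ ^ 2) ^ a) * ‖(𝓕 f : L2C) ξ‖ₑ ^ 2 := by
  rw [hNorm, ← ENNReal.rpow_natCast, ← ENNReal.rpow_mul]; norm_num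

lemma measurable_japanese (a : ℝ) : Measurable fun ξ : E3 => ENNReal.ofReal ((1 + freq ξ ^ 2) ^ a) :=
  ((measurable_const.add (measurable_freq.pow_const 2)).pow_const a).ennreal_ofReal

lemma Comp.hNorm_sq_eq {σ : ℝ} {n : L2R} {u : Fin 3 → L2R} {α : L2C} (h : Comp σ n u α) (a : ℝ) :
    hNorm a α ^ 2 = ∫⁻ ξ, ENNReal.ofReal ((1 + freq ξ ^ 2) ^ a) *
      (ENNReal.ofReal (1 + freq ξ ^ (-σ)) * ‖(𝓕 (cplx n) : L2C) ξ‖ₑ ^ 2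
        + ∑ j, ‖(𝓕 (cplx (u j)) : L2C) ξ‖ₑ ^ 2) := by
  rw [hNorm_sq, h.lintegral_eq (measurable_japanese a) fun ξ => by rw [freq_neg]]

lemma Comp.lintegral_n_le {σ : ℝ} {n : L2R} {u : Fin 3 → L2R} {α : L2C} (h : Comp σ n u α) (a : ℝ)
    {μ : E3 → ℂ} {c : ℝ} (hc : 0 ≤ c)
    (hμ : ∀ ξ, ξ ≠ 0 → ‖μ ξ‖ ^ 2 ≤ c * ((1 + freq ξ ^ 2) ^ a * (1 + freq ξ ^ (-σ)))) :
    ∫⁻ ξ, ‖μ ξ‖ₑ ^ 2 * ‖(𝓕 (cplx n) : L2C) ξ‖ₑ ^ 2 ≤ ENNReal.ofReal c * hNorm a α ^ 2 := by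
  rw [h.hNorm_sq_eq, ← lintegral_const_mul' _ _ ENNReal.ofReal_ne_top]
  refine lintegral_mono_ae ?_
  filter_upwards [ae_ne_zero] with ξ h0
  have h1 : 0 ≤ (1 + freq ξ ^ 2) ^ a := by positivity
  calc ‖μ ξ‖ₑ ^ 2 * ‖(𝓕 (cplx n) : L2C) ξ‖ₑ ^ 2
      ≤ ENNReal.ofReal (c * ((1 + freq ξ ^ 2) ^ a * (1 + freq ξ ^ (-σ)))) * ‖(𝓕 (cplx n) : L2C) ξ‖ₑ ^ 2 := by
        rw [enorm_sq_eq (μ ξ)]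
        gcongr
        exact hμ ξ h0
    _ = ENNReal.ofReal c * (ENNReal.ofReal ((1 + freq ξ ^ 2) ^ a) *
        (ENNReal.ofReal (1 + freq ξ ^ (-σ)) * ‖(𝓕 (cplx n) : L2C) ξ‖ₑ ^ 2)) := by
        rw [ENNReal.ofReal_mul hc, ENNReal.ofReal_mul h1]; ring
    _ ≤ _ := by gcongr; exact le_self_add

lemma Comp.lintegral_u_le {σ : ℝ} {n : L2R} {u : Fin 3 → L2R} {α : L2C} (h : Comp σ n u α) (a : ℝ) (j : Fin 3)
    {μ : E3 → ℂ} {c : ℝ} (hc : 0 ≤ c)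
    (hμ : ∀ ξ, ξ ≠ 0 → ‖μ ξ‖ ^ 2 ≤ c * (1 + freq ξ ^ 2) ^ a) :
    ∫⁻ ξ, ‖μ ξ‖ₑ ^ 2 * ‖(𝓕 (cplx (u j)) : L2C) ξ‖ₑ ^ 2 ≤ ENNReal.ofReal c * hNorm a α ^ 2 := by
  rw [h.hNorm_sq_eq, ← lintegral_const_mul' _ _ ENNReal.ofReal_ne_top]
  refine lintegral_mono_ae ?_
  filter_upwards [ae_ne_zero] with ξ h0
  have h1 : 0 ≤ (1 + freq ξ ^ 2) ^ a := by positivity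
  calc ‖μ ξ‖ₑ ^ 2 * ‖(𝓕 (cplx (u j)) : L2C) ξ‖ₑ ^ 2
      ≤ ENNReal.ofReal (c * (1 + freq ξ ^ 2) ^ a) * ‖(𝓕 (cplx (u j)) : L2C) ξ‖ₑ ^ 2 := by
        rw [enorm_sq_eq (μ ξ)]
        gcongr
        exact hμ ξ h0
    _ = ENNReal.ofReal c * (ENNReal.ofReal ((1 + freq ξ ^ 2) ^ a) * ‖(𝓕 (cplx (u j)) : L2C) ξ‖ₑ ^ 2) := by
        rw [ENNReal.ofReal_mul hc]; ring
    _ ≤ _ := by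
        gcongr
        exact le_add_left (Finset.single_le_sum (f := fun j => ‖(𝓕 (cplx (u j)) : L2C) ξ‖ₑ ^ 2)
          (fun _ _ => zero_le) (Finset.mem_univ j))

lemma Comp.sub {σ : ℝ} {n n' : L2R} {u u' : Fin 3 → L2R} {α α' : L2C} (h : Comp σ n u α)
    (h' : Comp σ n' u' α') : Comp σ (n - n') (u - u') (α - α') where
  alpha := by
    have e : ∀ᵐ ξ, ∀ j, (𝓕 (cplx ((u - u') j)) : L2C) ξ
        = (𝓕 (cplx (u j)) : L2C) ξ - (𝓕 (cplx (u' j)) : L2C) ξ :=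
      ae_all_iff.2 fun j => fourier_cplx_sub (u j) (u' j)
    unfold IsAlpha
    rw [fourier_sub']
    filter_upwards [h.alpha, h'.alpha, e, fourier_cplx_sub n n', Lp.coeFn_sub (𝓕 α : L2C) (𝓕 α')]
      with ξ h1 h2 h3 h4 h5
    rw [h5, Pi.sub_apply, h1, h2, h4]
    simp_rw [h3, mul_sub, Finset.sum_sub_distrib]
    ring
  curl j k := by
    filter_upwards [h.curl j k, h'.curl j k, fourier_cplx_sub (u j) (u' j), fourier_cplx_sub (u k) (u' k)]
      with ξ h1 h2 h3 h4
    rw [Pi.sub_apply, Pi.sub_apply, h3, h4, mul_sub, mul_sub, h1, h2]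

lemma ae_norm_le_of_herm {f : L2R} {z : L2C} {c : ℝ} (hz : ∀ᵐ x, ‖z x‖ ≤ c)
    (h : ∀ᵐ ξ, (𝓕 z : L2C) ξ + (starRingEnd ℂ) ((𝓕 z : L2C) (-ξ)) = 2 * (𝓕 (cplx f) : L2C) ξ) :
    ∀ᵐ x, ‖f x‖ ≤ c := by
  have e : z + star z = (2 : ℂ) • cplx f := by
    refine fourier_injective ?_
    have e1 : (𝓕 (z + star z) : L2C) = 𝓕 z + 𝓕 (star z) := (Lp.fourierTransformₗᵢ E3 ℂ).map_add _ _
    have e2 : (𝓕 ((2 : ℂ) • cplx f) : L2C) = (2 : ℂ) • 𝓕 (cplx f) := (Lp.fourierTransformₗᵢ E3 ℂ).map_smul _ _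
    rw [e1, e2]
    filter_upwards [h, ae_neg (fourier_star z), Lp.coeFn_add (𝓕 z : L2C) (𝓕 (star z)),
      Lp.coeFn_smul (2 : ℂ) (𝓕 (cplx f) : L2C)] with ξ h1 h2 h3 h4
    rw [h3, h4, Pi.add_apply, Pi.smul_apply, smul_eq_mul, ← h1, ← h2, neg_neg]
  filter_upwards [hz, Lp.coeFn_add z (star z), Lp.coeFn_star z, Lp.coeFn_smul (2 : ℂ) (cplx f), coe_cplx f]
    with x h1 h2 h3 h4 h5
  rw [e, h4, Pi.smul_apply, h5, Pi.add_apply, h3, Pi.star_apply] at h2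
  have h6 : ‖(2 : ℂ) • (f x : ℂ)‖ ≤ ‖z x‖ + ‖star (z x)‖ := by rw [h2]; exact norm_add_le _ _
  rw [norm_smul, norm_star, Complex.norm_real] at h6
  norm_num at h6
  rw [Real.norm_eq_abs]
  linarith

end EulerRiesz
end

noncomputable section

namespace EulerRiesz

lemma Comp.n_sup {σ : ℝ} (h0 : 0 < σ) (h2 : σ < 2) {n : L2R} {u : Fin 3 → L2R} {α : L2C}
    (hα : Comp σ n u α) {μ : E3 → ℂ} (hμ : ∀ ξ, μ (-ξ) = (starRingEnd ℂ) (μ ξ)) {f : L2R} {h : L2C}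
    (hf : (𝓕 (cplx f) : L2C) =ᵐ[volume] fun ξ => μ ξ * (𝓕 (cplx n) : L2C) ξ)
    (hh : ∀ᵐ ξ, (𝓕 h : L2C) ξ = μ ξ * (𝓕 α : L2C) ξ) {c : ℝ} (hc : 0 ≤ c) (hb : ∀ᵐ x, ‖h x‖ ≤ c) :
    ∀ᵐ x, ‖f x‖ ≤ 2 * c := by
  obtain ⟨z, hz⟩ := exists_fourier_eq (μ := fun ξ => (msymb σ ξ : ℂ)) (f := h)
    (memLp_bdd_mul (c := 1) (Complex.measurable_ofReal.comp (measurable_msymb σ)).aestronglyMeasurable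
      (fun ξ => by
        rw [Function.comp_apply, Complex.norm_real, Real.norm_of_nonneg (msymb_nonneg _ _)]
        exact msymb_le_one σ ξ) _)
  refine ae_norm_le_of_herm (ae_norm_le_of_msymb h0 h2 hc hz hb) ?_
  filter_upwards [hz, ae_neg hz, hh, ae_neg hh, hα.alpha.eq, ae_neg hα.alpha.eq, hf, bsum_neg u,
    fourier_cplx_neg n, ae_ne_zero] with ξ h1 h2 h3 h4 h5 h6 h7 h8 h9 hξ
  have hmp : (msymb σ ξ : ℂ) * psymb σ ξ = 1 := by exact_mod_cast msymb_mul_psymb σ hξ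
  rw [h1, h2, h3, h4, h5, h6, h7, h8, h9, msymb_neg, psymb_neg, hμ]
  simp only [map_mul, map_sub, map_neg, Complex.conj_conj, Complex.conj_ofReal]
  linear_combination (2 * μ ξ * (𝓕 (cplx n) : L2C) ξ) * hmp

lemma Comp.u_sup {σ : ℝ} {n : L2R} {u : Fin 3 → L2R} {α : L2C}
    (hα : Comp σ n u α) {μ : E3 → ℂ} (hμ : ∀ ξ, μ (-ξ) = (starRingEnd ℂ) (μ ξ)) {f : L2R} {h : L2C} {j : Fin 3}
    (hf : (𝓕 (cplx f) : L2C) =ᵐ[volume] fun ξ => μ ξ * (𝓕 (cplx (u j)) : L2C) ξ)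
    (hh : ∀ᵐ ξ : E3, (𝓕 h : L2C) ξ = -(ξ j : ℂ) * μ ξ * ((‖ξ‖⁻¹ : ℝ) : ℂ) * (𝓕 α : L2C) ξ)
    {c : ℝ} (hb : ∀ᵐ x, ‖h x‖ ≤ c) :
    ∀ᵐ x, ‖f x‖ ≤ c := by
  refine ae_norm_le_of_herm hb ?_
  filter_upwards [hh, ae_neg hh, hα.alpha.eq, ae_neg hα.alpha.eq, hf, bsum_neg u,
    fourier_cplx_neg n, hα.u_hat] with ξ h3 h4 h5 h6 h7 h8 h9 h10
  rw [h3, h4, h5, h6, h7, h8, h9, psymb_neg, hμ, h10, norm_neg, PiLp.neg_apply]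
  simp only [map_mul, map_sub, map_neg, Complex.conj_conj, Complex.conj_ofReal]
  push_cast
  rw [div_eq_mul_inv]
  ring

lemma exists_fourier_of_hNorm {a : ℝ} {f : L2C} {μ : E3 → ℂ} (hm : Measurable μ)
    (hμ : ∀ ξ, ‖μ ξ‖ ^ 2 ≤ (1 + freq ξ ^ 2) ^ a) (hf : hNorm a f ≠ ∞) :
    ∃ g : L2C, (𝓕 g : L2C) =ᵐ[volume] fun ξ => μ ξ * (𝓕 f : L2C) ξ := by
  refine exists_fourier_eq ⟨hm.aestronglyMeasurable.mul (Lp.aestronglyMeasurable _), ?_⟩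
  have h1 := eLpNorm_two_sq (ν := volume) fun ξ => μ ξ * (𝓕 f : L2C) ξ
  have h2 : ∫⁻ ξ, ‖μ ξ * (𝓕 f : L2C) ξ‖ₑ ^ 2 ≤ hNorm a f ^ 2 := by
    rw [hNorm_sq]
    refine lintegral_mono fun ξ => ?_
    rw [enorm_mul, mul_pow, enorm_sq_eq (μ ξ)]
    gcongr
    exact hμ ξ
  rw [← h1] at h2
  refine lt_top_iff_ne_top.2 fun h => ?_
  rw [h] at h2
  exact (ENNReal.pow_ne_top hf) (top_le_iff.1 h2)

lemma one_le_japanese {a : ℝ} (ha : 0 ≤ a) (ξ : E3) : 1 ≤ (1 + freq ξ ^ 2) ^ a :=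
  Real.one_le_rpow (by nlinarith [sq_nonneg (freq ξ)]) ha

lemma freq_rpow_le_japanese {a b : ℝ} (hb : 0 ≤ b) (hba : b ≤ 2 * a) (ξ : E3) :
    freq ξ ^ b ≤ (1 + freq ξ ^ 2) ^ a := by
  have h1 : (1 : ℝ) ≤ 1 + freq ξ ^ 2 := by nlinarith [sq_nonneg (freq ξ)]
  calc freq ξ ^ b = (freq ξ ^ 2) ^ (b / 2) := by
        rw [← Real.rpow_two, ← Real.rpow_mul (freq_nonneg ξ)]; congr 1; ring
    _ ≤ (1 + freq ξ ^ 2) ^ (b / 2) := by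
        gcongr
        linarith
    _ ≤ _ := Real.rpow_le_rpow_of_exponent_le h1 (by linarith)

lemma freq_pow_le_japanese {a : ℝ} (k : ℕ) (hba : k ≤ 2 * a) (ξ : E3) :
    freq ξ ^ k ≤ (1 + freq ξ ^ 2) ^ a := by
  rw [← Real.rpow_natCast]; exact freq_rpow_le_japanese (by positivity) hba ξ

lemma norm_ev (k : Fin 3) : ‖ev k‖ = 1 := by simp [ev]

lemma norm_dsymb_ev_le (k : Fin 3) (ξ : E3) : ‖dsymb (ev k) ξ‖ ≤ freq ξ := by
  simpa [norm_ev] using norm_dsymb_le (ev k) ξ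

lemma abs_coord_le (ξ : E3) (j : Fin 3) : |ξ j| ≤ ‖ξ‖ := PiLp.norm_apply_le ξ j

lemma norm_riesz_le (ξ : E3) (j : Fin 3) : ‖-(ξ j : ℂ) * ((‖ξ‖⁻¹ : ℝ) : ℂ)‖ ≤ 1 := by
  rw [norm_mul, norm_neg, Complex.norm_real, Complex.norm_real, Real.norm_eq_abs, norm_inv, norm_norm]
  exact mul_inv_le_one_of_le₀ (abs_coord_le ξ j) (norm_nonneg _)

lemma temperate_dsymb (v : E3) : (dsymb v).HasTemperateGrowth := by
  unfold dsymb; fun_prop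

lemma temperate_coord (j : Fin 3) : (fun ξ : E3 => -(ξ j : ℂ)).HasTemperateGrowth := by
  have : (fun ξ : E3 => ((inner ℝ ξ (ev j) : ℝ) : ℂ)).HasTemperateGrowth := by fun_prop
  simp only [inner_ev] at this
  exact this.neg

lemma exists_sup_bounds {σ p s : ℝ} (h0 : 0 < σ) (h2 : σ < 2) (hp : 1 < p) (hs : 1 + 3 / p < s) :
    ∃ C : ℝ≥0, ∀ (n : L2R) (u : Fin 3 → L2R) (α : L2C), Comp σ n u α →
      wNorm s (ENNReal.ofReal p) α ≠ ∞ → hNorm (2 * s) α ≠ ∞ →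
      (∀ᵐ x, ‖n x‖ ≤ C * (wNorm s (ENNReal.ofReal p) α).toReal) ∧
      (∀ k g, FD (ev k) n g → ∀ᵐ x, ‖g x‖ ≤ C * (wNorm s (ENNReal.ofReal p) α).toReal) ∧
      (∀ j, ∀ᵐ x, ‖u j x‖ ≤ C * (wNorm s (ENNReal.ofReal p) α).toReal) ∧
      (∀ j k g, FD (ev k) (u j) g → ∀ᵐ x, ‖g x‖ ≤ C * (wNorm s (ENNReal.ofReal p) α).toReal) := by
  have hp0 : 0 < 3 / p := by positivity
  have hs0 : 0 < s := by linarith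
  have hpp : 3 / (2 * p) = 3 / p / 2 := by field_simp
  obtain ⟨C0, hC0⟩ := exists_sup_bound hs0 hp (P := fun _ => 1) (by fun_prop) (l := 0) (by simp)
    (by rw [hpp]; norm_num; linarith)
  choose C1 hC1 using fun k : Fin 3 => exists_sup_bound hs0 hp (temperate_dsymb (ev k)) (l := 1)
    (fun c ξ => by simp only [dsymb, inner_smul_right]; push_cast; ring) (by rw [hpp]; norm_num; linarith)
  choose C2 hC2 using fun j : Fin 3 => exists_sup_bound_div hs0 hp (a := 0) (temperate_coord j) (l := 1)
    (fun c ξ => by simp) le_rfl le_rfl (by norm_num) (by rw [hpp]; norm_num; linarith)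
  choose C3 hC3 using fun q : Fin 3 × Fin 3 => exists_sup_bound_div hs0 hp
    (a := max 0 ((1 + 3 / p / 2 - s / 2 + 1 / 2) / 2))
    (P := fun ξ => -(ξ q.1 : ℂ) * dsymb (ev q.2) ξ) ((temperate_coord q.1).mul (temperate_dsymb (ev q.2)))
    (l := 2) (fun c ξ => by simp only [dsymb, inner_smul_right, PiLp.smul_apply, smul_eq_mul]; push_cast; ring)
    (by norm_num) (le_max_left _ _) (max_lt (by norm_num) (by linarith))
    (by
      rw [hpp]
      have := le_max_right 0 ((1 + 3 / p / 2 - s / 2 + 1 / 2) / 2)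
      push_cast
      linarith)
  obtain ⟨C, hC⟩ : ∃ C : ℝ≥0, C = 2 * C0 + 2 * ∑ k, C1 k + ∑ j, C2 j + ∑ q, C3 q := ⟨_, rfl⟩
  have e0 : 2 * C0 ≤ C := by rw [hC, add_assoc, add_assoc]; exact le_self_add
  have e1 : ∀ k, 2 * C1 k ≤ C := fun k => by
    have := Finset.single_le_sum (f := C1) (fun _ _ => zero_le) (Finset.mem_univ k)
    calc 2 * C1 k ≤ 2 * ∑ k, C1 k := by gcongr
      _ ≤ C := by rw [hC, add_assoc, add_assoc]; exact le_add_left le_self_add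
  have e2 : ∀ k, C2 k ≤ C := fun k => by
    calc C2 k ≤ ∑ k, C2 k := Finset.single_le_sum (f := C2) (fun _ _ => zero_le) (Finset.mem_univ k)
      _ ≤ C := by rw [hC, add_assoc]; exact le_add_left le_self_add
  have e3 : ∀ k, C3 k ≤ C := fun k => by
    calc C3 k ≤ ∑ k, C3 k := Finset.single_le_sum (f := C3) (fun _ _ => zero_le) (Finset.mem_univ k)
      _ ≤ C := by rw [hC]; exact le_add_self
  refine ⟨C, fun n u α hα hw hN => ?_⟩
  obtain ⟨w, hwdef⟩ : ∃ w, w = (wNorm s (ENNReal.ofReal p) α).toReal := ⟨_, rfl⟩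
  have hw0 : 0 ≤ w := hwdef ▸ ENNReal.toReal_nonneg
  have up : ∀ {c : ℝ≥0} {f : L2R}, c ≤ C → (∀ᵐ x, ‖f x‖ ≤ c * w) → ∀ᵐ x, ‖f x‖ ≤ C * w := by
    intro c f hc hf
    filter_upwards [hf] with x hx
    have : (c : ℝ) ≤ C := by exact_mod_cast hc
    exact hx.trans (by gcongr)
  rw [← hwdef]
  have hD : ∀ k ξ, ‖dsymb (ev k) ξ‖ ^ 2 ≤ (1 + freq ξ ^ 2) ^ (2 * s) := fun k ξ =>
    (pow_le_pow_left₀ (norm_nonneg _) (norm_dsymb_ev_le k ξ) 2).trans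
      (freq_pow_le_japanese 2 (by push_cast; linarith) ξ)
  refine ⟨?_, fun k g hg => ?_, fun j => ?_, fun j k g hg => ?_⟩
  · refine up e0 ?_
    have := hα.n_sup h0 h2 (μ := fun _ => 1) (by simp) (f := n) (h := α) (by simp) (by simp)
      (c := C0 * w) (by positivity) (hwdef ▸ hC0 α α hw (by simp))
    filter_upwards [this] with x hx
    push_cast; linarith
  · refine up (e1 k) ?_
    obtain ⟨h, hh⟩ := exists_fourier_of_hNorm (measurable_dsymb (ev k)) (hD k) hN
    have := hα.n_sup h0 h2 (dsymb_neg (ev k)) hg hh (c := C1 k * w) (by positivity) (hwdef ▸ hC1 k α h hw hh)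
    filter_upwards [this] with x hx
    push_cast; linarith
  · refine up (e2 j) ?_
    obtain ⟨h, hh⟩ := exists_fourier_of_hNorm (f := α) (a := 2 * s)
      (μ := fun ξ => -(ξ j : ℂ) * ((‖ξ‖⁻¹ : ℝ) : ℂ)) (by fun_prop)
      (fun ξ => (pow_le_one₀ (norm_nonneg _) (norm_riesz_le ξ j)).trans (one_le_japanese (by linarith) ξ)) hN
    exact hα.u_sup (μ := fun _ => 1) (by simp) (j := j) (f := u j) (by simp) (h := h)
      (by filter_upwards [hh] with ξ h1; rw [h1]; ring) (hwdef ▸ hC2 j α h hw hh)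
  · refine up (e3 (j, k)) ?_
    obtain ⟨h, hh⟩ := exists_fourier_of_hNorm (f := α) (a := 2 * s)
      (μ := fun ξ => -(ξ j : ℂ) * dsymb (ev k) ξ * ((‖ξ‖⁻¹ : ℝ) : ℂ))
      ((by fun_prop : Measurable fun ξ : E3 => -(ξ j : ℂ)).mul (measurable_dsymb _) |>.mul (by fun_prop))
      (fun ξ => by
        rw [mul_right_comm, norm_mul, mul_pow]
        calc _ ≤ 1 * ‖dsymb (ev k) ξ‖ ^ 2 := by
              gcongr; exact pow_le_one₀ (norm_nonneg _) (norm_riesz_le ξ j)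
          _ ≤ _ := by rw [one_mul]; exact hD k ξ) hN
    exact hα.u_sup (dsymb_neg (ev k)) (j := j) hg hh (hwdef ▸ hC3 (j, k) α h hw hh)

lemma hNorm_le_of_sq {a : ℝ} {f g : L2C} (h : hNorm a f ^ 2 ≤ hNorm a g ^ 2) : hNorm a f ≤ hNorm a g :=
  (ENNReal.pow_le_pow_left_iff two_ne_zero).1 h

lemma Comp.hNorm_n_le {σ : ℝ} {n : L2R} {u : Fin 3 → L2R} {α : L2C} (h : Comp σ n u α) (a : ℝ) :
    hNorm a (cplx n) ≤ hNorm a α := by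
  refine hNorm_le_of_sq ?_
  rw [h.hNorm_sq_eq, hNorm_sq]
  gcongr with ξ
  refine le_add_right (le_mul_of_one_le_left' ?_)
  rw [← ENNReal.ofReal_one]
  exact ENNReal.ofReal_le_ofReal (by linarith [Real.rpow_nonneg (freq_nonneg ξ) (-σ)])

lemma Comp.hNorm_u_le {σ : ℝ} {n : L2R} {u : Fin 3 → L2R} {α : L2C} (h : Comp σ n u α) (a : ℝ) (j : Fin 3) :
    hNorm a (cplx (u j)) ≤ hNorm a α := by
  refine hNorm_le_of_sq ?_
  rw [h.hNorm_sq_eq, hNorm_sq]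
  gcongr with ξ
  exact le_add_left (Finset.single_le_sum (f := fun j => ‖(𝓕 (cplx (u j)) : L2C) ξ‖ₑ ^ 2)
          (fun _ _ => zero_le) (Finset.mem_univ j))

lemma nice_of_hNorm {a : ℝ} (ha : 3 / 2 < a) {f : L2R} (hf : hNorm a (cplx f) ≠ ∞) : Nice f := by
  refine nice_of_fourier (ne_top_of_le_ne_top ?_ (lintegral_fourier_le_hNorm (a := a) (cplx f)))
  exact ENNReal.mul_ne_top (ENNReal.rpow_ne_top_of_nonneg (by norm_num) (lintegral_japanese ha).ne) hf

end EulerRiesz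
end

noncomputable section

namespace EulerRiesz

lemma mulL_add {f : L2R} (hf : Bdd f) (g g' : L2R) : mulL f (g + g') = mulL f g + mulL f g' := by
  refine Lp.ext ?_
  filter_upwards [hf.coe_mulL (g + g'), hf.coe_mulL g, hf.coe_mulL g', Lp.coeFn_add g g',
    Lp.coeFn_add (mulL f g) (mulL f g')] with x h1 h2 h3 h4 h5
  rw [h1, h4, h5, Pi.add_apply, Pi.add_apply, h2, h3]; ring

lemma mulL_smul {f : L2R} (hf : Bdd f) (c : ℝ) (g : L2R) : mulL f (c • g) = c • mulL f g := by
  refine Lp.ext ?_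
  filter_upwards [hf.coe_mulL (c • g), hf.coe_mulL g, Lp.coeFn_smul c g,
    Lp.coeFn_smul c (mulL f g)] with x h1 h2 h4 h5
  rw [h1, h4, h5, Pi.smul_apply, Pi.smul_apply, h2, smul_eq_mul, smul_eq_mul]; ring

/-- Multiplication by a bounded function as a linear map. -/
def mulLin {f : L2R} (hf : Bdd f) : L2R →ₗ[ℝ] L2R where
  toFun := mulL f
  map_add' := mulL_add hf
  map_smul' c g := mulL_smul hf c g

lemma mulL_sub {f : L2R} (hf : Bdd f) (g g' : L2R) : mulL f (g - g') = mulL f g - mulL f g' :=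
  (mulLin hf).map_sub g g'

lemma mulL_neg {f : L2R} (hf : Bdd f) (g : L2R) : mulL f (-g) = -mulL f g := (mulLin hf).map_neg g

lemma mulL_sum {f : L2R} (hf : Bdd f) {ι : Type*} (t : Finset ι) (g : ι → L2R) :
    mulL f (∑ i ∈ t, g i) = ∑ i ∈ t, mulL f (g i) := map_sum (mulLin hf) g t

lemma norm_mulL_le {f : L2R} {A : ℝ} (hf : ∀ᵐ x, ‖f x‖ ≤ A) (g : L2R) : ‖mulL f g‖ ≤ A * ‖g‖ := by
  refine norm_le_of_ae_le ?_
  filter_upwards [hf, Bdd.coe_mulL ⟨A, hf⟩ g] with x h1 h2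
  rw [h2, norm_mul]; gcongr

lemma inner_mulL {f : L2R} (hf : Bdd f) (g h : L2R) : inner ℝ (mulL f g) h = inner ℝ g (mulL f h) := by
  rw [inner_L2R, inner_L2R]
  refine integral_congr_ae ?_
  filter_upwards [hf.coe_mulL g, hf.coe_mulL h] with x h1 h2
  rw [h1, h2]; ring

lemma abs_inner_mulL_le {f : L2R} {A : ℝ} (hf : ∀ᵐ x, ‖f x‖ ≤ A) (g h : L2R) :
    |inner ℝ (mulL f g) h| ≤ A * (‖g‖ * ‖h‖) :=
  (abs_real_inner_le_norm _ _).trans (by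
    rw [← mul_assoc]; exact mul_le_mul_of_nonneg_right (norm_mulL_le hf g) (norm_nonneg h))

lemma mulL_mulL {f g : L2R} (hf : Bdd f) (hg : Bdd g) (h : L2R) :
    mulL f (mulL g h) = mulL (mulL f g) h := by
  refine Lp.ext ?_
  filter_upwards [hf.coe_mulL (mulL g h), hg.coe_mulL h, hf.coe_mulL g, (hf.mulL hg).coe_mulL h]
    with x h1 h2 h3 h4
  rw [h1, h2, h4, h3, mul_assoc]

lemma tr_mulL {f : L2R} (hf : Bdd f) (h : E3) (g : L2R) : tr h (mulL f g) = mulL (tr h f) (tr h g) := by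
  refine Lp.ext ?_
  filter_upwards [coe_tr h (mulL f g), ae_add_right (hf.coe_mulL g) h, (hf.tr h).coe_mulL (tr h g),
    coe_tr h f, coe_tr h g] with x h1 h2 h3 h4 h5
  rw [h1, h2, h3, h4, h5]

lemma inner_fourier (f g : L2R) : ((inner ℝ f g : ℝ) : ℂ)
    = ∫ ξ, (𝓕 (cplx f) : L2C) ξ * (starRingEnd ℂ) ((𝓕 (cplx g) : L2C) ξ) := by
  have h := Lp.inner_fourier_eq (cplx g) (cplx f)
  rw [L2.inner_def, L2.inner_def] at h
  rw [inner_L2R, ← integral_complex_ofReal]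
  simp only [RCLike.inner_apply] at h
  rw [h]
  refine integral_congr_ae ?_
  filter_upwards [coe_cplx f, coe_cplx g] with x h1 h2
  rw [h1, h2, Complex.conj_ofReal]; push_cast; ring

lemma integrable_fourier_inner (f g : L2C) :
    Integrable (fun ξ => (𝓕 f : L2C) ξ * (starRingEnd ℂ) ((𝓕 g : L2C) ξ)) volume := by
  have : MemLp (fun ξ => (starRingEnd ℂ) ((𝓕 g : L2C) ξ)) 2 volume := (Lp.memLp (𝓕 g : L2C)).star
  exact (Lp.memLp (𝓕 f : L2C)).integrable_mul this

/-- The measure `|h|^{-3-a} dh`. -/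
def kmeas (a : ℝ) : Measure E3 := (volume : Measure E3).withDensity (kw a)

lemma lintegral_kmeas (a : ℝ) {g : E3 → ℝ≥0∞} (hg : Measurable g) :
    ∫⁻ h, g h ∂(kmeas a) = ∫⁻ h, g h * kw a h := by
  rw [kmeas, lintegral_withDensity_eq_lintegral_mul _ (measurable_kw a) hg]
  simp only [Pi.mul_apply, mul_comm]

instance (a : ℝ) : SFinite (kmeas a) := by unfold kmeas; infer_instance

/-- The weight `|h| min(1, |h|)`. -/
def kb (h : E3) : ℝ := ‖h‖ * min 1 ‖h‖

lemma continuous_kb : Continuous kb := by unfold kb; fun_prop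

lemma kb_nonneg (h : E3) : 0 ≤ kb h := by unfold kb; positivity

lemma integrable_kb {a : ℝ} (h1 : 1 < a) (h2 : a < 2) : Integrable kb (kmeas a) := by
  refine ⟨continuous_kb.aestronglyMeasurable, ?_⟩
  have h3 := lintegral_min_kw_lt_top (a := a - 1) (b := 1) (by linarith) (by linarith)
  unfold HasFiniteIntegral
  rw [lintegral_kmeas a continuous_kb.measurable.enorm]
  refine lt_of_le_of_lt (lintegral_mono_ae ?_) h3
  filter_upwards [ae_ne_zero] with h hh
  have := kw_mul_rpow (a := a) (b := 1) hh
  rw [← this, ← mul_assoc, Real.rpow_one, ← ENNReal.ofReal_mul (by positivity), Real.enorm_of_nonneg (kb_nonneg h),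
    kb, mul_comm ‖h‖]

lemma abs_coord_mul_sin_le (h ξ : E3) (k : Fin 3) :
    |h k * Real.sin (2 * Real.pi * inner ℝ h ξ)| ≤ kb h * (1 + freq ξ) := by
  have h1 : |Real.sin (2 * Real.pi * inner ℝ h ξ)| ≤ min 1 ‖h‖ * (1 + freq ξ) := by
    rcases le_total 1 ‖h‖ with hh | hh
    · rw [min_eq_left hh]
      linarith [Real.abs_sin_le_one (2 * Real.pi * inner ℝ h ξ), freq_nonneg ξ]
    · rw [min_eq_right hh]
      calc _ ≤ |2 * Real.pi * inner ℝ h ξ| := Real.abs_sin_le_abs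
        _ = 2 * Real.pi * |inner ℝ h ξ| := by rw [abs_mul, abs_of_nonneg (by positivity)]
        _ ≤ 2 * Real.pi * (‖h‖ * ‖ξ‖) := by gcongr; exact abs_real_inner_le_norm _ _
        _ = ‖h‖ * freq ξ := by rw [freq]; ring
        _ ≤ _ := by gcongr; linarith
  rw [abs_mul, kb, mul_assoc ‖h‖]
  exact mul_le_mul (abs_coord_le h k) h1 (abs_nonneg _) (norm_nonneg _)

lemma integral_one_sub_cos {a : ℝ} (h0 : 0 < a) (ξ : E3) (h2 : a < 2) :
    Integrable (fun h => 1 - Real.cos (2 * Real.pi * inner ℝ h ξ)) (kmeas a) ∧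
    ∫ h, (1 - Real.cos (2 * Real.pi * inner ℝ h ξ)) ∂(kmeas a)
      = (1 / 2) * (diffConst 1 (a / 2)).toReal * ‖ξ‖ ^ a := by
  have hd1 := (diffConst_lt_top (k := 1) (a := a / 2) (by linarith) (by norm_num; linarith)).ne
  have hc : Continuous fun h : E3 => 1 - Real.cos (2 * Real.pi * inner ℝ h ξ) := by fun_prop
  have hpos : ∀ h : E3, 0 ≤ 1 - Real.cos (2 * Real.pi * inner ℝ h ξ) := fun h => by
    linarith [Real.cos_le_one (2 * Real.pi * inner ℝ h ξ)]
  have e : 2 * ∫⁻ h, ENNReal.ofReal (1 - Real.cos (2 * Real.pi * inner ℝ h ξ)) ∂(kmeas a)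
      = ENNReal.ofReal (‖ξ‖ ^ a) * diffConst 1 (a / 2) := by
    rw [← lintegral_const_mul' _ _ (by simp)]
    simp_rw [two_mul_ofReal, ← enorm_trSymb_sub_one_sq]
    have hm : Measurable fun h : E3 => ‖trSymb h ξ - 1‖ₑ ^ 2 :=
      ((continuous_trSymb_uncurry.comp (by fun_prop : Continuous fun h : E3 => (h, ξ))).sub
        continuous_const).measurable.enorm.pow_const 2
    rw [lintegral_kmeas a hm]
    rcases eq_or_ne ξ 0 with rfl | hξ
    · simp [trSymb, Real.zero_rpow h0.ne']
    · have := lintegral_trSymb 1 (a / 2) hξ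
      rwa [show 2 * (a / 2) = a by ring, mul_one] at this
  have hfin : ∫⁻ h, ENNReal.ofReal (1 - Real.cos (2 * Real.pi * inner ℝ h ξ)) ∂(kmeas a) ≠ ∞ := by
    intro h
    rw [h, ENNReal.mul_top (by simp)] at e
    exact ENNReal.mul_ne_top ENNReal.ofReal_ne_top hd1 e.symm
  refine ⟨⟨hc.aestronglyMeasurable, ?_⟩, ?_⟩
  · unfold HasFiniteIntegral
    simp_rw [fun h => Real.enorm_of_nonneg (hpos h)]
    exact lt_top_iff_ne_top.2 hfin
  · rw [integral_eq_lintegral_of_nonneg_ae (.of_forall hpos) hc.aestronglyMeasurable]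
    have := congrArg ENNReal.toReal e
    rw [ENNReal.toReal_mul, ENNReal.toReal_mul, ENNReal.toReal_ofReal (by positivity)] at this
    norm_num at this
    linarith

/-- The kernel of `∂_k |∇|^{a-2}`. -/
lemma integral_coord_mul_sin {a : ℝ} (h1 : 1 < a) (h2 : a < 2) {ξ : E3} (hξ : ξ ≠ 0) (k : Fin 3) :
    ∫ h : E3, h k * Real.sin (2 * Real.pi * inner ℝ h ξ) ∂(kmeas a)
      = (1 / 2) * (diffConst 1 (a / 2)).toReal * a / (2 * Real.pi) * (ξ k * ‖ξ‖ ^ (a - 2)) := by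
  have hin : ∀ (h : E3) (r : ℝ), inner ℝ h (ξ + r • ev k) = inner ℝ h ξ + r * h k := by
    intro h r; rw [inner_add_right, inner_smul_right, inner_ev]
  have hD : HasDerivAt (fun r : ℝ => ∫ h, (1 - Real.cos (2 * Real.pi * inner ℝ h (ξ + r • ev k))) ∂(kmeas a))
      (∫ h : E3, (2 * Real.pi) * (h k * Real.sin (2 * Real.pi * inner ℝ h (ξ + (0 : ℝ) • ev k))) ∂(kmeas a)) 0 := by
    refine (hasDerivAt_integral_of_dominated_loc_of_deriv_le
      (F' := fun (r : ℝ) (h : E3) => (2 * Real.pi) * (h k * Real.sin (2 * Real.pi * inner ℝ h (ξ + r • ev k))))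
      (bound := fun h => (2 * Real.pi) * (kb h * (1 + 2 * Real.pi * (‖ξ‖ + 1))))
      (Metric.ball_mem_nhds 0 one_pos) (.of_forall fun r => ?_) (integral_one_sub_cos (by linarith) _ h2).1
      ?_ (.of_forall fun h r hr => ?_) (((integrable_kb h1 h2).mul_const _).const_mul _)
      (.of_forall fun h r _ => ?_)).2
    · exact (by fun_prop : Continuous fun h : E3 =>
        1 - Real.cos (2 * Real.pi * inner ℝ h (ξ + r • ev k))).aestronglyMeasurable
    · exact (by fun_prop : Continuous fun h : E3 => (2 * Real.pi) *
        (h k * Real.sin (2 * Real.pi * inner ℝ h (ξ + (0 : ℝ) • ev k)))).aestronglyMeasurable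
    · rw [norm_mul, Real.norm_of_nonneg (by positivity)]
      gcongr
      refine (abs_coord_mul_sin_le h _ k).trans ?_
      gcongr
      · exact kb_nonneg h
      · rw [freq]
        gcongr
        refine (norm_add_le _ _).trans ?_
        rw [norm_smul, norm_ev, mul_one]
        have : ‖r‖ < 1 := by simpa using hr
        linarith
    · simp only [hin]
      have := (((((hasDerivAt_id r).mul_const (h k)).const_add (inner ℝ h ξ)).const_mul
        (2 * Real.pi)).cos.const_sub 1)
      convert! this using 1
      simp only [id_eq]; ring
  have hN : HasDerivAt (fun r : ℝ => (1 / 2) * (diffConst 1 (a / 2)).toReal * ‖ξ + r • ev k‖ ^ a)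
      ((1 / 2) * (diffConst 1 (a / 2)).toReal * (a * (ξ k * ‖ξ‖ ^ (a - 2)))) 0 := by
    have hn : 0 < ‖ξ‖ := norm_pos_iff.2 hξ
    have e1 : ∀ r : ℝ, ‖ξ + r • ev k‖ ^ a = (‖ξ‖ ^ 2 + r * (2 * ξ k) + r ^ 2) ^ (a / 2) := by
      intro r
      have : ‖ξ + r • ev k‖ ^ 2 = ‖ξ‖ ^ 2 + r * (2 * ξ k) + r ^ 2 := by
        rw [norm_add_sq_real, inner_smul_right, inner_ev, norm_smul, norm_ev, mul_one, Real.norm_eq_abs, sq_abs]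
        ring
      rw [← this, ← Real.rpow_two, ← Real.rpow_mul (norm_nonneg _)]
      congr 1; ring
    simp_rw [e1]
    refine HasDerivAt.const_mul _ ?_
    have h3 : HasDerivAt (fun r : ℝ => ‖ξ‖ ^ 2 + r * (2 * ξ k) + r ^ 2) (2 * ξ k) 0 := by
      have := (((hasDerivAt_id (0 : ℝ)).mul_const (2 * ξ k)).const_add (‖ξ‖ ^ 2)).add (hasDerivAt_pow 2 (0 : ℝ))
      convert! this using 1
      simp
    have h4 := h3.rpow_const (p := a / 2) (Or.inl (by simp [hξ]))
    convert! h4 using 1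
    have : (‖ξ‖ ^ 2 + 0 * (2 * ξ k) + 0 ^ 2) ^ (a / 2 - 1) = ‖ξ‖ ^ (a - 2) := by
      rw [show ‖ξ‖ ^ 2 + 0 * (2 * ξ k) + 0 ^ 2 = ‖ξ‖ ^ 2 by ring, ← Real.rpow_two, ← Real.rpow_mul hn.le]
      congr 1; ring
    rw [this]; ring
  have hE : (fun r : ℝ => ∫ h, (1 - Real.cos (2 * Real.pi * inner ℝ h (ξ + r • ev k))) ∂(kmeas a))
      = fun r : ℝ => (1 / 2) * (diffConst 1 (a / 2)).toReal * ‖ξ + r • ev k‖ ^ a :=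
    funext fun r => (integral_one_sub_cos (by linarith) _ h2).2
  rw [hE] at hD
  have := hD.unique hN
  rw [integral_const_mul, zero_smul, add_zero] at this
  have hpi : (2 * Real.pi) ≠ 0 := by positivity
  field_simp at this ⊢
  linarith

lemma trSymb_sub_trSymb_neg (h ξ : E3) : trSymb h ξ - trSymb (-h) ξ
    = 2 * Complex.I * (Real.sin (2 * Real.pi * inner ℝ h ξ) : ℝ) := by
  rw [Complex.ofReal_sin, Complex.sin, trSymb, trSymb, inner_neg_left]
  push_cast
  ring_nf
  rw [Complex.I_sq]
  ring

/-- The symbol of `∂_k |∇|^{-σ}`. -/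
def rsymb (σ : ℝ) (k : Fin 3) (ξ : E3) : ℂ := dsymb (ev k) ξ * (freq ξ ^ (-σ) : ℝ)

lemma inner_tr_sub_tr_neg (w g : L2R) (h : E3) : ((inner ℝ (tr h w - tr (-h) w) g : ℝ) : ℂ)
    = ∫ ξ, (2 * Complex.I * (Real.sin (2 * Real.pi * inner ℝ h ξ) : ℝ)) *
      ((𝓕 (cplx w) : L2C) ξ * (starRingEnd ℂ) ((𝓕 (cplx g) : L2C) ξ)) := by
  rw [inner_fourier]
  refine integral_congr_ae ?_
  filter_upwards [fourier_cplx_sub (tr h w) (tr (-h) w), fourier_cplx_tr h w, fourier_cplx_tr (-h) w]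
    with ξ h1 h2 h3
  rw [h1, h2, h3, ← sub_mul, trSymb_sub_trSymb_neg]; ring

lemma freq_le_sum (ξ : E3) : freq ξ ≤ ∑ k, ‖dsymb (ev k) ξ‖ := by
  have e : ∀ k, ‖dsymb (ev k) ξ‖ = 2 * Real.pi * |ξ k| := by
    intro k
    rw [dsymb, real_inner_comm, inner_ev, norm_mul, Complex.norm_I, mul_one, Complex.norm_real, norm_mul,
      Real.norm_of_nonneg (by positivity), Real.norm_eq_abs]
  simp_rw [e, ← Finset.mul_sum]
  rw [freq]
  gcongr
  have h1 : ‖ξ‖ ^ 2 ≤ (∑ k, |ξ k|) ^ 2 := by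
    rw [EuclideanSpace.real_norm_sq_eq, Fin.sum_univ_three, Fin.sum_univ_three]
    have := abs_nonneg (ξ 0)
    have := abs_nonneg (ξ 1)
    have := abs_nonneg (ξ 2)
    rw [← sq_abs (ξ 0), ← sq_abs (ξ 1), ← sq_abs (ξ 2)]
    nlinarith [mul_nonneg (abs_nonneg (ξ 0)) (abs_nonneg (ξ 1)), mul_nonneg (abs_nonneg (ξ 0)) (abs_nonneg (ξ 2)),
      mul_nonneg (abs_nonneg (ξ 1)) (abs_nonneg (ξ 2))]
  exact (pow_le_pow_iff_left₀ (norm_nonneg _) (Finset.sum_nonneg fun _ _ => abs_nonneg _) two_ne_zero).1 h1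

lemma integrable_freq_inner {w g : L2R} {d : Fin 3 → L2R} (hd : ∀ k, FD (ev k) w (d k)) :
    Integrable (fun ξ => (1 + freq ξ) * ‖(𝓕 (cplx w) : L2C) ξ * (starRingEnd ℂ) ((𝓕 (cplx g) : L2C) ξ)‖)
      volume := by
  have h0 := (integrable_fourier_inner (cplx w) (cplx g)).norm
  have h1 := fun k => (integrable_fourier_inner (cplx (d k)) (cplx g)).norm
  refine (h0.add (integrable_finsetSum Finset.univ fun k _ => h1 k)).mono'
    (((measurable_const.add measurable_freq).aestronglyMeasurable).mul h0.aestronglyMeasurable) ?_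
  filter_upwards [ae_all_iff.2 hd] with ξ hξ
  rw [Pi.add_apply, Real.norm_of_nonneg (mul_nonneg (by linarith [freq_nonneg ξ]) (norm_nonneg _)), add_mul, one_mul]
  refine add_le_add_right ?_ _
  simp_rw [hξ, mul_assoc, norm_mul (dsymb _ _), ← Finset.sum_mul]
  exact mul_le_mul_of_nonneg_right (freq_le_sum ξ) (norm_nonneg _)

lemma exists_riesz_form {σ : ℝ} (h0 : 0 < σ) (h1 : σ < 1) : ∃ c : ℝ, ∀ (k : Fin 3) (w t g : L2R)
    (d : Fin 3 → L2R), (∀ k, FD (ev k) w (d k)) →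
    ((𝓕 (cplx t) : L2C) =ᵐ[volume] fun ξ => rsymb σ k ξ * (𝓕 (cplx w) : L2C) ξ) →
    inner ℝ t g = c * ∫ h : E3, h k * inner ℝ (tr h w - tr (-h) w) g ∂(kmeas (2 - σ)) := by
  obtain ⟨C, hC⟩ : ∃ C, C = (1 / 2) * (diffConst 1 ((2 - σ) / 2)).toReal * (2 - σ) / (2 * Real.pi) := ⟨_, rfl⟩
  have hCpos : 0 < C := by
    have := ENNReal.toReal_pos (diffConst_ne_zero 1 ((2 - σ) / 2))
      (diffConst_lt_top (k := 1) (a := (2 - σ) / 2) (by linarith) (by norm_num; linarith)).ne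
    have : 0 < 2 - σ := by linarith
    rw [hC]; positivity
  refine ⟨2 * Real.pi * (2 * Real.pi) ^ (-σ) / (2 * C), fun k w t g d hd ht => ?_⟩
  let q : E3 → ℂ := fun ξ => (𝓕 (cplx w) : L2C) ξ * (starRingEnd ℂ) ((𝓕 (cplx g) : L2C) ξ)
  let Φ : E3 → E3 → ℂ := fun h ξ => ((h k * Real.sin (2 * Real.pi * inner ℝ h ξ) : ℝ) : ℂ) * q ξ
  have hint : Integrable (Function.uncurry Φ) ((kmeas (2 - σ)).prod volume) := by
    have hb := (integrable_kb (a := 2 - σ) (by linarith) (by linarith)).mul_prod (integrable_freq_inner hd (g := g))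
    refine hb.mono' ?_ (.of_forall fun z => ?_)
    · refine AEStronglyMeasurable.mul ?_ ?_
      · exact (by fun_prop : Continuous fun z : E3 × E3 =>
          ((z.1 k * Real.sin (2 * Real.pi * inner ℝ z.1 z.2) : ℝ) : ℂ)).aestronglyMeasurable
      · exact (integrable_fourier_inner (cplx w) (cplx g)).aestronglyMeasurable.comp_snd
    · change ‖((z.1 k * Real.sin (2 * Real.pi * inner ℝ z.1 z.2) : ℝ) : ℂ) * q z.2‖ ≤ _
      rw [norm_mul, Complex.norm_real, ← mul_assoc]
      exact mul_le_mul_of_nonneg_right (abs_coord_mul_sin_le z.1 z.2 k) (norm_nonneg _)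
  have hswap := integral_integral_swap hint
  have hR : ∀ h : E3, ∫ ξ, Φ h ξ = ((h k * inner ℝ (tr h w - tr (-h) w) g : ℝ) : ℂ) / (2 * Complex.I) := by
    intro h
    rw [Complex.ofReal_mul, inner_tr_sub_tr_neg, eq_div_iff (by simp), ← integral_mul_const, ← integral_const_mul]
    refine integral_congr_ae (.of_forall fun ξ => ?_)
    simp only [Φ, q]; push_cast; ring
  have hL : ∫ ξ, (∫ h, Φ h ξ ∂(kmeas (2 - σ))) = (inner ℝ t g : ℝ) *
      ((C : ℂ) / (2 * Real.pi * ((2 * Real.pi) ^ (-σ) : ℝ) * Complex.I)) := by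
    rw [inner_fourier, ← integral_mul_const]
    refine integral_congr_ae ?_
    filter_upwards [ht, ae_ne_zero] with ξ hξ hne
    have hp : (((2 * Real.pi) ^ (-σ) : ℝ) : ℂ) ≠ 0 := by
      exact_mod_cast (Real.rpow_pos_of_pos (by positivity) _).ne'
    simp only [Φ, q]
    rw [integral_mul_const, integral_complex_ofReal, integral_coord_mul_sin (by linarith) (by linarith) hne, ← hC,
      hξ, rsymb, dsymb, real_inner_comm, inner_ev, freq, Real.mul_rpow (by positivity) (norm_nonneg _),
      show 2 - σ - 2 = -σ by ring]
    have hpi : (Real.pi : ℂ) ≠ 0 := by exact_mod_cast Real.pi_ne_zero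
    have hI := Complex.I_ne_zero
    push_cast at hp ⊢
    field_simp
  simp_rw [hR] at hswap
  rw [hL, integral_div, integral_complex_ofReal] at hswap
  have hp : (0 : ℝ) < (2 * Real.pi) ^ (-σ) := Real.rpow_pos_of_pos (by positivity) _
  have hfin : ((∫ h : E3, h k * inner ℝ (tr h w - tr (-h) w) g ∂(kmeas (2 - σ)) : ℝ) : ℂ) * (2 * Real.pi *
      ((2 * Real.pi) ^ (-σ) : ℝ)) = ((inner ℝ t g : ℝ) : ℂ) * (2 * C) := by
    have hp' : (((2 * Real.pi) ^ (-σ) : ℝ) : ℂ) ≠ 0 := by exact_mod_cast hp.ne'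
    have hpi : (Real.pi : ℂ) ≠ 0 := by exact_mod_cast Real.pi_ne_zero
    have hI := Complex.I_ne_zero
    rw [div_eq_iff (by simp)] at hswap
    rw [hswap]
    field_simp
  have hfin' : (∫ h : E3, h k * inner ℝ (tr h w - tr (-h) w) g ∂(kmeas (2 - σ))) * (2 * Real.pi *
      ((2 * Real.pi) ^ (-σ) : ℝ)) = (inner ℝ t g : ℝ) * (2 * C) := by exact_mod_cast hfin
  field_simp
  linarith

lemma ae_dl_le {u : L2R} {d : Fin 3 → L2R} (hd : ∀ k, FD (ev k) u (d k)) {A : ℝ} (hA : 0 ≤ A)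
    (hu : ∀ᵐ x, ‖u x‖ ≤ A) (hdA : ∀ k, ∀ᵐ x, ‖d k x‖ ≤ A) (h : E3) :
    ∀ᵐ x, ‖dl h u x‖ ≤ 3 * A * min 1 ‖h‖ := by
  rcases le_total 1 ‖h‖ with hh | hh
  · rw [min_eq_left hh, dl_apply]
    filter_upwards [hu, ae_add_right hu h, coe_tr h u, Lp.coeFn_sub (tr h u) u] with x h1 h2 h3 h4
    rw [h4, Pi.sub_apply, h3]
    exact (norm_sub_le _ _).trans (by linarith)
  · rw [min_eq_right hh, ← eLpNorm_top_le_iff (by positivity)]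
    have := eLpNorm_dl_succ_le hd h 0 (q := ∞) (by simp)
    rw [zero_add, pow_one] at this
    refine this.trans ?_
    calc _ ≤ ENNReal.ofReal ‖h‖ * ∑ _k : Fin 3, ENNReal.ofReal A := by
          gcongr with k
          rw [pow_zero, one_apply_eq_self]
          exact (eLpNorm_top_le_iff hA).2 (hdA k)
      _ = ENNReal.ofReal (3 * A * ‖h‖) := by
          rw [Finset.sum_const, Finset.card_univ, Fintype.card_fin, nsmul_eq_mul, ← ENNReal.ofReal_natCast,
            ← ENNReal.ofReal_mul (by positivity), ← ENNReal.ofReal_mul (by positivity)]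
          congr 1; push_cast; ring

/-- Antisymmetry gains the derivative in `⟨∂_k |∇|^{-σ} w, u w⟩`. -/
lemma exists_riesz_commutator {σ : ℝ} (h0 : 0 < σ) (h1 : σ < 1) : ∃ C : ℝ, 0 ≤ C ∧
    ∀ (k : Fin 3) (w t u : L2R) (d du : Fin 3 → L2R) (A : ℝ), 0 ≤ A → (∀ k, FD (ev k) w (d k)) →
    ((𝓕 (cplx t) : L2C) =ᵐ[volume] fun ξ => rsymb σ k ξ * (𝓕 (cplx w) : L2C) ξ) →
    (∀ k, FD (ev k) u (du k)) → (∀ᵐ x, ‖u x‖ ≤ A) → (∀ k, ∀ᵐ x, ‖du k x‖ ≤ A) →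
    |inner ℝ t (mulL u w)| ≤ C * A * ‖w‖ ^ 2 := by
  obtain ⟨c, hc⟩ := exists_riesz_form h0 h1
  have hkb := integrable_kb (a := 2 - σ) (by linarith) (by linarith)
  have hI0 : 0 ≤ ∫ h, kb h ∂(kmeas (2 - σ)) := integral_nonneg kb_nonneg
  refine ⟨|c| * (3 * ∫ h, kb h ∂(kmeas (2 - σ))), by positivity, fun k w t u d du A hA hd ht hdu hu hduA => ?_⟩
  rw [hc k w t (mulL u w) d hd ht, abs_mul, mul_assoc, mul_assoc]
  gcongr
  have hub : Bdd u := ⟨A, hu⟩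
  have key : ∀ h : E3, ‖h k * inner ℝ (tr h w - tr (-h) w) (mulL u w)‖ ≤ kb h * (3 * A * ‖w‖ ^ 2) := by
    intro h
    have e : inner ℝ (tr h w - tr (-h) w) (mulL u w) = - inner ℝ (mulL (dl h u) (tr h w)) w := by
      have hdlb : Bdd (dl h u) := (hub.tr h).sub hub
      have e1 : inner ℝ (tr (-h) w) (mulL u w) = inner ℝ w (mulL (tr h u) (tr h w)) := by
        rw [inner_tr_left, neg_neg, tr_mulL hub]
      have e2 : mulL (dl h u) (tr h w) = mulL (tr h u) (tr h w) - mulL u (tr h w) := by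
        refine Lp.ext ?_
        filter_upwards [hdlb.coe_mulL (tr h w), (hub.tr h).coe_mulL (tr h w), hub.coe_mulL (tr h w),
          Lp.coeFn_sub (tr h u) u, Lp.coeFn_sub (mulL (tr h u) (tr h w)) (mulL u (tr h w))] with x a1 a2 a3 a4 a5
        rw [a1, a5, Pi.sub_apply, a2, a3, dl_apply, a4, Pi.sub_apply]; ring
      rw [inner_sub_left, e1, e2, inner_sub_left, real_inner_comm w, inner_mulL hub]
      ring
    rw [e, norm_mul, norm_neg, Real.norm_eq_abs, Real.norm_eq_abs, kb]
    have := abs_inner_mulL_le (ae_dl_le hdu hA hu hduA h) (tr h w) w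
    rw [LinearIsometry.norm_map] at this
    calc _ ≤ ‖h‖ * (3 * A * min 1 ‖h‖ * (‖w‖ * ‖w‖)) :=
          mul_le_mul (abs_coord_le h k) this (abs_nonneg _) (norm_nonneg _)
      _ = _ := by ring
  have := norm_integral_le_of_norm_le (hkb.mul_const (3 * A * ‖w‖ ^ 2)) (.of_forall key)
  rw [integral_mul_const, Real.norm_eq_abs] at this
  linarith

end EulerRiesz
end

noncomputable section

namespace EulerRiesz

lemma exists_riesz_bound {σ : ℝ} (h0 : 0 < σ) (hσ : σ < 2) : ∃ C : ℝ, 0 ≤ C ∧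
    ∀ (k : Fin 3) (w v t u : L2R) (d du : Fin 3 → L2R) (A : ℝ), 0 ≤ A → (∀ k, FD (ev k) w (d k)) →
    ((𝓕 (cplx v) : L2C) =ᵐ[volume] fun ξ => ((freq ξ ^ (-σ / 2) : ℝ) : ℂ) * (𝓕 (cplx w) : L2C) ξ) →
    ((𝓕 (cplx t) : L2C) =ᵐ[volume] fun ξ => rsymb σ k ξ * (𝓕 (cplx w) : L2C) ξ) →
    (∀ k, FD (ev k) u (du k)) → (∀ᵐ x, ‖u x‖ ≤ A) → (∀ k, ∀ᵐ x, ‖du k x‖ ≤ A) →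
    |inner ℝ t (mulL u w)| ≤ C * A * (‖w‖ ^ 2 + ‖v‖ ^ 2) := by
  rcases lt_or_ge σ 1 with h1 | h1
  · obtain ⟨C, hC0, hC⟩ := exists_riesz_commutator h0 h1
    refine ⟨C, hC0, fun k w v t u d du A hA hd _ ht hdu hu hduA => (hC k w t u d du A hA hd ht hdu hu hduA).trans ?_⟩
    gcongr
    linarith [sq_nonneg ‖v‖]
  · refine ⟨1, zero_le_one, fun k w v t u d du A hA _ hv ht _ hu _ => ?_⟩
    have hsq : ‖t‖ ^ 2 ≤ ‖w‖ ^ 2 + ‖v‖ ^ 2 := by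
      rw [← ENNReal.ofReal_le_ofReal_iff (by positivity), ENNReal.ofReal_add (by positivity) (by positivity),
        lintegral_sq_of_fourier ht, lintegral_sq_of_fourier hv, ← lintegral_enorm_sq w, ← lintegral_fourier_cplx w,
        ← lintegral_add_left' ((Lp.aestronglyMeasurable (𝓕 (cplx w) : L2C)).enorm.pow_const 2)]
      refine lintegral_mono_ae ?_
      filter_upwards [ae_ne_zero] with ξ hξ
      rw [← one_add_mul]
      gcongr
      have hf := freq_pos hξ
      rw [enorm_sq_eq, enorm_sq_eq, ← ENNReal.ofReal_one, ← ENNReal.ofReal_add zero_le_one (by positivity)]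
      refine ENNReal.ofReal_le_ofReal ?_
      rw [rsymb, norm_mul, mul_pow, Complex.norm_real, Complex.norm_real, Real.norm_of_nonneg (by positivity),
        Real.norm_of_nonneg (by positivity), ← Real.rpow_natCast (freq ξ ^ (-σ)), ← Real.rpow_natCast (freq ξ ^ (-σ / 2)),
        ← Real.rpow_mul hf.le, ← Real.rpow_mul hf.le]
      have e1 : ‖dsymb (ev k) ξ‖ ^ 2 * freq ξ ^ (-σ * (2 : ℕ)) ≤ freq ξ ^ (2 - 2 * σ) := by
        rw [show 2 - 2 * σ = 2 + -σ * (2 : ℕ) by push_cast; ring, Real.rpow_add hf, Real.rpow_two]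
        gcongr
        exact norm_dsymb_ev_le k ξ
      refine e1.trans ?_
      rcases le_total 1 (freq ξ) with h | h
      · have : freq ξ ^ (2 - 2 * σ) ≤ 1 := Real.rpow_le_one_of_one_le_of_nonpos h (by linarith)
        have : 0 ≤ freq ξ ^ (-σ / 2 * (2 : ℕ)) := by positivity
        linarith
      · have := Real.rpow_le_rpow_of_exponent_ge hf h (show -σ / 2 * (2 : ℕ) ≤ 2 - 2 * σ by push_cast; linarith)
        linarith
    rw [real_inner_comm, one_mul]
    refine (abs_inner_mulL_le hu w t).trans ?_
    gcongr
    nlinarith [sq_nonneg (‖w‖ - ‖t‖), sq_nonneg ‖v‖, sq_nonneg ‖w‖]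

lemma FD.mulL_ibp {v : E3} {U U' w w' z z' : L2R} (hU : FD v U U') (hw : FD v w w') (hz : FD v z z')
    (nU : Nice U) (nw : Nice w) :
    inner ℝ (EulerRiesz.mulL U w') z + inner ℝ (EulerRiesz.mulL U w) z' = -inner ℝ (EulerRiesz.mulL U' w) z := by
  have := (hU.mulL hw nU nw).inner_ibp hz
  rw [inner_add_left, mulL_comm w U'] at this
  linarith

lemma add_mulL {w : L2R} (hw : Bdd w) (f g : L2R) : mulL (f + g) w = mulL f w + mulL g w := by
  rw [mulL_comm, mulL_add hw, mulL_comm w, mulL_comm w]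

lemma neg_mulL {w : L2R} (hw : Bdd w) (f : L2R) : mulL (-f) w = -mulL f w := by
  rw [mulL_comm, mulL_neg hw, mulL_comm w]

lemma sum_mulL {w : L2R} (hw : Bdd w) {ι : Type*} (t : Finset ι) (f : ι → L2R) :
    mulL (∑ i ∈ t, f i) w = ∑ i ∈ t, mulL (f i) w := by
  rw [mulL_comm, mulL_sum hw]; simp_rw [mulL_comm w]

section Identity

variable {v : E3} {n n' U U' w w' z z' : L2R}

lemma inner_mulL_comm (hU : Bdd U) (w z : L2R) : inner ℝ (mulL U w) z = inner ℝ (mulL U z) w := by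
  rw [inner_mulL hU, real_inner_comm]

lemma transport_identity (nn : Nice n) (nU : Nice U) (nw : Nice w) (hn : FD v n n') (hU : FD v U U')
    (hw : FD v w w') :
    inner ℝ (w + mulL n w) (mulL U w')
      = -(1 / 2) * inner ℝ (mulL (mulL U n' + U' + mulL n U') w) w := by
  have h1 := hU.mulL_ibp hw hw nU nw
  have h2 := (hn.mulL hU nn nU).mulL_ibp hw hw (nn.mulL nU) nw
  rw [inner_mulL_comm nU.1 w w'] at h1
  rw [inner_mulL_comm (nn.mulL nU).1 w w', add_mulL nw.1, inner_add_left] at h2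
  have a1 : inner ℝ w (mulL U w') = inner ℝ (mulL U w') w := real_inner_comm _ _
  have a2 : inner ℝ (mulL n w) (mulL U w') = inner ℝ (mulL (mulL n U) w') w := by
    rw [inner_mulL nn.1, real_inner_comm, mulL_mulL nn.1 nU.1]
  rw [inner_add_left, a1, a2, add_mulL nw.1, add_mulL nw.1, inner_add_left, inner_add_left]
  linarith

lemma mulL_mulL_left (hn : Bdd n) (hw : Bdd w) (f : L2R) : mulL (mulL n f) w = mulL n (mulL f w) := by
  rw [mulL_comm _ w, mulL_mulL hw hn, mulL_comm f w, mulL_mulL hn hw, mulL_comm w n]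

lemma cross_identity (nn : Nice n) (nw : Nice w) (hn : FD v n n')
    (hw : FD v w w') (hz : FD v z z') :
    inner ℝ (z + mulL n z) (w' + mulL n w') + inner ℝ (w + mulL n w) (z' + mulL n z')
      = -(2 * (inner ℝ (mulL n' w) z + inner ℝ (mulL n (mulL n' w)) z)) := by
  have h0 := hw.inner_ibp hz
  have h1 := hn.mulL_ibp hw hz nn nw
  have h2 := (hn.mulL hn nn nn).mulL_ibp hw hz (nn.mulL nn) nw
  rw [add_mulL nw.1, inner_add_left, mulL_mulL_left nn.1 nw.1 n'] at h2
  have a0 : inner ℝ z w' = inner ℝ w' z := real_inner_comm _ _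
  have a1 : inner ℝ z (mulL n w') = inner ℝ (mulL n w') z := real_inner_comm _ _
  have a2 : inner ℝ (mulL n z) w' = inner ℝ (mulL n w') z := inner_mulL_comm nn.1 _ _
  have a3 : inner ℝ (mulL n z) (mulL n w') = inner ℝ (mulL (mulL n n) w') z := by
    rw [inner_mulL nn.1, real_inner_comm, mulL_mulL nn.1 nn.1]
  have b1 : inner ℝ w (mulL n z') = inner ℝ (mulL n w) z' := (inner_mulL nn.1 _ _).symm
  have b3 : inner ℝ (mulL n w) (mulL n z') = inner ℝ (mulL (mulL n n) w) z' := by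
    rw [← inner_mulL nn.1, mulL_mulL nn.1 nn.1]
  simp only [inner_add_left, inner_add_right, a0, a1, a2, a3, b1, b3]
  linarith

lemma pressure_identity (nn : Nice n) (nw : Nice w) (hn : FD v n n') (hw : FD v w w') (hz : FD v z z') :
    inner ℝ (w + mulL n w) z' + inner ℝ z (w' + mulL n w') = -inner ℝ (mulL n' w) z := by
  have h0 := hw.inner_ibp hz
  have h1 := hn.mulL_ibp hw hz nn nw
  have a0 : inner ℝ z w' = inner ℝ w' z := real_inner_comm _ _
  have a1 : inner ℝ z (mulL n w') = inner ℝ (mulL n w') z := real_inner_comm _ _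
  simp only [inner_add_left, inner_add_right, a0, a1]
  linarith

lemma flux_identity (nU : Nice U) (nw : Nice w) (hU : FD v U U') (hw : FD v w w') (hz : FD v z z') :
    inner ℝ z (mulL U w') = -inner ℝ z' (mulL U w) - inner ℝ (mulL U' w) z := by
  have h1 := hU.mulL_ibp hw hz nU nw
  have a0 : inner ℝ z (mulL U w') = inner ℝ (mulL U w') z := real_inner_comm _ _
  have a1 : inner ℝ z' (mulL U w) = inner ℝ (mulL U w) z' := real_inner_comm _ _
  rw [a0, a1]; linarith

end Identity

/-- The identity behind the energy estimate: the terms of top order cancel. -/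
lemma energy_identity {n : L2R} {u nd : Fin 3 → L2R} {ud : Fin 3 → L2R} {w0 G R0 : L2R}
    {w w0d Gd R : Fin 3 → L2R} {wd : Fin 3 → Fin 3 → L2R}
    (nn : Nice n) (nu : ∀ j, Nice (u j)) (nw0 : Nice w0) (nw : ∀ j, Nice (w j))
    (hn : ∀ j, FD (ev j) n (nd j)) (hu : ∀ j, FD (ev j) (u j) (ud j)) (hw0 : ∀ j, FD (ev j) w0 (w0d j))
    (hw : ∀ j k, FD (ev k) (w j) (wd j k)) (hG : ∀ j, FD (ev j) G (Gd j))
    {nt p0 : L2R} {p : Fin 3 → L2R}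
    (hnt : nt = -∑ j, (mulL (u j) (nd j) + ud j + mulL n (ud j)))
    (hp0 : p0 = -∑ j, (mulL (u j) (w0d j) + (wd j j + mulL n (wd j j))) - R0)
    (hp : ∀ j, p j = -((w0d j + mulL n (w0d j)) + ∑ k, mulL (u k) (wd j k) + Gd j) - R j) :
    inner ℝ (w0 + mulL n w0) p0 + ∑ j, inner ℝ (w j + mulL n (w j)) (p j)
      + (1 / 2) * (inner ℝ (mulL nt w0) w0 + ∑ j, inner ℝ (mulL nt (w j)) (w j)) + inner ℝ G p0
    = ∑ j, 2 * (inner ℝ (mulL (nd j) (w j)) w0 + inner ℝ (mulL n (mulL (nd j) (w j))) w0)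
      + ∑ j, inner ℝ (mulL (nd j) (w j)) G
      + ∑ j, (inner ℝ (Gd j) (mulL (u j) w0) + inner ℝ (mulL (ud j) w0) G)
      - inner ℝ (w0 + mulL n w0) R0 - ∑ j, inner ℝ (w j + mulL n (w j)) (R j) - inner ℝ G R0 := by
  have t0 := fun k => transport_identity nn (nu k) nw0 (hn k) (hu k) (hw0 k)
  have t := fun j k => transport_identity nn (nu k) (nw j) (hn k) (hu k) (hw j k)
  have c := fun j => cross_identity nn (nw j) (hn j) (hw j j) (hw0 j)
  have g := fun j => pressure_identity nn (nw j) (hn j) (hw j j) (hG j)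
  have f := fun j => flux_identity (nu j) nw0 (hu j) (hw0 j) (hG j)
  have n0 : inner ℝ (mulL nt w0) w0 = -∑ k, inner ℝ (mulL (mulL (u k) (nd k) + ud k + mulL n (ud k)) w0) w0 := by
    rw [hnt, neg_mulL nw0.1, sum_mulL nw0.1, inner_neg_left, sum_inner]
  have nj : ∀ j, inner ℝ (mulL nt (w j)) (w j)
      = -∑ k, inner ℝ (mulL (mulL (u k) (nd k) + ud k + mulL n (ud k)) (w j)) (w j) := fun j => by
    rw [hnt, neg_mulL (nw j).1, sum_mulL (nw j).1, inner_neg_left, sum_inner]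
  rw [n0, hp0]
  simp_rw [nj, hp]
  simp only [inner_sub_right, inner_neg_right, inner_sum, inner_add_right (𝕜 := ℝ) _ (mulL _ _) (_ + _),
    inner_add_right (𝕜 := ℝ) _ (_ + _) (Gd _), inner_add_right (𝕜 := ℝ) _ (_ + _) (∑ _, _)]
  simp only [Fin.sum_univ_three]
  linear_combination -(t0 0) - t0 1 - t0 2 - t 0 0 - t 0 1 - t 0 2 - t 1 0 - t 1 1 - t 1 2 - t 2 0 - t 2 1 - t 2 2
    - c 0 - c 1 - c 2 - g 0 - g 1 - g 2 - f 0 - f 1 - f 2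

lemma mul_le_half (a b : ℝ) : a * b ≤ (a ^ 2 + b ^ 2) / 2 := by nlinarith [sq_nonneg (a - b)]

lemma mul_le_weighted {A : ℝ} (hA : 0 < A) (a b : ℝ) : a * b ≤ (A * a ^ 2 + A⁻¹ * b ^ 2) / 2 := by
  have h : A * A⁻¹ = 1 := mul_inv_cancel₀ hA.ne'
  have : 0 ≤ A⁻¹ * (A * a - b) ^ 2 := by positivity
  have e : A⁻¹ * (A * a - b) ^ 2 = A * a ^ 2 * (A * A⁻¹) - 2 * (a * b) * (A * A⁻¹) + A⁻¹ * b ^ 2 := by ring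
  rw [e, h] at this
  linarith

lemma energy_rhs_bound {n : L2R} {u nd : Fin 3 → L2R} {ud : Fin 3 → L2R} {w0 G R0 : L2R}
    {w Gd R : Fin 3 → L2R} {A c S V : ℝ} (hA : 0 < A) (hc : 0 ≤ c) (hV : 0 ≤ V)
    (hn : ∀ᵐ x, ‖n x‖ ≤ 1 / 2) (hnd : ∀ j, ∀ᵐ x, ‖nd j x‖ ≤ A) (hud : ∀ j, ∀ᵐ x, ‖ud j x‖ ≤ A)
    (hG : ∀ j, |inner ℝ (Gd j) (mulL (u j) w0)| ≤ c * A * (‖w0‖ ^ 2 + V))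
    (hS : S = ‖w0‖ ^ 2 + ∑ j, ‖w j‖ ^ 2) :
    |∑ j, 2 * (inner ℝ (mulL (nd j) (w j)) w0 + inner ℝ (mulL n (mulL (nd j) (w j))) w0)
      + ∑ j, inner ℝ (mulL (nd j) (w j)) G
      + ∑ j, (inner ℝ (Gd j) (mulL (u j) w0) + inner ℝ (mulL (ud j) w0) G)
      - inner ℝ (w0 + mulL n w0) R0 - ∑ j, inner ℝ (w j + mulL n (w j)) (R j) - inner ℝ G R0|
    ≤ (20 + 3 * c) * (A * (S + ‖G‖ ^ 2 + V) + A⁻¹ * (‖R0‖ ^ 2 + ∑ j, ‖R j‖ ^ 2)) := by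
  have hA' : 0 < A⁻¹ := inv_pos.2 hA
  have b1 : ∀ j, |inner ℝ (mulL (nd j) (w j)) w0| ≤ A * ((‖w j‖ ^ 2 + ‖w0‖ ^ 2) / 2) := fun j =>
    (abs_inner_mulL_le (hnd j) _ _).trans (by gcongr; exact mul_le_half _ _)
  have b2 : ∀ j, |inner ℝ (mulL n (mulL (nd j) (w j))) w0| ≤ (1 / 2) * (A * ((‖w j‖ ^ 2 + ‖w0‖ ^ 2) / 2)) := fun j => by
    refine (abs_inner_mulL_le hn _ _).trans (mul_le_mul_of_nonneg_left ?_ (by norm_num))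
    calc _ ≤ A * ‖w j‖ * ‖w0‖ := mul_le_mul_of_nonneg_right (norm_mulL_le (hnd j) _) (norm_nonneg _)
      _ = A * (‖w j‖ * ‖w0‖) := by ring
      _ ≤ _ := mul_le_mul_of_nonneg_left (mul_le_half _ _) hA.le
  have b3 : ∀ j, |inner ℝ (mulL (nd j) (w j)) G| ≤ A * ((‖w j‖ ^ 2 + ‖G‖ ^ 2) / 2) := fun j =>
    (abs_inner_mulL_le (hnd j) _ _).trans (by gcongr; exact mul_le_half _ _)
  have b4 : ∀ j, |inner ℝ (mulL (ud j) w0) G| ≤ A * ((‖w0‖ ^ 2 + ‖G‖ ^ 2) / 2) := fun j =>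
    (abs_inner_mulL_le (hud j) _ _).trans (by gcongr; exact mul_le_half _ _)
  have hw : ∀ z R : L2R, |inner ℝ (z + mulL n z) R| ≤ (3 / 2) * ((A * ‖z‖ ^ 2 + A⁻¹ * ‖R‖ ^ 2) / 2) := fun z R => by
    refine (abs_real_inner_le_norm _ _).trans ?_
    have : ‖z + mulL n z‖ ≤ (3 / 2) * ‖z‖ := (norm_add_le _ _).trans (by linarith [norm_mulL_le hn z])
    calc _ ≤ (3 / 2) * ‖z‖ * ‖R‖ := by gcongr
      _ = (3 / 2) * (‖z‖ * ‖R‖) := by ring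
      _ ≤ _ := by gcongr; exact mul_le_weighted hA _ _
  have b5 := hw w0 R0
  have b6 := fun j => hw (w j) (R j)
  have b7 : |inner ℝ G R0| ≤ (A * ‖G‖ ^ 2 + A⁻¹ * ‖R0‖ ^ 2) / 2 :=
    (abs_real_inner_le_norm _ _).trans (mul_le_weighted hA _ _)
  simp only [Fin.sum_univ_three] at *
  have p1 : 0 ≤ c * A * ‖w0‖ ^ 2 := by positivity
  have p2 : 0 ≤ c * A * V := by positivity
  have p3 : 0 ≤ A * V := by positivity
  have p4 : ∀ z : L2R, 0 ≤ A * ‖z‖ ^ 2 := fun z => by positivity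
  have p5 : ∀ z : L2R, 0 ≤ A⁻¹ * ‖z‖ ^ 2 := fun z => by positivity
  have p6 : ∀ z : L2R, 0 ≤ c * (A * ‖z‖ ^ 2) := fun z => by positivity
  have p7 : ∀ z : L2R, 0 ≤ c * (A⁻¹ * ‖z‖ ^ 2) := fun z => by positivity
  have q1 := p4 w0; have q2 := p4 (w 0); have q3 := p4 (w 1); have q4 := p4 (w 2); have q5 := p4 G
  have r1 := p5 R0; have r2 := p5 (R 0); have r3 := p5 (R 1); have r4 := p5 (R 2)
  have s2 := p6 (w 0); have s3 := p6 (w 1); have s4 := p6 (w 2); have s5 := p6 G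
  have v1 := p7 R0; have v2 := p7 (R 0); have v3 := p7 (R 1); have v4 := p7 (R 2)
  simp only [abs_le] at *
  rw [hS]
  have b10 := b1 0; have b11 := b1 1; have b12 := b1 2
  have b20 := b2 0; have b21 := b2 1; have b22 := b2 2
  have b30 := b3 0; have b31 := b3 1; have b32 := b3 2
  have b40 := b4 0; have b41 := b4 1; have b42 := b4 2
  have b60 := b6 0; have b61 := b6 1; have b62 := b6 2
  have g0 := hG 0; have g1 := hG 1; have g2 := hG 2
  clear b1 b2 b3 b4 b6 hG hw p4 p5 p6 p7
  constructor
  · linarith only [b5.2, b7.2, b10.1, b11.1, b12.1, b20.1, b21.1, b22.1, b30.1, b31.1, b32.1, b40.1, b41.1, b42.1,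
      b60.2, b61.2, b62.2, g0.1, g1.1, g2.1, p1, p2, p3, q1, q2, q3, q4, q5, r1, r2, r3, r4, s2, s3, s4, s5, v1, v2, v3, v4]
  · linarith only [b5.1, b7.1, b10.2, b11.2, b12.2, b20.2, b21.2, b22.2, b30.2, b31.2, b32.2, b40.2, b41.2, b42.2,
      b60.1, b61.1, b62.1, g0.2, g1.2, g2.2, p1, p2, p3, q1, q2, q3, q4, q5, r1, r2, r3, r4, s2, s3, s4, s5, v1, v2, v3, v4]

end EulerRiesz
end

noncomputable section

namespace EulerRiesz

open LineDeriv

/-- A solution with its profile continuous in `H^{2s}`. -/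
structure Setup (σ s T : ℝ) (n : ℝ → L2R) (u : ℝ → Fin 3 → L2R) (α : ℝ → L2C) : Prop where
  pos : 0 < σ
  lt_two : σ < 2
  one_lt : 1 < s
  sol : IsSolution σ T n u
  comp : ∀ t ∈ Ico 0 T, Comp σ (n t) (u t) (α t)
  fin : ∀ t ∈ Ico 0 T, hNorm (2 * s) (α t) ≠ ∞
  cont : ∀ t ∈ Ico 0 T, Tendsto (fun τ => hNorm (2 * s) (α τ - α t)) (𝓝[Ico 0 T] t) (𝓝 0)

/-- Hermitian symbols of order at most `2a`. -/
structure Good (a : ℝ) (μ : E3 → ℂ) : Prop where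
  meas : Measurable μ
  herm : ∀ ξ, μ (-ξ) = (starRingEnd ℂ) (μ ξ)
  bound : ∀ ξ, ξ ≠ 0 → ‖μ ξ‖ ^ 2 ≤ (1 + freq ξ ^ 2) ^ a

/-- Hermitian symbols that may be singular at the origin like `|ξ|^{-σ/2}`. -/
structure GoodN (σ a : ℝ) (μ : E3 → ℂ) : Prop where
  meas : Measurable μ
  herm : ∀ ξ, μ (-ξ) = (starRingEnd ℂ) (μ ξ)
  bound : ∀ ξ, ξ ≠ 0 → ‖μ ξ‖ ^ 2 ≤ (1 + freq ξ ^ 2) ^ a * (1 + freq ξ ^ (-σ))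

lemma Good.goodN {a : ℝ} {μ : E3 → ℂ} (h : Good a μ) (σ : ℝ) : GoodN σ a μ where
  meas := h.meas
  herm := h.herm
  bound ξ hξ := (h.bound ξ hξ).trans (le_mul_of_one_le_right (by positivity)
    (by linarith [Real.rpow_nonneg (freq_nonneg ξ) (-σ)]))

lemma good_one {a : ℝ} (ha : 0 ≤ a) : Good a (fun _ => 1) where
  meas := measurable_const
  herm := by simp
  bound ξ _ := by simpa using one_le_japanese ha ξ

lemma good_dsymb {a : ℝ} (ha : 1 ≤ a) (k : Fin 3) : Good a (dsymb (ev k)) where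
  meas := measurable_dsymb _
  herm := dsymb_neg _
  bound ξ _ := (pow_le_pow_left₀ (norm_nonneg _) (norm_dsymb_ev_le k ξ) 2).trans
    (freq_pow_le_japanese 2 (by push_cast; linarith) ξ)

/-- The symbol of `|∇|^{-σ/2}`. -/
def vsymb (σ : ℝ) (ξ : E3) : ℂ := ((freq ξ ^ (-σ / 2) : ℝ) : ℂ)

lemma measurable_vsymb (σ : ℝ) : Measurable (vsymb σ) :=
  Complex.measurable_ofReal.comp (measurable_freq.pow_const _)

lemma vsymb_neg (σ : ℝ) (ξ : E3) : vsymb σ (-ξ) = (starRingEnd ℂ) (vsymb σ ξ) := by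
  rw [vsymb, vsymb, Complex.conj_ofReal, freq_neg]

lemma norm_vsymb_sq (σ : ℝ) (ξ : E3) : ‖vsymb σ ξ‖ ^ 2 = freq ξ ^ (-σ) := by
  rw [vsymb, Complex.norm_real, Real.norm_of_nonneg (Real.rpow_nonneg (freq_nonneg ξ) _), ← Real.rpow_natCast,
    ← Real.rpow_mul (freq_nonneg ξ)]
  congr 1; push_cast; ring

lemma goodN_vsymb {σ a : ℝ} (ha : 0 ≤ a) : GoodN σ a (vsymb σ) where
  meas := measurable_vsymb σ
  herm := vsymb_neg σ
  bound ξ hξ := by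
    rw [norm_vsymb_sq]
    have := one_le_japanese ha ξ
    have h2 := Real.rpow_nonneg (freq_nonneg ξ) (-σ)
    nlinarith

lemma measurable_rsymb (σ : ℝ) (k : Fin 3) : Measurable (rsymb σ k) :=
  (measurable_dsymb _).mul (Complex.measurable_ofReal.comp (measurable_freq.pow_const _))

lemma rsymb_neg (σ : ℝ) (k : Fin 3) (ξ : E3) : rsymb σ k (-ξ) = (starRingEnd ℂ) (rsymb σ k ξ) := by
  rw [rsymb, rsymb, map_mul, Complex.conj_ofReal, freq_neg, dsymb_neg]

lemma norm_rsymb_sq_le (σ : ℝ) (k : Fin 3) {ξ : E3} (hξ : ξ ≠ 0) :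
    ‖rsymb σ k ξ‖ ^ 2 ≤ freq ξ ^ (2 - σ) * freq ξ ^ (-σ) := by
  have hf := freq_pos hξ
  rw [rsymb, norm_mul, mul_pow, Complex.norm_real, Real.norm_of_nonneg (by positivity), ← Real.rpow_add hf,
    ← Real.rpow_natCast (freq ξ ^ (-σ)), ← Real.rpow_mul hf.le,
    show 2 - σ + -σ = 2 + -σ * (2 : ℕ) by push_cast; ring, Real.rpow_add hf, Real.rpow_two]
  gcongr
  exact norm_dsymb_ev_le k ξ

lemma goodN_rsymb {σ a : ℝ} (h0 : 0 < σ) (h2 : σ < 2) (ha : 1 ≤ a) (k : Fin 3) : GoodN σ a (rsymb σ k) where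
  meas := measurable_rsymb σ k
  herm := rsymb_neg σ k
  bound ξ hξ := by
    have hf := freq_pos hξ
    refine (norm_rsymb_sq_le σ k hξ).trans ?_
    gcongr
    · exact freq_rpow_le_japanese (by linarith) (by linarith) ξ
    · linarith

section Static

variable {σ a : ℝ} {n : L2R} {u : Fin 3 → L2R} {α : L2C} {μ : E3 → ℂ} {g : L2R}

lemma Comp.enorm_n_le (h : Comp σ n u α) (hμ : GoodN σ a μ)
    (hg : (𝓕 (cplx g) : L2C) =ᵐ[volume] fun ξ => μ ξ * (𝓕 (cplx n) : L2C) ξ) : ‖g‖ₑ ≤ hNorm a α := by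
  refine (ENNReal.pow_le_pow_left_iff two_ne_zero).1 ?_
  rw [enorm_sq_eq, lintegral_sq_of_fourier hg]
  simpa using h.lintegral_n_le a zero_le_one (by simpa using hμ.bound)

lemma Comp.enorm_u_le (h : Comp σ n u α) (hμ : Good a μ) {j : Fin 3}
    (hg : (𝓕 (cplx g) : L2C) =ᵐ[volume] fun ξ => μ ξ * (𝓕 (cplx (u j)) : L2C) ξ) : ‖g‖ₑ ≤ hNorm a α := by
  refine (ENNReal.pow_le_pow_left_iff two_ne_zero).1 ?_
  rw [enorm_sq_eq, lintegral_sq_of_fourier hg]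
  simpa using h.lintegral_u_le a j zero_le_one (by simpa using hμ.bound)

lemma Comp.mult_n (h : Comp σ n u α) (hμ : GoodN σ a μ) (hN : hNorm a α ≠ ∞) :
    (𝓕 (cplx (mult μ n)) : L2C) =ᵐ[volume] fun ξ => μ ξ * (𝓕 (cplx n) : L2C) ξ := by
  refine mult_spec hμ.meas hμ.herm (ne_top_of_le_ne_top (ENNReal.pow_ne_top hN (n := 2)) ?_)
  simpa using h.lintegral_n_le a zero_le_one (by simpa using hμ.bound)

lemma Comp.mult_u (h : Comp σ n u α) (hμ : Good a μ) (hN : hNorm a α ≠ ∞) (j : Fin 3) :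
    (𝓕 (cplx (mult μ (u j))) : L2C) =ᵐ[volume] fun ξ => μ ξ * (𝓕 (cplx (u j)) : L2C) ξ := by
  refine mult_spec hμ.meas hμ.herm (ne_top_of_le_ne_top (ENNReal.pow_ne_top hN (n := 2)) ?_)
  simpa using h.lintegral_u_le a j zero_le_one (by simpa using hμ.bound)

end Static

lemma fourier_sub_of {μ : E3 → ℂ} {f f' g g' : L2R}
    (h : (𝓕 (cplx g) : L2C) =ᵐ[volume] fun ξ => μ ξ * (𝓕 (cplx f) : L2C) ξ)
    (h' : (𝓕 (cplx g') : L2C) =ᵐ[volume] fun ξ => μ ξ * (𝓕 (cplx f') : L2C) ξ) :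
    (𝓕 (cplx (g - g')) : L2C) =ᵐ[volume] fun ξ => μ ξ * (𝓕 (cplx (f - f')) : L2C) ξ := by
  filter_upwards [h, h', fourier_cplx_sub g g', fourier_cplx_sub f f'] with ξ h1 h2 h3 h4
  rw [h3, h4, h1, h2, mul_sub]

/-- The partial derivative, when it is in `L²`. -/
def par (k : Fin 3) (f : L2R) : L2R := mult (dsymb (ev k)) f

namespace Setup

variable {σ s T : ℝ} {n : ℝ → L2R} {u : ℝ → Fin 3 → L2R} {α : ℝ → L2C}

lemma one_le (S : Setup σ s T n u α) : 1 ≤ 2 * s := by linarith [S.one_lt]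

lemma continuousOn_n (S : Setup σ s T n u α) {μ : E3 → ℂ} (hμ : GoodN σ (2 * s) μ) {X : ℝ → L2R}
    (hX : ∀ t ∈ Ico 0 T, (𝓕 (cplx (X t)) : L2C) =ᵐ[volume] fun ξ => μ ξ * (𝓕 (cplx (n t)) : L2C) ξ) :
    ContinuousOn X (Ico 0 T) := by
  intro t ht
  unfold ContinuousWithinAt
  rw [tendsto_iff_edist_tendsto_0]
  refine tendsto_of_tendsto_of_tendsto_of_le_of_le' tendsto_const_nhds (S.cont t ht)
    (.of_forall fun _ => zero_le) ?_
  filter_upwards [self_mem_nhdsWithin] with τ hτ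
  rw [edist_eq_enorm_sub]
  exact ((S.comp τ hτ).sub (S.comp t ht)).enorm_n_le hμ (fourier_sub_of (hX τ hτ) (hX t ht))

lemma continuousOn_u (S : Setup σ s T n u α) {μ : E3 → ℂ} (hμ : Good (2 * s) μ) {j : Fin 3} {X : ℝ → L2R}
    (hX : ∀ t ∈ Ico 0 T, (𝓕 (cplx (X t)) : L2C) =ᵐ[volume] fun ξ => μ ξ * (𝓕 (cplx (u t j)) : L2C) ξ) :
    ContinuousOn X (Ico 0 T) := by
  intro t ht
  unfold ContinuousWithinAt
  rw [tendsto_iff_edist_tendsto_0]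
  refine tendsto_of_tendsto_of_tendsto_of_le_of_le' tendsto_const_nhds (S.cont t ht)
    (.of_forall fun _ => zero_le) ?_
  filter_upwards [self_mem_nhdsWithin] with τ hτ
  rw [edist_eq_enorm_sub]
  exact ((S.comp τ hτ).sub (S.comp t ht)).enorm_u_le (j := j) hμ (fourier_sub_of (hX τ hτ) (hX t ht))

lemma FD_n (S : Setup σ s T n u α) {t : ℝ} (ht : t ∈ Ico 0 T) (k : Fin 3) : FD (ev k) (n t) (par k (n t)) :=
  (S.comp t ht).mult_n ((good_dsymb S.one_le k).goodN σ) (S.fin t ht)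

lemma FD_u (S : Setup σ s T n u α) {t : ℝ} (ht : t ∈ Ico 0 T) (j k : Fin 3) :
    FD (ev k) (u t j) (par k (u t j)) :=
  (S.comp t ht).mult_u (good_dsymb S.one_le k) (S.fin t ht) j

lemma riesz (S : Setup σ s T n u α) {t : ℝ} (ht : t ∈ Ico 0 T) (k : Fin 3) :
    (𝓕 (cplx (mult (rsymb σ k) (n t))) : L2C) =ᵐ[volume] fun ξ => rsymb σ k ξ * (𝓕 (cplx (n t)) : L2C) ξ :=
  (S.comp t ht).mult_n (goodN_rsymb S.pos S.lt_two S.one_le k) (S.fin t ht)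

lemma vel (S : Setup σ s T n u α) {t : ℝ} (ht : t ∈ Ico 0 T) :
    (𝓕 (cplx (mult (vsymb σ) (n t))) : L2C) =ᵐ[volume] fun ξ => vsymb σ ξ * (𝓕 (cplx (n t)) : L2C) ξ :=
  (S.comp t ht).mult_n (goodN_vsymb (zero_le_one.trans S.one_le)) (S.fin t ht)

lemma cont_n (S : Setup σ s T n u α) : ContinuousOn n (Ico 0 T) :=
  S.continuousOn_n ((good_one (zero_le_one.trans S.one_le)).goodN σ) fun t _ => by simp

lemma cont_u (S : Setup σ s T n u α) (j : Fin 3) : ContinuousOn (fun t => u t j) (Ico 0 T) :=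
  S.continuousOn_u (good_one (zero_le_one.trans S.one_le)) (j := j) fun t _ => by simp

lemma cont_par_n (S : Setup σ s T n u α) (k : Fin 3) : ContinuousOn (fun t => par k (n t)) (Ico 0 T) :=
  S.continuousOn_n ((good_dsymb S.one_le k).goodN σ) fun _ ht => S.FD_n ht k

lemma cont_par_u (S : Setup σ s T n u α) (j k : Fin 3) : ContinuousOn (fun t => par k (u t j)) (Ico 0 T) :=
  S.continuousOn_u (good_dsymb S.one_le k) (j := j) fun _ ht => S.FD_u ht j k

lemma cont_riesz (S : Setup σ s T n u α) (k : Fin 3) :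
    ContinuousOn (fun t => mult (rsymb σ k) (n t)) (Ico 0 T) :=
  S.continuousOn_n (goodN_rsymb S.pos S.lt_two S.one_le k) fun _ ht => S.riesz ht k

lemma cont_vel (S : Setup σ s T n u α) : ContinuousOn (fun t => mult (vsymb σ) (n t)) (Ico 0 T) :=
  S.continuousOn_n (goodN_vsymb (zero_le_one.trans S.one_le)) fun _ ht => S.vel ht

lemma curl (S : Setup σ s T n u α) {t : ℝ} (ht : t ∈ Ico 0 T) (j k : Fin 3) :
    par k (u t j) = par j (u t k) := by
  refine cplx_injective (fourier_injective ?_)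
  filter_upwards [S.FD_u ht j k, S.FD_u ht k j, (S.comp t ht).curl j k] with ξ h1 h2 h3
  rw [h1, h2, dsymb, dsymb, real_inner_comm, inner_ev, real_inner_comm, inner_ev]
  push_cast
  linear_combination (2 * Real.pi * Complex.I) * h3

lemma nice_n (S : Setup σ s T n u α) {t : ℝ} (ht : t ∈ Ico 0 T) : Nice (n t) :=
  nice_of_hNorm (a := 2 * s) (by linarith [S.one_lt]) (ne_top_of_le_ne_top (S.fin t ht) ((S.comp t ht).hNorm_n_le _))

lemma nice_u (S : Setup σ s T n u α) {t : ℝ} (ht : t ∈ Ico 0 T) (j : Fin 3) : Nice (u t j) :=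
  nice_of_hNorm (a := 2 * s) (by linarith [S.one_lt]) (ne_top_of_le_ne_top (S.fin t ht) ((S.comp t ht).hNorm_u_le _ j))

end Setup

lemma eventually_sup_le {a : ℝ} (ha : 3 / 2 < a) {l : Filter ℝ} {f : ℝ → L2R}
    (h : Tendsto (fun τ => hNorm a (cplx (f τ))) l (𝓝 0)) {ε : ℝ} (hε : 0 < ε) :
    ∀ᶠ τ in l, ∀ᵐ x, ‖f τ x‖ ≤ ε := by
  obtain ⟨J, hJ⟩ : ∃ J, J = (∫⁻ ξ : E3, ENNReal.ofReal ((1 + freq ξ ^ 2) ^ (-a))) ^ (1 / 2 : ℝ) := ⟨_, rfl⟩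
  have hJt : J ≠ ∞ := hJ ▸ ENNReal.rpow_ne_top_of_nonneg (by norm_num) (lintegral_japanese ha).ne
  have h1 : Tendsto (fun τ => J * hNorm a (cplx (f τ))) l (𝓝 0) := by
    simpa using ENNReal.Tendsto.const_mul h (Or.inr hJt)
  filter_upwards [h1.eventually_lt_const (ENNReal.ofReal_pos.2 hε)] with τ hτ
  have h2 : ∫⁻ ξ, ‖(𝓕 (cplx (f τ)) : L2C) ξ‖ₑ ≤ ENNReal.ofReal ε :=
    ((lintegral_fourier_le_hNorm (a := a) (cplx (f τ))).trans (hJ ▸ hτ.le))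
  filter_upwards [ae_norm_le_lintegral_fourier (ne_top_of_le_ne_top ENNReal.ofReal_ne_top h2), coe_cplx (f τ)]
    with x hx hc
  rw [hc, Complex.norm_real] at hx
  exact hx.trans (ENNReal.toReal_le_of_le_ofReal hε.le h2)

/-- Continuity of a curve in the sup norm. -/
def SupCont (f : ℝ → L2R) (t : ℝ) : Prop := ∀ ε > 0, ∀ᶠ r in 𝓝 t, ∀ᵐ x, ‖f r x - f t x‖ ≤ ε

lemma Setup.supCont_n {σ s T : ℝ} {n : ℝ → L2R} {u : ℝ → Fin 3 → L2R} {α : ℝ → L2C}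
    (S : Setup σ s T n u α) {t : ℝ} (ht : t ∈ Ioo 0 T) : SupCont n t := by
  intro ε hε
  have ht' : t ∈ Ico 0 T := ⟨ht.1.le, ht.2⟩
  have hnhds : 𝓝[Ico 0 T] t = 𝓝 t := nhdsWithin_eq_nhds.2 (Ico_mem_nhds ht.1 ht.2)
  have h := S.cont t ht'
  rw [hnhds] at h
  have h2 : Tendsto (fun τ => hNorm (2 * s) (cplx (n τ - n t))) (𝓝 t) (𝓝 0) :=
    tendsto_of_tendsto_of_tendsto_of_le_of_le' tendsto_const_nhds h (.of_forall fun _ => zero_le) (by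
      filter_upwards [Ico_mem_nhds ht.1 ht.2] with τ hτ
      exact ((S.comp τ hτ).sub (S.comp t ht')).hNorm_n_le _)
  filter_upwards [eventually_sup_le (by linarith [S.one_lt]) h2 hε] with τ hτ
  filter_upwards [hτ, Lp.coeFn_sub (n τ) (n t)] with x h1 h3
  rwa [h3, Pi.sub_apply] at h1

lemma Setup.supCont_u {σ s T : ℝ} {n : ℝ → L2R} {u : ℝ → Fin 3 → L2R} {α : ℝ → L2C}
    (S : Setup σ s T n u α) {t : ℝ} (ht : t ∈ Ioo 0 T) (j : Fin 3) : SupCont (fun t => u t j) t := by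
  intro ε hε
  have ht' : t ∈ Ico 0 T := ⟨ht.1.le, ht.2⟩
  have hnhds : 𝓝[Ico 0 T] t = 𝓝 t := nhdsWithin_eq_nhds.2 (Ico_mem_nhds ht.1 ht.2)
  have h := S.cont t ht'
  rw [hnhds] at h
  have h2 : Tendsto (fun τ => hNorm (2 * s) (cplx (u τ j - u t j))) (𝓝 t) (𝓝 0) :=
    tendsto_of_tendsto_of_tendsto_of_le_of_le' tendsto_const_nhds h (.of_forall fun _ => zero_le) (by
      filter_upwards [Ico_mem_nhds ht.1 ht.2] with τ hτ
      exact ((S.comp τ hτ).sub (S.comp t ht')).hNorm_u_le _ j)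
  filter_upwards [eventually_sup_le (by linarith [S.one_lt]) h2 hε] with τ hτ
  filter_upwards [hτ, Lp.coeFn_sub (u τ j) (u t j)] with x h1 h3
  rwa [h3, Pi.sub_apply] at h1

lemma SupCont.bound {f : ℝ → L2R} {t c : ℝ} (hf : SupCont f t) (hc : ∀ᵐ x, ‖f t x‖ ≤ c) :
    ∀ᶠ r in 𝓝 t, ∀ᵐ x, ‖f r x‖ ≤ c + 1 := by
  filter_upwards [hf 1 one_pos] with r hr
  filter_upwards [hr, hc] with x h1 h2
  calc ‖f r x‖ = ‖(f r x - f t x) + f t x‖ := by rw [sub_add_cancel]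
    _ ≤ _ := (norm_add_le _ _).trans (by linarith)

lemma SupCont.continuousAt_mulL {f g : ℝ → L2R} {t : ℝ} (hf : SupCont f t) (hb : Bdd (f t))
    (hg : ContinuousAt g t) : ContinuousAt (fun r => mulL (f r) (g r)) t := by
  obtain ⟨c, hc0, hc⟩ := hb.nonneg_bound
  unfold ContinuousAt
  rw [tendsto_iff_norm_sub_tendsto_zero]
  refine Metric.tendsto_nhds.2 fun ε hε => ?_
  have hg' := tendsto_iff_norm_sub_tendsto_zero.1 hg
  have hδ : 0 < ε / (2 * (‖g t‖ + 1)) := by positivity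
  filter_upwards [hf.bound hc, hf _ hδ, hg'.eventually_lt_const (show 0 < ε / (2 * (c + 1)) by positivity)]
    with r h1 h2 h3
  have hbr : Bdd (f r) := ⟨_, h1⟩
  have e : mulL (f r) (g r) - mulL (f t) (g t) = mulL (f r) (g r - g t) + mulL (f r - f t) (g t) := by
    rw [mulL_sub hbr]
    have : mulL (f r - f t) (g t) = mulL (f r) (g t) - mulL (f t) (g t) := by
      refine Lp.ext ?_
      filter_upwards [(hbr.sub hb).coe_mulL (g t), hbr.coe_mulL (g t), hb.coe_mulL (g t),
        Lp.coeFn_sub (f r) (f t), Lp.coeFn_sub (mulL (f r) (g t)) (mulL (f t) (g t))] with x a1 a2 a3 a4 a5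
      rw [a1, a5, Pi.sub_apply, a2, a3, a4, Pi.sub_apply]; ring
    rw [this]; abel
  rw [dist_zero_right, norm_norm, e]
  have b1 : ‖mulL (f r) (g r - g t)‖ ≤ (c + 1) * ‖g r - g t‖ := norm_mulL_le h1 _
  have b2 : ‖mulL (f r - f t) (g t)‖ ≤ ε / (2 * (‖g t‖ + 1)) * ‖g t‖ := norm_mulL_le (by
    filter_upwards [h2, Lp.coeFn_sub (f r) (f t)] with x a1 a2
    rwa [a2, Pi.sub_apply]) _
  have b3 : (c + 1) * ‖g r - g t‖ < ε / 2 := by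
    calc _ < (c + 1) * (ε / (2 * (c + 1))) := by gcongr
      _ = ε / 2 := by field_simp
  have b4 : ε / (2 * (‖g t‖ + 1)) * ‖g t‖ ≤ ε / 2 := by
    rw [div_mul_eq_mul_div, div_le_div_iff₀ (by positivity) (by positivity)]
    nlinarith [norm_nonneg (g t)]
  exact (norm_add_le _ _).trans_lt (by linarith)

/-- Differentiability of a curve from its pairings with enough test functions. -/
lemma hasDerivAt_of_tested {Q : Set L2R}
    (hQ : ∀ (f : L2R) (c : ℝ), 0 ≤ c → (∀ φ ∈ Q, |inner ℝ f φ| ≤ c * ‖φ‖) → ‖f‖ ≤ c) {X Y : ℝ → L2R} {t : ℝ}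
    (h : ∀ᶠ τ in 𝓝 t, ∀ φ ∈ Q, HasDerivAt (fun r => inner ℝ (X r) φ) (inner ℝ (Y τ) φ) τ)
    (hY : ContinuousAt Y t) : HasDerivAt X (Y t) t := by
  rw [hasDerivAt_iff_isLittleO, Asymptotics.isLittleO_iff]
  intro c hc
  have hYc : ∀ᶠ τ in 𝓝 t, ‖Y τ - Y t‖ ≤ c := by
    filter_upwards [(tendsto_iff_norm_sub_tendsto_zero.1 hY).eventually_lt_const hc] with τ hτ using hτ.le
  obtain ⟨δ, hδ, hball⟩ := Metric.eventually_nhds_iff_ball.1 (h.and hYc)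
  filter_upwards [Metric.ball_mem_nhds t hδ] with τ hτ
  refine hQ _ _ (by positivity) fun φ hφ => ?_
  have hd : ∀ r ∈ Metric.ball t δ, HasDerivWithinAt (fun r => inner ℝ (X r) φ - r * inner ℝ (Y t) φ)
      (inner ℝ (Y r - Y t) φ) (Metric.ball t δ) r := by
    intro r hr
    have := ((hball r hr).1 φ hφ).sub ((hasDerivAt_id r).mul_const (inner ℝ (Y t) φ))
    rw [one_mul, ← inner_sub_left] at this
    exact this.hasDerivWithinAt
  have hmv := (convex_ball t δ).norm_image_sub_le_of_norm_hasDerivWithin_le (C := c * ‖φ‖) hd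
    (fun r hr => (norm_inner_le_norm _ _).trans (by gcongr; exact (hball r hr).2))
    (Metric.mem_ball_self hδ) hτ
  have e : inner ℝ (X τ - X t - (τ - t) • Y t) φ
      = (inner ℝ (X τ) φ - τ * inner ℝ (Y t) φ) - (inner ℝ (X t) φ - t * inner ℝ (Y t) φ) := by
    rw [inner_sub_left, inner_sub_left, inner_smul_left]
    simp only [conj_trivial]; ring
  rw [e]
  calc _ ≤ c * ‖φ‖ * ‖τ - t‖ := hmv
    _ = _ := by ring

lemma norm_le_of_schwartz_tested (f : L2R) (c : ℝ) (hc : 0 ≤ c)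
    (h : ∀ φ ∈ range fun φ : 𝓢(E3, ℝ) => φ.toLp 2 volume, |inner ℝ f φ| ≤ c * ‖φ‖) : ‖f‖ ≤ c := by
  have hd : DenseRange fun φ : 𝓢(E3, ℝ) => φ.toLp 2 volume :=
    SchwartzMap.denseRange_toLpCLM (E := E3) (F := ℝ) (p := 2) (by norm_num)
  have h2 : ∀ φ : L2R, |inner ℝ f φ| ≤ c * ‖φ‖ := by
    intro φ
    refine hd.induction_on (p := fun φ => |inner ℝ f φ| ≤ c * ‖φ‖) φ
      (isClosed_le (by fun_prop) (by fun_prop)) fun ψ => h _ ⟨ψ, rfl⟩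
  have h3 := h2 f
  rw [real_inner_self_eq_norm_sq, abs_of_nonneg (by positivity)] at h3
  by_contra hlt
  push Not at hlt
  nlinarith

end EulerRiesz
end

noncomputable section

namespace EulerRiesz

open LineDeriv

/-- The mass flux `(1 + n) u_j`. -/
def flux (n : L2R) (u : Fin 3 → L2R) (j : Fin 3) : L2R := u j + mulL n (u j)

/-- The derivative `∂_k` of the mass flux. -/
def fluxD (n : L2R) (u : Fin 3 → L2R) (j k : Fin 3) : L2R :=
  par k (u j) + (mulL n (par k (u j)) + mulL (u j) (par k n))

/-- The right-hand side of the mass equation. -/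
def nDot (n : L2R) (u : Fin 3 → L2R) : L2R :=
  -∑ j, (mulL (u j) (par j n) + par j (u j) + mulL n (par j (u j)))

/-- The right-hand side of the momentum equation. -/
def uDot (σ : ℝ) (n : L2R) (u : Fin 3 → L2R) (j : Fin 3) : L2R :=
  -((par j n + mulL n (par j n)) + ∑ k, mulL (u k) (par j (u k)) + mult (rsymb σ j) n)

/-- The time derivative of `|∇|^{-σ/2} n`. -/
def vDot (σ : ℝ) (n : L2R) (u : Fin 3 → L2R) : L2R :=
  -∑ j, mult (fun ξ => vsymb σ ξ * dsymb (ev j) ξ) (flux n u j)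

lemma nDot_eq (n : L2R) (u : Fin 3 → L2R) : nDot n u = -∑ j, fluxD n u j j := by
  rw [nDot]; congr 1; refine Finset.sum_congr rfl fun j _ => ?_; rw [fluxD]; abel

lemma inner_toLp (f : L2R) (φ : 𝓢(E3, ℝ)) : inner ℝ f (φ.toLp 2) = ∫ x, f x * φ x := by
  rw [inner_L2R]
  refine integral_congr_ae ?_
  filter_upwards [φ.coeFn_toLp 2 volume] with x hx
  rw [hx]

lemma inner_toLp_deriv (f : L2R) (φ : 𝓢(E3, ℝ)) (j : Fin 3) :
    inner ℝ f ((∂_{ev j} φ).toLp 2) = ∫ x, f x * pderiv j φ x := by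
  rw [inner_L2R]
  refine integral_congr_ae ?_
  filter_upwards [coe_schwartz_deriv φ j] with x hx
  rw [hx]

namespace Setup

variable {σ s T : ℝ} {n : ℝ → L2R} {u : ℝ → Fin 3 → L2R} {α : ℝ → L2C}

lemma FD_flux (S : Setup σ s T n u α) {t : ℝ} (ht : t ∈ Ico 0 T) (j k : Fin 3) :
    FD (ev k) (flux (n t) (u t) j) (fluxD (n t) (u t) j k) :=
  (S.FD_u ht j k).add ((S.FD_n ht k).mulL (S.FD_u ht j k) (S.nice_n ht) (S.nice_u ht j))

lemma contAt {F : Type*} [TopologicalSpace F] {X : ℝ → F} {t : ℝ} (hX : ContinuousOn X (Ico 0 T))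
    (ht : t ∈ Ioo 0 T) : ContinuousAt X t := hX.continuousAt (Ico_mem_nhds ht.1 ht.2)

lemma mem_Ico {t : ℝ} (ht : t ∈ Ioo 0 T) : t ∈ Ico 0 T := ⟨ht.1.le, ht.2⟩

lemma cont_fluxD (S : Setup σ s T n u α) {t : ℝ} (ht : t ∈ Ioo 0 T) (j k : Fin 3) :
    ContinuousAt (fun r => fluxD (n r) (u r) j k) t :=
  (contAt (S.cont_par_u j k) ht).add
    (((S.supCont_n ht).continuousAt_mulL (S.nice_n (mem_Ico ht)).1 (contAt (S.cont_par_u j k) ht)).add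
    ((S.supCont_u ht j).continuousAt_mulL (S.nice_u (mem_Ico ht) j).1 (contAt (S.cont_par_n k) ht)))

lemma cont_flux (S : Setup σ s T n u α) {t : ℝ} (ht : t ∈ Ioo 0 T) (j : Fin 3) :
    ContinuousAt (fun r => flux (n r) (u r) j) t :=
  (contAt (S.cont_u j) ht).add
    ((S.supCont_n ht).continuousAt_mulL (S.nice_n (mem_Ico ht)).1 (contAt (S.cont_u j) ht))

lemma cont_nDot (S : Setup σ s T n u α) {t : ℝ} (ht : t ∈ Ioo 0 T) :
    ContinuousAt (fun r => nDot (n r) (u r)) t := by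
  simp_rw [nDot_eq]
  exact (tendsto_finsetSum _ fun j _ => S.cont_fluxD ht j j).neg

lemma cont_uDot (S : Setup σ s T n u α) {t : ℝ} (ht : t ∈ Ioo 0 T) (j : Fin 3) :
    ContinuousAt (fun r => uDot σ (n r) (u r) j) t := by
  have h1 := (contAt (S.cont_par_n j) ht).add
    ((S.supCont_n ht).continuousAt_mulL (S.nice_n (mem_Ico ht)).1 (contAt (S.cont_par_n j) ht))
  have h2 : ContinuousAt (fun r => ∑ k, mulL (u r k) (par j (u r k))) t :=
    tendsto_finsetSum _ fun k _ =>
      (S.supCont_u ht k).continuousAt_mulL (S.nice_u (mem_Ico ht) k).1 (contAt (S.cont_par_u k j) ht)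
  exact ((h1.add h2).add (contAt (S.cont_riesz j) ht)).neg

lemma hasDerivAt_n (S : Setup σ s T n u α) {t : ℝ} (ht : t ∈ Ioo 0 T) :
    HasDerivAt n (nDot (n t) (u t)) t := by
  refine hasDerivAt_of_tested (Y := fun r => nDot (n r) (u r)) norm_le_of_schwartz_tested ?_ (S.cont_nDot ht)
  filter_upwards [Ioo_mem_nhds ht.1 ht.2] with τ hτ
  rintro _ ⟨φ, rfl⟩
  have h := S.sol.mass τ hτ φ
  simp_rw [inner_toLp]
  convert! h using 1
  rw [← inner_toLp, nDot_eq, inner_neg_left, sum_inner, ← Finset.sum_neg_distrib]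
  refine Finset.sum_congr rfl fun j _ => ?_
  rw [(S.FD_flux (mem_Ico hτ) j j).inner_ibp (FD_schwartz φ (ev j)), neg_neg, inner_toLp_deriv]
  refine integral_congr_ae ?_
  filter_upwards [Lp.coeFn_add (u τ j) (mulL (n τ) (u τ j)), (S.nice_n (mem_Ico hτ)).1.coe_mulL (u τ j)]
    with x h1 h2
  rw [flux, h1, Pi.add_apply, h2]

/-- The Bernoulli pressure `n + n²/2 + |u|²/2`. -/
lemma FD_pressure (S : Setup σ s T n u α) {t : ℝ} (ht : t ∈ Ico 0 T) (j : Fin 3) :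
    FD (ev j) (n t + (1 / 2 : ℝ) • (mulL (n t) (n t)) + (1 / 2 : ℝ) • ∑ k, mulL (u t k) (u t k))
      ((par j (n t) + mulL (n t) (par j (n t))) + ∑ k, mulL (u t k) (par j (u t k))) := by
  have h1 := ((S.FD_n ht j).mulL (S.FD_n ht j) (S.nice_n ht) (S.nice_n ht)).smul (1 / 2)
  have h2 := fun k => ((S.FD_u ht k j).mulL (S.FD_u ht k j) (S.nice_u ht k) (S.nice_u ht k)).smul (1 / 2)
  have half : ∀ f : L2R, (1 / 2 : ℝ) • (f + f) = f := fun f => by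
    rw [← two_smul ℝ f, smul_smul]; norm_num
  simp_rw [half] at h1 h2
  rw [Fin.sum_univ_three, Fin.sum_univ_three, smul_add, smul_add]
  exact ((S.FD_n ht j).add h1).add (((h2 0).add (h2 1)).add (h2 2))

lemma hasDerivAt_u (S : Setup σ s T n u α) {t : ℝ} (ht : t ∈ Ioo 0 T) (j : Fin 3) :
    HasDerivAt (fun r => u r j) (uDot σ (n t) (u t) j) t := by
  refine hasDerivAt_of_tested (Y := fun r => uDot σ (n r) (u r) j) norm_le_of_schwartz_tested ?_ (S.cont_uDot ht j)
  filter_upwards [Ioo_mem_nhds ht.1 ht.2] with τ hτ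
  rintro _ ⟨φ, rfl⟩
  have hτ' := mem_Ico hτ
  obtain ⟨F, hF, hd⟩ := S.sol.momentum τ hτ j
  have h := hd φ
  have hFeq : F = mult (rsymb σ j) (n τ) := by
    refine cplx_injective (fourier_injective ?_)
    filter_upwards [hF, S.riesz hτ' j] with ξ h1 h2
    rw [h1, h2, rsymb, dsymb, real_inner_comm, inner_ev]
  simp_rw [inner_toLp]
  convert! h using 1
  rw [← inner_toLp, ← inner_toLp, uDot, inner_neg_left, inner_add_left,
    (S.FD_pressure hτ' j).inner_ibp (FD_schwartz φ (ev j)), inner_toLp_deriv, hFeq]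
  have e : ∫ x, (n τ + (1 / 2 : ℝ) • (mulL (n τ) (n τ)) + (1 / 2 : ℝ) • ∑ k, mulL (u τ k) (u τ k) : L2R) x
        * pderiv j φ x
      = ∫ x, (n τ x + (n τ x) ^ 2 / 2 + (∑ k, (u τ k x) ^ 2) / 2) * pderiv j φ x := by
    refine integral_congr_ae ?_
    have hs : ∀ᵐ x, ∀ k, mulL (u τ k) (u τ k) x = u τ k x * u τ k x :=
      ae_all_iff.2 fun k => (S.nice_u hτ' k).1.coe_mulL (u τ k)
    filter_upwards [hs, (S.nice_n hτ').1.coe_mulL (n τ),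
      Lp.coeFn_add (n τ + (1 / 2 : ℝ) • (mulL (n τ) (n τ))) ((1 / 2 : ℝ) • ∑ k, mulL (u τ k) (u τ k)),
      Lp.coeFn_add (n τ) ((1 / 2 : ℝ) • (mulL (n τ) (n τ))), Lp.coeFn_smul (1 / 2 : ℝ) (mulL (n τ) (n τ)),
      Lp.coeFn_smul (1 / 2 : ℝ) (∑ k, mulL (u τ k) (u τ k)),
      Lp.coeFn_finsetSum (Finset.univ) fun k => mulL (u τ k) (u τ k)] with x h1 h2 h3 h4 h5 h6 h7
    rw [h3, Pi.add_apply, h4, Pi.add_apply, h5, h6, Pi.smul_apply, Pi.smul_apply, h7, h2]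
    simp only [Finset.sum_apply, h1, smul_eq_mul]
    congr 1
    simp_rw [sq]
    ring
  rw [e]; ring

end Setup

lemma inner_vsymb_comm {σ : ℝ} {a a' b b' : L2R}
    (ha : (𝓕 (cplx a') : L2C) =ᵐ[volume] fun ξ => vsymb σ ξ * (𝓕 (cplx a) : L2C) ξ)
    (hb : (𝓕 (cplx b') : L2C) =ᵐ[volume] fun ξ => vsymb σ ξ * (𝓕 (cplx b) : L2C) ξ) :
    inner ℝ a' b = inner ℝ a b' := by
  have : ((inner ℝ a' b : ℝ) : ℂ) = ((inner ℝ a b' : ℝ) : ℂ) := by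
    rw [inner_fourier, inner_fourier]
    refine integral_congr_ae ?_
    filter_upwards [ha, hb] with ξ h1 h2
    rw [h1, h2, map_mul, vsymb, Complex.conj_ofReal]; ring
  exact_mod_cast this

lemma norm_le_of_domain_tested (σ : ℝ) (f : L2R) (c : ℝ) (hc : 0 ≤ c)
    (h : ∀ ψ ∈ {ψ : L2R | ∃ χ : L2R, (𝓕 (cplx χ) : L2C) =ᵐ[volume] fun ξ => vsymb σ ξ * (𝓕 (cplx ψ) : L2C) ξ},
      |inner ℝ f ψ| ≤ c * ‖ψ‖) : ‖f‖ ≤ c := by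
  let μ : ℕ → E3 → ℂ := fun j ξ => if 1 / ((j : ℝ) + 1) < freq ξ ∧ freq ξ < j + 1 then 1 else 0
  have hset : ∀ j : ℕ, MeasurableSet {ξ : E3 | 1 / ((j : ℝ) + 1) < freq ξ ∧ freq ξ < j + 1} := fun j =>
    (measurableSet_lt measurable_const measurable_freq).inter (measurableSet_lt measurable_freq measurable_const)
  have hm : ∀ j, Measurable (μ j) := fun j => Measurable.ite (hset j) measurable_const measurable_const
  have hherm : ∀ j ξ, μ j (-ξ) = (starRingEnd ℂ) (μ j ξ) := fun j ξ => by
    simp only [μ, freq_neg]; split_ifs <;> simp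
  have hμ1 : ∀ j ξ, ‖μ j ξ‖ ≤ 1 := fun j ξ => by simp only [μ]; split_ifs <;> simp
  choose ψ hψ using fun j => exists_real_multiplier (μ j) f (hherm j)
    (memLp_bdd_mul (hm j).aestronglyMeasurable (hμ1 j) _)
  have hdom : ∀ j, ∃ χ : L2R, (𝓕 (cplx χ) : L2C) =ᵐ[volume] fun ξ => vsymb σ ξ * (𝓕 (cplx (ψ j)) : L2C) ξ := by
    intro j
    have hb : ∀ ξ, ‖vsymb σ ξ * μ j ξ‖ ≤ max (((j : ℝ) + 1) ^ (-σ / 2)) ((1 / ((j : ℝ) + 1)) ^ (-σ / 2)) := by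
      intro ξ
      simp only [μ]
      split_ifs with hh
      · rw [mul_one, vsymb, Complex.norm_real, Real.norm_of_nonneg (Real.rpow_nonneg (freq_nonneg ξ) _)]
        have hp : (0 : ℝ) < 1 / ((j : ℝ) + 1) := by positivity
        rcases le_total 0 (-σ / 2) with h0 | h0
        · exact (Real.rpow_le_rpow (freq_nonneg ξ) hh.2.le h0).trans (le_max_left _ _)
        · exact (Real.rpow_le_rpow_of_nonpos hp hh.1.le h0).trans (le_max_right _ _)
      · rw [mul_zero, norm_zero]; positivity
    obtain ⟨χ, hχ⟩ := exists_real_multiplier (fun ξ => vsymb σ ξ * μ j ξ) f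
      (fun ξ => by rw [map_mul, vsymb_neg, hherm])
      (memLp_bdd_mul ((measurable_vsymb σ).mul (hm j)).aestronglyMeasurable hb _)
    refine ⟨χ, ?_⟩
    filter_upwards [hχ, hψ j] with ξ h1 h2
    rw [h1, h2]; ring
  have hin : ∀ j, inner ℝ f (ψ j) = ‖ψ j‖ ^ 2 := by
    intro j
    have : ((inner ℝ f (ψ j) : ℝ) : ℂ) = ((inner ℝ (ψ j) (ψ j) : ℝ) : ℂ) := by
      rw [inner_fourier, inner_fourier]
      refine integral_congr_ae ?_
      filter_upwards [hψ j] with ξ h1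
      rw [h1]
      simp only [μ]; split_ifs <;> simp
    rw [← real_inner_self_eq_norm_sq]
    exact_mod_cast this
  have hle : ∀ j, ‖ψ j‖ ≤ c := by
    intro j
    have := h (ψ j) (hdom j)
    rw [hin, abs_of_nonneg (by positivity)] at this
    rcases eq_or_lt_of_le (norm_nonneg (ψ j)) with h0 | h0
    · rw [← h0]; exact hc
    · nlinarith
  have hlim : Tendsto (fun j => ENNReal.ofReal (‖ψ j‖ ^ 2)) atTop (𝓝 (ENNReal.ofReal (‖f‖ ^ 2))) := by
    have e : ENNReal.ofReal (‖f‖ ^ 2) = ∫⁻ ξ, ‖(1 : ℂ)‖ₑ ^ 2 * ‖(𝓕 (cplx f) : L2C) ξ‖ₑ ^ 2 := by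
      rw [← lintegral_sq_of_fourier (μ := fun _ => 1) (f := f) (g := f) (by simp)]
    rw [e]
    simp_rw [fun j => lintegral_sq_of_fourier (hψ j)]
    refine tendsto_lintegral_of_dominated_convergence' (fun ξ => ‖(𝓕 (cplx f) : L2C) ξ‖ₑ ^ 2) (fun j => ?_)
      (fun j => .of_forall fun ξ => ?_) ?_ ?_
    · exact ((hm j).enorm.pow_const 2).aemeasurable.mul
        ((Lp.aestronglyMeasurable (𝓕 (cplx f) : L2C)).enorm.pow_const 2)
    · refine mul_le_of_le_one_left' ?_
      simp only [μ]; split_ifs <;> simp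
    · rw [lintegral_fourier_cplx, lintegral_enorm_sq]; exact ENNReal.ofReal_ne_top
    · filter_upwards [ae_ne_zero] with ξ hξ
      have h1 := (tendsto_one_div_add_atTop_nhds_zero_nat (𝕜 := ℝ)).eventually_lt_const (freq_pos hξ)
      have h2 : ∀ᶠ j : ℕ in atTop, freq ξ < (j : ℝ) + 1 := by
        filter_upwards [(tendsto_natCast_atTop_atTop (R := ℝ)).eventually_gt_atTop (freq ξ)] with j hj
        linarith
      refine tendsto_const_nhds.congr' ?_
      filter_upwards [h1, h2] with j a1 a2
      simp only [μ]
      rw [if_pos ⟨a1, a2⟩]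
  have h3 := le_of_tendsto' hlim fun j => ENNReal.ofReal_le_ofReal (pow_le_pow_left₀ (norm_nonneg _) (hle j) 2)
  rw [ENNReal.ofReal_le_ofReal_iff (by positivity)] at h3
  exact (pow_le_pow_iff_left₀ (norm_nonneg _) hc two_ne_zero).1 h3

lemma freq_sq_eq (ξ : E3) : freq ξ ^ 2 = ∑ k, ‖dsymb (ev k) ξ‖ ^ 2 := by
  have e : ∀ k, ‖dsymb (ev k) ξ‖ ^ 2 = (2 * Real.pi) ^ 2 * (ξ k) ^ 2 := by
    intro k
    rw [dsymb, real_inner_comm, inner_ev, norm_mul, Complex.norm_I, mul_one, Complex.norm_real, Real.norm_eq_abs,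
      sq_abs, mul_pow]
  simp_rw [e, ← Finset.mul_sum, ← EuclideanSpace.real_norm_sq_eq, freq, mul_pow]

lemma flux_symb_bound {σ : ℝ} (h0 : 0 < σ) (h2 : σ < 2) {q : L2R} {d : Fin 3 → L2R} (hd : ∀ k, FD (ev k) q (d k))
    (j : Fin 3) : ∫⁻ ξ, ‖vsymb σ ξ * dsymb (ev j) ξ‖ₑ ^ 2 * ‖(𝓕 (cplx q) : L2C) ξ‖ₑ ^ 2
      ≤ ENNReal.ofReal (‖q‖ ^ 2 + ∑ k, ‖d k‖ ^ 2) := by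
  have hm : ∀ f : L2R, AEMeasurable (fun ξ => ‖(𝓕 (cplx f) : L2C) ξ‖ₑ ^ 2) volume := fun f =>
    (Lp.aestronglyMeasurable (𝓕 (cplx f) : L2C)).enorm.pow_const 2
  rw [ENNReal.ofReal_add (by positivity) (by positivity), ENNReal.ofReal_sum_of_nonneg fun _ _ => by positivity]
  simp_rw [← lintegral_enorm_sq, ← lintegral_fourier_cplx]
  rw [← lintegral_finsetSum' _ fun k _ => hm (d k), ← lintegral_add_left' (hm q)]
  refine lintegral_mono_ae ?_
  filter_upwards [ae_all_iff.2 hd, ae_ne_zero] with ξ h1 hξ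
  have hf := freq_pos hξ
  simp_rw [h1, enorm_mul, mul_pow, ← Finset.sum_mul]
  rw [← one_add_mul]
  gcongr
  simp_rw [enorm_sq_eq]
  rw [← ENNReal.ofReal_sum_of_nonneg fun _ _ => by positivity, ← freq_sq_eq, norm_vsymb_sq,
    ← ENNReal.ofReal_one, ← ENNReal.ofReal_add zero_le_one (by positivity), ← ENNReal.ofReal_mul (by positivity)]
  refine ENNReal.ofReal_le_ofReal ?_
  calc freq ξ ^ (-σ) * ‖dsymb (ev j) ξ‖ ^ 2 ≤ freq ξ ^ (-σ) * freq ξ ^ (2 : ℝ) := by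
        rw [Real.rpow_two]; gcongr; exact norm_dsymb_ev_le j ξ
    _ = freq ξ ^ (2 - σ) := by rw [← Real.rpow_add hf]; congr 1; ring
    _ ≤ (1 + freq ξ ^ 2) ^ (1 : ℝ) := freq_rpow_le_japanese (by linarith) (by linarith) ξ
    _ = _ := Real.rpow_one _

namespace Setup

variable {σ s T : ℝ} {n : ℝ → L2R} {u : ℝ → Fin 3 → L2R} {α : ℝ → L2C}

lemma flux_symb (S : Setup σ s T n u α) {t : ℝ} (ht : t ∈ Ico 0 T) (j : Fin 3) :
    (𝓕 (cplx (mult (fun ξ => vsymb σ ξ * dsymb (ev j) ξ) (flux (n t) (u t) j))) : L2C)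
      =ᵐ[volume] fun ξ => vsymb σ ξ * dsymb (ev j) ξ * (𝓕 (cplx (flux (n t) (u t) j)) : L2C) ξ :=
  mult_spec ((measurable_vsymb σ).mul (measurable_dsymb _))
    (fun ξ => by rw [map_mul, vsymb_neg, dsymb_neg])
    (ne_top_of_le_ne_top ENNReal.ofReal_ne_top (flux_symb_bound S.pos S.lt_two (S.FD_flux ht j) j))

lemma fourier_neg_sum {μ : E3 → ℂ} {f g : Fin 3 → L2R}
    (h : ∀ j, (𝓕 (cplx (g j)) : L2C) =ᵐ[volume] fun ξ => μ ξ * (𝓕 (cplx (f j)) : L2C) ξ) :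
    (𝓕 (cplx (-∑ j, g j)) : L2C) =ᵐ[volume] fun ξ => μ ξ * (𝓕 (cplx (-∑ j, f j)) : L2C) ξ := by
  have e : ∀ f : Fin 3 → L2R, (𝓕 (cplx (-∑ j, f j)) : L2C) =ᵐ[volume]
      fun ξ => -∑ j, (𝓕 (cplx (f j)) : L2C) ξ := by
    intro f
    have h1 : -∑ j, f j = (-1 : ℝ) • ((f 0 + f 1) + f 2) := by rw [Fin.sum_univ_three, neg_one_smul]
    rw [h1]
    filter_upwards [fourier_cplx_smul (-1) (f 0 + f 1 + f 2), fourier_cplx_add (f 0 + f 1) (f 2),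
      fourier_cplx_add (f 0) (f 1)] with ξ a1 a2 a3
    rw [a1, a2, a3, Fin.sum_univ_three]; push_cast; ring
  filter_upwards [e f, e g, ae_all_iff.2 h] with ξ h1 h2 h3
  rw [h1, h2]
  simp_rw [h3, ← Finset.mul_sum]
  ring

lemma fourier_vDot (S : Setup σ s T n u α) {t : ℝ} (ht : t ∈ Ico 0 T) :
    (𝓕 (cplx (vDot σ (n t) (u t))) : L2C) =ᵐ[volume] fun ξ => vsymb σ ξ * (𝓕 (cplx (nDot (n t) (u t))) : L2C) ξ := by
  rw [vDot, nDot_eq]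
  refine fourier_neg_sum fun j => ?_
  filter_upwards [S.flux_symb ht j, S.FD_flux ht j j] with ξ h1 h2
  rw [h1, h2, mul_assoc]

lemma cont_vDot (S : Setup σ s T n u α) {t : ℝ} (ht : t ∈ Ioo 0 T) :
    ContinuousAt (fun r => vDot σ (n r) (u r)) t := by
  refine (tendsto_finsetSum _ fun j _ => ?_).neg
  have ht' := mem_Ico ht
  rw [tendsto_iff_norm_sub_tendsto_zero]
  have hb : Tendsto (fun r => √(‖flux (n r) (u r) j - flux (n t) (u t) j‖ ^ 2
      + ∑ k, ‖fluxD (n r) (u r) j k - fluxD (n t) (u t) j k‖ ^ 2)) (𝓝 t) (𝓝 0) := by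
    have h1 := (tendsto_iff_norm_sub_tendsto_zero.1 (S.cont_flux ht j)).pow 2
    have h2 := tendsto_finsetSum (Finset.univ : Finset (Fin 3)) fun k _ =>
      (tendsto_iff_norm_sub_tendsto_zero.1 (S.cont_fluxD ht j k)).pow 2
    simpa using (h1.add h2).sqrt
  refine squeeze_zero' (.of_forall fun _ => norm_nonneg _) ?_ hb
  filter_upwards [Ioo_mem_nhds ht.1 ht.2] with r hr
  refine Real.le_sqrt_of_sq_le ?_
  rw [← ENNReal.ofReal_le_ofReal_iff (by positivity)]
  rw [lintegral_sq_of_fourier (fourier_sub_of (S.flux_symb (mem_Ico hr) j) (S.flux_symb ht' j))]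
  exact flux_symb_bound S.pos S.lt_two (fun k => (S.FD_flux (mem_Ico hr) j k).sub (S.FD_flux ht' j k)) j

lemma hasDerivAt_v (S : Setup σ s T n u α) {t : ℝ} (ht : t ∈ Ioo 0 T) :
    HasDerivAt (fun r => mult (vsymb σ) (n r)) (vDot σ (n t) (u t)) t := by
  refine hasDerivAt_of_tested (Y := fun r => vDot σ (n r) (u r)) (norm_le_of_domain_tested σ) ?_ (S.cont_vDot ht)
  filter_upwards [Ioo_mem_nhds ht.1 ht.2] with τ hτ
  rintro ψ ⟨χ, hχ⟩
  have h := (S.hasDerivAt_n hτ).inner ℝ (hasDerivAt_const τ χ)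
  rw [inner_zero_right, zero_add] at h
  rw [inner_vsymb_comm (S.fourier_vDot (mem_Ico hτ)) hχ]
  refine h.congr_of_eventuallyEq ?_
  filter_upwards [Ioo_mem_nhds hτ.1 hτ.2] with r hr
  exact inner_vsymb_comm (S.vel (mem_Ico hr)) hχ

end Setup

end EulerRiesz
end

noncomputable section

namespace EulerRiesz

/-- The commutator of the `m`-th difference with the multiplication by `f`. -/
def cm (h : E3) (m : ℕ) (f g : L2R) : L2R := (dl h ^ m) (mulL f g) - mulL f ((dl h ^ m) g)

lemma dl_mulL_eq (h : E3) (m : ℕ) (f g : L2R) :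
    (dl h ^ m) (mulL f g) = mulL f ((dl h ^ m) g) + cm h m f g := by rw [cm]; abel

lemma fourier_dl_of {μ : E3 → ℂ} {f g : L2R} (h : E3) (m : ℕ)
    (hg : (𝓕 (cplx g) : L2C) =ᵐ[volume] fun ξ => μ ξ * (𝓕 (cplx f) : L2C) ξ) :
    (𝓕 (cplx ((dl h ^ m) g)) : L2C) =ᵐ[volume] fun ξ => μ ξ * (𝓕 (cplx ((dl h ^ m) f)) : L2C) ξ := by
  filter_upwards [hg, fourier_dl_pow h m g, fourier_dl_pow h m f] with ξ h1 h2 h3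
  rw [h2, h3, h1]; ring

/-- The derivative of a weighted energy. -/
lemma hasDerivAt_weighted {n w : ℝ → L2R} {t : ℝ} {nt w' : L2R} (hn : HasDerivAt n nt t) (hw : HasDerivAt w w' t)
    (bn : ∀ᶠ r in 𝓝 t, Bdd (n r)) (bw : Bdd (w t)) (cn : SupCont n t) :
    HasDerivAt (fun r => inner ℝ (w r + mulL (n r) (w r)) (w r))
      (2 * inner ℝ (w t + mulL (n t) (w t)) w' + inner ℝ (mulL nt (w t)) (w t)) t := by
  have b0 := bn.self_of_nhds
  have hP : HasDerivAt (fun r => mulL (n r) (w r)) (mulL (n t) w' + mulL nt (w t)) t := by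
    refine hasDerivAt_mul_curve (F := n) (G := w) (bn.mono fun r hr => hr.coe_mulL _) hn hw b0 bw cn ?_
    filter_upwards [Lp.coeFn_add (mulL (n t) w') (mulL nt (w t)), b0.coe_mulL w', bw.coe_mulL nt] with x h1 h2 h3
    rw [h1, Pi.add_apply, h2, mulL_comm nt, h3]; ring
  have := (hw.add hP).inner ℝ hw
  refine this.congr_deriv ?_
  have e1 := real_inner_comm w' (w t)
  have e2 := real_inner_comm w' (mulL (n t) (w t))
  simp only [Pi.add_apply, inner_add_left, inner_mulL b0 w']
  linarith

/-- The energy of the differences of order `m`. -/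
def energy (σ : ℝ) (m : ℕ) (h : E3) (n : L2R) (u : Fin 3 → L2R) : ℝ :=
  (1 / 2) * (inner ℝ ((dl h ^ m) n + mulL n ((dl h ^ m) n)) ((dl h ^ m) n)
    + ∑ j, inner ℝ ((dl h ^ m) (u j) + mulL n ((dl h ^ m) (u j))) ((dl h ^ m) (u j))
    + ‖(dl h ^ m) (mult (vsymb σ) n)‖ ^ 2)

/-- The time derivative of the energy. -/
def energyD (σ : ℝ) (m : ℕ) (h : E3) (n : L2R) (u : Fin 3 → L2R) : ℝ :=
  inner ℝ ((dl h ^ m) n + mulL n ((dl h ^ m) n)) ((dl h ^ m) (nDot n u))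
    + ∑ j, inner ℝ ((dl h ^ m) (u j) + mulL n ((dl h ^ m) (u j))) ((dl h ^ m) (uDot σ n u j))
    + (1 / 2) * (inner ℝ (mulL (nDot n u) ((dl h ^ m) n)) ((dl h ^ m) n)
      + ∑ j, inner ℝ (mulL (nDot n u) ((dl h ^ m) (u j))) ((dl h ^ m) (u j)))
    + inner ℝ ((dl h ^ m) (mult (vsymb σ) n)) ((dl h ^ m) (vDot σ n u))

/-- `|∇|^{-σ} D n` for a difference `D`. -/
def pot (σ : ℝ) (m : ℕ) (h : E3) (n : L2R) : L2R := mult (vsymb σ) ((dl h ^ m) (mult (vsymb σ) n))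

def res0 (m : ℕ) (h : E3) (n : L2R) (u : Fin 3 → L2R) : L2R :=
  ∑ j, (cm h m (u j) (par j n) + cm h m n (par j (u j)))

def res (m : ℕ) (h : E3) (n : L2R) (u : Fin 3 → L2R) (j : Fin 3) : L2R :=
  cm h m n (par j n) + ∑ k, cm h m (u k) (par j (u k))

namespace Setup

variable {σ s T : ℝ} {n : ℝ → L2R} {u : ℝ → Fin 3 → L2R} {α : ℝ → L2C}

lemma hasDerivAt_energy (S : Setup σ s T n u α) {t : ℝ} (ht : t ∈ Ioo 0 T) (m : ℕ) (h : E3) :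
    HasDerivAt (fun r => energy σ m h (n r) (u r)) (energyD σ m h (n t) (u t)) t := by
  have ht' := mem_Ico ht
  have bn : ∀ᶠ r in 𝓝 t, Bdd (n r) := by
    filter_upwards [Ioo_mem_nhds ht.1 ht.2] with r hr
    exact (S.nice_n (mem_Ico hr)).1
  have d0 := hasDerivAt_weighted (S.hasDerivAt_n ht) ((dl h ^ m).hasFDerivAt.comp_hasDerivAt t (S.hasDerivAt_n ht))
    bn ((S.nice_n ht').dl_pow h m).1 (S.supCont_n ht)
  have d1 := fun j => hasDerivAt_weighted (S.hasDerivAt_n ht)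
    ((dl h ^ m).hasFDerivAt.comp_hasDerivAt t (S.hasDerivAt_u ht j)) bn ((S.nice_u ht' j).dl_pow h m).1 (S.supCont_n ht)
  have d2 := ((dl h ^ m).hasFDerivAt.comp_hasDerivAt t (S.hasDerivAt_v ht)).norm_sq
  have := ((d0.add (HasDerivAt.fun_sum fun j (_ : j ∈ Finset.univ) => d1 j)).add d2).const_mul (1 / 2 : ℝ)
  refine this.congr_deriv ?_
  simp only [Function.comp_apply, energyD, Fin.sum_univ_three]
  ring

lemma pot_spec (S : Setup σ s T n u α) {t : ℝ} (ht : t ∈ Ico 0 T) {m : ℕ} (hm : 1 ≤ m) (h : E3) :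
    (𝓕 (cplx (pot σ m h (n t))) : L2C)
      =ᵐ[volume] fun ξ => vsymb σ ξ * (𝓕 (cplx ((dl h ^ m) (mult (vsymb σ) (n t)))) : L2C) ξ := by
  refine mult_spec (measurable_vsymb σ) (vsymb_neg σ) ?_
  obtain ⟨k, rfl⟩ : ∃ k, m = k + 1 := ⟨m - 1, by omega⟩
  have e : ∀ᵐ ξ, ‖vsymb σ ξ‖ₑ ^ 2 * ‖(𝓕 (cplx ((dl h ^ (k + 1)) (mult (vsymb σ) (n t)))) : L2C) ξ‖ₑ ^ 2
      = ‖vsymb σ ξ * (trSymb h ξ - 1) ^ (k + 1) * vsymb σ ξ‖ₑ ^ 2 * ‖(𝓕 (cplx (n t)) : L2C) ξ‖ₑ ^ 2 := by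
    filter_upwards [fourier_dl_pow h (k + 1) (mult (vsymb σ) (n t)), S.vel ht] with ξ h1 h2
    rw [h1, h2]
    simp only [enorm_mul, mul_pow]
    ring
  rw [lintegral_congr_ae e]
  refine ne_top_of_le_ne_top ?_ ((S.comp t ht).lintegral_n_le (2 * s) (c := (2 ^ k * ‖h‖) ^ 2) (by positivity) ?_)
  · exact ENNReal.mul_ne_top ENNReal.ofReal_ne_top (ENNReal.pow_ne_top (S.fin t ht))
  · intro ξ hξ
    have hf := freq_pos hξ
    simp only [norm_mul, mul_pow, norm_pow, norm_vsymb_sq]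
    have h1 : ‖trSymb h ξ - 1‖ ≤ ‖h‖ * freq ξ := (norm_trSymb_sub_one_le h ξ).trans (norm_dsymb_le h ξ)
    have h2 := norm_trSymb_sub_one_le_two h ξ
    have h3 : ‖trSymb h ξ - 1‖ ^ (k + 1) ≤ 2 ^ k * (‖h‖ * freq ξ) := by rw [pow_succ]; gcongr
    have h4 : freq ξ ^ 2 * freq ξ ^ (-σ) ≤ (1 + freq ξ ^ 2) ^ (2 * s) := by
      rw [← Real.rpow_two, ← Real.rpow_add hf, Real.rpow_two]
      exact freq_rpow_le_japanese (by linarith [S.lt_two]) (by linarith [S.pos, S.one_lt]) ξ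
    have h5 : 0 ≤ freq ξ ^ (-σ) := by positivity
    calc freq ξ ^ (-σ) * (‖trSymb h ξ - 1‖ ^ (k + 1)) ^ 2 * freq ξ ^ (-σ)
        ≤ freq ξ ^ (-σ) * (2 ^ k * (‖h‖ * freq ξ)) ^ 2 * freq ξ ^ (-σ) := by gcongr
      _ = (2 ^ k * ‖h‖) ^ 2 * ((freq ξ ^ 2 * freq ξ ^ (-σ)) * freq ξ ^ (-σ)) := by ring
      _ ≤ (2 ^ k * ‖h‖) ^ 2 * ((1 + freq ξ ^ 2) ^ (2 * s) * (1 + freq ξ ^ (-σ))) := by gcongr; linarith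
      _ = _ := by ring

lemma pot_FD (S : Setup σ s T n u α) {t : ℝ} (ht : t ∈ Ico 0 T) {m : ℕ} (hm : 1 ≤ m) (h : E3) (j : Fin 3) :
    FD (ev j) (pot σ m h (n t)) ((dl h ^ m) (mult (rsymb σ j) (n t))) := by
  filter_upwards [S.pot_spec ht hm h, fourier_dl_pow h m (mult (vsymb σ) (n t)), S.vel ht,
    fourier_dl_pow h m (mult (rsymb σ j) (n t)), S.riesz ht j, ae_ne_zero] with ξ h1 h2 h3 h4 h5 hξ
  have e : vsymb σ ξ * vsymb σ ξ = ((freq ξ ^ (-σ) : ℝ) : ℂ) := by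
    rw [vsymb, ← Complex.ofReal_mul, ← Real.rpow_add (freq_pos hξ)]; congr 2; ring
  rw [h1, h2, h3, h4, h5, rsymb, ← e]
  ring

end Setup

section Rearrange

variable {E : Type*} [NormedAddCommGroup E] [NormedSpace ℝ E]

lemma map_mass (D : E →L[ℝ] E) {a b c a' b' c' e e' : Fin 3 → E} {x : E} (hx : x = -∑ j, (a j + b j + c j))
    (ha : ∀ j, D (a j) = a' j + e j) (hb : ∀ j, D (b j) = b' j) (hc : ∀ j, D (c j) = c' j + e' j) :
    D x = -∑ j, (a' j + (b' j + c' j)) - ∑ j, (e j + e' j) := by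
  rw [hx, map_neg, map_sum, ← neg_add', ← Finset.sum_add_distrib]
  refine congrArg _ (Finset.sum_congr rfl fun j _ => ?_)
  rw [map_add, map_add, ha, hb, hc]
  abel

lemma map_momentum (D : E →L[ℝ] E) {x a b d a' b' d' e : E} {c c' f : Fin 3 → E}
    (hx : x = -((a + b) + ∑ k, c k + d)) (ha : D a = a') (hb : D b = b' + e) (hc : ∀ k, D (c k) = c' k + f k)
    (hd : D d = d') :
    D x = -((a' + b') + ∑ k, c' k + d') - (e + ∑ k, f k) := by
  rw [hx, map_neg, map_add, map_add, map_add, map_sum, ha, hb, hd]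
  simp_rw [hc, Finset.sum_add_distrib]
  abel

end Rearrange

lemma dl_nDot (m : ℕ) (h : E3) (n : L2R) (u : Fin 3 → L2R) :
    (dl h ^ m) (nDot n u) = -∑ j, (mulL (u j) ((dl h ^ m) (par j n)) + ((dl h ^ m) (par j (u j))
      + mulL n ((dl h ^ m) (par j (u j))))) - res0 m h n u :=
  map_mass (dl h ^ m) (nDot.eq_1 n u) (fun j => dl_mulL_eq h m (u j) (par j n)) (fun _ => rfl)
    (fun j => dl_mulL_eq h m n (par j (u j)))

lemma dl_uDot {σ : ℝ} (m : ℕ) (h : E3) (n : L2R) (u : Fin 3 → L2R) (hc : ∀ j k, par k (u j) = par j (u k))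
    (j : Fin 3) :
    (dl h ^ m) (uDot σ n u j) = -(((dl h ^ m) (par j n) + mulL n ((dl h ^ m) (par j n)))
      + ∑ k, mulL (u k) ((dl h ^ m) (par k (u j))) + (dl h ^ m) (mult (rsymb σ j) n)) - res m h n u j :=
  map_momentum (dl h ^ m) (uDot.eq_1 σ n u j) rfl (dl_mulL_eq h m n (par j n))
    (fun k => (dl_mulL_eq h m (u k) (par j (u k))).trans (by rw [hc j k])) rfl

/-- The sum of the squares in the energy of differences. -/
def sqSum (σ : ℝ) (m : ℕ) (h : E3) (n : L2R) (u : Fin 3 → L2R) : ℝ :=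
  ‖(dl h ^ m) n‖ ^ 2 + ∑ j, ‖(dl h ^ m) (u j)‖ ^ 2 + ‖(dl h ^ m) (mult (vsymb σ) n)‖ ^ 2

lemma energy_bounds {σ : ℝ} (m : ℕ) (h : E3) {n : L2R} (hn : ∀ᵐ x, ‖n x‖ ≤ 1 / 2) (u : Fin 3 → L2R) :
    (1 / 4) * sqSum σ m h n u ≤ energy σ m h n u ∧ energy σ m h n u ≤ sqSum σ m h n u := by
  have hw : ∀ w : L2R, (1 / 2) * ‖w‖ ^ 2 ≤ inner ℝ (w + mulL n w) w ∧ inner ℝ (w + mulL n w) w ≤ (3 / 2) * ‖w‖ ^ 2 := by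
    intro w
    have := abs_inner_mulL_le hn w w
    rw [abs_le] at this
    rw [inner_add_left, real_inner_self_eq_norm_sq]
    constructor <;> nlinarith
  have h0 := hw ((dl h ^ m) n)
  have h1 := hw ((dl h ^ m) (u 0))
  have h2 := hw ((dl h ^ m) (u 1))
  have h3 := hw ((dl h ^ m) (u 2))
  have h4 := sq_nonneg ‖(dl h ^ m) (mult (vsymb σ) n)‖
  have p0 := sq_nonneg ‖(dl h ^ m) n‖
  have p1 := sq_nonneg ‖(dl h ^ m) (u 0)‖
  have p2 := sq_nonneg ‖(dl h ^ m) (u 1)‖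
  have p3 := sq_nonneg ‖(dl h ^ m) (u 2)‖
  simp only [sqSum, energy, Fin.sum_univ_three]
  constructor <;> linarith

lemma exists_energyD_bound {σ : ℝ} (h0 : 0 < σ) (h2 : σ < 2) : ∃ C : ℝ, 0 ≤ C ∧
    ∀ (s T : ℝ) (n : ℝ → L2R) (u : ℝ → Fin 3 → L2R) (α : ℝ → L2C), Setup σ s T n u α → ∀ t ∈ Ico 0 T,
    ∀ A : ℝ, 0 < A → (∀ᵐ x, ‖n t x‖ ≤ 1 / 2) → (∀ j, ∀ᵐ x, ‖par j (n t) x‖ ≤ A) → (∀ j, ∀ᵐ x, ‖u t j x‖ ≤ A) →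
    (∀ j k, ∀ᵐ x, ‖par k (u t j) x‖ ≤ A) → ∀ (m : ℕ), 1 ≤ m → ∀ h : E3,
    |energyD σ m h (n t) (u t)| ≤ C * (A * (sqSum σ m h (n t) (u t) + ‖pot σ m h (n t)‖ ^ 2)
      + A⁻¹ * (‖res0 m h (n t) (u t)‖ ^ 2 + ∑ j, ‖res m h (n t) (u t) j‖ ^ 2)) := by
  obtain ⟨c, hc, hR⟩ := exists_riesz_bound h0 h2
  refine ⟨20 + 3 * c, by positivity, fun s T n u α S t ht A hA hn hdn hu hdu m hm h => ?_⟩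
  have nn := S.nice_n ht
  have nu := S.nice_u ht
  have hwd := fun j k => (S.FD_u ht j k).dl_pow h m
  have hw0 := fun k => (S.FD_n ht k).dl_pow h m
  have hv : inner ℝ ((dl h ^ m) (mult (vsymb σ) (n t))) ((dl h ^ m) (vDot σ (n t) (u t)))
      = inner ℝ (pot σ m h (n t)) ((dl h ^ m) (nDot (n t) (u t))) :=
    (inner_vsymb_comm (S.pot_spec ht hm h) (fourier_dl_of h m (S.fourier_vDot ht))).symm
  have key := energy_identity (n := n t) (u := u t) (nd := fun j => par j (n t)) (ud := fun j => par j (u t j))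
    (w0 := (dl h ^ m) (n t)) (w := fun j => (dl h ^ m) (u t j)) (G := pot σ m h (n t)) (R0 := res0 m h (n t) (u t))
    (R := res m h (n t) (u t)) (w0d := fun k => (dl h ^ m) (par k (n t)))
    (Gd := fun j => (dl h ^ m) (mult (rsymb σ j) (n t))) (wd := fun j k => (dl h ^ m) (par k (u t j)))
    nn nu (nn.dl_pow h m) (fun j => (nu j).dl_pow h m) (fun j => S.FD_n ht j) (fun j => S.FD_u ht j j)
    hw0 hwd (fun j => S.pot_FD ht hm h j)
    (nt := nDot (n t) (u t)) (p0 := (dl h ^ m) (nDot (n t) (u t))) (p := fun j => (dl h ^ m) (uDot σ (n t) (u t) j))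
    rfl (dl_nDot m h (n t) (u t)) (fun j => dl_uDot m h (n t) (u t) (S.curl ht) j)
  rw [energyD, hv, key]
  refine (energy_rhs_bound (S := ‖(dl h ^ m) (n t)‖ ^ 2 + ∑ j, ‖(dl h ^ m) (u t j)‖ ^ 2)
    (V := ‖(dl h ^ m) (mult (vsymb σ) (n t))‖ ^ 2) hA hc (by positivity) hn hdn (fun j => hdu j j)
    (fun j => hR j _ _ _ _ _ _ A hA.le hw0 (fourier_dl_of h m (S.vel ht)) (fourier_dl_of h m (S.riesz ht j))
      (S.FD_u ht j) (hu j) (hdu j)) rfl).trans_eq ?_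
  rw [sqSum]; ring

end EulerRiesz
end

noncomputable section

namespace EulerRiesz

lemma continuous_dl_pow (m : ℕ) (f : L2R) : Continuous fun h : E3 => (dl h ^ m) f := by
  induction m with
  | zero => simpa using continuous_const
  | succ k ih =>
    simp_rw [dl_pow_succ]
    refine Continuous.sub ?_ ih
    rw [continuous_iff_continuousAt]
    intro h₀
    unfold ContinuousAt
    rw [tendsto_iff_norm_sub_tendsto_zero]
    have h1 : Tendsto (fun h => ‖(dl h ^ k) f - (dl h₀ ^ k) f‖ + ‖tr h ((dl h₀ ^ k) f) - tr h₀ ((dl h₀ ^ k) f)‖)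
        (𝓝 h₀) (𝓝 (0 + 0)) :=
      (tendsto_iff_norm_sub_tendsto_zero.1 (ih.tendsto h₀)).add
        (tendsto_iff_norm_sub_tendsto_zero.1 ((continuous_tr ((dl h₀ ^ k) f)).tendsto h₀))
    rw [add_zero] at h1
    refine squeeze_zero (fun _ => norm_nonneg _) (fun h => ?_) h1
    rw [← LinearIsometry.norm_map (tr h) ((dl h ^ k) f - (dl h₀ ^ k) f), map_sub]
    exact norm_sub_le_norm_sub_add_norm_sub _ _ _

lemma continuous_mulL {f : L2R} (hf : Bdd f) : Continuous fun g => mulL f g := by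
  obtain ⟨c, hc0, hc⟩ := hf.nonneg_bound
  exact ((mulLin hf).mkContinuous c fun g => norm_mulL_le hc g).continuous

lemma continuous_cm (m : ℕ) {f : L2R} (hf : Bdd f) (g : L2R) : Continuous fun h => cm h m f g :=
  (continuous_dl_pow m _).sub ((continuous_mulL hf).comp (continuous_dl_pow m g))

section Symbol

variable {m : ℕ} {μ : E3 → ℂ} {f : L2R} {X : E3 → L2R}

lemma ofReal_norm_sq_of_fourier_dl
    (hX : ∀ h, (𝓕 (cplx (X h)) : L2C) =ᵐ[volume] fun ξ => (trSymb h ξ - 1) ^ m * (μ ξ * (𝓕 (cplx f) : L2C) ξ)) (h : E3) :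
    ENNReal.ofReal (‖X h‖ ^ 2)
      = ∫⁻ ξ, ‖trSymb h ξ - 1‖ₑ ^ (2 * m) * (‖μ ξ‖ₑ ^ 2 * ‖(𝓕 (cplx f) : L2C) ξ‖ₑ ^ 2) := by
  rw [← lintegral_enorm_sq, ← lintegral_fourier_cplx]
  refine lintegral_congr_ae ?_
  filter_upwards [hX h] with ξ h1
  rw [h1, enorm_mul, enorm_mul, enorm_pow, mul_pow, mul_pow, ← pow_mul, mul_comm m 2]

lemma measurable_fourier_sq (hμ : Measurable μ) (f : L2R) :
    Measurable fun ξ => ‖μ ξ‖ₑ ^ 2 * ‖(𝓕 (cplx f) : L2C) ξ‖ₑ ^ 2 :=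
  (hμ.enorm.pow_const 2).mul ((Lp.stronglyMeasurable (𝓕 (cplx f) : L2C)).measurable.enorm.pow_const 2)

lemma measurable_norm_sq_of_fourier_dl (hμ : Measurable μ)
    (hX : ∀ h, (𝓕 (cplx (X h)) : L2C) =ᵐ[volume] fun ξ => (trSymb h ξ - 1) ^ m * (μ ξ * (𝓕 (cplx f) : L2C) ξ)) :
    Measurable fun h => ENNReal.ofReal (‖X h‖ ^ 2) := by
  simp_rw [ofReal_norm_sq_of_fourier_dl hX]
  refine Measurable.lintegral_prod_right' (f := fun z : E3 × E3 => ‖trSymb z.1 z.2 - 1‖ₑ ^ (2 * m)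
    * (‖μ z.2‖ₑ ^ 2 * ‖(𝓕 (cplx f) : L2C) z.2‖ₑ ^ 2)) ?_
  exact ((continuous_trSymb_uncurry.sub continuous_const).measurable.enorm.pow_const _).mul
    ((measurable_fourier_sq hμ f).comp measurable_snd)

lemma lintegral_nu_of_fourier_dl (a ε : ℝ) (hμ : Measurable μ)
    (hX : ∀ h, (𝓕 (cplx (X h)) : L2C) =ᵐ[volume] fun ξ => (trSymb h ξ - 1) ^ m * (μ ξ * (𝓕 (cplx f) : L2C) ξ)) :
    ∫⁻ h, ENNReal.ofReal (‖X h‖ ^ 2) ∂(nu (2 * a) ε)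
      ≤ diffConst m a * ∫⁻ ξ, ENNReal.ofReal (‖ξ‖ ^ (2 * a)) * (‖μ ξ‖ₑ ^ 2 * ‖(𝓕 (cplx f) : L2C) ξ‖ₑ ^ 2) := by
  rw [← lintegral_dl_pow_kw m a _ (measurable_fourier_sq hμ f)]
  refine (lintegral_nu_le _ _ (measurable_norm_sq_of_fourier_dl hμ hX)).trans_eq ?_
  simp_rw [ofReal_norm_sq_of_fourier_dl hX]

end Symbol

lemma norm_rpow_le_japanese {a b : ℝ} (hb : 0 ≤ b) (hba : b ≤ 2 * a) (ξ : E3) : ‖ξ‖ ^ b ≤ (1 + freq ξ ^ 2) ^ a := by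
  refine (Real.rpow_le_rpow (norm_nonneg ξ) ?_ hb).trans (freq_rpow_le_japanese hb hba ξ)
  rw [freq]
  exact le_mul_of_one_le_left (norm_nonneg ξ) (by linarith [Real.pi_gt_three])

lemma ofReal_sqrt_rpow (b : ℝ) (ξ : E3) : ENNReal.ofReal (‖ξ‖ ^ (2 * b)) = ‖((‖ξ‖ ^ b : ℝ) : ℂ)‖ₑ ^ 2 := by
  rw [enorm_sq_eq, Complex.norm_real, Real.norm_of_nonneg (by positivity), ← Real.rpow_natCast, ← Real.rpow_mul
    (norm_nonneg ξ)]
  congr 2; push_cast; ring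

/-- Weighted `L²` bounds for the components, with a weight `|ξ|^{2b}`. -/
lemma Comp.weight_n_le {σ a b : ℝ} {n : L2R} {u : Fin 3 → L2R} {α : L2C} (hc : Comp σ n u α) {μ : E3 → ℂ}
    (h : ∀ ξ, ξ ≠ 0 → ‖ξ‖ ^ (2 * b) * ‖μ ξ‖ ^ 2 ≤ (1 + freq ξ ^ 2) ^ a * (1 + freq ξ ^ (-σ))) :
    ∫⁻ ξ, ENNReal.ofReal (‖ξ‖ ^ (2 * b)) * (‖μ ξ‖ₑ ^ 2 * ‖(𝓕 (cplx n) : L2C) ξ‖ₑ ^ 2) ≤ hNorm a α ^ 2 := by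
  have := hc.lintegral_n_le a (μ := fun ξ => ((‖ξ‖ ^ b : ℝ) : ℂ) * μ ξ) zero_le_one (fun ξ hξ => by
    rw [norm_mul, mul_pow, Complex.norm_real, Real.norm_of_nonneg (by positivity), ← Real.rpow_natCast (‖ξ‖ ^ b),
      ← Real.rpow_mul (norm_nonneg ξ), one_mul]
    refine le_trans (le_of_eq ?_) (h ξ hξ)
    congr 2; push_cast; ring)
  simp_rw [ofReal_sqrt_rpow, ← mul_assoc, ← mul_pow, ← enorm_mul]
  simpa [mul_pow, enorm_mul] using this

lemma Comp.weight_u_le {σ a b : ℝ} {n : L2R} {u : Fin 3 → L2R} {α : L2C} (hc : Comp σ n u α) (j : Fin 3) {μ : E3 → ℂ}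
    (h : ∀ ξ, ξ ≠ 0 → ‖ξ‖ ^ (2 * b) * ‖μ ξ‖ ^ 2 ≤ (1 + freq ξ ^ 2) ^ a) :
    ∫⁻ ξ, ENNReal.ofReal (‖ξ‖ ^ (2 * b)) * (‖μ ξ‖ₑ ^ 2 * ‖(𝓕 (cplx (u j)) : L2C) ξ‖ₑ ^ 2) ≤ hNorm a α ^ 2 := by
  have := hc.lintegral_u_le a j (μ := fun ξ => ((‖ξ‖ ^ b : ℝ) : ℂ) * μ ξ) zero_le_one (fun ξ hξ => by
    rw [norm_mul, mul_pow, Complex.norm_real, Real.norm_of_nonneg (by positivity), ← Real.rpow_natCast (‖ξ‖ ^ b),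
      ← Real.rpow_mul (norm_nonneg ξ), one_mul]
    refine le_trans (le_of_eq ?_) (h ξ hξ)
    congr 2; push_cast; ring)
  simp_rw [ofReal_sqrt_rpow, ← mul_assoc, ← mul_pow, ← enorm_mul]
  simpa [mul_pow, enorm_mul] using this

/-- Sup bounds for the solution and its first derivatives at a fixed time. -/
structure SupBound (n : L2R) (u : Fin 3 → L2R) (A : ℝ) : Prop where
  pos : 0 < A
  n_half : ∀ᵐ x, ‖n x‖ ≤ 1 / 2
  par_n : ∀ j, ∀ᵐ x, ‖par j n x‖ ≤ A
  u_le : ∀ j, ∀ᵐ x, ‖u j x‖ ≤ A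
  par_u : ∀ j k, ∀ᵐ x, ‖par k (u j) x‖ ≤ A

lemma fourier_dl_one (m : ℕ) (f : L2R) (h : E3) : (𝓕 (cplx ((dl h ^ m) f)) : L2C)
    =ᵐ[volume] fun ξ => (trSymb h ξ - 1) ^ m * ((fun _ => (1 : ℂ)) ξ * (𝓕 (cplx f) : L2C) ξ) := by
  filter_upwards [fourier_dl_pow h m f] with ξ h1
  rw [h1, one_mul]

lemma continuous_sqSum (σ : ℝ) (m : ℕ) (n : L2R) (u : Fin 3 → L2R) : Continuous fun h => sqSum σ m h n u := by
  unfold sqSum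
  have := continuous_dl_pow m n
  have h2 := fun j => continuous_dl_pow m (u j)
  have h3 := continuous_dl_pow m (mult (vsymb σ) n)
  fun_prop

/-- The sum of squares is the square of the norm of the difference of the profile. -/
lemma Comp.ofReal_sqSum {σ : ℝ} {n : L2R} {u : Fin 3 → L2R} {α : L2C} (hc : Comp σ n u α)
    (hv : (𝓕 (cplx (mult (vsymb σ) n)) : L2C) =ᵐ[volume] fun ξ => vsymb σ ξ * (𝓕 (cplx n) : L2C) ξ)
    (m : ℕ) (h : E3) : ENNReal.ofReal (sqSum σ m h n u)
      = ∫⁻ ξ, ‖trSymb h ξ - 1‖ₑ ^ (2 * m) * ‖(𝓕 α : L2C) ξ‖ₑ ^ 2 := by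
  have hW : Measurable fun ξ => ‖trSymb h ξ - 1‖ₑ ^ (2 * m) :=
    ((continuous_trSymb h).sub continuous_const).measurable.enorm.pow_const _
  have hm : ∀ f : L2R, Measurable fun ξ => ‖(𝓕 (cplx f) : L2C) ξ‖ₑ ^ 2 := fun f =>
    (Lp.stronglyMeasurable (𝓕 (cplx f) : L2C)).measurable.enorm.pow_const 2
  rw [hc.lintegral_eq hW fun ξ => by
    rw [trSymb_neg, ← map_one (starRingEnd ℂ), ← map_sub, enorm_eq_nnnorm, RCLike.nnnorm_conj, map_one, enorm_eq_nnnorm]]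
  have e : ∀ f : L2R, ENNReal.ofReal (‖(dl h ^ m) f‖ ^ 2) = ∫⁻ ξ, ‖trSymb h ξ - 1‖ₑ ^ (2 * m) * ‖(𝓕 (cplx f) : L2C) ξ‖ₑ ^ 2 := by
    intro f
    rw [ofReal_norm_sq_of_fourier_dl (fourier_dl_one m f)]
    simp
  rw [sqSum, ENNReal.ofReal_add (by positivity) (by positivity), ENNReal.ofReal_add (by positivity) (by positivity),
    ENNReal.ofReal_sum_of_nonneg fun _ _ => by positivity]
  simp_rw [e]
  have hp : ∀ f : L2R, Measurable fun ξ => ‖trSymb h ξ - 1‖ₑ ^ (2 * m) * ‖(𝓕 (cplx f) : L2C) ξ‖ₑ ^ 2 := fun f =>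
    hW.mul (hm f)
  rw [← lintegral_finsetSum _ fun j _ => hp (u j), ← lintegral_add_left (hp n), ← lintegral_add_right _ (hp _)]
  refine lintegral_congr_ae ?_
  filter_upwards [hv] with ξ h1
  rw [h1, enorm_mul, mul_pow, enorm_sq_eq (vsymb σ ξ), norm_vsymb_sq, ← Finset.mul_sum,
    ENNReal.ofReal_add zero_le_one (Real.rpow_nonneg (freq_nonneg ξ) _), ENNReal.ofReal_one]
  ring

namespace Setup

variable {σ s T : ℝ} {n : ℝ → L2R} {u : ℝ → Fin 3 → L2R} {α : ℝ → L2C}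

lemma lintegral_sqSum (S : Setup σ s T n u α) {t : ℝ} (ht : t ∈ Ico 0 T) (m : ℕ) :
    ∫⁻ h, ENNReal.ofReal (sqSum σ m h (n t) (u t)) * kw (4 * s) h
      = diffConst m (2 * s) * ∫⁻ ξ, ENNReal.ofReal (‖ξ‖ ^ (4 * s)) * ‖(𝓕 (α t) : L2C) ξ‖ₑ ^ 2 := by
  simp_rw [(S.comp t ht).ofReal_sqSum (S.vel ht)]
  rw [show 4 * s = 2 * (2 * s) by ring]
  exact lintegral_dl_pow_kw m (2 * s) _ ((Lp.stronglyMeasurable (𝓕 (α t) : L2C)).measurable.enorm.pow_const 2)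

lemma lintegral_sqSum_nu_le (S : Setup σ s T n u α) {t : ℝ} (ht : t ∈ Ico 0 T) (m : ℕ) (ε : ℝ) :
    ∫⁻ h, ENNReal.ofReal (sqSum σ m h (n t) (u t)) ∂(nu (4 * s) ε) ≤ diffConst m (2 * s) * hNorm (2 * s) (α t) ^ 2 := by
  refine (lintegral_nu_le _ _ (continuous_sqSum σ m _ _).measurable.ennreal_ofReal).trans ?_
  rw [S.lintegral_sqSum ht, hNorm_sq]
  gcongr with ξ
  exact norm_rpow_le_japanese (by linarith [S.one_lt]) (by linarith) ξ

lemma fourier_pot (S : Setup σ s T n u α) {t : ℝ} (ht : t ∈ Ico 0 T) {m : ℕ} (hm : 1 ≤ m) (h : E3) :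
    (𝓕 (cplx (pot σ m h (n t))) : L2C)
      =ᵐ[volume] fun ξ => (trSymb h ξ - 1) ^ m * (vsymb σ ξ ^ 2 * (𝓕 (cplx (n t)) : L2C) ξ) := by
  filter_upwards [S.pot_spec ht hm h, fourier_dl_pow h m (mult (vsymb σ) (n t)), S.vel ht] with ξ h1 h2 h3
  rw [h1, h2, h3]; ring

lemma lintegral_pot_le (S : Setup σ s T n u α) {t : ℝ} (ht : t ∈ Ico 0 T) {m : ℕ} (hm : 1 ≤ m) (ε : ℝ) :
    ∫⁻ h, ENNReal.ofReal (‖pot σ m h (n t)‖ ^ 2) ∂(nu (4 * s) ε) ≤ diffConst m (2 * s) * hNorm (2 * s) (α t) ^ 2 := by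
  rw [show 4 * s = 2 * (2 * s) by ring]
  refine (lintegral_nu_of_fourier_dl (2 * s) ε ((measurable_vsymb σ).pow_const 2) (S.fourier_pot ht hm)).trans ?_
  gcongr
  refine (S.comp t ht).weight_n_le fun ξ hξ => ?_
  have hf := freq_pos hξ
  rw [norm_pow, norm_vsymb_sq]
  have h1 : ‖ξ‖ ≤ freq ξ := by
    rw [freq]; exact le_mul_of_one_le_left (norm_nonneg ξ) (by linarith [Real.pi_gt_three])
  calc ‖ξ‖ ^ (2 * (2 * s)) * (freq ξ ^ (-σ)) ^ 2 ≤ freq ξ ^ (2 * (2 * s)) * (freq ξ ^ (-σ)) ^ 2 := by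
        gcongr; linarith [S.one_lt]
    _ = freq ξ ^ (2 * (2 * s) - σ) * freq ξ ^ (-σ) := by
        rw [sq, ← mul_assoc, ← Real.rpow_add hf]; congr 2
    _ ≤ (1 + freq ξ ^ 2) ^ (2 * s) * (1 + freq ξ ^ (-σ)) := by
        gcongr
        · exact freq_rpow_le_japanese (by linarith [S.one_lt, S.lt_two]) (by linarith [S.pos]) ξ
        · linarith

end Setup

end EulerRiesz
end

noncomputable section

namespace EulerRiesz

lemma exists_cm_bound {K : ℕ} {R : ℝ} (hR : 0 < R) (hRK : R < K) : ∃ C : ℝ≥0, ∀ ε A : ℝ, 0 < ε → 0 < A →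
    ∀ (f g : L2R) (d : Fin 3 → L2R) (H : ℝ≥0∞), Bdd f → (∀ k, FD (ev k) f (d k)) → (∀ k, ∀ᵐ x, ‖d k x‖ ≤ A) →
    (∀ᵐ x, ‖g x‖ ≤ A) →
    (∀ k, ∫⁻ ξ, ENNReal.ofReal (‖ξ‖ ^ (2 * R)) * ‖(𝓕 (cplx (d k)) : L2C) ξ‖ₑ ^ 2 ≤ H) →
    (∫⁻ ξ, ENNReal.ofReal (‖ξ‖ ^ (2 * R)) * ‖(𝓕 (cplx g) : L2C) ξ‖ₑ ^ 2 ≤ H) →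
    ∫⁻ h, ENNReal.ofReal (‖cm h (K + 1) f g‖ ^ 2) ∂(nu (2 * R + 2) ε) ≤ C * ENNReal.ofReal (A ^ 2) * H := by
  obtain ⟨C, hC⟩ := exists_commutator_bound hR hRK
  have hd := (diffConst_lt_top hR hRK).ne
  refine ⟨C * (4 * (diffConst K R).toNNReal), fun ε A hε hA f g d H bf hf hdA hg hdH hgH => ?_⟩
  simp_rw [← lintegral_enorm_sq]
  refine (hC ε A hε hA f g d bf hf hdA hg).trans ?_
  have h1 : ∑ k, sqDiff K R ε (d k) + sqDiff K R ε g ≤ 4 * (diffConst K R * H) := by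
    calc _ ≤ ∑ _k : Fin 3, diffConst K R * H + diffConst K R * H := by
          gcongr with k
          · exact (sqDiff_le K R ε (d k)).trans (mul_le_mul_right (hdH k) _)
          · exact (sqDiff_le K R ε g).trans (mul_le_mul_right hgH _)
      _ = 4 * (diffConst K R * H) := by
          rw [Finset.sum_const, Finset.card_univ, Fintype.card_fin, nsmul_eq_mul, ← add_one_mul]; norm_num
  refine (mul_le_mul_right h1 _).trans_eq ?_
  rw [ENNReal.coe_mul, ENNReal.coe_mul, ENNReal.coe_toNNReal hd]
  push_cast
  ring

section Norms

variable {E : Type*} [SeminormedAddCommGroup E]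

lemma norm_add_sq_le (a b : E) : ‖a + b‖ ^ 2 ≤ 2 * (‖a‖ ^ 2 + ‖b‖ ^ 2) := by
  have := pow_le_pow_left₀ (norm_nonneg _) (norm_add_le a b) 2
  nlinarith [sq_nonneg (‖a‖ - ‖b‖)]

lemma norm_sum_sq_le (a : Fin 3 → E) : ‖∑ j, a j‖ ^ 2 ≤ 3 * ∑ j, ‖a j‖ ^ 2 := by
  have h1 := pow_le_pow_left₀ (norm_nonneg _) (norm_sum_le Finset.univ a) 2
  have h2 := sq_sum_le_card_mul_sum_sq (s := (Finset.univ : Finset (Fin 3))) (f := fun j => ‖a j‖)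
  simp only [Finset.card_univ, Fintype.card_fin, Nat.cast_ofNat] at h2
  exact h1.trans h2

lemma residual_sq_le (a b c : Fin 3 → E) (d : Fin 3 → Fin 3 → E) :
    ‖∑ j, (a j + b j)‖ ^ 2 + ∑ j, ‖c j + ∑ k, d j k‖ ^ 2
      ≤ 6 * (∑ j, (‖a j‖ ^ 2 + ‖b j‖ ^ 2) + ∑ j, (‖c j‖ ^ 2 + ∑ k, ‖d j k‖ ^ 2)) := by
  have h1 : ‖∑ j, (a j + b j)‖ ^ 2 ≤ 6 * ∑ j, (‖a j‖ ^ 2 + ‖b j‖ ^ 2) := by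
    refine (norm_sum_sq_le _).trans ?_
    rw [show (6 : ℝ) = 3 * 2 by norm_num, mul_assoc]
    refine mul_le_mul_of_nonneg_left ?_ (by norm_num)
    rw [Finset.mul_sum]
    exact Finset.sum_le_sum fun j _ => norm_add_sq_le _ _
  have h2 : ∑ j, ‖c j + ∑ k, d j k‖ ^ 2 ≤ 6 * ∑ j, (‖c j‖ ^ 2 + ∑ k, ‖d j k‖ ^ 2) := by
    rw [Finset.mul_sum]
    gcongr with j
    have := norm_add_sq_le (c j) (∑ k, d j k)
    have := norm_sum_sq_le (d j)
    nlinarith [sq_nonneg ‖c j‖]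
  linarith

end Norms

lemma par_weight_symb_le {s : ℝ} (hs : 1 < s) (k : Fin 3) (ξ : E3) :
    ‖ξ‖ ^ (2 * (2 * s - 1)) * ‖dsymb (ev k) ξ‖ ^ 2 ≤ (1 + freq ξ ^ 2) ^ (2 * s) := by
  rcases eq_or_ne ξ 0 with rfl | hξ
  · rw [norm_zero, Real.zero_rpow (by linarith), zero_mul]; positivity
  have hf := freq_pos hξ
  have h1 : ‖ξ‖ ≤ freq ξ := by
    rw [freq]; exact le_mul_of_one_le_left (norm_nonneg ξ) (by linarith [Real.pi_gt_three])
  calc _ ≤ freq ξ ^ (2 * (2 * s - 1)) * freq ξ ^ 2 := by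
        have := norm_dsymb_ev_le k ξ
        gcongr; linarith
    _ = freq ξ ^ (4 * s) := by rw [← Real.rpow_two, ← Real.rpow_add hf]; congr 1; ring
    _ ≤ _ := freq_rpow_le_japanese (by linarith) (by linarith) ξ

lemma exists_res_bound {s : ℝ} (hs : 1 < s) {K : ℕ} (hK : 2 * s - 1 < K) : ∃ C : ℝ≥0,
    ∀ (σ T : ℝ) (n : ℝ → L2R) (u : ℝ → Fin 3 → L2R) (α : ℝ → L2C), Setup σ s T n u α → ∀ t ∈ Ico 0 T,
    ∀ A : ℝ, SupBound (n t) (u t) A → ∀ ε : ℝ, 0 < ε →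
    ∫⁻ h, ENNReal.ofReal (‖res0 (K + 1) h (n t) (u t)‖ ^ 2 + ∑ j, ‖res (K + 1) h (n t) (u t) j‖ ^ 2) ∂(nu (4 * s) ε)
      ≤ C * ENNReal.ofReal (A ^ 2) * hNorm (2 * s) (α t) ^ 2 := by
  obtain ⟨C, hC⟩ := exists_cm_bound (R := 2 * s - 1) (by linarith) hK
  rw [show 2 * (2 * s - 1) + 2 = 4 * s by ring] at hC
  refine ⟨108 * C, fun σ T n u α S t ht A hA ε hε => ?_⟩
  have wn : ∀ k, ∫⁻ ξ, ENNReal.ofReal (‖ξ‖ ^ (2 * (2 * s - 1))) * ‖(𝓕 (cplx (par k (n t))) : L2C) ξ‖ₑ ^ 2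
      ≤ hNorm (2 * s) (α t) ^ 2 := by
    intro k
    refine le_trans (le_of_eq (lintegral_congr_ae ?_)) ((S.comp t ht).weight_n_le (μ := dsymb (ev k)) fun ξ hξ =>
      (par_weight_symb_le hs k ξ).trans (le_mul_of_one_le_right (by positivity)
        (by linarith [Real.rpow_nonneg (freq_nonneg ξ) (-σ)])))
    filter_upwards [S.FD_n ht k] with ξ h1
    rw [h1, enorm_mul, mul_pow]
  have wu : ∀ j k, ∫⁻ ξ, ENNReal.ofReal (‖ξ‖ ^ (2 * (2 * s - 1))) * ‖(𝓕 (cplx (par k (u t j))) : L2C) ξ‖ₑ ^ 2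
      ≤ hNorm (2 * s) (α t) ^ 2 := by
    intro j k
    refine le_trans (le_of_eq (lintegral_congr_ae ?_)) ((S.comp t ht).weight_u_le j (μ := dsymb (ev k)) fun ξ hξ =>
      par_weight_symb_le hs k ξ)
    filter_upwards [S.FD_u ht j k] with ξ h1
    rw [h1, enorm_mul, mul_pow]
  have bn := (S.nice_n ht).1
  have bu := fun j => (S.nice_u ht j).1
  obtain ⟨B, hB⟩ : ∃ B, B = C * ENNReal.ofReal (A ^ 2) * hNorm (2 * s) (α t) ^ 2 := ⟨_, rfl⟩
  have c1 : ∀ j, ∫⁻ h, ENNReal.ofReal (‖cm h (K + 1) (u t j) (par j (n t))‖ ^ 2) ∂(nu (4 * s) ε) ≤ B := fun j =>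
    hB ▸ hC ε A hε hA.pos _ _ (fun k => par k (u t j)) _ (bu j) (S.FD_u ht j) (hA.par_u j) (hA.par_n j) (wu j) (wn j)
  have c2 : ∀ j, ∫⁻ h, ENNReal.ofReal (‖cm h (K + 1) (n t) (par j (u t j))‖ ^ 2) ∂(nu (4 * s) ε) ≤ B := fun j =>
    hB ▸ hC ε A hε hA.pos _ _ (fun k => par k (n t)) _ bn (S.FD_n ht) hA.par_n (hA.par_u j j) wn (wu j j)
  have c3 : ∀ j, ∫⁻ h, ENNReal.ofReal (‖cm h (K + 1) (n t) (par j (n t))‖ ^ 2) ∂(nu (4 * s) ε) ≤ B := fun j =>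
    hB ▸ hC ε A hε hA.pos _ _ (fun k => par k (n t)) _ bn (S.FD_n ht) hA.par_n (hA.par_n j) wn (wn j)
  have c4 : ∀ j k, ∫⁻ h, ENNReal.ofReal (‖cm h (K + 1) (u t k) (par j (u t k))‖ ^ 2) ∂(nu (4 * s) ε) ≤ B := fun j k =>
    hB ▸ hC ε A hε hA.pos _ _ (fun i => par i (u t k)) _ (bu k) (S.FD_u ht k) (hA.par_u k) (hA.par_u k j) (wu k)
      (wu k j)
  have m0 : ∀ {f : L2R} (_ : Bdd f) (g : L2R), Measurable fun h => ENNReal.ofReal (‖cm h (K + 1) f g‖ ^ 2) :=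
    fun hf g => ((continuous_cm (K + 1) hf g).norm.pow 2).measurable.ennreal_ofReal
  calc _ ≤ ∫⁻ h, 6 * (∑ j, (ENNReal.ofReal (‖cm h (K + 1) (u t j) (par j (n t))‖ ^ 2)
          + ENNReal.ofReal (‖cm h (K + 1) (n t) (par j (u t j))‖ ^ 2))
        + ∑ j, (ENNReal.ofReal (‖cm h (K + 1) (n t) (par j (n t))‖ ^ 2)
          + ∑ k, ENNReal.ofReal (‖cm h (K + 1) (u t k) (par j (u t k))‖ ^ 2))) ∂(nu (4 * s) ε) := by
        refine lintegral_mono fun h => (ENNReal.ofReal_le_ofReal (residual_sq_le _ _ _ _)).trans_eq ?_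
        rw [ENNReal.ofReal_mul (by norm_num), ENNReal.ofReal_add (by positivity) (by positivity),
          ENNReal.ofReal_sum_of_nonneg fun _ _ => by positivity, ENNReal.ofReal_sum_of_nonneg fun _ _ => by positivity]
        congr 1
        · norm_num
        · congr 1
          · exact Finset.sum_congr rfl fun j _ => ENNReal.ofReal_add (by positivity) (by positivity)
          · refine Finset.sum_congr rfl fun j _ => ?_
            rw [ENNReal.ofReal_add (by positivity) (by positivity),
              ENNReal.ofReal_sum_of_nonneg fun _ _ => by positivity]
    _ = 6 * (∑ j, (∫⁻ h, ENNReal.ofReal (‖cm h (K + 1) (u t j) (par j (n t))‖ ^ 2) ∂(nu (4 * s) ε)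
          + ∫⁻ h, ENNReal.ofReal (‖cm h (K + 1) (n t) (par j (u t j))‖ ^ 2) ∂(nu (4 * s) ε))
        + ∑ j, (∫⁻ h, ENNReal.ofReal (‖cm h (K + 1) (n t) (par j (n t))‖ ^ 2) ∂(nu (4 * s) ε)
          + ∑ k, ∫⁻ h, ENNReal.ofReal (‖cm h (K + 1) (u t k) (par j (u t k))‖ ^ 2) ∂(nu (4 * s) ε))) := by
        have m1 := fun j => m0 (bu j) (par j (n t))
        have m2 := fun j => m0 bn (par j (u t j))
        have m3 := fun j => m0 bn (par j (n t))
        have m4 := fun j k => m0 (bu k) (par j (u t k))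
        rw [lintegral_const_mul' _ _ (by norm_num), lintegral_add_left, lintegral_finsetSum, lintegral_finsetSum]
        · congr 2
          · exact Finset.sum_congr rfl fun j _ => lintegral_add_left (m1 j) _
          · refine Finset.sum_congr rfl fun j _ => ?_
            rw [lintegral_add_left (m3 j), lintegral_finsetSum _ fun k _ => m4 j k]
        · exact fun j _ => (m3 j).add (Finset.measurable_fun_sum _ fun k _ => m4 j k)
        · exact fun j _ => (m1 j).add (m2 j)
        · exact Finset.measurable_fun_sum _ fun j _ => (m1 j).add (m2 j)
    _ ≤ 6 * (∑ _j : Fin 3, (B + B) + ∑ _j : Fin 3, (B + ∑ _k : Fin 3, B)) := by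
        exact mul_le_mul_right (add_le_add (Finset.sum_le_sum fun j _ => add_le_add (c1 j) (c2 j))
          (Finset.sum_le_sum fun j _ => add_le_add (c3 j) (Finset.sum_le_sum fun k _ => c4 j k))) _
    _ = _ := by
        simp only [Finset.sum_const, Finset.card_univ, Fintype.card_fin, nsmul_eq_mul, hB]
        push_cast
        ring

/-- The integrated bound for the time derivative of the energy. -/
lemma exists_lintegral_energyD {σ s : ℝ} (h0 : 0 < σ) (h2 : σ < 2) (hs : 1 < s) {K : ℕ} (hK : 2 * s < K) : ∃ C : ℝ≥0,
    ∀ (T : ℝ) (n : ℝ → L2R) (u : ℝ → Fin 3 → L2R) (α : ℝ → L2C), Setup σ s T n u α → ∀ t ∈ Ico 0 T,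
    ∀ A : ℝ, SupBound (n t) (u t) A → ∀ ε : ℝ, 0 < ε →
    ∫⁻ h, ‖energyD σ (K + 1) h (n t) (u t)‖ₑ ∂(nu (4 * s) ε) ≤ C * ENNReal.ofReal A * hNorm (2 * s) (α t) ^ 2 := by
  obtain ⟨c, hc0, hc⟩ := exists_energyD_bound h0 h2
  obtain ⟨D, hD⟩ := exists_res_bound hs (K := K) (by linarith)
  have hdc : diffConst (K + 1) (2 * s) ≠ ∞ := (diffConst_lt_top (by linarith) (by push_cast; linarith)).ne
  refine ⟨c.toNNReal * (2 * (diffConst (K + 1) (2 * s)).toNNReal + D), fun T n u α S t ht A hA ε hε => ?_⟩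
  have hAp := hA.pos
  have mp : Measurable fun h => ENNReal.ofReal (‖pot σ (K + 1) h (n t)‖ ^ 2) :=
    measurable_norm_sq_of_fourier_dl ((measurable_vsymb σ).pow_const 2) (S.fourier_pot ht (by omega))
  have ms : Measurable fun h => ENNReal.ofReal (sqSum σ (K + 1) h (n t) (u t)) :=
    (continuous_sqSum σ (K + 1) _ _).measurable.ennreal_ofReal
  have sq0 : ∀ h, 0 ≤ sqSum σ (K + 1) h (n t) (u t) := fun h => by unfold sqSum; positivity
  have b1 := S.lintegral_sqSum_nu_le ht (K + 1) ε
  have b2 := S.lintegral_pot_le ht (m := K + 1) (by omega) ε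
  have b3 := hD σ T n u α S t ht A hA ε hε
  calc _ ≤ ∫⁻ h, ENNReal.ofReal c * (ENNReal.ofReal A * (ENNReal.ofReal (sqSum σ (K + 1) h (n t) (u t))
          + ENNReal.ofReal (‖pot σ (K + 1) h (n t)‖ ^ 2)) + ENNReal.ofReal A⁻¹ * ENNReal.ofReal
          (‖res0 (K + 1) h (n t) (u t)‖ ^ 2 + ∑ j, ‖res (K + 1) h (n t) (u t) j‖ ^ 2)) ∂(nu (4 * s) ε) := by
        refine lintegral_mono fun h => ?_
        have h1 := hc s T n u α S t ht A hAp hA.n_half hA.par_n hA.u_le hA.par_u (K + 1) (by omega) h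
        rw [← ENNReal.ofReal_add (sq0 h) (by positivity), ← ENNReal.ofReal_mul hAp.le,
          ← ENNReal.ofReal_mul (by positivity), ← ENNReal.ofReal_add (by have := sq0 h; positivity) (by positivity),
          ← ENNReal.ofReal_mul hc0, ← ofReal_norm, Real.norm_eq_abs]
        exact ENNReal.ofReal_le_ofReal h1
    _ = ENNReal.ofReal c * (ENNReal.ofReal A * (∫⁻ h, ENNReal.ofReal (sqSum σ (K + 1) h (n t) (u t)) ∂(nu (4 * s) ε)
          + ∫⁻ h, ENNReal.ofReal (‖pot σ (K + 1) h (n t)‖ ^ 2) ∂(nu (4 * s) ε)) + ENNReal.ofReal A⁻¹ * ∫⁻ h, ENNReal.ofReal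
          (‖res0 (K + 1) h (n t) (u t)‖ ^ 2 + ∑ j, ‖res (K + 1) h (n t) (u t) j‖ ^ 2) ∂(nu (4 * s) ε)) := by
        have msp : Measurable fun h => ENNReal.ofReal A * (ENNReal.ofReal (sqSum σ (K + 1) h (n t) (u t))
          + ENNReal.ofReal (‖pot σ (K + 1) h (n t)‖ ^ 2)) := (ms.add mp).const_mul _
        rw [lintegral_const_mul' _ _ ENNReal.ofReal_ne_top, lintegral_add_left msp,
          lintegral_const_mul' _ _ ENNReal.ofReal_ne_top, lintegral_const_mul' _ _ ENNReal.ofReal_ne_top,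
          lintegral_add_left ms]
    _ ≤ ENNReal.ofReal c * (ENNReal.ofReal A * (diffConst (K + 1) (2 * s) * hNorm (2 * s) (α t) ^ 2
          + diffConst (K + 1) (2 * s) * hNorm (2 * s) (α t) ^ 2)
          + ENNReal.ofReal A⁻¹ * (D * ENNReal.ofReal (A ^ 2) * hNorm (2 * s) (α t) ^ 2)) := by gcongr
    _ = _ := by
        have e : ENNReal.ofReal A⁻¹ * ENNReal.ofReal (A ^ 2) = ENNReal.ofReal A := by
          rw [← ENNReal.ofReal_mul (by positivity)]; congr 1; field_simp
        rw [show ENNReal.ofReal A⁻¹ * (D * ENNReal.ofReal (A ^ 2) * hNorm (2 * s) (α t) ^ 2)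
          = D * (ENNReal.ofReal A⁻¹ * ENNReal.ofReal (A ^ 2)) * hNorm (2 * s) (α t) ^ 2 by ring, e]
        push_cast
        rw [ENNReal.coe_toNNReal hdc, ENNReal.ofReal]
        ring

end EulerRiesz
end

noncomputable section

namespace EulerRiesz

lemma ae_mulL_le {f g : L2R} {a b : ℝ} (ha : 0 ≤ a) (hf : ∀ᵐ x, ‖f x‖ ≤ a) (hg : ∀ᵐ x, ‖g x‖ ≤ b) :
    ∀ᵐ x, ‖mulL f g x‖ ≤ a * b := by
  filter_upwards [hf, hg, Bdd.coe_mulL ⟨a, hf⟩ g] with x h1 h2 h3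
  rw [h3, norm_mul]
  gcongr

lemma ae_add_le {f g : L2R} {a b : ℝ} (hf : ∀ᵐ x, ‖f x‖ ≤ a) (hg : ∀ᵐ x, ‖g x‖ ≤ b) :
    ∀ᵐ x, ‖(f + g : L2R) x‖ ≤ a + b := by
  filter_upwards [hf, hg, Lp.coeFn_add f g] with x h1 h2 h3
  rw [h3, Pi.add_apply]
  exact (norm_add_le _ _).trans (add_le_add h1 h2)

lemma ae_neg_le {f : L2R} {a : ℝ} (hf : ∀ᵐ x, ‖f x‖ ≤ a) : ∀ᵐ x, ‖(-f : L2R) x‖ ≤ a := by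
  filter_upwards [hf, Lp.coeFn_neg f] with x h1 h2
  rwa [h2, Pi.neg_apply, norm_neg]

lemma SupBound.nDot_le {n : L2R} {u : Fin 3 → L2R} {A : ℝ} (h : SupBound n u A) :
    ∀ᵐ x, ‖nDot n u x‖ ≤ 3 * (A * A + A + 1 / 2 * A) := by
  have hj : ∀ j, ∀ᵐ x, ‖(mulL (u j) (par j n) + par j (u j) + mulL n (par j (u j)) : L2R) x‖
      ≤ A * A + A + 1 / 2 * A := fun j =>
    ae_add_le (ae_add_le (ae_mulL_le h.pos.le (h.u_le j) (h.par_n j)) (h.par_u j j))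
      (ae_mulL_le (by norm_num) h.n_half (h.par_u j j))
  rw [nDot, Fin.sum_univ_three]
  refine (ae_neg_le (ae_add_le (ae_add_le (hj 0) (hj 1)) (hj 2))).mono fun x hx => hx.trans_eq (by ring)

lemma norm_weight_le {n : L2R} (hn : ∀ᵐ x, ‖n x‖ ≤ 1 / 2) (w : L2R) : ‖w + mulL n w‖ ≤ (3 / 2) * ‖w‖ :=
  (norm_add_le _ _).trans (by linarith [norm_mulL_le hn w])

/-- A bound for the time derivative of the energy that does not depend on the difference. -/
def rawBound (σ : ℝ) (m : ℕ) (N : ℝ) (n : L2R) (u : Fin 3 → L2R) : ℝ :=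
  (2 ^ m * 2 ^ m) * ((3 / 2) * (‖n‖ * ‖nDot n u‖ + ∑ j, ‖u j‖ * ‖uDot σ n u j‖)
    + (1 / 2) * (N * (‖n‖ * ‖n‖ + ∑ j, ‖u j‖ * ‖u j‖)) + ‖mult (vsymb σ) n‖ * ‖vDot σ n u‖)

lemma raw_arith {P N a b c e1 e2 e3 e4 e5 : ℝ} {y z : Fin 3 → ℝ} (h1 : |e1| ≤ P * ((3 / 2) * a))
    (h2 : |e2| ≤ ∑ j, P * ((3 / 2) * y j)) (h3 : |e3| ≤ P * (N * b)) (h4 : |e4| ≤ ∑ j, P * (N * z j))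
    (h5 : |e5| ≤ P * c) :
    |e1 + e2 + (1 / 2) * (e3 + e4) + e5| ≤ P * ((3 / 2) * (a + ∑ j, y j) + (1 / 2) * (N * (b + ∑ j, z j)) + c) := by
  simp only [← Finset.mul_sum] at h2 h4
  rw [abs_le] at *
  constructor <;> nlinarith only [h1, h2, h3, h4, h5]

lemma abs_energyD_le_raw {σ : ℝ} (m : ℕ) (h : E3) {n : L2R} {u : Fin 3 → L2R} {N : ℝ} (hN0 : 0 ≤ N)
    (hn : ∀ᵐ x, ‖n x‖ ≤ 1 / 2) (hN : ∀ᵐ x, ‖nDot n u x‖ ≤ N) :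
    |energyD σ m h n u| ≤ rawBound σ m N n u := by
  have h1 : ∀ f g : L2R, |inner ℝ ((dl h ^ m) f + mulL n ((dl h ^ m) f)) ((dl h ^ m) g)|
      ≤ (2 ^ m * 2 ^ m) * ((3 / 2) * (‖f‖ * ‖g‖)) := fun f g => by
    calc _ ≤ (3 / 2 * ‖(dl h ^ m) f‖) * ‖(dl h ^ m) g‖ :=
          (abs_real_inner_le_norm _ _).trans (by gcongr; exact norm_weight_le hn _)
      _ ≤ (3 / 2 * (2 ^ m * ‖f‖)) * (2 ^ m * ‖g‖) := by gcongr <;> exact norm_dl_pow_le h m _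
      _ = _ := by ring
  have h2 : ∀ f : L2R, |inner ℝ (mulL (nDot n u) ((dl h ^ m) f)) ((dl h ^ m) f)|
      ≤ (2 ^ m * 2 ^ m) * (N * (‖f‖ * ‖f‖)) := fun f => by
    calc _ ≤ N * (‖(dl h ^ m) f‖ * ‖(dl h ^ m) f‖) := abs_inner_mulL_le hN _ _
      _ ≤ N * ((2 ^ m * ‖f‖) * (2 ^ m * ‖f‖)) := by gcongr <;> exact norm_dl_pow_le h m _
      _ = _ := by ring
  have h3 : ∀ f g : L2R, |inner ℝ ((dl h ^ m) f) ((dl h ^ m) g)| ≤ (2 ^ m * 2 ^ m) * (‖f‖ * ‖g‖) := fun f g => by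
    calc _ ≤ ‖(dl h ^ m) f‖ * ‖(dl h ^ m) g‖ := abs_real_inner_le_norm _ _
      _ ≤ (2 ^ m * ‖f‖) * (2 ^ m * ‖g‖) := by gcongr <;> exact norm_dl_pow_le h m _
      _ = _ := by ring
  have sum : ∀ (x y : Fin 3 → ℝ), (∀ j, |x j| ≤ y j) → |∑ j, x j| ≤ ∑ j, y j := fun x y hxy =>
    (Finset.abs_sum_le_sum_abs _ _).trans (Finset.sum_le_sum fun j _ => hxy j)
  exact raw_arith (h1 n (nDot n u)) (sum _ _ fun j => h1 (u j) (uDot σ n u j)) (h2 n) (sum _ _ fun j => h2 (u j))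
    (h3 (mult (vsymb σ) n) (vDot σ n u))

lemma continuous_inner_weight {n : L2R} (hn : Bdd n) {X Y : E3 → L2R} (hX : Continuous X) (hY : Continuous Y) :
    Continuous fun h => (inner ℝ (X h + mulL n (X h)) (Y h) : ℝ) :=
  (hX.add ((continuous_mulL hn).comp hX)).inner hY

lemma continuous_energy (σ : ℝ) (m : ℕ) {n : L2R} (hn : Bdd n) (u : Fin 3 → L2R) :
    Continuous fun h => energy σ m h n u := by
  unfold energy
  have c := fun f => continuous_dl_pow m f
  exact continuous_const.mul (((continuous_inner_weight hn (c n) (c n)).add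
    (continuous_finsetSum _ fun j _ => continuous_inner_weight hn (c (u j)) (c (u j)))).add ((c _).norm.pow 2))

lemma continuous_energyD (σ : ℝ) (m : ℕ) {n : L2R} {u : Fin 3 → L2R} (hn : Bdd n) (hd : Bdd (nDot n u)) :
    Continuous fun h => energyD σ m h n u := by
  unfold energyD
  have c := fun f => continuous_dl_pow m f
  have q : ∀ f, Continuous fun h : E3 => (inner ℝ (mulL (nDot n u) ((dl h ^ m) f)) ((dl h ^ m) f) : ℝ) := fun f =>
    ((continuous_mulL hd).comp (c f)).inner (c f)
  exact (((continuous_inner_weight hn (c n) (c _)).add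
    (continuous_finsetSum _ fun j _ => continuous_inner_weight hn (c (u j)) (c _))).add
    (continuous_const.mul ((q n).add (continuous_finsetSum _ fun j _ => q (u j))))).add ((c _).inner (c _))

lemma sqSum_le (σ : ℝ) (m : ℕ) (h : E3) (n : L2R) (u : Fin 3 → L2R) :
    sqSum σ m h n u ≤ (2 ^ m) ^ 2 * (‖n‖ ^ 2 + ∑ j, ‖u j‖ ^ 2 + ‖mult (vsymb σ) n‖ ^ 2) := by
  have e : ∀ f : L2R, ‖(dl h ^ m) f‖ ^ 2 ≤ (2 ^ m) ^ 2 * ‖f‖ ^ 2 := fun f => by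
    rw [← mul_pow]; exact pow_le_pow_left₀ (norm_nonneg _) (norm_dl_pow_le h m f) 2
  rw [sqSum, mul_add, mul_add, Finset.mul_sum]
  exact add_le_add (add_le_add (e _) (Finset.sum_le_sum fun j _ => e _)) (e _)

lemma sqSum_nonneg (σ : ℝ) (m : ℕ) (h : E3) (n : L2R) (u : Fin 3 → L2R) : 0 ≤ sqSum σ m h n u := by
  unfold sqSum; positivity

namespace Setup

variable {σ s T : ℝ} {n : ℝ → L2R} {u : ℝ → Fin 3 → L2R} {α : ℝ → L2C}

lemma cont_rawBound (S : Setup σ s T n u α) {t : ℝ} (ht : t ∈ Ioo 0 T) (m : ℕ) (N : ℝ) :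
    ContinuousAt (fun r => rawBound σ m N (n r) (u r)) t := by
  have c1 := (contAt S.cont_n ht).norm
  have c2 := fun j => (contAt (S.cont_u j) ht).norm
  have c3 := (S.cont_nDot ht).norm
  have c4 := fun j => (S.cont_uDot ht j).norm
  have c5 := (contAt S.cont_vel ht).norm
  have c6 := (S.cont_vDot ht).norm
  unfold rawBound
  exact continuousAt_const.mul (((continuousAt_const.mul ((c1.mul c3).add
    (tendsto_finsetSum _ fun j _ => (c2 j).mul (c4 j)))).add (continuousAt_const.mul (continuousAt_const.mul
      ((c1.mul c1).add (tendsto_finsetSum _ fun j _ => (c2 j).mul (c2 j)))))).add (c5.mul c6))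

lemma integrable_energy (S : Setup σ s T n u α) {t : ℝ} (ht : t ∈ Ico 0 T) (hn : ∀ᵐ x, ‖n t x‖ ≤ 1 / 2) (m : ℕ)
    {ε : ℝ} (hε : 0 < ε) : Integrable (fun h => energy σ m h (n t) (u t)) (nu (4 * s) ε) := by
  have := nu_finite (a := 4 * s) (by linarith [S.one_lt]) hε
  refine Integrable.of_bound (continuous_energy σ m (S.nice_n ht).1 _).aestronglyMeasurable
    ((2 ^ m) ^ 2 * (‖n t‖ ^ 2 + ∑ j, ‖u t j‖ ^ 2 + ‖mult (vsymb σ) (n t)‖ ^ 2)) (.of_forall fun h => ?_)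
  have h1 := energy_bounds (σ := σ) m h hn (u t)
  have h2 := sqSum_nonneg σ m h (n t) (u t)
  rw [Real.norm_of_nonneg (by linarith [h1.1])]
  exact h1.2.trans (sqSum_le _ _ _ _ _)

lemma hasDerivAt_integral_energy (S : Setup σ s T n u α) {A : ℝ} (hA : ∀ t ∈ Ioo 0 T, SupBound (n t) (u t) A)
    {t : ℝ} (ht : t ∈ Ioo 0 T) (m : ℕ) {ε : ℝ} (hε : 0 < ε) :
    HasDerivAt (fun r => ∫ h, energy σ m h (n r) (u r) ∂(nu (4 * s) ε))
      (∫ h, energyD σ m h (n t) (u t) ∂(nu (4 * s) ε)) t := by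
  have := nu_finite (a := 4 * s) (by linarith [S.one_lt]) hε
  have hAp := (hA t ht).pos
  have hev := (S.cont_rawBound ht m (3 * (A * A + A + 1 / 2 * A))).eventually_lt_const
    (show rawBound σ m (3 * (A * A + A + 1 / 2 * A)) (n t) (u t)
      < rawBound σ m (3 * (A * A + A + 1 / 2 * A)) (n t) (u t) + 1 by linarith)
  refine (hasDerivAt_integral_of_dominated_loc_of_deriv_le
    (bound := fun _ => rawBound σ m (3 * (A * A + A + 1 / 2 * A)) (n t) (u t) + 1)
    (F := fun r h => energy σ m h (n r) (u r)) (F' := fun r h => energyD σ m h (n r) (u r))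
    (Filter.inter_mem (Ioo_mem_nhds ht.1 ht.2) hev) ?_ (S.integrable_energy (mem_Ico ht) (hA t ht).n_half m hε)
    ?_ ?_ (integrable_const _) ?_).2
  · filter_upwards [Ioo_mem_nhds ht.1 ht.2] with r hr
    exact (continuous_energy σ m (S.nice_n (mem_Ico hr)).1 _).aestronglyMeasurable
  · exact (continuous_energyD σ m (S.nice_n (mem_Ico ht)).1 ⟨_, (hA t ht).nDot_le⟩).aestronglyMeasurable
  · refine .of_forall fun h r hr => ?_
    rw [Real.norm_eq_abs]
    exact (abs_energyD_le_raw m h (by positivity) (hA r hr.1).n_half (hA r hr.1).nDot_le).trans hr.2.le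
  · exact .of_forall fun h r hr => S.hasDerivAt_energy hr.1 m h

end Setup

end EulerRiesz
end

noncomputable section

namespace EulerRiesz

lemma SupBound.mono {n : L2R} {u : Fin 3 → L2R} {A B : ℝ} (h : SupBound n u A) (hAB : A ≤ B) : SupBound n u B where
  pos := h.pos.trans_le hAB
  n_half := h.n_half
  par_n j := (h.par_n j).mono fun _ hx => hx.trans hAB
  u_le j := (h.u_le j).mono fun _ hx => hx.trans hAB
  par_u j k := (h.par_u j k).mono fun _ hx => hx.trans hAB

/-- The squares in the energy without derivatives. -/
def lowSq (σ : ℝ) (n : L2R) (u : Fin 3 → L2R) : ℝ := ‖n‖ ^ 2 + ∑ j, ‖u j‖ ^ 2 + ‖mult (vsymb σ) n‖ ^ 2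

lemma lowSq_eq (σ : ℝ) (n : L2R) (u : Fin 3 → L2R) : lowSq σ n u = sqSum σ 0 0 n u := by
  simp [lowSq, sqSum]

/-- Half of the time derivative of `lowSq`. -/
def lowD (σ : ℝ) (n : L2R) (u : Fin 3 → L2R) : ℝ :=
  inner ℝ n (nDot n u) + ∑ j, inner ℝ (u j) (uDot σ n u j) + inner ℝ (mult (vsymb σ) n) (vDot σ n u)

lemma trilinear_identity {n : L2R} {u d F : Fin 3 → L2R} {e : Fin 3 → Fin 3 → L2R} {q : ℝ}
    (hd : ∀ j, inner ℝ (d j) (u j) = -inner ℝ n (e j j))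
    (hq : q = ∑ j, inner ℝ (F j) (u j + mulL n (u j))) :
    inner ℝ n (-∑ j, (mulL (u j) (d j) + e j j + mulL n (e j j)))
      + ∑ j, inner ℝ (u j) (-((d j + mulL n (d j)) + ∑ k, mulL (u k) (e k j) + F j)) + q
    = ∑ j, (inner ℝ (F j) (mulL n (u j)) - inner ℝ n (mulL (u j) (d j)) - inner ℝ n (mulL n (e j j))
        - inner ℝ (u j) (mulL n (d j)) - ∑ k, inner ℝ (u j) (mulL (u k) (e k j))) := by
  have c : ∀ j, inner ℝ (u j) (d j) = inner ℝ (d j) (u j) := fun j => real_inner_comm _ _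
  have c2 : ∀ j, inner ℝ (u j) (F j) = inner ℝ (F j) (u j) := fun j => real_inner_comm _ _
  rw [hq]
  simp only [inner_neg_right, inner_add_right, c, c2, hd, Fin.sum_univ_three]
  ring

lemma abs_inner_mulL_right_le {f g h : L2R} {A : ℝ} (hg : ∀ᵐ x, ‖g x‖ ≤ A) :
    |inner ℝ f (mulL g h)| ≤ A * (‖f‖ * ‖h‖) := by
  rw [real_inner_comm, mul_comm ‖f‖]
  exact abs_inner_mulL_le hg h f

namespace Setup

variable {σ s T : ℝ} {n : ℝ → L2R} {u : ℝ → Fin 3 → L2R} {α : ℝ → L2C}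

lemma hasDerivAt_lowSq (S : Setup σ s T n u α) {t : ℝ} (ht : t ∈ Ioo 0 T) :
    HasDerivAt (fun r => (1 / 2) * lowSq σ (n r) (u r)) (lowD σ (n t) (u t)) t := by
  have h := (((S.hasDerivAt_n ht).norm_sq.add (HasDerivAt.fun_sum fun j (_ : j ∈ Finset.univ) =>
    (S.hasDerivAt_u ht j).norm_sq)).add (S.hasDerivAt_v ht).norm_sq).const_mul (1 / 2 : ℝ)
  refine h.congr_deriv ?_
  rw [lowD, ← Finset.mul_sum]
  ring

lemma inner_vel_vDot (S : Setup σ s T n u α) {t : ℝ} (ht : t ∈ Ico 0 T) :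
    inner ℝ (mult (vsymb σ) (n t)) (vDot σ (n t) (u t))
      = ∑ j, inner ℝ (mult (rsymb σ j) (n t)) (u t j + mulL (n t) (u t j)) := by
  rw [vDot, inner_neg_right, inner_sum, ← Finset.sum_neg_distrib]
  refine Finset.sum_congr rfl fun j _ => ?_
  have : ((-inner ℝ (mult (vsymb σ) (n t)) (mult (fun ξ => vsymb σ ξ * dsymb (ev j) ξ) (flux (n t) (u t) j)) : ℝ) : ℂ)
      = ((inner ℝ (mult (rsymb σ j) (n t)) (flux (n t) (u t) j) : ℝ) : ℂ) := by
    rw [Complex.ofReal_neg, inner_fourier, inner_fourier, ← integral_neg]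
    refine integral_congr_ae ?_
    filter_upwards [S.vel ht, S.riesz ht j, S.flux_symb ht j, ae_ne_zero] with ξ h1 h2 h3 hξ
    have e : vsymb σ ξ * vsymb σ ξ = ((freq ξ ^ (-σ) : ℝ) : ℂ) := by
      rw [vsymb, ← Complex.ofReal_mul, ← Real.rpow_add (freq_pos hξ)]; congr 2; ring
    have e2 : (starRingEnd ℂ) (dsymb (ev j) ξ) = -dsymb (ev j) ξ := by
      rw [← dsymb_neg, dsymb, dsymb, inner_neg_right]; push_cast; ring
    rw [h1, h2, h3, map_mul, map_mul, e2, rsymb, ← e, vsymb, Complex.conj_ofReal]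
    ring
  exact_mod_cast this

lemma abs_lowD_le (S : Setup σ s T n u α) {t : ℝ} (ht : t ∈ Ico 0 T) {A H : ℝ} (hA : SupBound (n t) (u t) A)
    (hH : hNorm (2 * s) (α t) ≤ ENNReal.ofReal H) (hH0 : 0 ≤ H) : |lowD σ (n t) (u t)| ≤ 21 * A * H ^ 2 := by
  have real : ∀ {g : L2R}, ‖g‖ₑ ≤ hNorm (2 * s) (α t) → ‖g‖ ≤ H := fun hg => by
    rw [← ENNReal.ofReal_le_ofReal_iff hH0, ofReal_norm]; exact hg.trans hH
  have h2s : (0 : ℝ) ≤ 2 * s := zero_le_one.trans S.one_le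
  have bn : ‖n t‖ ≤ H := real ((S.comp t ht).enorm_n_le ((good_one h2s).goodN σ) (by simp))
  have bu : ∀ j, ‖u t j‖ ≤ H := fun j => real ((S.comp t ht).enorm_u_le (good_one h2s) (j := j) (by simp))
  have bd : ∀ j, ‖par j (n t)‖ ≤ H := fun j =>
    real ((S.comp t ht).enorm_n_le ((good_dsymb S.one_le j).goodN σ) (S.FD_n ht j))
  have be : ∀ j k, ‖par k (u t j)‖ ≤ H := fun j k =>
    real ((S.comp t ht).enorm_u_le (good_dsymb S.one_le k) (S.FD_u ht j k))
  have bF : ∀ j, ‖mult (rsymb σ j) (n t)‖ ≤ H := fun j =>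
    real ((S.comp t ht).enorm_n_le (goodN_rsymb S.pos S.lt_two S.one_le j) (S.riesz ht j))
  have key := trilinear_identity (n := n t) (u := u t) (d := fun j => par j (n t)) (e := fun j k => par k (u t j))
    (F := fun j => mult (rsymb σ j) (n t)) (fun j => (S.FD_n ht j).inner_ibp (S.FD_u ht j j)) (S.inner_vel_vDot ht)
  have hAp := hA.pos
  have g : ∀ {a b : ℝ}, 0 ≤ a → 0 ≤ b → a ≤ H → b ≤ H → A * (a * b) ≤ A * H ^ 2 := fun ha hb h1 h2 => by
    rw [sq]; gcongr
  have t1 : ∀ j, |inner ℝ (mult (rsymb σ j) (n t)) (mulL (n t) (u t j))| ≤ A * H ^ 2 := fun j => by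
    rw [mulL_comm]
    exact (abs_inner_mulL_right_le (hA.u_le j)).trans (g (norm_nonneg _) (norm_nonneg _) (bF j) bn)
  have t2 : ∀ j, |inner ℝ (n t) (mulL (u t j) (par j (n t)))| ≤ A * H ^ 2 := fun j =>
    (abs_inner_mulL_right_le (hA.u_le j)).trans (g (norm_nonneg _) (norm_nonneg _) bn (bd j))
  have t3 : ∀ j, |inner ℝ (n t) (mulL (n t) (par j (u t j)))| ≤ A * H ^ 2 := fun j => by
    rw [mulL_comm]
    exact (abs_inner_mulL_right_le (hA.par_u j j)).trans (g (norm_nonneg _) (norm_nonneg _) bn bn)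
  have t4 : ∀ j, |inner ℝ (u t j) (mulL (n t) (par j (n t)))| ≤ A * H ^ 2 := fun j => by
    rw [mulL_comm]
    exact (abs_inner_mulL_right_le (hA.par_n j)).trans (g (norm_nonneg _) (norm_nonneg _) (bu j) bn)
  have t5 : ∀ j, |∑ k, inner ℝ (u t j) (mulL (u t k) (par j (u t k)))| ≤ 3 * (A * H ^ 2) := fun j => by
    refine (Finset.abs_sum_le_sum_abs _ _).trans ((Finset.sum_le_sum fun k _ =>
      (abs_inner_mulL_right_le (hA.u_le k)).trans (g (norm_nonneg _) (norm_nonneg _) (bu j) (be k j))).trans_eq ?_)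
    simp
  have key' : lowD σ (n t) (u t) = _ := key
  rw [key']
  refine (Finset.abs_sum_le_sum_abs _ _).trans ((Finset.sum_le_sum (g := fun _ => 7 * (A * H ^ 2)) fun j _ => ?_).trans_eq ?_)
  · have a1 := t1 j; have a2 := t2 j; have a3 := t3 j; have a4 := t4 j; have a5 := t5 j
    rw [abs_le] at *
    constructor <;> linarith
  · simp; ring

end Setup

/-- The integrated energy inequality. -/
lemma exists_energy_ineq {σ s β : ℝ} (h0 : 0 < σ) (h2 : σ < 2) (hs : 1 < s) (hβ : 1 < β) {K : ℕ} (hK : 2 * s < K) :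
    ∃ C : ℝ, 0 ≤ C ∧ ∀ (T : ℝ) (n : ℝ → L2R) (u : ℝ → Fin 3 → L2R) (α : ℝ → L2C), Setup σ s T n u α →
    ∀ a H : ℝ, 0 ≤ H → (∀ t ∈ Ioo 0 T, SupBound (n t) (u t) (a * (1 + t) ^ (-β))) →
    (∀ t ∈ Ioo 0 T, hNorm (2 * s) (α t) ≤ ENNReal.ofReal H) → ∀ t₀ ∈ Ioo 0 T, ∀ t ∈ Ioo 0 T, t₀ ≤ t → ∀ ε : ℝ, 0 < ε →
    ∫ h, energy σ (K + 1) h (n t) (u t) ∂(nu (4 * s) ε) + (1 / 2) * lowSq σ (n t) (u t)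
      ≤ ∫ h, energy σ (K + 1) h (n t₀) (u t₀) ∂(nu (4 * s) ε) + (1 / 2) * lowSq σ (n t₀) (u t₀) + C * (a * H ^ 2) := by
  obtain ⟨D, hD⟩ := exists_lintegral_energyD h0 h2 hs hK
  have hβ' : 0 < β - 1 := by linarith
  refine ⟨(D + 21) / (β - 1), by positivity, fun T n u α S a H hH0 hA hH t₀ ht₀ t ht htt ε hε => ?_⟩
  have one_le : ∀ {r : ℝ}, r ∈ Ioo 0 T → (0 : ℝ) < 1 + r := fun hr => by linarith [hr.1]
  have ha : 0 < a := pos_of_mul_pos_left (hA t ht).pos (Real.rpow_nonneg (one_le ht).le _)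
  have hA' : ∀ r ∈ Ioo 0 T, SupBound (n r) (u r) a := fun r hr => (hA r hr).mono
    (mul_le_of_le_one_right ha.le (Real.rpow_le_one_of_one_le_of_nonpos (by linarith [hr.1]) (by linarith)))
  have hint : ∀ r ∈ Ioo 0 T, ∫ h, energyD σ (K + 1) h (n r) (u r) ∂(nu (4 * s) ε)
      ≤ D * (a * (1 + r) ^ (-β)) * H ^ 2 := by
    intro r hr
    refine (le_abs_self _).trans ?_
    have hp := (hA r hr).pos
    rw [← Real.norm_eq_abs, ← ENNReal.ofReal_le_ofReal_iff (by positivity), ofReal_norm]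
    refine (enorm_integral_le_lintegral_enorm _).trans ((hD T n u α S r (Setup.mem_Ico hr) _ (hA r hr) ε hε).trans ?_)
    rw [ENNReal.ofReal_mul (p := (D : ℝ) * (a * (1 + r) ^ (-β))) (by positivity),
      ENNReal.ofReal_mul (p := (D : ℝ)) D.2, ENNReal.ofReal_coe_nnreal,
      ENNReal.ofReal_pow hH0]
    gcongr
    exact hH r hr
  obtain ⟨B, hB⟩ : ∃ B, B = (D + 21) / (β - 1) * (a * H ^ 2) := ⟨_, rfl⟩
  have hder : ∀ r ∈ Ioo 0 T, HasDerivAt (fun r => ∫ h, energy σ (K + 1) h (n r) (u r) ∂(nu (4 * s) ε)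
      + (1 / 2) * lowSq σ (n r) (u r) + B * (1 + r) ^ (1 - β))
      (∫ h, energyD σ (K + 1) h (n r) (u r) ∂(nu (4 * s) ε) + lowD σ (n r) (u r)
        + B * (1 * (1 - β) * (1 + r) ^ (1 - β - 1))) r := fun r hr =>
    ((S.hasDerivAt_integral_energy hA' hr (K + 1) hε).add (S.hasDerivAt_lowSq hr)).add
      ((((hasDerivAt_id r).const_add 1).rpow_const (Or.inl (one_le hr).ne')).const_mul B)
  have hsub : Icc t₀ t ⊆ Ioo 0 T := fun r hr => ⟨ht₀.1.trans_le hr.1, hr.2.trans_lt ht.2⟩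
  have anti := antitoneOn_of_deriv_nonpos (convex_Icc t₀ t)
    (fun r hr => (hder r (hsub hr)).continuousAt.continuousWithinAt)
    (fun r hr => (hder r (hsub (interior_subset hr))).differentiableAt.differentiableWithinAt)
    (fun r hr => by
      have hr' := hsub (interior_subset hr)
      rw [(hder r hr').deriv]
      have e1 := hint r hr'
      have e2 := (abs_le.1 (S.abs_lowD_le (Setup.mem_Ico hr') (hA r hr') (hH r hr') hH0)).2
      have e3 : B * (1 * (1 - β) * (1 + r) ^ (1 - β - 1)) = -((D + 21) * (a * (1 + r) ^ (-β)) * H ^ 2) := by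
        rw [hB, show 1 - β - 1 = -β by ring]
        field_simp
        ring
      rw [e3]
      linarith)
  have := anti (left_mem_Icc.2 htt) (right_mem_Icc.2 htt) htt
  have p1 : B * (1 + t₀) ^ (1 - β) ≤ B := by
    refine mul_le_of_le_one_right (by rw [hB]; positivity)
      (Real.rpow_le_one_of_one_le_of_nonpos (by linarith [ht₀.1]) (by linarith))
  have p2 : 0 ≤ B * (1 + t) ^ (1 - β) := by
    have := one_le ht
    rw [hB]; positivity
  simp only at this
  rw [← hB]
  linarith

end EulerRiesz
end

noncomputable section

namespace EulerRiesz

lemma lintegral_le_hNorm_sq {a : ℝ} (ha : 0 ≤ a) (f : L2C) : ∫⁻ ξ, ‖(𝓕 f : L2C) ξ‖ₑ ^ 2 ≤ hNorm a f ^ 2 := by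
  rw [hNorm_sq]
  refine lintegral_mono fun ξ => ?_
  refine le_mul_of_one_le_left zero_le ?_
  rw [ENNReal.one_le_ofReal]
  exact one_le_japanese ha ξ

lemma japanese_le {a : ℝ} (ha : 0 ≤ a) (ξ : E3) :
    (1 + freq ξ ^ 2) ^ a ≤ (2 * (2 * Real.pi) ^ 2) ^ a * (1 + ‖ξ‖ ^ (2 * a)) := by
  have hpi : 1 ≤ 2 * Real.pi := by linarith [Real.pi_gt_three]
  have e : ∀ x : ℝ, 0 ≤ x → (x ^ 2) ^ a = x ^ (2 * a) := fun x hx => by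
    rw [← Real.rpow_two, ← Real.rpow_mul hx]
  have h1 : 1 + freq ξ ^ 2 ≤ 2 * (2 * Real.pi) ^ 2 * (max 1 ‖ξ‖) ^ 2 := by
    have a1 : 1 ≤ max 1 ‖ξ‖ := le_max_left _ _
    have a2 : freq ξ ≤ 2 * Real.pi * max 1 ‖ξ‖ := by
      rw [freq]; gcongr; exact le_max_right _ _
    have a3 : 1 ≤ 2 * Real.pi * max 1 ‖ξ‖ := by nlinarith
    have a4 := freq_nonneg ξ
    nlinarith
  calc (1 + freq ξ ^ 2) ^ a ≤ (2 * (2 * Real.pi) ^ 2 * (max 1 ‖ξ‖) ^ 2) ^ a := by gcongr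
    _ = (2 * (2 * Real.pi) ^ 2) ^ a * (max 1 ‖ξ‖) ^ (2 * a) := by
        rw [Real.mul_rpow (by positivity) (by positivity), e _ (by positivity)]
    _ ≤ _ := by
        gcongr
        rcases le_total ‖ξ‖ 1 with h | h
        · rw [max_eq_left h, Real.one_rpow]; linarith [Real.rpow_nonneg (norm_nonneg ξ) (2 * a)]
        · rw [max_eq_right h]; linarith

lemma hNorm_sq_le_split {a : ℝ} (ha : 0 ≤ a) (f : L2C) :
    hNorm a f ^ 2 ≤ ENNReal.ofReal ((2 * (2 * Real.pi) ^ 2) ^ a) * ((∫⁻ ξ, ‖(𝓕 f : L2C) ξ‖ₑ ^ 2)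
      + ∫⁻ ξ, ENNReal.ofReal (‖ξ‖ ^ (2 * a)) * ‖(𝓕 f : L2C) ξ‖ₑ ^ 2) := by
  have hm : Measurable fun ξ => ‖(𝓕 f : L2C) ξ‖ₑ ^ 2 := (Lp.stronglyMeasurable (𝓕 f : L2C)).measurable.enorm.pow_const 2
  rw [hNorm_sq, ← lintegral_add_left hm, ← lintegral_const_mul' _ _ ENNReal.ofReal_ne_top]
  refine lintegral_mono fun ξ => ?_
  dsimp only
  rw [← one_add_mul, ← mul_assoc]
  refine mul_le_mul_left ?_ _
  rw [← ENNReal.ofReal_one, ← ENNReal.ofReal_add zero_le_one (by positivity), ← ENNReal.ofReal_mul (by positivity)]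
  exact ENNReal.ofReal_le_ofReal (japanese_le ha ξ)

lemma hNorm_sq_le_sub (a : ℝ) (f g : L2C) : hNorm a f ^ 2 ≤ 2 * (hNorm a g ^ 2 + hNorm a (f - g) ^ 2) := by
  have hm : ∀ f : L2C, AEMeasurable (fun ξ => ENNReal.ofReal ((1 + freq ξ ^ 2) ^ a) * ‖(𝓕 f : L2C) ξ‖ₑ ^ 2) volume :=
    fun f => (measurable_japanese a).aemeasurable.mul ((Lp.aestronglyMeasurable (𝓕 f : L2C)).enorm.pow_const 2)
  rw [hNorm_sq, hNorm_sq, hNorm_sq, ← lintegral_add_left' (hm g), ← lintegral_const_mul' _ _ (by norm_num)]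
  refine lintegral_mono_ae ?_
  filter_upwards [Lp.coeFn_sub (𝓕 f : L2C) (𝓕 g : L2C)] with ξ h1
  rw [fourier_sub', h1, Pi.sub_apply, ← mul_add, mul_left_comm]
  refine mul_le_mul_right ?_ _
  rw [enorm_sq_eq, enorm_sq_eq, enorm_sq_eq, ← ENNReal.ofReal_add (by positivity) (by positivity), two_mul_ofReal]
  refine ENNReal.ofReal_le_ofReal ?_
  have := norm_add_sq_le ((𝓕 g : L2C) ξ) ((𝓕 f : L2C) ξ - (𝓕 g : L2C) ξ)
  rwa [add_sub_cancel] at this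

namespace Setup

variable {σ s T : ℝ} {n : ℝ → L2R} {u : ℝ → Fin 3 → L2R} {α : ℝ → L2C}

lemma ofReal_lowSq (S : Setup σ s T n u α) {t : ℝ} (ht : t ∈ Ico 0 T) :
    ENNReal.ofReal (lowSq σ (n t) (u t)) = ∫⁻ ξ, ‖(𝓕 (α t) : L2C) ξ‖ₑ ^ 2 := by
  rw [lowSq_eq, (S.comp t ht).ofReal_sqSum (S.vel ht)]
  simp

lemma integrable_sqSum (S : Setup σ s T n u α) (t : ℝ) (m : ℕ) {ε : ℝ} (hε : 0 < ε) :
    Integrable (fun h => sqSum σ m h (n t) (u t)) (nu (4 * s) ε) := by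
  have := nu_finite (a := 4 * s) (by linarith [S.one_lt]) hε
  refine Integrable.of_bound (continuous_sqSum σ m _ _).aestronglyMeasurable
    ((2 ^ m) ^ 2 * (‖n t‖ ^ 2 + ∑ j, ‖u t j‖ ^ 2 + ‖mult (vsymb σ) (n t)‖ ^ 2)) (.of_forall fun h => ?_)
  rw [Real.norm_of_nonneg (sqSum_nonneg _ _ _ _ _)]
  exact sqSum_le _ _ _ _ _

end Setup

lemma ofReal_le_of_le {a b c d e x : ℝ} (ha : 0 ≤ a) (hb : 0 ≤ b) (hc : 0 ≤ c) (hd : 0 ≤ d) (he : 0 ≤ e)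
    (hx : 0 ≤ x) (h : a + b ≤ 4 * (c + d + e * x)) :
    ENNReal.ofReal a + ENNReal.ofReal b
      ≤ 4 * (ENNReal.ofReal c + ENNReal.ofReal d + ENNReal.ofReal e * ENNReal.ofReal x) := by
  rw [← ENNReal.ofReal_add ha hb, ← ENNReal.ofReal_add hc hd, ← ENNReal.ofReal_mul he,
    ← ENNReal.ofReal_add (by positivity) (by positivity), ← ENNReal.ofReal_ofNat, ← ENNReal.ofReal_mul (by norm_num)]
  exact ENNReal.ofReal_le_ofReal h

lemma exists_truncated_ineq {σ s β : ℝ} (h0 : 0 < σ) (h2 : σ < 2) (hs : 1 < s) (hβ : 1 < β) {K : ℕ} (hK : 2 * s < K) :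
    ∃ D : ℝ, ∀ (T : ℝ) (n : ℝ → L2R) (u : ℝ → Fin 3 → L2R) (α : ℝ → L2C), Setup σ s T n u α →
    ∀ a H : ℝ, 0 ≤ H → (∀ t ∈ Ioo 0 T, SupBound (n t) (u t) (a * (1 + t) ^ (-β))) →
    (∀ t ∈ Ioo 0 T, hNorm (2 * s) (α t) ≤ ENNReal.ofReal H) → ∀ t₀ ∈ Ioo 0 T, ∀ t ∈ Ioo 0 T, t₀ ≤ t → ∀ ε : ℝ, 0 < ε →
    (∫⁻ h, ENNReal.ofReal (sqSum σ (K + 1) h (n t) (u t)) ∂(nu (4 * s) ε)) + ∫⁻ ξ, ‖(𝓕 (α t) : L2C) ξ‖ₑ ^ 2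
      ≤ 4 * (diffConst (K + 1) (2 * s) * hNorm (2 * s) (α t₀) ^ 2 + hNorm (2 * s) (α t₀) ^ 2
        + ENNReal.ofReal D * ENNReal.ofReal (a * H ^ 2)) := by
  obtain ⟨D, hD0, hD⟩ := exists_energy_ineq h0 h2 hs hβ hK
  refine ⟨D, fun T n u α S a H hH0 hA hH t₀ ht₀ t ht htt ε hε => ?_⟩
  have ht' := Setup.mem_Ico ht
  have ht₀' := Setup.mem_Ico ht₀
  have ha : 0 ≤ a := by
    have : 0 < 1 + t := by linarith [ht.1]
    exact (pos_of_mul_pos_left (hA t ht).pos (Real.rpow_nonneg this.le _)).le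
  have i1 := S.integrable_sqSum t (K + 1) hε
  have i2 := S.integrable_sqSum t₀ (K + 1) hε
  have e1 : (1 / 4) * ∫ h, sqSum σ (K + 1) h (n t) (u t) ∂(nu (4 * s) ε)
      ≤ ∫ h, energy σ (K + 1) h (n t) (u t) ∂(nu (4 * s) ε) := by
    rw [← integral_const_mul]
    exact integral_mono (i1.const_mul _) (S.integrable_energy ht' (hA t ht).n_half _ hε)
      fun h => (energy_bounds _ h (hA t ht).n_half _).1
  have e2 : ∫ h, energy σ (K + 1) h (n t₀) (u t₀) ∂(nu (4 * s) ε)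
      ≤ ∫ h, sqSum σ (K + 1) h (n t₀) (u t₀) ∂(nu (4 * s) ε) :=
    integral_mono (S.integrable_energy ht₀' (hA t₀ ht₀).n_half _ hε) i2
      fun h => (energy_bounds _ h (hA t₀ ht₀).n_half _).2
  have e3 := hD T n u α S a H hH0 hA hH t₀ ht₀ t ht htt ε hε
  have l1 : 0 ≤ lowSq σ (n t) (u t) := by unfold lowSq; positivity
  have l2 : 0 ≤ lowSq σ (n t₀) (u t₀) := by unfold lowSq; positivity
  have n1 : ∀ r, 0 ≤ ∫ h, sqSum σ (K + 1) h (n r) (u r) ∂(nu (4 * s) ε) := fun r =>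
    integral_nonneg fun h => sqSum_nonneg _ _ _ _ _
  have x0 : 0 ≤ a * H ^ 2 := by positivity
  have e5 := ofReal_le_of_le (n1 t) l1 (n1 t₀) l2 hD0 x0
    (by linarith [mul_nonneg hD0 x0])
  rw [ofReal_integral_eq_lintegral_ofReal i1 (.of_forall fun h => sqSum_nonneg _ _ _ _ _),
    ofReal_integral_eq_lintegral_ofReal i2 (.of_forall fun h => sqSum_nonneg _ _ _ _ _),
    S.ofReal_lowSq ht', S.ofReal_lowSq ht₀'] at e5
  exact e5.trans (mul_le_mul_right (add_le_add_left (add_le_add (S.lintegral_sqSum_nu_le ht₀' _ ε)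
    (lintegral_le_hNorm_sq (by linarith) _)) _) _)

lemma exists_hNorm_sq_ineq {σ s β : ℝ} (h0 : 0 < σ) (h2 : σ < 2) (hs : 1 < s) (hβ : 1 < β) :
    ∃ C : ℝ≥0, ∀ (T : ℝ) (n : ℝ → L2R) (u : ℝ → Fin 3 → L2R) (α : ℝ → L2C), Setup σ s T n u α →
    ∀ a H : ℝ, 0 ≤ H → (∀ t ∈ Ioo 0 T, SupBound (n t) (u t) (a * (1 + t) ^ (-β))) →
    (∀ t ∈ Ioo 0 T, hNorm (2 * s) (α t) ≤ ENNReal.ofReal H) → ∀ t₀ ∈ Ioo 0 T, ∀ t ∈ Ioo 0 T, t₀ ≤ t →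
    hNorm (2 * s) (α t) ^ 2 ≤ C * (hNorm (2 * s) (α t₀) ^ 2 + ENNReal.ofReal (a * H ^ 2)) := by
  obtain ⟨K, hK⟩ := exists_nat_gt (2 * s)
  obtain ⟨D, hD⟩ := exists_truncated_ineq h0 h2 hs hβ hK
  obtain ⟨d, hd⟩ : ∃ d, d = diffConst (K + 1) (2 * s) := ⟨_, rfl⟩
  have hdt : d ≠ ∞ := hd ▸ (diffConst_lt_top (by linarith) (by push_cast; linarith)).ne
  have hd0 : d ≠ 0 := hd ▸ diffConst_ne_zero _ _
  obtain ⟨J, hJ⟩ : ∃ J, J = ENNReal.ofReal ((2 * (2 * Real.pi) ^ 2) ^ (2 * s)) := ⟨_, rfl⟩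
  have hJt : J ≠ ∞ := hJ ▸ ENNReal.ofReal_ne_top
  refine ⟨(J * (1 + d⁻¹) * (4 * (d + 1 + ENNReal.ofReal D))).toNNReal,
    fun T n u α S a H hH0 hA hH t₀ ht₀ t ht htt => ?_⟩
  have hfin : J * (1 + d⁻¹) * (4 * (d + 1 + ENNReal.ofReal D)) ≠ ∞ :=
    ENNReal.mul_ne_top (ENNReal.mul_ne_top hJt (ENNReal.add_ne_top.2 ⟨ENNReal.one_ne_top, ENNReal.inv_ne_top.2 hd0⟩))
      (ENNReal.mul_ne_top (by norm_num) (ENNReal.add_ne_top.2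
        ⟨ENNReal.add_ne_top.2 ⟨hdt, ENNReal.one_ne_top⟩, ENNReal.ofReal_ne_top⟩))
  rw [ENNReal.coe_toNNReal hfin]
  have ht' := Setup.mem_Ico ht
  have h2s : 0 ≤ 2 * s := by linarith
  have hlim := (tendsto_lintegral_nu (a := 4 * s) (g := fun h => ENNReal.ofReal (sqSum σ (K + 1) h (n t) (u t)))
    (continuous_sqSum σ (K + 1) _ _).measurable.ennreal_ofReal (by
      rw [S.lintegral_sqSum ht']
      refine ENNReal.mul_ne_top (hd ▸ hdt) (ne_top_of_le_ne_top (ENNReal.pow_ne_top (S.fin t ht') (n := 2)) ?_)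
      rw [hNorm_sq]
      gcongr with ξ
      exact norm_rpow_le_japanese (by linarith) (by linarith) ξ)).add
    (tendsto_const_nhds (x := ∫⁻ ξ, ‖(𝓕 (α t) : L2C) ξ‖ₑ ^ 2))
  have hle := le_of_tendsto' hlim fun j => hD T n u α S a H hH0 hA hH t₀ ht₀ t ht htt _ (by positivity)
  rw [S.lintegral_sqSum ht', ← hd] at hle
  have hsplit := hNorm_sq_le_split h2s (α t)
  rw [← hJ, show 2 * (2 * s) = 4 * s by ring] at hsplit
  generalize ∫⁻ ξ, ‖(𝓕 (α t) : L2C) ξ‖ₑ ^ 2 = L at *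
  generalize ∫⁻ ξ, ENNReal.ofReal (‖ξ‖ ^ (4 * s)) * ‖(𝓕 (α t) : L2C) ξ‖ₑ ^ 2 = I at *
  generalize hNorm (2 * s) (α t₀) ^ 2 = P at *
  generalize ENNReal.ofReal (a * H ^ 2) = Q at *
  generalize ENNReal.ofReal D = D' at *
  have hI : L + I ≤ (1 + d⁻¹) * (d * I + L) := by
    have e : d⁻¹ * (d * I) = I := by rw [← mul_assoc, ENNReal.inv_mul_cancel hd0 hdt, one_mul]
    calc L + I = L + d⁻¹ * (d * I) := by rw [e]
      _ ≤ (d * I + L) + d⁻¹ * (d * I + L) := by gcongr <;> simp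
      _ = _ := by ring
  calc _ ≤ J * (L + I) := hsplit
    _ ≤ J * ((1 + d⁻¹) * (4 * (d * P + P + D' * Q))) := by gcongr; exact hI.trans (by gcongr)
    _ ≤ J * ((1 + d⁻¹) * (4 * ((d + 1 + D') * (P + Q)))) := by
        gcongr
        calc d * P + P + D' * Q ≤ (d * P + P + D' * Q) + (d * Q + Q + D' * P) := le_self_add
          _ = _ := by ring
    _ = _ := by ring

end EulerRiesz
end

noncomputable section

namespace EulerRiesz

lemma one_lt_beta {σ p : ℝ} (hp : AdmissibleExponent σ p) : 1 < beta σ p := by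
  rw [beta]
  split_ifs with h
  · have h6 := hp.1 h
    have : 1 / p < 1 / 6 := one_div_lt_one_div_of_lt (by norm_num) h6
    linarith
  · have h8 := hp.2 (not_le.1 h)
    have : 1 / p < 1 / 8 := one_div_lt_one_div_of_lt (by norm_num) h8
    linarith

lemma AdmissibleExponent.six_lt {σ p : ℝ} (hp : AdmissibleExponent σ p) : 6 < p := by
  rcases le_or_gt σ 1 with h | h
  · exact hp.1 h
  · linarith [hp.2 h]

lemma hNorm_le_xNorm (σ p s t : ℝ) (f : L2C) : hNorm (2 * s) f ≤ xNorm σ p s t f := by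
  rw [xNorm, add_right_comm]; exact le_add_self

lemma hNorm_le_yNorm (σ p s : ℝ) (f : L2C) : hNorm (2 * s) f ≤ yNorm σ p s f := by
  rw [yNorm, add_right_comm]; exact le_add_self

lemma wNorm_le_xNorm (σ p s t : ℝ) (f : L2C) :
    ENNReal.ofReal ((1 + t) ^ beta σ p) * wNorm s (ENNReal.ofReal p) f ≤ xNorm σ p s t f := by
  rw [xNorm]; exact le_add_self

lemma Setup.of_solution {σ p s T : ℝ} (h0 : 0 < σ) (h2 : σ < 2) (hs : 1 < s) {n : ℝ → L2R} {u : ℝ → Fin 3 → L2R}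
    {α : ℝ → L2C} (hsol : IsSolution σ T n u) (hα : ∀ t ∈ Ico 0 T, IsAlpha σ (n t) (u t) (α t))
    (hc : ContinuousInX σ p s T α) : Setup σ s T n u α where
  pos := h0
  lt_two := h2
  one_lt := hs
  sol := hsol
  comp t ht := ⟨hα t ht, fun j k => (hsol.irrotational t ht).fourier j k⟩
  fin t ht := ((hNorm_le_xNorm σ p s t _).trans_lt (hc t ht).1).ne
  cont t ht := tendsto_of_tendsto_of_tendsto_of_le_of_le tendsto_const_nhds (hc t ht).2
    (fun _ => zero_le) fun _ => hNorm_le_xNorm σ p s t _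

/-- The decay of the sup norms, from the weighted norm. -/
lemma exists_supBound {σ p s : ℝ} (h0 : 0 < σ) (h2 : σ < 2) (hp : 1 < p) (hs : 1 + 3 / p < s) :
    ∃ c : ℝ, 0 < c ∧ ∀ (T : ℝ) (n : ℝ → L2R) (u : ℝ → Fin 3 → L2R) (α : ℝ → L2C), Setup σ s T n u α →
    ∀ M : ℝ, 0 < M → ∀ t ∈ Ioo 0 T, xNorm σ p s t (α t) ≤ ENNReal.ofReal M → (∀ᵐ x, ‖n t x‖ ≤ 1 / 2) →
    SupBound (n t) (u t) (c * M * (1 + t) ^ (-beta σ p)) := by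
  obtain ⟨C, hC⟩ := exists_sup_bounds h0 h2 hp hs
  refine ⟨C + 1, by positivity, fun T n u α S M hM t ht hx hn => ?_⟩
  have ht' := Setup.mem_Ico ht
  have ht1 : 0 < 1 + t := by linarith [ht.1]
  have hw := (wNorm_le_xNorm σ p s t (α t)).trans hx
  have hpos : 0 < (1 + t) ^ beta σ p := by positivity
  have hfin : wNorm s (ENNReal.ofReal p) (α t) ≠ ∞ := by
    intro h
    rw [h, ENNReal.mul_top (by simpa using hpos)] at hw
    exact absurd hw (by simp)
  have hle : C * (wNorm s (ENNReal.ofReal p) (α t)).toReal ≤ (C + 1) * M * (1 + t) ^ (-beta σ p) := by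
    have h1 := ENNReal.toReal_mono ENNReal.ofReal_ne_top hw
    rw [ENNReal.toReal_mul, ENNReal.toReal_ofReal hpos.le, ENNReal.toReal_ofReal hM.le] at h1
    rw [Real.rpow_neg ht1.le, mul_assoc, ← div_eq_mul_inv]
    have h3 : (wNorm s (ENNReal.ofReal p) (α t)).toReal ≤ M / (1 + t) ^ beta σ p := by
      rw [le_div_iff₀ hpos]; linarith
    have h4 : 0 ≤ M / (1 + t) ^ beta σ p := by positivity
    calc _ ≤ C * (M / (1 + t) ^ beta σ p) := by gcongr
      _ ≤ _ := by gcongr; linarith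
  obtain ⟨_, b2, b3, b4⟩ := hC (n t) (u t) (α t) (S.comp t ht') hfin (S.fin t ht')
  exact ⟨by positivity, hn, fun j => (b2 j _ (S.FD_n ht' j)).mono fun _ h => h.trans hle,
    fun j => (b3 j).mono fun _ h => h.trans hle,
    fun j k => (b4 j k _ (S.FD_u ht' j k)).mono fun _ h => h.trans hle⟩

lemma sqrt_step {h y m : ℝ≥0∞} {c : ℝ≥0} (hc : 1 ≤ c) (hh : h ^ 2 ≤ c * (y ^ 2 + m ^ 3)) :
    h ≤ c * (y + m ^ (3 / 2 : ℝ)) := by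
  refine (ENNReal.pow_le_pow_left_iff two_ne_zero).1 (hh.trans ?_)
  have e : (m ^ (3 / 2 : ℝ)) ^ 2 = m ^ 3 := by
    rw [← ENNReal.rpow_natCast, ← ENNReal.rpow_mul, ← ENNReal.rpow_natCast]; norm_num
  have hc' : (1 : ℝ≥0∞) ≤ c := by exact_mod_cast hc
  rw [mul_pow, ← e]
  gcongr
  · rw [sq]; exact le_mul_of_one_le_left zero_le hc'
  · rw [add_sq]
    gcongr
    exact le_self_add

end EulerRiesz
end

theorem lemma5p2 (σ p s ε : ℝ) (hσ0 : 0 < σ) (hσ2 : σ < 2)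
    (hp : EulerRiesz.AdmissibleExponent σ p) (hs : 1 + 3 / p < s) (hε : 0 < ε) :
    ∃ C : ℝ≥0, ∀ T : ℝ, 0 < T →
      ∀ (n : ℝ → EulerRiesz.L2R) (u : ℝ → Fin 3 → EulerRiesz.L2R) (α : ℝ → EulerRiesz.L2C),
        EulerRiesz.IsSolution σ T n u →
        (∀ t ∈ Ico 0 T, EulerRiesz.IsAlpha σ (n t) (u t) (α t)) →
        EulerRiesz.ContinuousInX σ p s T α →
        EulerRiesz.yNormPair σ p s (n 0) (u 0) < ENNReal.ofReal ε →
        (⨆ t ∈ Ioo 0 T, eLpNorm (n t) ∞ volume) < 1 / 2 →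
        ∀ t ∈ Ico 0 T,
          EulerRiesz.hNorm (2 * s) (α t) ≤
            C * (EulerRiesz.yNorm σ p s (α 0)
              + (⨆ τ ∈ Ioo 0 T, EulerRiesz.xNorm σ p s τ (α τ)) ^ (3 / 2 : ℝ)) := by
  have hp6 := hp.six_lt
  have hs1 : 1 < s := by
    have : 0 < 3 / p := by positivity
    linarith
  obtain ⟨c, hc0, hc⟩ := EulerRiesz.exists_supBound hσ0 hσ2 (by linarith) hs
  obtain ⟨D, hD⟩ := EulerRiesz.exists_hNorm_sq_ineq hσ0 hσ2 hs1 (EulerRiesz.one_lt_beta hp)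
  obtain ⟨k, hk⟩ : ∃ k : ℝ≥0, k = c.toNNReal := ⟨_, rfl⟩
  refine ⟨D * (2 + 3 * k) + 1, fun T hT n u α hsol hα hcX _ hn t ht => ?_⟩
  have S := EulerRiesz.Setup.of_solution hσ0 hσ2 hs1 hsol hα hcX
  obtain ⟨M, hM⟩ : ∃ M, M = ⨆ τ ∈ Ioo 0 T, EulerRiesz.xNorm σ p s τ (α τ) := ⟨_, rfl⟩
  have hMx : ∀ τ ∈ Ioo 0 T, EulerRiesz.xNorm σ p s τ (α τ) ≤ M := fun τ hτ => hM ▸ le_iSup₂_of_le τ hτ le_rfl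
  rw [← hM]
  have hC1 : (1 : ℝ≥0∞) ≤ ((D * (2 + 3 * k) + 1 : ℝ≥0) : ℝ≥0∞) := by
    exact_mod_cast (le_add_self : (1 : ℝ≥0) ≤ D * (2 + 3 * k) + 1)
  have big : ∀ {x : ℝ≥0∞}, x ≤ EulerRiesz.yNorm σ p s (α 0) + M ^ (3 / 2 : ℝ) →
      x ≤ ((D * (2 + 3 * k) + 1 : ℝ≥0) : ℝ≥0∞) * (EulerRiesz.yNorm σ p s (α 0) + M ^ (3 / 2 : ℝ)) := fun hx =>
    hx.trans (le_mul_of_one_le_left zero_le hC1)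
  rcases eq_or_lt_of_le ht.1 with rfl | ht0
  · exact big ((EulerRiesz.hNorm_le_yNorm σ p s _).trans le_self_add)
  have htI : t ∈ Ioo 0 T := ⟨ht0, ht.2⟩
  rcases eq_or_ne M ∞ with hMt | hMt
  · refine big ?_
    rw [hMt, ENNReal.top_rpow_of_pos (by norm_num), add_top]
    exact le_top
  rcases eq_or_ne M 0 with hM0 | hM0
  · have := (EulerRiesz.hNorm_le_xNorm σ p s t (α t)).trans (hMx t htI)
    rw [hM0] at this
    rw [nonpos_iff_eq_zero.1 this]
    exact zero_le
  have hMr : 0 < M.toReal := ENNReal.toReal_pos hM0 hMt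
  have hMe : ENNReal.ofReal M.toReal = M := ENNReal.ofReal_toReal hMt
  have hsup : ∀ τ ∈ Ioo 0 T, EulerRiesz.SupBound (n τ) (u τ) (c * M.toReal * (1 + τ) ^ (-EulerRiesz.beta σ p)) := by
    intro τ hτ
    refine hc T n u α S M.toReal hMr τ hτ (by rw [hMe]; exact hMx τ hτ) ?_
    rw [← EulerRiesz.eLpNorm_top_le_iff (by norm_num)]
    have h1 : eLpNorm (n τ) ∞ volume ≤ ⨆ t ∈ Ioo 0 T, eLpNorm (n t) ∞ volume := le_iSup₂_of_le τ hτ le_rfl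
    refine (h1.trans hn.le).trans_eq ?_
    rw [ENNReal.ofReal_div_of_pos (by norm_num)]; simp
  have hQ : ENNReal.ofReal (c * M.toReal * M.toReal ^ 2) = k * M ^ 3 := by
    rw [mul_assoc, ENNReal.ofReal_mul hc0.le, ← pow_succ', ENNReal.ofReal_pow hMr.le, hMe, hk]; rfl
  have hQ0 : 0 < (k : ℝ≥0∞) * M ^ 3 := by
    rw [← hQ, ENNReal.ofReal_pos]; positivity
  obtain ⟨t₀, ht₀, hsmall⟩ : ∃ t₀ ∈ Ioo 0 t, EulerRiesz.hNorm (2 * s) (α t₀ - α 0) ^ 2 < k * M ^ 3 := by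
    have h1 := ENNReal.Tendsto.pow (n := 2) (S.cont 0 (Set.left_mem_Ico.2 hT))
    rw [zero_pow two_ne_zero] at h1
    have h2 : ∀ᶠ r in 𝓝[Ioo 0 t] 0, EulerRiesz.hNorm (2 * s) (α r - α 0) ^ 2 < k * M ^ 3 :=
      nhdsWithin_mono 0 (fun r (hr : r ∈ Ioo 0 t) => (⟨hr.1.le, hr.2.trans ht.2⟩ : r ∈ Ico 0 T)) (h1.eventually_lt_const hQ0)
    have : (𝓝[Ioo 0 t] (0 : ℝ)).NeBot := by rw [nhdsWithin_Ioo_eq_nhdsGT ht0]; infer_instance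
    obtain ⟨r, hr1, hr2⟩ := (h2.and self_mem_nhdsWithin).exists
    exact ⟨r, hr2, hr1⟩
  have key := hD T n u α S (c * M.toReal) M.toReal hMr.le hsup
    (fun τ hτ => by rw [hMe]; exact (EulerRiesz.hNorm_le_xNorm σ p s τ _).trans (hMx τ hτ))
    t₀ ⟨ht₀.1, ht₀.2.trans ht.2⟩ t htI ht₀.2.le
  refine EulerRiesz.sqrt_step le_add_self (key.trans ?_)
  rw [hQ]
  have h3 := EulerRiesz.hNorm_sq_le_sub (2 * s) (α t₀) (α 0)
  have h4 := EulerRiesz.hNorm_le_yNorm σ p s (α 0)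
  generalize EulerRiesz.yNorm σ p s (α 0) = y at *
  calc (D : ℝ≥0∞) * (EulerRiesz.hNorm (2 * s) (α t₀) ^ 2 + k * M ^ 3)
      ≤ D * (2 * (y ^ 2 + k * M ^ 3) + k * M ^ 3) := by
        gcongr
        exact h3.trans (by gcongr)
    _ = D * (2 * y ^ 2 + 3 * k * M ^ 3) := by ring
    _ ≤ D * ((2 + 3 * k) * y ^ 2 + (2 + 3 * k) * M ^ 3) := by
        gcongr <;> simp
    _ ≤ (D * (2 + 3 * k) + 1) * (y ^ 2 + M ^ 3) := by
        rw [← mul_add, ← mul_assoc]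
        gcongr
        exact le_self_add
    _ = _ := by push_cast; ring
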